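/- **Theorem (Sandwiching implies Tolerant Testable Learning).** *Setting.* Let $d,\ell\ge 1$ be integers and let $\mathcal X$ be $\mathbb R^d$ or $\{\pm1\}^d$. A probability distribution $D^*$ on $\mathcal X$ is *$A$-hypercontractive* ($A\ge 1$) if $\mathbb E_{D^*}[|p|^t]\le (At)^{kt}\,(\mathbb E_{D^*}[|p|])^t$ for every $t\ge 2$, every $k$ and every polynomial $p$ of degree $k$, and all coordinates have finite absolute expectation under $D^*$. A class $\mathcal C$ of functions $\mathcal X\to\{\pm1\}$ has *$\gamma$-sandwiching degree $\ell$* with respect to $D^*$ if for every $f\in\mathcal C$ there are polynomials $p_{\mathrm{up}},p_{\mathrm{down}}$ of degree at most $\ell$ with $p_{\mathrm{down}}\le f\le p_{\mathrm{up}}$ on $\mathcal X$ and $\mathbb E_{D^*}[p_{\mathrm{up}}-p_{\mathrm{down}}]\le\gamma$; no bound on the coefficients is required. An algorithm has access to i.i.d. reference examples from $D^*$, receives a set $\bar S$ of $m$ i.i.d. labeled examples from an arbitrary unknown distribution $\bar D$ on $\mathcal X\times\{\pm1\}$, and either rejects or accepts and outputs (a description of) a hypothesis $h:\mathcal X\to\{\pm1\}$.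 It is an *$(\varepsilon,\delta,\tau)$-tolerant tester-learner* for $\mathcal C$ with respect to $D^*$, using $m$ examples, if for every $\bar D$, with probability at least $1-\delta$ over $\bar S$ and the reference examples, both of the following hold: 1. (Soundness) if it accepts, then $\Pr_{(x,y)\sim\bar D}[y\ne h(x)]\le \inf_{f\in\mathcal C}\Pr_{(x,y)\sim\bar D}[y\ne f(x)]+\tau+\varepsilon$; 2. (Completeness) if the marginal $D$ of $\bar D$ on $\mathcal X$ satisfies $d_{\mathrm{TV}}(D,D^*)\le\tau$, then it accepts. Running time is counted on a real RAM (unit-cost real field operations and comparisons, memory accesses with index arithmetic, unit cost per coordinate of an example that is read). *Statement.* There are universal constants $C,K\ge 1$, a polynomial $q$ in four variables with nonnegative integer coefficients, and one algorithm, which is given $d,\ell,A,\varepsilon,\delta,\tau$ and the examples as input, such that the following holds. Let $\varepsilon,\delta,\tau\in(0,1)$ and $A\ge1$, let $D^*$ be an $A$-hypercontractive distribution on $\mathcal X$, and let $\mathcal C$ be a non-empty class of measurable functions $\mathcal X\to\{\pm1\}$ whose $\frac{\varepsilon}{C(1+\tau/\varepsilon)}$-sandwiching degree with respect to $D^*$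 is $\ell$. Then, for every $$m\ \ge\ \frac1{\varepsilon^5}\,(KAd)^{2\ell}\,\log\frac2\delta ,$$ the algorithm with $m$ examples is an $(\varepsilon,\delta,\tau)$-tolerant tester-learner for $\mathcal C$ with respect to $D^*$. The time it takes for training, and for every evaluation of the hypothesis after acceptance, is always at most $q\big(A^\ell,(\log\tfrac1\delta)^\ell,(d+1)^\ell,\tfrac1\varepsilon\big)$. -/

import Mathlib

open MeasureTheory

namespace TolerantTesting

noncomputable section

/-! ### Distributions, polynomials and concept classes

The feature space is a set `X` of points of `ℝ^d` (all of `ℝ^d`, or the hypercube); distributions on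
it are measures on the subtype, and polynomials are evaluated at the underlying vector. Labels are
Booleans, `true` standing for `+1` and `false` for `-1`. -/

/-- The hypercube `{-1, 1}^d`. -/
def hypercube (d : ℕ) : Set (Fin d → ℝ) := {x | ∀ i, x i = 1 ∨ x i = -1}

/-- The numerical value `±1` of a label. -/
def labelValue (b : Bool) : ℝ := if b then 1 else -1

/-- `D` is `A`-hypercontractive with respect to polynomials: for every polynomial `p` of degree `k`
and every real `t ≥ 2`, `E|p|^t ≤ (A t)^(k t) (E|p|)^t`, and the coordinates have finite absolute
expectation. The expectations of the nonnegative quantities are taken in `[0, ∞]`. (On the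
hypercube, a polynomial and its multilinear reduction are the same function, and the inequality for
the multilinear one, whose degree is smaller, is the stronger one since `A t ≥ 1`. So letting `p`
range over all polynomials gives the notion in terms of multilinear expansions.) -/
def IsHypercontractive {d : ℕ} {X : Set (Fin d → ℝ)} (D : Measure X) (A : ℝ) : Prop :=
  (∀ (p : MvPolynomial (Fin d) ℝ) (t : ℝ), 2 ≤ t →
    ∫⁻ x : X, ENNReal.ofReal (|MvPolynomial.eval x.1 p| ^ t) ∂D ≤
      ENNReal.ofReal ((A * t) ^ ((p.totalDegree : ℝ) * t)) *
        (∫⁻ x : X, ENNReal.ofReal |MvPolynomial.eval x.1 p| ∂D) ^ t) ∧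
  ∀ i : Fin d, Integrable (fun x : X => x.1 i) D

/-- The class `F` has `γ`-sandwiching degree (at most) `l` with respect to `D`: every `f ∈ F` lies
pointwise between two polynomials of degree at most `l` whose difference (which is nonnegative on
`X`) has expectation at most `γ`. -/
def HasSandwichingDegree {d : ℕ} {X : Set (Fin d → ℝ)} (F : Set (X → Bool)) (D : Measure X)
    (γ : ℝ) (l : ℕ) : Prop :=
  ∀ f ∈ F, ∃ pUp pDown : MvPolynomial (Fin d) ℝ, pUp.totalDegree ≤ l ∧ pDown.totalDegree ≤ l ∧
    (∀ x : X, MvPolynomial.eval x.1 pDown ≤ labelValue (f x) ∧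
      labelValue (f x) ≤ MvPolynomial.eval x.1 pUp) ∧
    ∫⁻ x : X, ENNReal.ofReal (MvPolynomial.eval x.1 pUp - MvPolynomial.eval x.1 pDown) ∂D ≤
      ENNReal.ofReal γ

/-- The total variation distance of two probability measures. -/
def tvDist {α : Type*} [MeasurableSpace α] (μ ν : Measure α) : ℝ :=
  ⨆ B : {B : Set α // MeasurableSet B}, |μ.real B.1 - ν.real B.1|

/-- The probability that the label of a labeled example drawn from `E` differs from `h`. -/
def errorRate {d : ℕ} {X : Set (Fin d → ℝ)} (E : Measure (X × Bool)) (h : X → Bool) : ℝ :=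
  E.real {z | z.2 ≠ h z.1}

/-- The optimal error of the class `F` on the labeled distribution `E`. -/
def optError {d : ℕ} {X : Set (Fin d → ℝ)} (E : Measure (X × Bool)) (F : Set (X → Bool)) : ℝ :=
  ⨅ f : F, errorRate E f.1

/-! ### The machine model: a real RAM

The memory consists of arrays of natural numbers (used for counters and indices) and
two-dimensional arrays of real numbers, both addressed indirectly. A program is a fixed finite
command; its only constants are natural numbers. Every occurrence of an arithmetic operation, a
memory access, a constant, a comparison or a command that is executed costs one time unit. Natural
numbers support addition and truncated subtraction, real numbers the four field operations (with
the convention `x / 0 = 0`); both can be compared. There is no conversion of reals to integers. -/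

/-- Index expressions; `get a i` is the `i`-th entry of the `a`-th array of natural numbers. -/
inductive NExp : Type
  | lit (n : ℕ)
  | get (a : ℕ) (i : NExp)
  | add (e f : NExp)
  | sub (e f : NExp)

/-- Real expressions; `get a i j` is the entry `(i, j)` of the `a`-th array of real numbers. -/
inductive RExp : Type
  | ofNat (e : NExp)
  | get (a : ℕ) (i j : NExp)
  | add (e f : RExp)
  | sub (e f : RExp)
  | mul (e f : RExp)
  | div (e f : RExp)

/-- Tests. -/
inductive Test : Type
  | natLt (e f : NExp)
  | realLt (e f : RExp)
  | not (b : Test)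
  | and (b c : Test)

/-- Commands. `setN a i e` stores `e` in entry `i` of array `a` of natural numbers, and
`setR a i j e` stores `e` in entry `(i, j)` of array `a` of real numbers. -/
inductive Cmd : Type
  | skip
  | setN (a : ℕ) (i e : NExp)
  | setR (a : ℕ) (i j : NExp) (e : RExp)
  | seq (c₁ c₂ : Cmd)
  | ite (b : Test) (c₁ c₂ : Cmd)
  | while (b : Test) (c : Cmd)

/-- Memory contents. -/
@[ext]
structure Mem : Type where
  nat : ℕ → ℕ → ℕ
  real : ℕ → ℕ → ℕ → ℝ

/-- The memory after storing `v` in entry `i` of array `a` of natural numbers. -/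
def Mem.storeN (M : Mem) (a i v : ℕ) : Mem where
  nat a' i' := if a' = a ∧ i' = i then v else M.nat a' i'
  real := M.real

/-- The memory after storing `v` in entry `(i, j)` of array `a` of real numbers. -/
def Mem.storeR (M : Mem) (a i j : ℕ) (v : ℝ) : Mem where
  nat := M.nat
  real a' i' j' := if a' = a ∧ i' = i ∧ j' = j then v else M.real a' i' j'

/-- Value of an index expression. -/
def NExp.eval (M : Mem) : NExp → ℕ
  | lit n => n
  | get a i => M.nat a (i.eval M)
  | add e f => e.eval M + f.eval M
  | sub e f => e.eval M - f.eval M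

/-- Time for evaluating an index expression. -/
def NExp.cost : NExp → ℕ
  | lit _ => 1
  | get _ i => i.cost + 1
  | add e f => e.cost + f.cost + 1
  | sub e f => e.cost + f.cost + 1

/-- Value of a real expression. -/
def RExp.eval (M : Mem) : RExp → ℝ
  | ofNat e => (e.eval M : ℝ)
  | get a i j => M.real a (i.eval M) (j.eval M)
  | add e f => e.eval M + f.eval M
  | sub e f => e.eval M - f.eval M
  | mul e f => e.eval M * f.eval M
  | div e f => e.eval M / f.eval M

/-- Time for evaluating a real expression. -/
def RExp.cost : RExp → ℕ
  | ofNat e => e.cost + 1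
  | get _ i j => i.cost + j.cost + 1
  | add e f => e.cost + f.cost + 1
  | sub e f => e.cost + f.cost + 1
  | mul e f => e.cost + f.cost + 1
  | div e f => e.cost + f.cost + 1

/-- Truth of a test. -/
def Test.Holds (M : Mem) : Test → Prop
  | natLt e f => e.eval M < f.eval M
  | realLt e f => e.eval M < f.eval M
  | not b => ¬ b.Holds M
  | and b c => b.Holds M ∧ c.Holds M

/-- Time for evaluating a test. -/
def Test.cost : Test → ℕ
  | natLt e f => e.cost + f.cost + 1
  | realLt e f => e.cost + f.cost + 1
  | not b => b.cost + 1
  | and b c => b.cost + c.cost + 1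

/-- `Exec c M M' n`: the command `c`, started in memory `M`, halts in memory `M'` after exactly `n`
time units. -/
inductive Exec : Cmd → Mem → Mem → ℕ → Prop
  | skip (M : Mem) : Exec Cmd.skip M M 1
  | setN (a : ℕ) (i e : NExp) (M : Mem) :
      Exec (Cmd.setN a i e) M (M.storeN a (i.eval M) (e.eval M)) (i.cost + e.cost + 1)
  | setR (a : ℕ) (i j : NExp) (e : RExp) (M : Mem) :
      Exec (Cmd.setR a i j e) M (M.storeR a (i.eval M) (j.eval M) (e.eval M))
        (i.cost + j.cost + e.cost + 1)
  | seq {c₁ c₂ : Cmd} {M M₁ M₂ : Mem} {n₁ n₂ : ℕ} (h₁ : Exec c₁ M M₁ n₁) (h₂ : Exec c₂ M₁ M₂ n₂) :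
      Exec (Cmd.seq c₁ c₂) M M₂ (n₁ + n₂ + 1)
  | iteTrue {b : Test} {c₁ c₂ : Cmd} {M M₁ : Mem} {n : ℕ} (hb : b.Holds M) (h : Exec c₁ M M₁ n) :
      Exec (Cmd.ite b c₁ c₂) M M₁ (b.cost + n + 1)
  | iteFalse {b : Test} {c₁ c₂ : Cmd} {M M₁ : Mem} {n : ℕ} (hb : ¬ b.Holds M)
      (h : Exec c₂ M M₁ n) : Exec (Cmd.ite b c₁ c₂) M M₁ (b.cost + n + 1)
  | whileTrue {b : Test} {c : Cmd} {M M₁ M₂ : Mem} {n₁ n₂ : ℕ} (hb : b.Holds M)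
      (h₁ : Exec c M M₁ n₁) (h₂ : Exec (Cmd.while b c) M₁ M₂ n₂) :
      Exec (Cmd.while b c) M M₂ (b.cost + n₁ + n₂ + 1)
  | whileFalse {b : Test} {c : Cmd} {M : Mem} (hb : ¬ b.Holds M) :
      Exec (Cmd.while b c) M M (b.cost + 1)

/-- Programs are deterministic: the final memory and the running time are unique. -/
theorem Exec.unique {c : Cmd} {M M₁ M₂ : Mem} {n₁ n₂ : ℕ} (h₁ : Exec c M M₁ n₁)
    (h₂ : Exec c M M₂ n₂) : M₁ = M₂ ∧ n₁ = n₂ := by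
  induction h₁ generalizing M₂ n₂ with
  | skip => cases h₂; exact ⟨rfl, rfl⟩
  | setN => cases h₂; exact ⟨rfl, rfl⟩
  | setR => cases h₂; exact ⟨rfl, rfl⟩
  | seq _ _ ih₁ ih₂ =>
    cases h₂ with
    | seq k₁ k₂ =>
      obtain ⟨rfl, rfl⟩ := ih₁ k₁
      obtain ⟨rfl, rfl⟩ := ih₂ k₂
      exact ⟨rfl, rfl⟩
  | iteTrue hb _ ih =>
    cases h₂ with
    | iteTrue _ k => obtain ⟨rfl, rfl⟩ := ih k; exact ⟨rfl, rfl⟩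
    | iteFalse hb' _ => exact absurd hb hb'
  | iteFalse hb _ ih =>
    cases h₂ with
    | iteTrue hb' _ => exact absurd hb' hb
    | iteFalse _ k => obtain ⟨rfl, rfl⟩ := ih k; exact ⟨rfl, rfl⟩
  | whileTrue hb _ _ ih₁ ih₂ =>
    cases h₂ with
    | whileTrue _ k₁ k₂ =>
      obtain ⟨rfl, rfl⟩ := ih₁ k₁
      obtain ⟨rfl, rfl⟩ := ih₂ k₂
      exact ⟨rfl, rfl⟩
    | whileFalse hb' => exact absurd hb hb'
  | whileFalse hb =>
    cases h₂ with
    | whileTrue hb' _ _ => exact absurd hb' hb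
    | whileFalse _ => exact ⟨rfl, rfl⟩

/-! ### Tester-learners -/

/-- A learning algorithm: a training program, which decides on acceptance and leaves (a description
of) a hypothesis in memory, and a program that evaluates the hypothesis at a point. -/
structure Learner : Type where
  train : Cmd
  predict : Cmd

/-- The parameters that an algorithm is given: the dimension, the degree, the hypercontractivity
constant, and the accuracy, failure probability and tolerance. -/
structure Params : Type where
  d : ℕ
  l : ℕ
  A : ℝ
  ε : ℝ
  δ : ℝ
  τ : ℝ

/-- Entry `j` of a vector, and `0` beyond its end. -/
def entry {d : ℕ} (x : Fin d → ℝ) (j : ℕ) : ℝ := if h : j < d then x ⟨j, h⟩ else 0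

/-- The initial memory of the training program, on the labeled examples `S` and an unlimited supply
`ω` of unlabeled reference examples. Array `0` of natural numbers holds `d`, `l`, `m`; row `0` of
array `0` of real numbers holds `A`, `ε`, `δ`, `τ`; arrays `1` and `2` hold the points of the `m`
labeled examples and their labels; array `3` gives access to the reference examples (reading a
coordinate costs one time unit). Everything else is zero. -/
def Params.input (P : Params) {X : Set (Fin P.d → ℝ)} {m : ℕ} (S : Fin m → X × Bool)
    (ω : ℕ → X) : Mem where
  nat a i := if a = 0 then (if i = 0 then P.d else if i = 1 then P.l else if i = 2 then m else 0)
    else 0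
  real a i j :=
    if a = 0 then
      (if i = 0 then
        (if j = 0 then P.A else if j = 1 then P.ε else if j = 2 then P.δ else
          if j = 3 then P.τ else 0)
      else 0)
    else if a = 1 then (if h : i < m then entry (S ⟨i, h⟩).1.1 j else 0)
    else if a = 2 then (if h : i < m ∧ j = 0 then labelValue (S ⟨i, h.1⟩).2 else 0)
    else if a = 3 then entry (ω i).1 j
    else 0

/-- The training program accepts if it leaves `1` in entry `0` of array `1` of natural numbers;
otherwise it rejects. -/
def Mem.Accepts (M : Mem) : Prop := M.nat 1 0 = 1

/-- The initial memory for evaluating at `x` the hypothesis left in memory `M` by the training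
program: the point `x` is written in row `0` of array `1` of real numbers, and the examples are no
longer available. -/
def Mem.query (M : Mem) {d : ℕ} (x : Fin d → ℝ) : Mem where
  nat := M.nat
  real a i j :=
    if a = 1 then (if i = 0 then entry x j else 0)
    else if a = 2 then 0
    else if a = 3 then 0
    else M.real a i j

open Classical in
/-- The hypothesis left in memory `M`: its label at `x` is `+1` if the evaluation program halts with
`1` in entry `0` of array `2` of natural numbers. -/
def Learner.hypothesis (L : Learner) {d : ℕ} {X : Set (Fin d → ℝ)} (M : Mem) (x : X) : Bool :=
  decide (∃ M' n, Exec L.predict (M.query x.1) M' n ∧ M'.nat 2 0 = 1)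

/-- On every input with `m` labeled examples from `X`, and for every sequence of reference examples
from `X`, training takes at most `T` time units, and after acceptance every evaluation of the
hypothesis takes at most `T` time units. -/
def Learner.RunsInTime (L : Learner) (P : Params) (X : Set (Fin P.d → ℝ)) (m : ℕ) (T : ℝ) : Prop :=
  ∀ (S : Fin m → X × Bool) (ω : ℕ → X), ∃ (M : Mem) (n : ℕ),
    Exec L.train (P.input S ω) M n ∧ (n : ℝ) ≤ T ∧
    (M.Accepts → ∀ x : X, ∃ (M' : Mem) (n' : ℕ),
      Exec L.predict (M.query x.1) M' n' ∧ (n' : ℝ) ≤ T)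

/-- The run of `L` on `S` and `ω` is successful: it halts; if it accepts, then the error of the
hypothesis exceeds the optimal error of the class `F` by at most `τ + ε`; and it does accept if the
marginal of the labeled distribution `E` is `τ`-close to the target `D`. -/
def Learner.Succeeds (L : Learner) (P : Params) {X : Set (Fin P.d → ℝ)} (F : Set (X → Bool))
    (D : Measure X) (E : Measure (X × Bool)) {m : ℕ} (S : Fin m → X × Bool) (ω : ℕ → X) : Prop :=
  ∃ (M : Mem) (n : ℕ), Exec L.train (P.input S ω) M n ∧
    (M.Accepts → errorRate E (L.hypothesis M) ≤ optError E F + P.τ + P.ε) ∧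
    (tvDist (E.map Prod.fst) D ≤ P.τ → M.Accepts)

/-- With `m` labeled examples, `L` is an `(ε, δ, τ)`-tolerant tester-learner for the class `F` with
respect to the target distribution `D`: whatever the distribution `E` of the labeled examples is,
the run is successful with probability at least `1 - δ` over `m` i.i.d. examples from `E` and
independent i.i.d. reference examples from `D`. -/
def Learner.IsTolerantTesterLearner (L : Learner) (P : Params) {X : Set (Fin P.d → ℝ)}
    (F : Set (X → Bool)) (D : Measure X) [IsProbabilityMeasure D] (m : ℕ) : Prop :=
  ∀ (E : Measure (X × Bool)) [IsProbabilityMeasure E],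
    ((Measure.pi fun _ : Fin m => E).prod (Measure.infinitePi fun _ : ℕ => D))
      {z | ¬ L.Succeeds P F D E z.1 z.2} ≤ ENNReal.ofReal P.δ

end

end TolerantTesting

/-! The algorithm runs a filter and a regression online, on fresh examples, over polynomials given
by their coefficients on the entries of the `l`-th tensor power of `(1, x)`. No bound on
coefficients is available, so every size is measured by reference data. `n` reference points define
the semi-inner product `ip u v = ∑ u(x_r) v(x_r)`. Call a point inside the region if `p(x)^2 ≤ ip p
p` for every polynomial `p`. There evaluation is represented by a kernel vector `kap` of norm at
most one, and gradient steps along such vectors are bounded. A leverage argument makes the region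
large: among `n + 1` points, at most `2 N` lie outside the region of the other `n`, so by
exchangeability a fresh point is outside with probability at most `2 N / (n + 1)`.

A block maintains two polynomials. The filter `q` retains a point (gate `g = 1`) if it lies in the
region and `q(x) < 1`. It moves by gradient ascent for `(1 - g) + g q(x) - |q(x')|`, with `x` a
labeled and `x'` a reference point, the last term being dropped outside the region; the sum of these
values is the test statistic. The second polynomial `p` moves by subgradient descent for `g |y -
p(x)|`.

Completeness: under the target, `(1 - g) + g q` is at most `min(1, |q|)` in the region and at most
`1` outside. This majorant takes values in `[0, 1]`, so a change of distribution within distance `τ`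
costs only `τ`, and subtracting `E|q|` over the region leaves at most `τ` plus the mass outside.
Martingale concentration puts the statistic below `T (τ + ε/8)`.

Soundness: regret against an arbitrary `u` gives `∑ ((1 - g) + g u(x)) ≤ statistic + ∑ |u(x')| + ip
u u / (2η) + 2ηT` (`sum_gate_le`). Take `u = p_up - p_down` for a near-optimal `f`. Sandwiching
makes `∑ |u(x')|` small, and hypercontractivity bounds second moments, hence `ip u u`, by Markov's
inequality. So in a passing block the rejected fraction plus the retained sandwiching gap is at most
about `τ`. Comparing the regression with `p_down` (`sum_gate_abs_le`) bounds `∑ g |y - p|` by twice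
the number of errors of `f` plus the retained gap. A random threshold turns `|y - p|` into half as
much classification error (`thrLoss_le`), and rejected points are charged one error each; hence the
average loss is at most that of `f` plus `τ + 7ε/32`. The bound concerns the loss at all points, so
the hypothesis is a plain polynomial threshold without the filter. Online-to-batch conversion, again
by martingale concentration, shows that some round and threshold have small true error.

One block fails with probability at most `1/64` (`measure_blockExc_le`). With `k` of order `log
(1/δ)` independent blocks, fewer than half fail except with probability `δ/2`; acceptance by
majority is then complete, and an accepted run contains a good passing block. Independent validation
examples select the best candidate over all blocks, rounds and thresholds.

The program is verified by a small Hoare logic with time bounds (`Runs`), which identifies its run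
with the functions analysed above; the link is `runs_train`. -/

open MeasureTheory

namespace TolerantTesting

noncomputable section

/-! ### Reasoning about programs -/

/-- The arrays of natural numbers that a command may write. -/
def Cmd.writesN : Cmd → List ℕ
  | skip => []
  | setN a _ _ => [a]
  | setR _ _ _ _ => []
  | seq c₁ c₂ => c₁.writesN ++ c₂.writesN
  | ite _ c₁ c₂ => c₁.writesN ++ c₂.writesN
  | .while _ c => c.writesN

/-- The arrays of real numbers that a command may write. -/
def Cmd.writesR : Cmd → List ℕ
  | skip => []
  | setN _ _ _ => []
  | setR a _ _ _ => [a]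
  | seq c₁ c₂ => c₁.writesR ++ c₂.writesR
  | ite _ c₁ c₂ => c₁.writesR ++ c₂.writesR
  | .while _ c => c.writesR

/-- The footprint is syntactic, so for concrete programs non-membership is settled by `decide`, and
specifications need only mention the arrays that are written. -/
theorem Exec.frameN {c : Cmd} {M M' : Mem} {n : ℕ} (h : Exec c M M' n) :
    ∀ a ∉ c.writesN, M'.nat a = M.nat a := by
  induction h with
  | skip => intro a _; rfl
  | setN a i e M =>
    intro b hb
    simp only [Cmd.writesN, List.mem_singleton] at hb
    funext j
    simp [Mem.storeN, hb]
  | setR => intro a _; rfl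
  | seq _ _ ih₁ ih₂ =>
    intro a ha
    simp only [Cmd.writesN, List.mem_append, not_or] at ha
    rw [ih₂ a ha.2, ih₁ a ha.1]
  | iteTrue _ _ ih =>
    intro a ha
    simp only [Cmd.writesN, List.mem_append, not_or] at ha
    exact ih a ha.1
  | iteFalse _ _ ih =>
    intro a ha
    simp only [Cmd.writesN, List.mem_append, not_or] at ha
    exact ih a ha.2
  | whileTrue _ _ _ ih₁ ih₂ =>
    intro a ha
    rw [ih₂ a ha, ih₁ a ha]
  | whileFalse => intro a _; rfl

theorem Exec.frameR {c : Cmd} {M M' : Mem} {n : ℕ} (h : Exec c M M' n) :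
    ∀ a ∉ c.writesR, M'.real a = M.real a := by
  induction h with
  | skip => intro a _; rfl
  | setR a i j e M =>
    intro b hb
    simp only [Cmd.writesR, List.mem_singleton] at hb
    funext i j
    simp [Mem.storeR, hb]
  | setN => intro a _; rfl
  | seq _ _ ih₁ ih₂ =>
    intro a ha
    simp only [Cmd.writesR, List.mem_append, not_or] at ha
    rw [ih₂ a ha.2, ih₁ a ha.1]
  | iteTrue _ _ ih =>
    intro a ha
    simp only [Cmd.writesR, List.mem_append, not_or] at ha
    exact ih a ha.1
  | iteFalse _ _ ih =>
    intro a ha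
    simp only [Cmd.writesR, List.mem_append, not_or] at ha
    exact ih a ha.2
  | whileTrue _ _ _ ih₁ ih₂ =>
    intro a ha
    rw [ih₂ a ha, ih₁ a ha]
  | whileFalse => intro a _; rfl

/-- Started in memory `M`, the command `c` halts after at most `t` time units in a memory that
satisfies `Q`. -/
def Runs (c : Cmd) (M : Mem) (t : ℕ) (Q : Mem → Prop) : Prop :=
  ∃ M' n, Exec c M M' n ∧ n ≤ t ∧ Q M'

/-- The rule of consequence. It hands the frame conditions to the new postcondition, which may
therefore speak of arrays that the old one ignores. -/
theorem Runs.mono {c : Cmd} {M : Mem} {t t' : ℕ} {Q Q' : Mem → Prop} (h : Runs c M t Q)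
    (ht : t ≤ t') (hQ : ∀ M', (∀ a ∉ c.writesN, M'.nat a = M.nat a) →
      (∀ a ∉ c.writesR, M'.real a = M.real a) → Q M' → Q' M') : Runs c M t' Q' := by
  obtain ⟨M', n, he, hn, hq⟩ := h
  exact ⟨M', n, he, hn.trans ht, hQ M' he.frameN he.frameR hq⟩

theorem Runs.skip {M : Mem} {Q : Mem → Prop} (h : Q M) : Runs Cmd.skip M 1 Q :=
  ⟨M, 1, Exec.skip M, le_rfl, h⟩

theorem Runs.setN {a : ℕ} {i e : NExp} {M : Mem} {Q : Mem → Prop}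
    (h : Q (M.storeN a (i.eval M) (e.eval M))) :
    Runs (Cmd.setN a i e) M (i.cost + e.cost + 1) Q :=
  ⟨_, _, Exec.setN a i e M, le_rfl, h⟩

theorem Runs.setR {a : ℕ} {i j : NExp} {e : RExp} {M : Mem} {Q : Mem → Prop}
    (h : Q (M.storeR a (i.eval M) (j.eval M) (e.eval M))) :
    Runs (Cmd.setR a i j e) M (i.cost + j.cost + e.cost + 1) Q :=
  ⟨_, _, Exec.setR a i j e M, le_rfl, h⟩

theorem Runs.seq {c₁ c₂ : Cmd} {M : Mem} {t₁ t₂ : ℕ} {Q₁ Q₂ : Mem → Prop} (h₁ : Runs c₁ M t₁ Q₁)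
    (h₂ : ∀ M₁, (∀ a ∉ c₁.writesN, M₁.nat a = M.nat a) →
      (∀ a ∉ c₁.writesR, M₁.real a = M.real a) → Q₁ M₁ → Runs c₂ M₁ t₂ Q₂) :
    Runs (Cmd.seq c₁ c₂) M (t₁ + t₂ + 1) Q₂ := by
  obtain ⟨M₁, n₁, he₁, hn₁, hq₁⟩ := h₁
  obtain ⟨M₂, n₂, he₂, hn₂, hq₂⟩ := h₂ M₁ he₁.frameN he₁.frameR hq₁
  exact ⟨M₂, _, Exec.seq he₁ he₂, by omega, hq₂⟩

theorem Runs.ite {b : Test} {c₁ c₂ : Cmd} {M : Mem} {t : ℕ} {Q : Mem → Prop}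
    (h₁ : b.Holds M → Runs c₁ M t Q) (h₂ : ¬ b.Holds M → Runs c₂ M t Q) :
    Runs (Cmd.ite b c₁ c₂) M (b.cost + t + 1) Q := by
  by_cases hb : b.Holds M
  · obtain ⟨M', n, he, hn, hq⟩ := h₁ hb
    exact ⟨M', _, Exec.iteTrue hb he, by omega, hq⟩
  · obtain ⟨M', n, he, hn, hq⟩ := h₂ hb
    exact ⟨M', _, Exec.iteFalse hb he, by omega, hq⟩

/-- The invariant is indexed by the number of completed iterations and `K` is the exact number of
iterations, so termination, the time bound and the postcondition come from one induction. -/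
theorem Runs.while {b : Test} {c : Cmd} {t K : ℕ} (I : ℕ → Mem → Prop)
    (hb : ∀ j < K, ∀ M, I j M → b.Holds M ∧ Runs c M t (I (j + 1)))
    (hK : ∀ M, I K M → ¬ b.Holds M) {M : Mem} (h0 : I 0 M) :
    Runs (Cmd.while b c) M (K * (b.cost + t + 1) + b.cost + 1) (I K) := by
  -- Induction on the number `r` of remaining iterations, with the current memory left free.
  have key : ∀ r j M, j + r = K → I j M →
      Runs (Cmd.while b c) M (r * (b.cost + t + 1) + b.cost + 1) (I K) := by
    intro r
    induction r with
    | zero =>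
      intro j M hj h
      obtain rfl : j = K := by omega
      exact ⟨M, _, Exec.whileFalse (hK M h), by omega, h⟩
    | succ r ih =>
      intro j M hj h
      obtain ⟨hbM, M₁, n₁, he₁, hn₁, hq₁⟩ := hb j (by omega) M h
      obtain ⟨M₂, n₂, he₂, hn₂, hq₂⟩ := ih (j + 1) M₁ (by omega) hq₁
      refine ⟨M₂, _, Exec.whileTrue hbM he₁ he₂, ?_, hq₂⟩
      rw [Nat.succ_mul]
      omega
  exact key K 0 M (by omega) h0

/-- The scalar natural number variable `a`. -/
def nv (a : ℕ) : NExp := .get a (.lit 0)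

/-- The scalar real variable `a`. -/
def rv (a : ℕ) : RExp := .get a (.lit 0) (.lit 0)

@[simp] theorem nv_eval (a : ℕ) (M : Mem) : (nv a).eval M = M.nat a 0 := rfl
@[simp] theorem rv_eval (a : ℕ) (M : Mem) : (rv a).eval M = M.real a 0 0 := rfl
@[simp] theorem nv_cost (a : ℕ) : (nv a).cost = 2 := rfl
@[simp] theorem rv_cost (a : ℕ) : (rv a).cost = 3 := rfl
@[simp] theorem storeN_real (M : Mem) (a i v : ℕ) : (M.storeN a i v).real = M.real := rfl
@[simp] theorem storeR_nat (M : Mem) (a i j : ℕ) (v : ℝ) : (M.storeR a i j v).nat = M.nat := rfl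
@[simp] theorem storeN_same (M : Mem) (a i v : ℕ) : (M.storeN a i v).nat a i = v := by
  simp [Mem.storeN]
theorem storeN_ne (M : Mem) {a b : ℕ} (i v : ℕ) (h : b ≠ a) :
    (M.storeN a i v).nat b = M.nat b := by
  funext j; simp [Mem.storeN, h]
@[simp] theorem storeR_same (M : Mem) (a i j : ℕ) (v : ℝ) :
    (M.storeR a i j v).real a i j = v := by
  simp [Mem.storeR]
theorem storeR_ne (M : Mem) {a b : ℕ} (i j : ℕ) (v : ℝ) (h : b ≠ a) :
    (M.storeR a i j v).real b = M.real b := by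
  funext i' j'; simp [Mem.storeR, h]

/-- Run the body for the values `0, 1, …` of the variable `i` below the variable `a`. -/
def forN (i a : ℕ) (body : Cmd) : Cmd :=
  .seq (.setN i (.lit 0) (.lit 0))
    (.while (.natLt (nv i) (nv a)) (.seq body (.setN i (.lit 0) (.add (nv i) (.lit 1)))))

/-- The body writes neither the counter nor the bound, so the number of iterations is fixed at
entry. `hI` requires the invariant to be blind to the counter, so that increments preserve it; the
body receives the counter value and the frame relative to the entry memory separately. -/
theorem runs_forN {i a : ℕ} {body : Cmd} {M : Mem} {t K : ℕ} (I : ℕ → Mem → Prop) (hia : i ≠ a)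
    (hi : i ∉ body.writesN) (ha : a ∉ body.writesN) (hK : M.nat a 0 = K)
    (hI : ∀ j M v, I j M → I j (M.storeN i 0 v)) (h0 : I 0 M)
    (hb : ∀ j < K, ∀ M', (∀ b ∉ body.writesN, b ≠ i → M'.nat b = M.nat b) →
      (∀ b ∉ body.writesR, M'.real b = M.real b) → M'.nat i 0 = j → I j M' →
      Runs body M' t (I (j + 1))) :
    Runs (forN i a body) M (K * (t + 13) + 10) (I K) := by
  let J : ℕ → Mem → Prop := fun j M' => I j M' ∧ M'.nat i 0 = j ∧
    (∀ b ∉ body.writesN, b ≠ i → M'.nat b = M.nat b) ∧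
    (∀ b ∉ body.writesR, M'.real b = M.real b)
  have hw := fun (M₁ : Mem) (h : J 0 M₁) => Runs.while (M := M₁) (b := .natLt (nv i) (nv a))
    (c := .seq body (.setN i (.lit 0) (.add (nv i) (.lit 1)))) (t := t + 7) (K := K) J (by
      rintro j hj M' ⟨h1, h2, h3, h4⟩
      refine ⟨?_, ?_⟩
      · simp only [Test.Holds, nv_eval, h2, h3 a ha hia.symm, hK]; exact hj
      · refine Runs.mono (Runs.seq (t₂ := 6) (hb j hj M' h3 h4 h2 h1) ?_) (by omega)
          (fun _ _ _ h => h)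
        intro M₁ f1 f2 h5
        have hi1 : M₁.nat i 0 = j := by rw [f1 i hi, h2]
        refine Runs.setN ?_
        refine ⟨hI _ _ _ h5, ?_, ?_, ?_⟩
        · simp [NExp.eval, hi1]
        · intro b hb1 hb2
          rw [storeN_ne _ _ _ hb2, f1 b hb1, h3 b hb1 hb2]
        · intro b hb1
          rw [storeN_real, f2 b hb1, h4 b hb1]) (by
      rintro M' ⟨h1, h2, h3, h4⟩
      simp [Test.Holds, h2, h3 a ha hia.symm, hK]) h
  refine Runs.mono (Runs.seq (t₂ := K * (t + 13) + 6) (Q₂ := J K) (Runs.setN (Q := J 0) ?_) ?_) ?_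
    (fun _ _ _ h => h.1)
  · refine ⟨hI _ _ _ h0, storeN_same _ _ _ _, ?_, fun _ _ => rfl⟩
    intro b _ hb2
    exact storeN_ne _ _ _ hb2
  · intro M₁ _ _ h
    refine Runs.mono (hw M₁ h) ?_ (fun _ _ _ h => h)
    simp only [Test.cost, nv_cost]
    have : K * (2 + 2 + 1 + (t + 7) + 1) = K * (t + 13) := by ring
    omega
  · simp only [NExp.cost]; omega

/-- Store in `acc` the sum of the values of `e` over the values of `i` below the variable `a`. -/
def sumN (i a acc : ℕ) (e : RExp) : Cmd :=
  .seq (.setR acc (.lit 0) (.lit 0) (.ofNat (.lit 0)))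
    (forN i a (.setR acc (.lit 0) (.lit 0) (.add (rv acc) e)))

theorem runs_sumN {i a acc : ℕ} {e : RExp} {M : Mem} {K : ℕ} (f : ℕ → ℝ) (hia : i ≠ a)
    (hK : M.nat a 0 = K)
    (he : ∀ j < K, ∀ M', (∀ b, b ≠ i → M'.nat b = M.nat b) →
      (∀ b, b ≠ acc → M'.real b = M.real b) → M'.nat i 0 = j → e.eval M' = f j) :
    Runs (sumN i a acc e) M (K * (e.cost + 20) + 16)
      (fun M' => M'.real acc 0 0 = ∑ j ∈ Finset.range K, f j) := by
  refine Runs.mono (Runs.seq (t₂ := K * (e.cost + 20) + 10)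
    (Runs.setR (Q := fun M' => M'.real acc 0 0 = 0) ?_) ?_) ?_ (fun _ _ _ h => h)
  · simp [RExp.eval, NExp.eval]
  · intro M₁ f1 f2 h1
    refine Runs.mono (runs_forN (t := e.cost + 7)
      (fun j M' => M'.real acc 0 0 = ∑ j ∈ Finset.range j, f j) hia (by simp [Cmd.writesN])
      (by simp [Cmd.writesN]) (K := K) ?_ (fun j M' v h => h) (by simpa using h1) ?_) ?_
      (fun _ _ _ h => h)
    · rw [f1 a (by simp [Cmd.writesN])]; exact hK
    · intro j hj M' g1 g2 g3 g4
      refine Runs.mono (Runs.setR (Q := fun M' => M'.real acc 0 0 = ∑ j ∈ Finset.range (j + 1), f j)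
        ?_) ?_ (fun _ _ _ h => h)
      · have : e.eval M' = f j := by
          refine he j hj M' ?_ ?_ g3
          · intro b hb
            rw [g1 b (by simp [Cmd.writesN]) hb, f1 b (by simp [Cmd.writesN])]
          · intro b hb
            rw [g2 b (by simp [Cmd.writesR, hb]), f2 b (by simp [Cmd.writesR, hb])]
        simp [RExp.eval, NExp.eval, this, g4, Finset.sum_range_succ]
      · simp only [NExp.cost, RExp.cost, rv_cost]; omega
    · have : K * (e.cost + 7 + 13) = K * (e.cost + 20) := by ring
      omega
  · simp only [NExp.cost, RExp.cost]; omega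

/-- Fill the row `row` of the array `r` with values of `e`, for the column `i` below `a`. -/
def mapN (i a r : ℕ) (row : NExp) (e : RExp) : Cmd := forN i a (.setR r row (nv i) e)

/-- When column `j` is computed, the columns from `j` on still hold their original values. This is
what permits the in-place updates of the two states of the online algorithm. -/
theorem runs_mapN {i a r : ℕ} {row : NExp} {e : RExp} {M : Mem} {K ρ : ℕ} (f : ℕ → ℝ) (hia : i ≠ a)
    (hK : M.nat a 0 = K)
    (hrow : ∀ M' : Mem, (∀ b, b ≠ i → M'.nat b = M.nat b) → row.eval M' = ρ)
    (he : ∀ j < K, ∀ M', (∀ b, b ≠ i → M'.nat b = M.nat b) →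
      (∀ b, b ≠ r → M'.real b = M.real b) →
      (∀ r' c', r' ≠ ρ ∨ j ≤ c' → M'.real r r' c' = M.real r r' c') →
      M'.nat i 0 = j → e.eval M' = f j) :
    Runs (mapN i a r row e) M (K * (row.cost + e.cost + 16) + 10)
      (fun M' => ∀ r' c', M'.real r r' c' = if r' = ρ ∧ c' < K then f c' else M.real r r' c') := by
  refine Runs.mono (runs_forN (t := row.cost + e.cost + 3)
      (fun j M' => ∀ r' c', M'.real r r' c' = if r' = ρ ∧ c' < j then f c' else M.real r r' c')
      hia (by simp [Cmd.writesN]) (by simp [Cmd.writesN]) hK (fun j M' v h => h) (by simp) ?_) ?_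
      (fun _ _ _ h => h)
  · intro j hj M' g1 g2 g3 g4
    have g1' : ∀ b, b ≠ i → M'.nat b = M.nat b := fun b hb => g1 b (by simp [Cmd.writesN]) hb
    have hv : e.eval M' = f j := by
      refine he j hj M' g1' (fun b hb => g2 b (by simp [Cmd.writesR, hb])) ?_ g3
      intro r' c' h
      rw [g4, if_neg]
      rintro ⟨h1, h2⟩
      rcases h with h | h
      · exact h h1
      · omega
    refine Runs.mono (Runs.setR (Q := fun M' => ∀ r' c', M'.real r r' c' =
      if r' = ρ ∧ c' < j + 1 then f c' else M.real r r' c') ?_) ?_ (fun _ _ _ h => h)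
    · intro r' c'
      simp only [Mem.storeR, hrow M' g1', nv_eval, g3, hv, true_and]
      rcases eq_or_ne r' ρ with rfl | hr
      · rcases lt_trichotomy c' j with h | rfl | h
        · simp [h.ne, g4, h, h.trans (Nat.lt_succ_self j)]
        · simp
        · simp [h.ne', g4, not_lt.2 h.le, not_lt.2 (Nat.succ_le_of_lt h)]
      · simp [hr, g4]
    · simp only [nv_cost]; omega
  · have : K * (row.cost + e.cost + 3 + 13) = K * (row.cost + e.cost + 16) := by ring
    omega

/-- Fill the row `row` of the array `r` with sums of values of `e` over `j` below `b`, for the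
column `i` below `a`. -/
def mapSumN (i a r : ℕ) (row : NExp) (j b acc : ℕ) (e : RExp) : Cmd :=
  forN i a (.seq (sumN j b acc e) (.setR r row (nv i) (rv acc)))

/-- All rows other than `ρ` are known to be unchanged while `e` is evaluated. The orthogonalization
needs this, since it computes a row from earlier rows of the same array. -/
theorem runs_mapSumN {i a r j b acc : ℕ} {row : NExp} {e : RExp} {M : Mem} {K L ρ : ℕ}
    (f : ℕ → ℕ → ℝ) (hia : i ≠ a) (hjb : j ≠ b) (hij : i ≠ j) (haj : a ≠ j) (hbi : b ≠ i)
    (hr : r ≠ acc) (hK : M.nat a 0 = K) (hL : M.nat b 0 = L)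
    (hrow : ∀ M' : Mem, (∀ b, b ≠ i → b ≠ j → M'.nat b = M.nat b) → row.eval M' = ρ)
    (he : ∀ c < K, ∀ s < L, ∀ M', (∀ b, b ≠ i → b ≠ j → M'.nat b = M.nat b) →
      (∀ b, b ≠ r → b ≠ acc → M'.real b = M.real b) →
      (∀ r' c', r' ≠ ρ ∨ c ≤ c' → M'.real r r' c' = M.real r r' c') →
      M'.nat i 0 = c → M'.nat j 0 = s → e.eval M' = f c s) :
    Runs (mapSumN i a r row j b acc e) M (K * (L * (e.cost + 20) + row.cost + 36) + 10)
      (fun M' => ∀ r' c', M'.real r r' c' =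
        if r' = ρ ∧ c' < K then ∑ s ∈ Finset.range L, f c' s else M.real r r' c') := by
  have hwN : (Cmd.seq (sumN j b acc e) (.setR r row (nv i) (rv acc))).writesN = [j, j] := rfl
  have hwR : (Cmd.seq (sumN j b acc e) (.setR r row (nv i) (rv acc))).writesR = [acc, acc, r] := rfl
  have hsN : (sumN j b acc e).writesN = [j, j] := rfl
  have hsR : (sumN j b acc e).writesR = [acc, acc] := rfl
  refine Runs.mono (runs_forN (t := L * (e.cost + 20) + row.cost + 23)
      (fun j M' => ∀ r' c', M'.real r r' c' =
        if r' = ρ ∧ c' < j then ∑ s ∈ Finset.range L, f c' s else M.real r r' c')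
      hia (by simp [hwN, hij]) (by simp [hwN, haj]) hK (fun j M' v h => h) (by simp) ?_) ?_
      (fun _ _ _ h => h)
  · intro c hc M' g1 g2 g3 g4
    have g1' : ∀ b, b ≠ i → b ≠ j → M'.nat b = M.nat b :=
      fun b hb hb2 => g1 b (by simp [hwN, hb2]) hb
    refine Runs.mono (Runs.seq (t₂ := row.cost + 6) (runs_sumN (f c) hjb (K := L) ?_ ?_) ?_) ?_
      (fun _ _ _ h => h)
    · rw [g1' b hbi hjb.symm]; exact hL
    · intro s hs M₂ h1 h2 h3
      refine he c hc s hs M₂ ?_ ?_ ?_ ?_ h3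
      · intro b hb1 hb2
        rw [h1 b hb2, g1' b hb1 hb2]
      · intro b hb1 hb2
        rw [h2 b hb2, g2 b (by simp [hwR, hb1, hb2])]
      · intro r' c' h
        rw [h2 r hr, g4, if_neg]
        rintro ⟨h1, h2⟩
        rcases h with h | h
        · exact h h1
        · omega
      · rw [h1 i hij, g3]
    · intro M₂ h1 h2 h3
      have h1' : ∀ b, b ≠ i → b ≠ j → M₂.nat b = M.nat b := fun b hb hb2 => by
        rw [h1 b (by simp [hsN, hb2]), g1' b hb hb2]
      have hi2 : M₂.nat i 0 = c := by rw [h1 i (by simp [hsN, hij]), g3]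
      have hr2 : M₂.real r = M'.real r := h2 r (by simp [hsR, hr])
      refine Runs.mono (Runs.setR (Q := fun M' => ∀ r' c', M'.real r r' c' =
        if r' = ρ ∧ c' < c + 1 then ∑ s ∈ Finset.range L, f c' s else M.real r r' c') ?_) ?_
        (fun _ _ _ h => h)
      · intro r' c'
        simp only [Mem.storeR, hrow M₂ h1', nv_eval, rv_eval, h3, true_and, hr2, hi2]
        rcases eq_or_ne r' ρ with rfl | hr
        · rcases lt_trichotomy c' c with h | rfl | h
          · simp [h.ne, g4, h, h.trans (Nat.lt_succ_self c)]
          · simp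
          · simp [h.ne', g4, not_lt.2 h.le, not_lt.2 (Nat.succ_le_of_lt h)]
        · simp [hr, g4]
      · simp only [nv_cost, rv_cost]; omega
    · omega
  · have : K * (L * (e.cost + 20) + row.cost + 23 + 13) = K * (L * (e.cost + 20) + row.cost + 36) := by
      ring
    omega

/-! ### Features and whitening -/

/-- The features of a point `x`: the entries of the `k`-th tensor power of `(1, x)`. -/
def feat (d : ℕ) (x : ℕ → ℝ) : ℕ → ℕ → ℝ
  | 0, _ => 1
  | k + 1, w => if w < (d + 1) ^ k then feat d x k w else
      x (w / (d + 1) ^ k - 1) * feat d x k (w % (d + 1) ^ k)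

/-- The value at a point with features `φ` of the polynomial with coefficients `u`. -/
def dot (N : ℕ) (u φ : ℕ → ℝ) : ℝ := ∑ w ∈ Finset.range N, u w * φ w

/-- The Gram matrix of the features. -/
def gram (n : ℕ) (Φ : ℕ → ℕ → ℝ) (w w' : ℕ) : ℝ := ∑ r ∈ Finset.range n, Φ r w * Φ r w'

/-- Gram–Schmidt orthogonalization of the features with respect to the points `Φ`: the coefficients
of the polynomials in the orthogonal basis. -/
def gsB (N n : ℕ) (Φ : ℕ → ℕ → ℝ) (i : ℕ) : ℕ → ℝ := fun w =>
  (if w = i then 1 else 0) - ∑ i' : Fin i,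
    dot N (gram n Φ i) (gsB N n Φ i') /
      (∑ v ∈ Finset.range N, gsB N n Φ i' v * dot N (gram n Φ v) (gsB N n Φ i')) * gsB N n Φ i' w
termination_by i
decreasing_by all_goals exact i'.2

/-- The squared norms of the orthogonal basis. -/
def gsn (N n : ℕ) (Φ : ℕ → ℕ → ℝ) (i : ℕ) : ℝ :=
  ∑ v ∈ Finset.range N, gsB N n Φ i v * dot N (gram n Φ v) (gsB N n Φ i)

/-- The basis is orthogonal but not normalized, so field operations suffice and no square root
occurs. If an earlier vector has norm zero, the convention `x / 0 = 0` drops its term. -/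
theorem gsB_eq (N n : ℕ) (Φ : ℕ → ℕ → ℝ) (i w : ℕ) :
    gsB N n Φ i w = (if w = i then 1 else 0) - ∑ j ∈ Finset.range i,
      dot N (gram n Φ i) (gsB N n Φ j) / gsn N n Φ j * gsB N n Φ j w := by
  rw [gsB, Finset.sum_range]
  rfl

/-- The coefficients of the reproducing kernel at a point with features `φ`. -/
def kap (N n : ℕ) (Φ : ℕ → ℕ → ℝ) (φ : ℕ → ℝ) (w : ℕ) : ℝ :=
  ∑ j ∈ Finset.range N, dot N (gsB N n Φ j) φ / gsn N n Φ j * gsB N n Φ j w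

/-- The leverage of a point with features `φ`. -/
def lev (N n : ℕ) (Φ : ℕ → ℕ → ℝ) (φ : ℕ → ℝ) : ℝ := dot N φ (kap N n Φ φ)

/-- The squared norm of the component of `φ` that is not seen by the points `Φ`. -/
def nul (N n : ℕ) (Φ : ℕ → ℕ → ℝ) (φ : ℕ → ℝ) : ℝ :=
  ∑ j ∈ Finset.range N, (1 - gsn N n Φ j / gsn N n Φ j) *
    (dot N (gsB N n Φ j) φ * dot N (gsB N n Φ j) φ)

/-- The region where polynomials are controlled by their values at the points `Φ`. -/
def InRegion (N n : ℕ) (Φ : ℕ → ℕ → ℝ) (φ : ℕ → ℝ) : Prop :=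
  ¬ 0 < nul N n Φ φ ∧ ¬ 1 < lev N n Φ φ

/-- The inner product of polynomials given by the points `Φ`. -/
def ip (N n : ℕ) (Φ : ℕ → ℕ → ℝ) (u v : ℕ → ℝ) : ℝ :=
  ∑ r ∈ Finset.range n, dot N u (Φ r) * dot N v (Φ r)

/-! ### Orthogonality and the reproducing kernel of the empirical inner product -/

theorem dot_comm (N : ℕ) (u v : ℕ → ℝ) : dot N u v = dot N v u := by
  simp only [dot, mul_comm]

theorem ip_comm (N n : ℕ) (Φ : ℕ → ℕ → ℝ) (u v : ℕ → ℝ) : ip N n Φ u v = ip N n Φ v u := by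
  simp only [ip, mul_comm]

theorem ip_self_nonneg (N n : ℕ) (Φ : ℕ → ℕ → ℝ) (u : ℕ → ℝ) : 0 ≤ ip N n Φ u u :=
  Finset.sum_nonneg fun _ _ => mul_self_nonneg _

theorem ip_self_eq (N n : ℕ) (Φ : ℕ → ℕ → ℝ) (u : ℕ → ℝ) :
    ip N n Φ u u = ∑ r ∈ Finset.range n, dot N u (Φ r) ^ 2 := by
  simp only [ip, pow_two]

theorem dot_gram (N n : ℕ) (Φ : ℕ → ℕ → ℝ) (w : ℕ) (v : ℕ → ℝ) :
    dot N (gram n Φ w) v = ∑ r ∈ Finset.range n, Φ r w * dot N v (Φ r) := by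
  simp only [dot, gram, Finset.sum_mul, Finset.mul_sum]
  rw [Finset.sum_comm]
  exact Finset.sum_congr rfl fun _ _ => Finset.sum_congr rfl fun _ _ => by ring

theorem sum_mul_dot_gram (N n : ℕ) (Φ : ℕ → ℕ → ℝ) (u v : ℕ → ℝ) :
    ∑ w ∈ Finset.range N, u w * dot N (gram n Φ w) v = ip N n Φ u v := by
  simp only [dot_gram, ip, Finset.mul_sum]
  rw [Finset.sum_comm]
  refine Finset.sum_congr rfl fun r _ => ?_
  rw [dot_comm N u, dot, dot, Finset.sum_mul]
  exact Finset.sum_congr rfl fun _ _ => by ring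

theorem gsn_eq (N n : ℕ) (Φ : ℕ → ℕ → ℝ) (i : ℕ) :
    gsn N n Φ i = ip N n Φ (gsB N n Φ i) (gsB N n Φ i) := sum_mul_dot_gram ..

theorem dot_gsB (N n : ℕ) (Φ : ℕ → ℕ → ℝ) {i : ℕ} (hi : i < N) (φ : ℕ → ℝ) :
    dot N (gsB N n Φ i) φ = φ i - ∑ j ∈ Finset.range i,
      dot N (gram n Φ i) (gsB N n Φ j) / gsn N n Φ j * dot N (gsB N n Φ j) φ := by
  rw [dot]
  simp only [gsB_eq N n Φ i, sub_mul, Finset.sum_sub_distrib, ite_mul, one_mul, zero_mul,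
    Finset.sum_ite_eq', Finset.mem_range, hi, if_true, Finset.sum_mul]
  rw [Finset.sum_comm]
  congr 1
  refine Finset.sum_congr rfl fun j _ => ?_
  simp only [dot, Finset.mul_sum, mul_assoc]

/-- The squared norm is a sum of squares of the values at the reference points, so norm zero means
vanishing at all of them. -/
theorem dot_gsB_of_gsn_eq_zero {N n : ℕ} {Φ : ℕ → ℕ → ℝ} {i : ℕ} (h : gsn N n Φ i = 0) {r : ℕ}
    (hr : r < n) : dot N (gsB N n Φ i) (Φ r) = 0 := by
  rw [gsn_eq, ip, Finset.sum_eq_zero_iff_of_nonneg fun _ _ => mul_self_nonneg _] at h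
  simpa using h r (Finset.mem_range.2 hr)

theorem ip_gsB_left (N n : ℕ) (Φ : ℕ → ℕ → ℝ) {i : ℕ} (hi : i < N) (v : ℕ → ℝ) :
    ip N n Φ (gsB N n Φ i) v = dot N (gram n Φ i) v - ∑ j ∈ Finset.range i,
      dot N (gram n Φ i) (gsB N n Φ j) / gsn N n Φ j * ip N n Φ (gsB N n Φ j) v := by
  rw [ip]
  simp only [dot_gsB N n Φ hi, sub_mul, Finset.sum_sub_distrib, Finset.sum_mul]
  rw [Finset.sum_comm, dot_gram]
  congr 1
  refine Finset.sum_congr rfl fun j _ => ?_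
  simp only [ip, Finset.mul_sum, mul_assoc]

/-- The usual Gram–Schmidt induction: by orthogonality of the earlier vectors only the `j`-th
correction survives. If `gsB j` has norm zero that correction is absent, but then `gsB j` vanishes
at all points and is orthogonal to everything. -/
theorem ip_gsB_of_lt (N n : ℕ) (Φ : ℕ → ℕ → ℝ) (i : ℕ) :
    i < N → ∀ j < i, ip N n Φ (gsB N n Φ i) (gsB N n Φ j) = 0 := by
  induction i using Nat.strong_induction_on with
  | _ i ih =>
    intro hi j hj
    rw [ip_gsB_left N n Φ hi, Finset.sum_eq_single_of_mem j (Finset.mem_range.2 hj)]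
    · rw [← gsn_eq]
      by_cases h : gsn N n Φ j = 0
      · rw [h, mul_zero, sub_zero, dot_gram]
        exact Finset.sum_eq_zero fun r hr => by
          rw [dot_gsB_of_gsn_eq_zero h (Finset.mem_range.1 hr), mul_zero]
      · rw [div_mul_cancel₀ _ h, sub_self]
    · intro k hk hkj
      rw [Finset.mem_range] at hk
      rcases lt_or_gt_of_ne hkj with h | h
      · rw [ip_comm, ih j hj (hj.trans hi) k h, mul_zero]
      · rw [ih k hk (hk.trans hi) j h, mul_zero]

theorem ip_gsB_of_ne (N n : ℕ) (Φ : ℕ → ℕ → ℝ) {i j : ℕ} (hi : i < N) (hj : j < N) (h : i ≠ j) :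
    ip N n Φ (gsB N n Φ i) (gsB N n Φ j) = 0 := by
  rcases lt_or_gt_of_ne h with h | h
  · rw [ip_comm]; exact ip_gsB_of_lt N n Φ j hj i h
  · exact ip_gsB_of_lt N n Φ i hi j h

theorem dot_kap (N n : ℕ) (Φ : ℕ → ℕ → ℝ) (φ ψ : ℕ → ℝ) :
    dot N (kap N n Φ φ) ψ = ∑ j ∈ Finset.range N,
      dot N (gsB N n Φ j) φ / gsn N n Φ j * dot N (gsB N n Φ j) ψ := by
  simp only [dot, kap, Finset.sum_mul, Finset.mul_sum]
  rw [Finset.sum_comm]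
  exact Finset.sum_congr rfl fun _ _ => Finset.sum_congr rfl fun _ _ => by ring

/-- With `x / 0 = 0`, the factor `1 - x / x` is the indicator of `x = 0`; so `nul` is a sum of
squares over exactly the degenerate basis vectors. -/
theorem not_nul_pos_iff {N n : ℕ} {Φ : ℕ → ℕ → ℝ} {φ : ℕ → ℝ} :
    ¬ 0 < nul N n Φ φ ↔ ∀ j < N, gsn N n Φ j = 0 → dot N (gsB N n Φ j) φ = 0 := by
  have h0 : ∀ j ∈ Finset.range N, 0 ≤ (1 - gsn N n Φ j / gsn N n Φ j) *
      (dot N (gsB N n Φ j) φ * dot N (gsB N n Φ j) φ) := fun j _ =>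
    mul_nonneg (sub_nonneg.2 (div_self_le_one _)) (mul_self_nonneg _)
  rw [not_lt, nul]
  constructor
  · intro h j hj hn
    have := (Finset.sum_eq_zero_iff_of_nonneg h0).1 (le_antisymm h (Finset.sum_nonneg h0)) j
      (Finset.mem_range.2 hj)
    simpa [hn] using this
  · intro h
    refine (Finset.sum_eq_zero fun j hj => ?_).le
    by_cases hn : gsn N n Φ j = 0
    · simp [h j (Finset.mem_range.1 hj) hn]
    · simp [div_self hn]

/-- Orthogonality leaves the term of index `i`, where the norm cancels. In a degenerate direction
the left side is zero, and the hypothesis on `nul` says that the right side is too. -/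
theorem ip_gsB_kap {N n : ℕ} {Φ : ℕ → ℕ → ℝ} {φ : ℕ → ℝ} (h : ¬ 0 < nul N n Φ φ) {i : ℕ}
    (hi : i < N) : ip N n Φ (gsB N n Φ i) (kap N n Φ φ) = dot N (gsB N n Φ i) φ := by
  have : ip N n Φ (gsB N n Φ i) (kap N n Φ φ) = ∑ j ∈ Finset.range N,
      dot N (gsB N n Φ j) φ / gsn N n Φ j * ip N n Φ (gsB N n Φ i) (gsB N n Φ j) := by
    simp only [ip, dot_kap, Finset.mul_sum]
    rw [Finset.sum_comm]
    exact Finset.sum_congr rfl fun _ _ => Finset.sum_congr rfl fun _ _ => by ring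
  rw [this, Finset.sum_eq_single_of_mem i (Finset.mem_range.2 hi), ← gsn_eq]
  · by_cases hn : gsn N n Φ i = 0
    · rw [hn, mul_zero, not_nul_pos_iff.1 h i hi hn]
    · rw [div_mul_cancel₀ _ hn]
  · intro j hj hji
    rw [ip_gsB_of_ne N n Φ hi (Finset.mem_range.1 hj) hji.symm, mul_zero]

/-- The reproducing property. -/
theorem ip_kap {N n : ℕ} {Φ : ℕ → ℕ → ℝ} {φ : ℕ → ℝ} (h : ¬ 0 < nul N n Φ φ) (u : ℕ → ℝ) :
    ip N n Φ u (kap N n Φ φ) = dot N u φ := by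
  rw [← sum_mul_dot_gram, dot]
  refine Finset.sum_congr rfl fun i hi => ?_
  rw [Finset.mem_range] at hi
  congr 1
  -- The `i`-th coordinate vector is `gsB i` plus a combination of earlier basis vectors. Both
  -- functionals expand along it with the same coefficients and agree on the basis, hence on
  -- coordinate vectors.
  have h1 := ip_gsB_left N n Φ hi (kap N n Φ φ)
  have h2 := dot_gsB N n Φ hi φ
  rw [ip_gsB_kap h hi, h2] at h1
  have h3 : ∑ j ∈ Finset.range i, dot N (gram n Φ i) (gsB N n Φ j) / gsn N n Φ j *
      ip N n Φ (gsB N n Φ j) (kap N n Φ φ) = ∑ j ∈ Finset.range i,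
      dot N (gram n Φ i) (gsB N n Φ j) / gsn N n Φ j * dot N (gsB N n Φ j) φ :=
    Finset.sum_congr rfl fun j hj => by rw [ip_gsB_kap h ((Finset.mem_range.1 hj).trans hi)]
  linarith

theorem ip_kap_kap {N n : ℕ} {Φ : ℕ → ℕ → ℝ} {φ : ℕ → ℝ} (h : ¬ 0 < nul N n Φ φ) :
    ip N n Φ (kap N n Φ φ) (kap N n Φ φ) = lev N n Φ φ := by
  rw [ip_kap h, lev, dot_comm]

/-- The hypothesis is tested on the degenerate basis vectors, which gives `nul = 0`, and then on the
kernel itself, where it reads `lev ^ 2 ≤ lev`. With the next lemma, the computable region is exactly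
the set of points at which evaluation has norm at most one. -/
theorem inRegion_of_forall {N n : ℕ} {Φ : ℕ → ℕ → ℝ} {φ : ℕ → ℝ}
    (h : ∀ u, dot N u φ ^ 2 ≤ ip N n Φ u u) : InRegion N n Φ φ := by
  have h0 : ¬ 0 < nul N n Φ φ := by
    rw [not_nul_pos_iff]
    intro j _ hn
    have := h (gsB N n Φ j)
    rw [← gsn_eq, hn] at this
    exact pow_eq_zero_iff two_ne_zero |>.1 (le_antisymm this (sq_nonneg _))
  refine ⟨h0, fun h1 => ?_⟩
  have := h (kap N n Φ φ)
  rw [ip_kap_kap h0, dot_comm, ← lev] at this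
  nlinarith

/-- Cauchy–Schwarz applied to the reproducing property; the squared norm of the kernel is the
leverage. -/
theorem sq_dot_le_of_inRegion {N n : ℕ} {Φ : ℕ → ℕ → ℝ} {φ : ℕ → ℝ} (h : InRegion N n Φ φ)
    (u : ℕ → ℝ) : dot N u φ ^ 2 ≤ ip N n Φ u u := by
  rw [← ip_kap h.1 u]
  have h1 : ip N n Φ u (kap N n Φ φ) ^ 2 ≤
      ip N n Φ u u * ip N n Φ (kap N n Φ φ) (kap N n Φ φ) := by
    rw [ip_self_eq, ip_self_eq]
    exact Finset.sum_mul_sq_le_sq_mul_sq _ _ _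
  rw [ip_kap_kap h.1] at h1
  have h2 := not_lt.1 h.2
  nlinarith [ip_self_nonneg N n Φ u]

/-! ### Few points of a sample lie outside the region given by the others -/

/-- The value vectors of polynomials form a space of dimension at most `N`, so the leverages (the
squared lengths of the projections of the coordinate vectors onto it) sum to at most `N`. The
hypothesis forces leverage at least `1/2` at each point of `s`, by Cauchy–Schwarz in an orthonormal
basis of that space. -/
theorem card_high_leverage_le {ι : Type*} [Fintype ι] (N : ℕ) (ψ : ι → ℕ → ℝ) (s : Finset ι)
    (hs : ∀ i ∈ s, ∃ u, ∑ j, dot N u (ψ j) ^ 2 < 2 * dot N u (ψ i) ^ 2) : s.card ≤ 2 * N := by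
  classical
  -- `L` sends coefficients to the vector of values at the points.
  let L : (Fin N → ℝ) →ₗ[ℝ] EuclideanSpace ℝ ι :=
    (WithLp.linearEquiv 2 ℝ (ι → ℝ)).symm.toLinearMap ∘ₗ
      (Matrix.toLin' (Matrix.of fun i (w : Fin N) => ψ i w))
  have hL : ∀ (u : ℕ → ℝ) i, L (fun w => u w) i = dot N u (ψ i) := by
    intro u i
    simp only [L, LinearMap.comp_apply, Matrix.toLin'_apply, dot, Finset.sum_range]
    simp [Matrix.mulVec, dotProduct, mul_comm]
  let W := LinearMap.range L
  have hW : Module.finrank ℝ W ≤ N := by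
    have := LinearMap.finrank_range_le L
    simpa using this
  let b := stdOrthonormalBasis ℝ W
  let lv : ι → ℝ := fun i => ∑ k, ((b k : W) : EuclideanSpace ℝ ι) i ^ 2
  have hsum : ∑ i, lv i ≤ N := by
    simp only [lv]
    rw [Finset.sum_comm]
    have : ∀ k, ∑ i, ((b k : W) : EuclideanSpace ℝ ι) i ^ 2 = 1 := by
      intro k
      have h1 : ‖((b k : W) : EuclideanSpace ℝ ι)‖ = 1 := b.norm_eq_one k
      have h2 := EuclideanSpace.norm_sq_eq ((b k : W) : EuclideanSpace ℝ ι)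
      rw [h1] at h2
      simpa using h2.symm
    simp only [this, Finset.sum_const, Finset.card_univ, Fintype.card_fin, nsmul_eq_mul, mul_one]
    exact_mod_cast hW
  have hlv : ∀ i ∈ s, 1 ≤ 2 * lv i := by
    intro i hi
    obtain ⟨u, hu⟩ := hs i hi
    let p : W := ⟨L fun w => u w, LinearMap.mem_range_self _ _⟩
    have hp : ∀ j, (p : EuclideanSpace ℝ ι) j = dot N u (ψ j) := hL u
    have h1 : (p : EuclideanSpace ℝ ι) i = ∑ k, b.repr p k * ((b k : W) : EuclideanSpace ℝ ι) i := by
      conv_lhs => rw [← b.sum_repr p]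
      simp
    have h2 : ‖p‖ ^ 2 = ∑ k, b.repr p k ^ 2 := by
      rw [← b.repr.norm_map p, EuclideanSpace.norm_sq_eq]
      simp
    have h3 : ‖p‖ ^ 2 = ∑ j, dot N u (ψ j) ^ 2 := by
      have : ‖p‖ = ‖(p : EuclideanSpace ℝ ι)‖ := rfl
      rw [this, EuclideanSpace.norm_sq_eq]
      simp [hp]
    have h4 : (p : EuclideanSpace ℝ ι) i ^ 2 ≤ ‖p‖ ^ 2 * lv i := by
      rw [h1, h2]
      exact Finset.sum_mul_sq_le_sq_mul_sq _ _ _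
    rw [hp, h3] at h4
    set t := ∑ j, dot N u (ψ j) ^ 2
    have ht : 0 ≤ t := Finset.sum_nonneg fun _ _ => sq_nonneg _
    by_contra h5
    push Not at h5
    nlinarith
  have h6 : (s.card : ℝ) ≤ 2 * N := by
    calc (s.card : ℝ) = ∑ i ∈ s, (1 : ℝ) := by simp
      _ ≤ ∑ i ∈ s, 2 * lv i := Finset.sum_le_sum hlv
      _ ≤ ∑ i, 2 * lv i := Finset.sum_le_sum_of_subset_of_nonneg (Finset.subset_univ _)
          fun i _ _ => mul_nonneg zero_le_two (Finset.sum_nonneg fun _ _ => sq_nonneg _)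
      _ ≤ 2 * N := by rw [← Finset.mul_sum]; linarith
  exact_mod_cast h6

/-- A finite sequence, continued by a constant. -/
def extend {α : Type*} (a : α) {n : ℕ} (z : Fin n → α) (i : ℕ) : α :=
  if h : i < n then z ⟨i, h⟩ else a

theorem extend_lt {α : Type*} (a : α) {n : ℕ} (z : Fin n → α) {i : ℕ} (h : i < n) :
    extend a z i = z ⟨i, h⟩ := dif_pos h

/-- A point outside the region of the others has a polynomial whose square there exceeds the sum of
its squares at the others. Adding the point's own square to both sides gives the leverage condition
with the factor `2`. -/
theorem card_not_inRegion_le (N n : ℕ) (ψ : Fin (n + 1) → ℕ → ℝ) (a : ℕ → ℝ)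
    (s : Finset (Fin (n + 1)))
    (hs : ∀ i ∈ s, ¬ InRegion N n (extend a fun r => ψ (i.succAbove r)) (ψ i)) :
    s.card ≤ 2 * N := by
  refine card_high_leverage_le N ψ s fun i hi => ?_
  have := mt inRegion_of_forall (hs i hi)
  push Not at this
  obtain ⟨u, hu⟩ := this
  refine ⟨u, ?_⟩
  rw [ip_self_eq, Finset.sum_range] at hu
  rw [Fin.sum_univ_succAbove _ i, two_mul]
  refine add_lt_add_right ?_ _
  simp only [extend_lt _ _ (Fin.is_lt _), Fin.eta] at hu
  exact hu

/-! ### Polynomials in terms of features -/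

theorem dot_single {N w : ℕ} (hw : w < N) (φ : ℕ → ℝ) : dot N (Pi.single w 1) φ = φ w := by
  rw [dot, Finset.sum_eq_single_of_mem w (Finset.mem_range.2 hw)]
  · simp
  · intro b _ hb; simp [hb]

theorem feat_zero (d : ℕ) (x : ℕ → ℝ) (k : ℕ) : feat d x k 0 = 1 := by
  induction k with
  | zero => rfl
  | succ k ih => rw [feat, if_pos (by positivity), ih]

/-- The block structure of the tensor power: the first block repeats the previous level (factor
`1`), and block `j + 1` is the previous level times `x j`. -/
theorem feat_succ (d : ℕ) (x : ℕ → ℝ) (k j w : ℕ) (hw : w < (d + 1) ^ k) :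
    feat d x (k + 1) ((d + 1) ^ k + (j * (d + 1) ^ k + w)) = x j * feat d x k w := by
  have hpos : 0 < (d + 1) ^ k := by positivity
  have e : (d + 1) ^ k + (j * (d + 1) ^ k + w) = w + (d + 1) ^ k * (j + 1) := by ring
  rw [feat, if_neg (by omega), e, Nat.add_mul_div_left _ _ hpos, Nat.div_eq_of_lt hw,
    Nat.add_mul_mod_self_left, Nat.mod_eq_of_lt hw]
  simp

/-- The function `f` is a linear combination of the features. -/
def IsFeatureComb (d l : ℕ) (f : (Fin d → ℝ) → ℝ) : Prop :=
  ∃ u : ℕ → ℝ, ∀ x, f x = dot ((d + 1) ^ l) u (feat d (entry x) l)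

theorem IsFeatureComb.feat {d l w : ℕ} (hw : w < (d + 1) ^ l) :
    IsFeatureComb d l fun x => feat d (entry x) l w :=
  ⟨Pi.single w 1, fun _ => (dot_single hw _).symm⟩

theorem IsFeatureComb.sum {d l : ℕ} {ι : Type*} (s : Finset ι) (c : ι → ℝ)
    (f : ι → (Fin d → ℝ) → ℝ) (h : ∀ i ∈ s, IsFeatureComb d l (f i)) :
    IsFeatureComb d l fun x => ∑ i ∈ s, c i * f i x := by
  classical
  choose! u hu using h
  refine ⟨fun w => ∑ i ∈ s, c i * u i w, fun x => ?_⟩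
  simp only [dot, Finset.sum_mul]
  rw [Finset.sum_comm]
  refine Finset.sum_congr rfl fun i hi => ?_
  rw [hu i hi x, dot, Finset.mul_sum]
  exact Finset.sum_congr rfl fun _ _ => by ring

theorem IsFeatureComb.mul_coord {d l : ℕ} {f : (Fin d → ℝ) → ℝ} (h : IsFeatureComb d l f)
    (i : Fin d) : IsFeatureComb d (l + 1) fun x => x i * f x := by
  obtain ⟨u, hu⟩ := h
  have := IsFeatureComb.sum (l := l + 1) (Finset.range ((d + 1) ^ l)) u
    (fun w x => TolerantTesting.feat d (entry x) (l + 1) ((d + 1) ^ l + (i * (d + 1) ^ l + w)))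
    (fun w hw => by
      refine IsFeatureComb.feat ?_
      rw [Finset.mem_range] at hw
      have h1 : (i : ℕ) * (d + 1) ^ l + (d + 1) ^ l ≤ d * (d + 1) ^ l := by
        rw [← Nat.succ_mul]; exact Nat.mul_le_mul_right _ i.2
      have h2 : (d + 1) ^ (l + 1) = d * (d + 1) ^ l + (d + 1) ^ l := by ring
      omega)
  convert this using 2 with x
  rw [hu x, dot, Finset.mul_sum]
  refine Finset.sum_congr rfl fun w hw => ?_
  rw [feat_succ _ _ _ _ _ (Finset.mem_range.1 hw)]
  have : entry x i = x i := by simp [entry]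
  rw [this]; ring

/-- One variable is stripped from the monomial for each tensor level. Monomials of smaller degree
are covered because `1` is among the tensor factors. -/
theorem isFeatureComb_monomial (d l : ℕ) (s : Fin d →₀ ℕ) (hs : (s.sum fun _ e => e) ≤ l) :
    IsFeatureComb d l fun x => s.prod fun i e => x i ^ e := by
  induction l generalizing s with
  | zero =>
    have : s = 0 := by
      ext i
      by_contra hi
      have := Finset.single_le_sum (f := fun i => s i) (fun _ _ => Nat.zero_le _)
        (Finsupp.mem_support_iff.2 hi)
      rw [Finsupp.sum] at hs
      exact hi (Nat.le_zero.1 (this.trans hs))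
    subst this
    simpa [feat_zero] using IsFeatureComb.feat (d := d) (l := 0) (w := 0) (by simp)
  | succ l ih =>
    by_cases h : s = 0
    · subst h
      simpa [feat_zero] using IsFeatureComb.feat (d := d) (l := l + 1) (w := 0) (by positivity)
    · obtain ⟨i, hi⟩ := Finsupp.ne_iff.1 h
      obtain ⟨s', rfl⟩ : ∃ s', s = s' + Finsupp.single i 1 :=
        ⟨s - Finsupp.single i 1, (tsub_add_cancel_of_le (by
          rw [Finsupp.single_le_iff]; exact Nat.one_le_iff_ne_zero.2 hi)).symm⟩
      rw [Finsupp.sum_add_index' (fun _ => rfl) (fun _ _ _ => rfl), Finsupp.sum_single_index rfl]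
        at hs
      convert (ih s' (by omega)).mul_coord i using 2 with x
      rw [Finsupp.prod_add_index' (h := fun i e => x i ^ e) (fun _ => pow_zero _)
        (fun _ _ _ => pow_add _ _ _), Finsupp.prod_single_index (h := fun i e => x i ^ e)
        (pow_zero _), pow_one, mul_comm]

/-- Monomials are repeated among the features, so `u` is not unique and the Gram matrix may be
singular. Only the values of the polynomial are used, and the orthogonalization tolerates degenerate
directions. -/
theorem exists_dot_feat {d l : ℕ} (p : MvPolynomial (Fin d) ℝ) (hp : p.totalDegree ≤ l) :
    ∃ u : ℕ → ℝ, ∀ x, MvPolynomial.eval x p = dot ((d + 1) ^ l) u (feat d (entry x) l) := by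
  have := IsFeatureComb.sum (l := l) p.support (fun s => p.coeff s)
    (fun s x => s.prod fun i e => x i ^ e)
    (fun s hs => isFeatureComb_monomial d l s ((MvPolynomial.le_totalDegree hs).trans hp))
  obtain ⟨u, hu⟩ := this
  refine ⟨u, fun x => ?_⟩
  rw [← hu x, MvPolynomial.eval_eq]
  rfl

/-! ### The online algorithm -/

/-- The data of one round: the features of a labeled example, its label and the features of a
reference example. -/
abbrev Round : Type := (ℕ → ℝ) × ℝ × (ℕ → ℝ)

open Classical in
/-- The filter given by the polynomial `q`. -/
def gate (N n : ℕ) (Φ : ℕ → ℕ → ℝ) (q φ : ℕ → ℝ) : ℝ :=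
  if InRegion N n Φ φ ∧ dot N q φ < 1 then 1 else 0

open Classical in
/-- The sign of the polynomial `q`, in the region. -/
def sgnR (N n : ℕ) (Φ : ℕ → ℕ → ℝ) (q φ : ℕ → ℝ) : ℝ :=
  if InRegion N n Φ φ then (if dot N q φ < 0 then -1 else 1) else 0

/-- The sign of the residual. -/
def sgnY (N : ℕ) (p φ : ℕ → ℝ) (y : ℝ) : ℝ := if dot N p φ < y then 1 else -1

/-- One round of the online algorithm. -/
def step (N n : ℕ) (Φ : ℕ → ℕ → ℝ) (η : ℝ) (s : (ℕ → ℝ) × (ℕ → ℝ)) (z : Round) :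
    (ℕ → ℝ) × (ℕ → ℝ) :=
  (fun w => s.1 w + η * (gate N n Φ s.1 z.1 * kap N n Φ z.1 w -
      sgnR N n Φ s.1 z.2.2 * kap N n Φ z.2.2 w),
   fun w => s.2 w + η * (gate N n Φ s.1 z.1 * sgnY N s.2 z.1 z.2.1 * kap N n Φ z.1 w))

/-- The contribution of a round to the test statistic. -/
def val (N n : ℕ) (Φ : ℕ → ℕ → ℝ) (q : ℕ → ℝ) (z : Round) : ℝ :=
  (1 - gate N n Φ q z.1) + gate N n Φ q z.1 * dot N q z.1 -
    sgnR N n Φ q z.2.2 * dot N q z.2.2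

/-- The state of the online algorithm after `t` rounds, started from `s`. -/
def runFrom (N n : ℕ) (Φ : ℕ → ℕ → ℝ) (η : ℝ) (s : (ℕ → ℝ) × (ℕ → ℝ)) (z : ℕ → Round) :
    ℕ → (ℕ → ℝ) × (ℕ → ℝ)
  | 0 => s
  | t + 1 => step N n Φ η (runFrom N n Φ η s z t) (z t)

theorem gate_cases (N n : ℕ) (Φ : ℕ → ℕ → ℝ) (q φ : ℕ → ℝ) :
    (gate N n Φ q φ = 1 ∧ InRegion N n Φ φ ∧ dot N q φ < 1) ∨ gate N n Φ q φ = 0 := by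
  rw [gate]; split_ifs with h
  · exact Or.inl ⟨rfl, h⟩
  · exact Or.inr rfl

theorem sgnR_cases (N n : ℕ) (Φ : ℕ → ℕ → ℝ) (q φ : ℕ → ℝ) :
    (InRegion N n Φ φ ∧ |sgnR N n Φ q φ| = 1 ∧ sgnR N n Φ q φ * dot N q φ = |dot N q φ|) ∨
      (¬ InRegion N n Φ φ ∧ sgnR N n Φ q φ = 0) := by
  rw [sgnR]; split_ifs with h h'
  · exact Or.inl ⟨h, by simp, by rw [abs_of_neg h']; ring⟩
  · exact Or.inl ⟨h, by simp, by rw [abs_of_nonneg (not_lt.1 h')]; ring⟩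
  · exact Or.inr ⟨h, rfl⟩

theorem sgnY_mul (N : ℕ) (p φ : ℕ → ℝ) (y : ℝ) :
    sgnY N p φ y * (y - dot N p φ) = |y - dot N p φ| := by
  rw [sgnY]; split_ifs with h
  · rw [abs_of_pos (sub_pos.2 h), one_mul]
  · rw [abs_of_nonpos (by linarith)]; ring

theorem abs_sgnY (N : ℕ) (p φ : ℕ → ℝ) (y : ℝ) : |sgnY N p φ y| = 1 := by
  rw [sgnY]; split_ifs <;> simp

/-! ### Bilinearity of evaluation and of the inner product -/

theorem dot_add_left (N : ℕ) (u v φ : ℕ → ℝ) : dot N (u + v) φ = dot N u φ + dot N v φ := by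
  simp [dot, add_mul, Finset.sum_add_distrib]

theorem dot_sub_left (N : ℕ) (u v φ : ℕ → ℝ) : dot N (u - v) φ = dot N u φ - dot N v φ := by
  simp [dot, sub_mul, Finset.sum_sub_distrib]

theorem dot_smul_left (N : ℕ) (c : ℝ) (v φ : ℕ → ℝ) : dot N (c • v) φ = c * dot N v φ := by
  simp [dot, Finset.mul_sum, mul_assoc]

theorem ip_add_left (N n : ℕ) (Φ : ℕ → ℕ → ℝ) (u v w : ℕ → ℝ) :
    ip N n Φ (u + v) w = ip N n Φ u w + ip N n Φ v w := by
  simp [ip, dot_add_left, add_mul, Finset.sum_add_distrib]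

theorem ip_sub_left (N n : ℕ) (Φ : ℕ → ℕ → ℝ) (u v w : ℕ → ℝ) :
    ip N n Φ (u - v) w = ip N n Φ u w - ip N n Φ v w := by
  simp [ip, dot_sub_left, sub_mul, Finset.sum_sub_distrib]

theorem ip_smul_left (N n : ℕ) (Φ : ℕ → ℕ → ℝ) (c : ℝ) (v w : ℕ → ℝ) :
    ip N n Φ (c • v) w = c * ip N n Φ v w := by
  simp [ip, dot_smul_left, Finset.mul_sum, mul_assoc]

theorem ip_add_right (N n : ℕ) (Φ : ℕ → ℕ → ℝ) (u v w : ℕ → ℝ) :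
    ip N n Φ w (u + v) = ip N n Φ w u + ip N n Φ w v := by
  rw [ip_comm, ip_add_left, ip_comm _ _ _ u, ip_comm _ _ _ v]

theorem ip_sub_right (N n : ℕ) (Φ : ℕ → ℕ → ℝ) (u v w : ℕ → ℝ) :
    ip N n Φ w (u - v) = ip N n Φ w u - ip N n Φ w v := by
  rw [ip_comm, ip_sub_left, ip_comm _ _ _ u, ip_comm _ _ _ v]

theorem ip_smul_right (N n : ℕ) (Φ : ℕ → ℕ → ℝ) (c : ℝ) (v w : ℕ → ℝ) :
    ip N n Φ w (c • v) = c * ip N n Φ w v := by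
  rw [ip_comm, ip_smul_left, ip_comm]

/-- Change of the squared norm in a gradient step in the direction of two kernels. -/
theorem ip_step_le (N n : ℕ) (Φ : ℕ → ℕ → ℝ) (a : ℕ → ℝ) (φ ψ : ℕ → ℝ) (g s η : ℝ)
    (hg : g = 0 ∨ |g| = 1 ∧ InRegion N n Φ φ) (hs : s = 0 ∨ |s| = 1 ∧ InRegion N n Φ ψ) :
    ip N n Φ (a + η • (g • kap N n Φ φ - s • kap N n Φ ψ))
        (a + η • (g • kap N n Φ φ - s • kap N n Φ ψ)) ≤
      ip N n Φ a a + 2 * η * (g * dot N a φ - s * dot N a ψ) + 2 * η ^ 2 * (g ^ 2 + s ^ 2) := by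
  set k₁ := kap N n Φ φ with hk₁
  set k₂ := kap N n Φ ψ with hk₂
  have e : ip N n Φ (a + η • (g • k₁ - s • k₂)) (a + η • (g • k₁ - s • k₂)) =
      ip N n Φ a a + 2 * η * (g * ip N n Φ a k₁ - s * ip N n Φ a k₂) +
        η ^ 2 * ip N n Φ (g • k₁ - s • k₂) (g • k₁ - s • k₂) := by
    simp only [ip_add_left, ip_smul_left, ip_sub_left, ip_add_right, ip_smul_right, ip_sub_right,
      ip_comm N n Φ k₁ a, ip_comm N n Φ k₂ a]
    ring
  -- `‖a - b‖ ^ 2 ≤ 2 ‖a‖ ^ 2 + 2 ‖b‖ ^ 2`, from nonnegativity of `‖a + b‖ ^ 2`.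
  have h1 : ip N n Φ (g • k₁ - s • k₂) (g • k₁ - s • k₂) ≤
      2 * (g ^ 2 * ip N n Φ k₁ k₁ + s ^ 2 * ip N n Φ k₂ k₂) := by
    have h2 := ip_self_nonneg N n Φ (g • k₁ + s • k₂)
    simp only [ip_add_left, ip_smul_left, ip_sub_left, ip_add_right, ip_smul_right, ip_sub_right,
      ip_comm N n Φ k₂ k₁] at h2 ⊢
    nlinarith
  -- The reproducing property and the bound by one on the leverage are available only in the region;
  -- elsewhere the coefficient is zero.
  have h3 : g * ip N n Φ a k₁ = g * dot N a φ ∧ g ^ 2 * ip N n Φ k₁ k₁ ≤ g ^ 2 := by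
    rcases hg with rfl | ⟨_, h⟩
    · simp
    · rw [hk₁, ip_kap h.1, ip_kap_kap h.1]
      exact ⟨rfl, mul_le_of_le_one_right (sq_nonneg _) (not_lt.1 h.2)⟩
  have h4 : s * ip N n Φ a k₂ = s * dot N a ψ ∧ s ^ 2 * ip N n Φ k₂ k₂ ≤ s ^ 2 := by
    rcases hs with rfl | ⟨_, h⟩
    · simp
    · rw [hk₂, ip_kap h.1, ip_kap_kap h.1]
      exact ⟨rfl, mul_le_of_le_one_right (sq_nonneg _) (not_lt.1 h.2)⟩
  rw [e, h3.1, h4.1]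
  nlinarith [sq_nonneg η, mul_le_mul_of_nonneg_left h1 (sq_nonneg η),
    mul_le_mul_of_nonneg_left (add_le_add h3.2 h4.2) (sq_nonneg η)]

/-! ### Potential functions and regret of the online algorithm -/

theorem step_fst (N n : ℕ) (Φ : ℕ → ℕ → ℝ) (η : ℝ) (s : (ℕ → ℝ) × (ℕ → ℝ)) (z : Round) :
    (step N n Φ η s z).1 = s.1 + η • (gate N n Φ s.1 z.1 • kap N n Φ z.1 -
      sgnR N n Φ s.1 z.2.2 • kap N n Φ z.2.2) := rfl

theorem step_snd (N n : ℕ) (Φ : ℕ → ℕ → ℝ) (η : ℝ) (s : (ℕ → ℝ) × (ℕ → ℝ)) (z : Round) :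
    (step N n Φ η s z).2 = s.2 + η • ((gate N n Φ s.1 z.1 * sgnY N s.2 z.1 z.2.1) •
      kap N n Φ z.1 - (0 : ℝ) • kap N n Φ z.1) := by
  simp [step, Pi.add_def, Pi.smul_def, mul_assoc]

/-- The potential of online gradient ascent is the squared distance to a comparator `u`. Gate and
sign are at most one in absolute value, so the quadratic term is at most `4 η ^ 2`. -/
theorem ip_step_fst_sub_le (N n : ℕ) (Φ : ℕ → ℕ → ℝ) (η : ℝ) (s : (ℕ → ℝ) × (ℕ → ℝ)) (z : Round)
    (u : ℕ → ℝ) :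
    ip N n Φ ((step N n Φ η s z).1 - u) ((step N n Φ η s z).1 - u) ≤
      ip N n Φ (s.1 - u) (s.1 - u) + 2 * η * (gate N n Φ s.1 z.1 * dot N (s.1 - u) z.1 -
        sgnR N n Φ s.1 z.2.2 * dot N (s.1 - u) z.2.2) + 4 * η ^ 2 := by
  have h1 : gate N n Φ s.1 z.1 = 0 ∨ |gate N n Φ s.1 z.1| = 1 ∧ InRegion N n Φ z.1 := by
    rcases gate_cases N n Φ s.1 z.1 with h | h
    · exact Or.inr ⟨by rw [h.1, abs_one], h.2.1⟩
    · exact Or.inl h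
  have h2 : sgnR N n Φ s.1 z.2.2 = 0 ∨ |sgnR N n Φ s.1 z.2.2| = 1 ∧ InRegion N n Φ z.2.2 := by
    rcases sgnR_cases N n Φ s.1 z.2.2 with h | h
    · exact Or.inr ⟨h.2.1, h.1⟩
    · exact Or.inl h.2
  have h3 := ip_step_le N n Φ (s.1 - u) z.1 z.2.2 _ _ η h1 h2
  rw [step_fst, add_sub_right_comm]
  refine h3.trans ?_
  have h5 : gate N n Φ s.1 z.1 ^ 2 ≤ 1 := by
    rcases h1 with h | h
    · simp [h]
    · rw [← sq_abs, h.1]; norm_num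
  have h6 : sgnR N n Φ s.1 z.2.2 ^ 2 ≤ 1 := by
    rcases h2 with h | h
    · simp [h]
    · rw [← sq_abs, h.1]; norm_num
  nlinarith [sq_nonneg η, mul_le_mul_of_nonneg_left (add_le_add h5 h6) (sq_nonneg η)]

theorem gate_mul_le (N n : ℕ) (Φ : ℕ → ℕ → ℝ) (q φ : ℕ → ℝ) :
    gate N n Φ q φ * dot N q φ ≤ 1 := by
  rcases gate_cases N n Φ q φ with h | h
  · rw [h.1, one_mul]; exact h.2.2.le
  · rw [h, zero_mul]; exact zero_le_one

theorem sgnR_mul_nonneg (N n : ℕ) (Φ : ℕ → ℕ → ℝ) (q φ : ℕ → ℝ) :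
    0 ≤ sgnR N n Φ q φ * dot N q φ := by
  rcases sgnR_cases N n Φ q φ with h | h
  · rw [h.2.2]; exact abs_nonneg _
  · rw [h.2, zero_mul]

/-- With comparator zero the linear term is at most `2 η`: the gate closes once `q` reaches one, and
the reference term only shrinks `q`. Hence each round adds at most `2 η + 4 η ^ 2 ≤ 6 η`. This a
priori bound on the filter is what keeps the martingale increments of the statistic of order `√(η
T)`. -/
theorem ip_runFrom_fst_le (N n : ℕ) (Φ : ℕ → ℕ → ℝ) {η : ℝ} (h0 : 0 ≤ η) (h1 : η ≤ 1)
    (z : ℕ → Round) (t : ℕ) :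
    ip N n Φ (runFrom N n Φ η 0 z t).1 (runFrom N n Φ η 0 z t).1 ≤ 6 * η * t := by
  induction t with
  | zero => simp [runFrom, ip, dot]
  | succ t ih =>
    have := ip_step_fst_sub_le N n Φ η (runFrom N n Φ η 0 z t) (z t) 0
    simp only [sub_zero] at this
    rw [runFrom]
    have h2 := gate_mul_le N n Φ (runFrom N n Φ η 0 z t).1 (z t).1
    have h3 := sgnR_mul_nonneg N n Φ (runFrom N n Φ η 0 z t).1 (z t).2.2
    push_cast
    nlinarith [mul_le_mul_of_nonneg_left (sub_le_sub h2 h3) h0]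

/-- The filter found by the online algorithm controls every polynomial. -/
theorem sum_gate_le (N n : ℕ) (Φ : ℕ → ℕ → ℝ) {η : ℝ} (h0 : 0 < η) (z : ℕ → Round) (u : ℕ → ℝ)
    (T : ℕ) :
    ∑ t ∈ Finset.range T, ((1 - gate N n Φ (runFrom N n Φ η 0 z t).1 (z t).1) +
        gate N n Φ (runFrom N n Φ η 0 z t).1 (z t).1 * dot N u (z t).1) ≤
      ∑ t ∈ Finset.range T, val N n Φ (runFrom N n Φ η 0 z t).1 (z t) +
        ∑ t ∈ Finset.range T, |dot N u (z t).2.2| + ip N n Φ u u / (2 * η) + 2 * η * T := by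
  -- The potential `‖q - u‖ ^ 2`, with the accumulated regret kept on the right side. Its
  -- nonnegativity after the last round is the claim multiplied by `2 η`.
  have key : ∀ T : ℕ, ip N n Φ ((runFrom N n Φ η 0 z T).1 - u) ((runFrom N n Φ η 0 z T).1 - u) ≤
      ip N n Φ u u + 4 * η ^ 2 * T + 2 * η * (
        ∑ t ∈ Finset.range T, val N n Φ (runFrom N n Φ η 0 z t).1 (z t) +
        ∑ t ∈ Finset.range T, |dot N u (z t).2.2| -
        ∑ t ∈ Finset.range T, ((1 - gate N n Φ (runFrom N n Φ η 0 z t).1 (z t).1) +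
          gate N n Φ (runFrom N n Φ η 0 z t).1 (z t).1 * dot N u (z t).1)) := by
    intro T
    induction T with
    | zero =>
      simp only [runFrom, Finset.range_zero, Finset.sum_empty]
      have : ip N n Φ ((0 : (ℕ → ℝ) × (ℕ → ℝ)).1 - u) ((0 : (ℕ → ℝ) × (ℕ → ℝ)).1 - u) =
          ip N n Φ u u := by
        simp [ip, dot]
      rw [this]; simp
    | succ t ih =>
      have h1 := ip_step_fst_sub_le N n Φ η (runFrom N n Φ η 0 z t) (z t) u
      simp only [Finset.sum_range_succ]
      rw [runFrom]
      set q := (runFrom N n Φ η 0 z t).1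
      have h2 : sgnR N n Φ q (z t).2.2 * dot N u (z t).2.2 ≤ |dot N u (z t).2.2| := by
        rcases sgnR_cases N n Φ q (z t).2.2 with h | h
        · calc _ ≤ |sgnR N n Φ q (z t).2.2 * dot N u (z t).2.2| := le_abs_self _
            _ = _ := by rw [abs_mul, h.2.1, one_mul]
        · rw [h.2, zero_mul]; exact abs_nonneg _
      rw [dot_sub_left, dot_sub_left] at h1
      rw [val]
      push_cast
      nlinarith [mul_le_mul_of_nonneg_left h2 h0.le]
  have h1 := (ip_self_nonneg N n Φ _).trans (key T)
  have h2 : ip N n Φ u u / (2 * η) * (2 * η) = ip N n Φ u u := div_mul_cancel₀ _ (by positivity)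
  by_contra h3
  push Not at h3
  nlinarith [mul_lt_mul_of_pos_left h3 (by positivity : 0 < 2 * η)]

/-- The filtered regression error of the online algorithm is close to that of every polynomial. -/
theorem sum_gate_abs_le (N n : ℕ) (Φ : ℕ → ℕ → ℝ) {η : ℝ} (h0 : 0 < η) (z : ℕ → Round) (u : ℕ → ℝ)
    (T : ℕ) :
    ∑ t ∈ Finset.range T, gate N n Φ (runFrom N n Φ η 0 z t).1 (z t).1 *
        |(z t).2.1 - dot N (runFrom N n Φ η 0 z t).2 (z t).1| ≤
      ∑ t ∈ Finset.range T, gate N n Φ (runFrom N n Φ η 0 z t).1 (z t).1 *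
        |(z t).2.1 - dot N u (z t).1| + ip N n Φ u u / (2 * η) + 2 * η * T := by
  -- The same potential for the second component. The gates are those of the first component and
  -- enter only as weights in `{0, 1}`.
  have key : ∀ T : ℕ, ip N n Φ ((runFrom N n Φ η 0 z T).2 - u) ((runFrom N n Φ η 0 z T).2 - u) ≤
      ip N n Φ u u + 4 * η ^ 2 * T + 2 * η * (
        ∑ t ∈ Finset.range T, gate N n Φ (runFrom N n Φ η 0 z t).1 (z t).1 *
          |(z t).2.1 - dot N u (z t).1| -
        ∑ t ∈ Finset.range T, gate N n Φ (runFrom N n Φ η 0 z t).1 (z t).1 *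
          |(z t).2.1 - dot N (runFrom N n Φ η 0 z t).2 (z t).1|) := by
    intro T
    induction T with
    | zero =>
      simp only [runFrom, Finset.range_zero, Finset.sum_empty]
      have : ip N n Φ ((0 : (ℕ → ℝ) × (ℕ → ℝ)).2 - u) ((0 : (ℕ → ℝ) × (ℕ → ℝ)).2 - u) =
          ip N n Φ u u := by
        simp [ip, dot]
      rw [this]; simp
    | succ t ih =>
      simp only [Finset.sum_range_succ]
      rw [runFrom, step_snd, add_sub_right_comm]
      set q := (runFrom N n Φ η 0 z t).1
      set p := (runFrom N n Φ η 0 z t).2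
      set φ := (z t).1
      set y := (z t).2.1
      have hY := sgnY_mul N p φ y
      have hY1 := abs_sgnY N p φ y
      set g := gate N n Φ q φ with hg
      have hgc := gate_cases N n Φ q φ
      rw [← hg] at hgc
      have h1 := ip_step_le N n Φ (p - u) φ φ (g * sgnY N p φ y) 0 η (by
        rcases hgc with h | h
        · right; rw [h.1, one_mul]; exact ⟨hY1, h.2.1⟩
        · left; rw [h, zero_mul]) (Or.inl rfl)
      refine h1.trans ?_
      rw [dot_sub_left]
      have h2 : sgnY N p φ y * (y - dot N u φ) ≤ |y - dot N u φ| := by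
        calc _ ≤ |sgnY N p φ y * (y - dot N u φ)| := le_abs_self _
            _ = _ := by rw [abs_mul, hY1, one_mul]
      have h3 : 0 ≤ g ∧ (g * sgnY N p φ y) ^ 2 ≤ 1 := by
        have : sgnY N p φ y ^ 2 = 1 := by rw [← sq_abs, hY1, one_pow]
        rcases hgc with h | h
        · rw [h.1, one_mul, this]; norm_num
        · rw [h]; norm_num
      -- Convexity of the absolute loss: the sign of the residual is the negative of a subgradient.
      have h4 : g * sgnY N p φ y * (dot N p φ - dot N u φ) ≤
          g * |y - dot N u φ| - g * |y - dot N p φ| := by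
        rw [← hY]
        nlinarith [mul_le_mul_of_nonneg_left h2 h3.1]
      push_cast
      nlinarith [mul_le_mul_of_nonneg_left h4 h0.le, mul_le_mul_of_nonneg_left h3.2 (sq_nonneg η)]
  have h1 := (ip_self_nonneg N n Φ _).trans (key T)
  have h2 : ip N n Φ u u / (2 * η) * (2 * η) = ip N n Φ u u := div_mul_cancel₀ _ (by positivity)
  by_contra h3
  push Not at h3
  nlinarith [mul_lt_mul_of_pos_left h3 (by positivity : 0 < 2 * η)]

/-! ### Programs for features and orthogonalization -/

/-- Only the first `d` coordinates matter, since the array that holds a loaded point may contain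
anything beyond them. -/
theorem feat_congr {d : ℕ} {x x' : ℕ → ℝ} (h : ∀ j < d, x j = x' j) (k : ℕ) :
    ∀ w < (d + 1) ^ k, feat d x k w = feat d x' k w := by
  induction k with
  | zero => intro w _; rfl
  | succ k ih =>
    intro w hw
    have hpos : 0 < (d + 1) ^ k := by positivity
    rw [feat, feat]
    split_ifs with h1
    · exact ih w h1
    · rw [ih _ (Nat.mod_lt _ hpos), h]
      have h2 : w / (d + 1) ^ k < d + 1 := by
        rw [Nat.div_lt_iff_lt_mul hpos]; rw [pow_succ, mul_comm] at hw; exact hw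
      have h3 : 0 < w / (d + 1) ^ k := Nat.div_pos (not_lt.1 h1) hpos
      omega

/-- Copy a point to array `4`. -/
def loadC (s : ℕ) (e : NExp) : Cmd := mapN 20 0 4 (.lit 0) (.get s e (nv 20))

/-- One pass of the feature computation. -/
def featLevelC : Cmd :=
  .seq (.setN 16 (.lit 0) (nv 15)) (.seq
    (forN 22 0 (forN 23 15 (.seq
      (.setR 5 (.lit 0) (nv 16) (.mul (.get 4 (.lit 0) (nv 22)) (.get 5 (.lit 0) (nv 23))))
      (.setN 16 (.lit 0) (.add (nv 16) (.lit 1))))))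
    (.setN 15 (.lit 0) (nv 16)))

/-- Compute the features of the point in array `4`, in array `5`. -/
def featC : Cmd :=
  .seq (.setR 5 (.lit 0) (.lit 0) (.ofNat (.lit 1))) (.seq (.setN 15 (.lit 0) (.lit 1))
    (forN 21 4 featLevelC))

/-- The products are appended behind the current level, at the position kept in array `16` of
natural numbers. The entries of the current level stay in place: they are the factors still to be
read and also the first block of the next level. -/
theorem runs_featLevel {M : Mem} {d k : ℕ} (hd : M.nat 0 0 = d) (hn : M.nat 15 0 = (d + 1) ^ k)
    (hF : ∀ w < (d + 1) ^ k, M.real 5 0 w = feat d (M.real 4 0) k w) :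
    Runs featLevelC M (d * ((d + 1) ^ k * 34 + 23) + 25)
      (fun M' => M'.nat 15 0 = (d + 1) ^ (k + 1) ∧
        ∀ w < (d + 1) ^ (k + 1), M'.real 5 0 w = feat d (M.real 4 0) (k + 1) w) := by
  set n := (d + 1) ^ k with hndef
  have e1 : (d + 1) ^ (k + 1) = n + d * n := by rw [hndef]; ring
  let I : ℕ → Mem → Prop := fun o M' => M'.nat 16 0 = n + o ∧
    ∀ w < n + o, M'.real 5 0 w = feat d (M.real 4 0) (k + 1) w
  have hI : ∀ o i M' v, i ≠ 16 → I o M' → I o (M'.storeN i 0 v) := by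
    rintro o i M' v hi ⟨h1, h2⟩
    exact ⟨by rw [storeN_ne _ _ _ hi.symm, h1], h2⟩
  refine Runs.mono (Runs.seq (t₁ := 4) (t₂ := d * (n * 34 + 23) + 15) (Q₁ := I 0) (Runs.setN ?_) ?_)
    (by omega) (fun _ _ _ h => h)
  · refine ⟨by simp [NExp.eval, hn], ?_⟩
    intro w hw
    rw [storeN_real, hF w (by omega), feat, if_pos (by omega)]
  intro M₁ f1 f2 h1
  refine Runs.mono (Runs.seq (t₁ := d * (n * 34 + 23) + 10) (t₂ := 4) (Q₁ := I (d * n)) ?_ ?_)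
    (by omega) (fun _ _ _ h => h)
  · refine Runs.mono (runs_forN (t := n * 34 + 10) (K := d) (fun j M' => I (j * n) M') (by decide)
      (by decide) (by decide) ?_ (fun j M v h => hI _ _ _ _ (by decide) h) (by simpa using h1) ?_)
      (by ring_nf; omega) (fun _ _ _ h => h)
    · rw [f1 0 (by decide), hd]
    intro j hj M₂ g1 g2 g3 g4
    have h15 : M₂.nat 15 0 = n := by
      rw [g1 15 (by decide) (by decide), f1 15 (by decide), hn]
    have h4 : M₂.real 4 0 = M.real 4 0 := by
      rw [g2 4 (by decide), f2 4 (by decide)]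
    refine Runs.mono (runs_forN (t := 21) (K := n) (fun w M' => I (j * n + w) M') (by decide)
      (by decide) (by decide) h15 (fun j M v h => hI _ _ _ _ (by decide) h) g4 ?_)
      (by omega) (fun _ _ _ h => by rw [Nat.succ_mul]; exact h)
    intro w hw M₃ p1 p2 p3 p4
    have h22 : M₃.nat 22 0 = j := by rw [p1 22 (by decide) (by decide), g3]
    have h43 : M₃.real 4 0 = M.real 4 0 := by rw [p2 4 (by decide), h4]
    refine Runs.mono (Runs.seq (t₁ := 14) (t₂ := 6)
      (Q₁ := fun M' => M'.nat 16 0 = n + (j * n + w) ∧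
        ∀ w' < n + (j * n + w) + 1, M'.real 5 0 w' = feat d (M.real 4 0) (k + 1) w')
      (Runs.mono (Runs.setR ?_) (by decide) (fun _ _ _ h => h)) ?_) (by omega)
      (fun _ _ _ h => h)
    · refine ⟨p4.1, ?_⟩
      intro w' hw'
      simp only [Mem.storeR, NExp.eval, nv_eval, p4.1, RExp.eval, h22, p3, h43, true_and]
      split_ifs with h
      · rw [h, feat_succ _ _ _ _ _ hw, p4.2 w (by omega), feat, if_pos hw]
      · exact p4.2 w' (by omega)
    · rintro M₄ q1 q2 ⟨q3, q4⟩
      refine Runs.setN ⟨by simp [NExp.eval, q3, add_assoc], ?_⟩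
      intro w' hw'
      exact q4 w' (by omega)
  · rintro M₂ g1 g2 ⟨g3, g4⟩
    refine Runs.setN ⟨by simp [NExp.eval, g3, e1], ?_⟩
    rw [e1]
    exact g4

theorem runs_feat {M : Mem} {d l : ℕ} (hd : M.nat 0 0 = d) (hl : M.nat 4 0 = l) :
    Runs featC M (l * (d * ((d + 1) ^ l * 34 + 23) + 38) + 30)
      (fun M' => M'.nat 15 0 = (d + 1) ^ l ∧
        ∀ w < (d + 1) ^ l, M'.real 5 0 w = feat d (M.real 4 0) l w) := by
  refine Runs.mono (Runs.seq (t₁ := 5) (t₂ := l * (d * ((d + 1) ^ l * 34 + 23) + 38) + 20)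
    (Q₁ := fun M' => M'.real 5 0 0 = 1) (Runs.setR ?_) ?_) (by omega) (fun _ _ _ h => h)
  · simp [NExp.eval, RExp.eval]
  intro M₁ f1 f2 h1
  refine Runs.mono (Runs.seq (t₁ := 3) (t₂ := l * (d * ((d + 1) ^ l * 34 + 23) + 38) + 10)
    (Q₁ := fun M' => M'.nat 15 0 = 1 ∧ M'.real 5 0 0 = 1) (Runs.setN ?_) ?_) (by omega)
    (fun _ _ _ h => h)
  · exact ⟨by simp [NExp.eval], h1⟩
  rintro M₂ g1 g2 ⟨h2, h3⟩
  refine Runs.mono (runs_forN (t := d * ((d + 1) ^ l * 34 + 23) + 25) (K := l)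
    (fun k M' => M'.nat 15 0 = (d + 1) ^ k ∧
      ∀ w < (d + 1) ^ k, M'.real 5 0 w = feat d (M.real 4 0) k w) (by decide)
    (by decide) (by decide) ?_ ?_ ?_ ?_) (le_of_eq (by ring)) (fun _ _ _ h => h)
  · rw [g1 4 (by decide), f1 4 (by decide), hl]
  · rintro k M' v ⟨h, h'⟩
    exact ⟨by rw [storeN_ne _ _ _ (by decide), h], h'⟩
  · refine ⟨by simpa using h2, ?_⟩
    intro w hw
    obtain rfl : w = 0 := by simpa using hw
    exact h3
  intro k hk M₃ p1 p2 p3 p4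
  have h4 : M₃.real 4 = M.real 4 := by
    rw [p2 4 (by decide), g2 4 (by decide), f2 4 (by decide)]
  have hd3 : M₃.nat 0 0 = d := by
    rw [p1 0 (by decide) (by decide), g1 0 (by decide), f1 0 (by decide), hd]
  rw [← h4] at p4 ⊢
  refine Runs.mono (runs_featLevel hd3 p4.1 p4.2) ?_ (fun _ _ _ h => h)
  have := Nat.pow_le_pow_right (Nat.succ_pos d) hk.le
  gcongr

/-- Compute the features of a point, in array `5`. -/
def loadFeatC (s : ℕ) (e : NExp) : Cmd := .seq (loadC s e) featC

/-- Time for the computation of features. -/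
def featTime (d l : ℕ) : ℕ := l * (d * ((d + 1) ^ l * 34 + 23) + 38) + d * 40 + 60

theorem runs_loadFeat {M : Mem} {d l s ρ : ℕ} {e : NExp} (hs : s ≠ 4) (hec : e.cost ≤ 10)
    (hd : M.nat 0 0 = d) (hl : M.nat 4 0 = l)
    (he : ∀ M' : Mem, (∀ b, b ≠ 20 → M'.nat b = M.nat b) → e.eval M' = ρ) :
    Runs (loadFeatC s e) M (featTime d l)
      (fun M' => ∀ w < (d + 1) ^ l, M'.real 5 0 w = feat d (M.real s ρ) l w) := by
  refine Runs.mono (Runs.seq (runs_mapN (fun j => M.real s ρ j) (by decide) hd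
    (ρ := 0) (fun _ _ => rfl) ?_) (t₂ := l * (d * ((d + 1) ^ l * 34 + 23) + 38) + 30) ?_) ?_
    (fun _ _ _ h => h)
  · intro j hj M' h1 h2 h3 h4
    simp [RExp.eval, he M' h1, h4, h2 s hs]
  · intro M₁ f1 f2 h
    refine Runs.mono (runs_feat (d := d) (l := l) ?_ ?_) le_rfl ?_
    · rw [← hd]; exact congrFun (f1 0 (of_decide_eq_true rfl)) 0
    · rw [← hl]; exact congrFun (f1 4 (of_decide_eq_true rfl)) 0
    · rintro M₂ - - ⟨-, h5⟩ w hw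
      rw [h5 w hw]
      refine feat_congr (fun j hj => ?_) l w hw
      rw [h, if_pos ⟨rfl, hj⟩]
  · simp only [NExp.cost, RExp.cost, nv_cost, featTime]
    have : d * (1 + (e.cost + 2 + 1) + 16) ≤ d * 40 := Nat.mul_le_mul_left _ (by omega)
    omega

/-- Compute the Gram matrix of the features in array `6`, in array `7`. -/
def gramC : Cmd := forN 20 10 (mapSumN 21 10 7 (nv 20) 22 11 20
  (.mul (.get 6 (nv 22) (nv 20)) (.get 6 (nv 22) (nv 21))))

theorem runs_gram {M : Mem} {N n : ℕ} {Φ : ℕ → ℕ → ℝ} (hN : M.nat 10 0 = N) (hn : M.nat 11 0 = n)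
    (hΦ : ∀ r < n, ∀ w < N, M.real 6 r w = Φ r w) :
    Runs gramC M (N * (N * (n * 31 + 38) + 23) + 10)
      (fun M' => ∀ w < N, ∀ w' < N, M'.real 7 w w' = gram n Φ w w') := by
  refine Runs.mono (runs_forN (t := N * (n * 31 + 38) + 10) (K := N)
    (fun k M' => ∀ w < k, ∀ w' < N, M'.real 7 w w' = gram n Φ w w') (by decide)
    (by decide) (by decide) hN (fun _ _ _ h => h) (by simp) ?_) (le_of_eq (by ring)) (fun _ _ _ h => h)
  intro k hk M₁ f1 f2 f3 f4
  refine Runs.mono (runs_mapSumN (fun w' r => Φ r k * Φ r w') (by decide) (by decide) (by decide)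
    (by decide) (by decide) (by decide) (K := N) (L := n) (ρ := k) ?_ ?_ ?_ ?_) ?_ ?_
  · rw [f1 10 (by decide) (by decide), hN]
  · rw [f1 11 (by decide) (by decide), hn]
  · intro M' h
    simp [h, f3]
  · intro c hc s hs M' h1 h2 h3 h4 h5
    have : M'.real 6 = M.real 6 := by rw [h2 6 (by decide) (by decide), f2 6 (by decide)]
    simp [RExp.eval, h1, f3, h4, h5, this, hΦ s hs _ hk, hΦ s hs _ hc]
  · exact le_of_eq (by simp only [RExp.cost, nv_cost])
  · intro M' _ _ h w hw w' hw'
    rw [h]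
    split_ifs with h1
    · rw [h1.1]; rfl
    · exact f4 w (by omega) w' hw'

/-- One step of the orthogonalization. -/
def gsStepC : Cmd :=
  .seq (mapSumN 21 10 8 (nv 20) 22 20 20 (.sub (.ofNat (.lit 0))
    (.mul (.div (.get 9 (nv 22) (nv 20)) (.get 10 (.lit 0) (nv 22))) (.get 8 (nv 22) (nv 21)))))
  (.seq (.setR 8 (nv 20) (nv 20) (.add (.ofNat (.lit 1)) (.get 8 (nv 20) (nv 20))))
  (.seq (mapSumN 21 10 9 (nv 20) 22 10 20 (.mul (.get 7 (nv 21) (nv 22)) (.get 8 (nv 20) (nv 22))))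
  (.seq (sumN 21 10 20 (.mul (.get 8 (nv 20) (nv 21)) (.get 9 (nv 20) (nv 21))))
  (.setR 10 (.lit 0) (nv 20) (rv 20)))))

/-- The rows below `k` of the arrays `8`, `9`, `10` hold the first `k` steps of the
orthogonalization. -/
def GsRows (N n : ℕ) (Φ : ℕ → ℕ → ℝ) (k : ℕ) (M : Mem) : Prop :=
  ∀ i < k, (∀ w < N, M.real 8 i w = gsB N n Φ i w) ∧
    (∀ w < N, M.real 9 i w = dot N (gram n Φ w) (gsB N n Φ i)) ∧ M.real 10 0 i = gsn N n Φ i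

/-- Row `k` of array `8` first receives minus the projections onto the earlier vectors, and then `1`
is added on the diagonal. Row `k` of array `9` is the Gram matrix applied to the new vector; its
entries are the inner products needed by later steps, so each projection coefficient is a single
quotient. Array `10` keeps the squared norms. -/
theorem runs_gsStep {M : Mem} {N n k : ℕ} {Φ : ℕ → ℕ → ℝ} (hk : k < N) (hN : M.nat 10 0 = N)
    (hi : M.nat 20 0 = k)
    (hG : ∀ w < N, ∀ w' < N, M.real 7 w w' = gram n Φ w w')
    (h0 : GsRows N n Φ k M) :
    Runs gsStepC M (N * (N * 80 + 120) + 100) (GsRows N n Φ (k + 1)) := by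
  refine Runs.mono (Runs.seq (t₁ := N * (N * 40 + 40) + 10) (t₂ := N * (N * 40 + 80) + 89)
    (Q₁ := fun M' => GsRows N n Φ k M' ∧ ∀ w < N, M'.real 8 k w = ∑ j ∈ Finset.range k,
      (0 - dot N (gram n Φ k) (gsB N n Φ j) / gsn N n Φ j * gsB N n Φ j w)) ?_ ?_)
    (by nlinarith) (fun _ _ _ h => h)
  · refine Runs.mono (runs_mapSumN (K := N) (L := k) (ρ := k) (fun w j =>
      (0 - dot N (gram n Φ k) (gsB N n Φ j) / gsn N n Φ j * gsB N n Φ j w))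
      (by decide) (by decide) (by decide)
      (by decide) (by decide) (by decide) hN hi ?_ ?_) ?_ ?_
    · intro M' h; simp [h, hi]
    · intro c hc s hs M' h1 h2 h3 h4 h5
      have e8 : M'.real 8 s c = gsB N n Φ s c := by
        rw [h3 s c (Or.inl hs.ne), (h0 s hs).1 c hc]
      simp [RExp.eval, NExp.eval, h1, hi, h4, h5, h2, e8, (h0 s hs).2.1 k hk, (h0 s hs).2.2]
    · simp only [RExp.cost, NExp.cost, nv_cost]
      have : k * (1 + 1 + (2 + 2 + 1 + (1 + 2 + 1) + 1 + (2 + 2 + 1) + 1) + 1 + 20) ≤ N * 40 :=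
        Nat.mul_le_mul hk.le (by norm_num)
      have := Nat.mul_le_mul_left N this
      nlinarith
    · intro M' f1 f2 h
      refine ⟨fun i hik => ⟨?_, ?_, ?_⟩, ?_⟩
      · intro w hw
        rw [h, if_neg (by omega), (h0 i hik).1 w hw]
      · intro w hw
        rw [f2 9 (by decide), (h0 i hik).2.1 w hw]
      · rw [f2 10 (by decide), (h0 i hik).2.2]
      · intro w hw
        rw [h, if_pos ⟨rfl, hw⟩]
  rintro M₁ f1 f2 ⟨g0, g1⟩
  have hN1 : M₁.nat 10 0 = N := by rw [f1 10 (by decide), hN]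
  have hi1 : M₁.nat 20 0 = k := by rw [f1 20 (by decide), hi]
  have hG1 : ∀ w < N, ∀ w' < N, M₁.real 7 w w' = gram n Φ w w' := by
    rw [f2 7 (by decide)]; exact hG
  refine Runs.mono (Runs.seq (t₁ := 20) (t₂ := N * (N * 40 + 80) + 60)
    (Q₁ := fun M' => GsRows N n Φ k M' ∧ ∀ w < N, M'.real 8 k w = gsB N n Φ k w) (Runs.mono (Runs.setR ?_)
      (by decide) (fun _ _ _ h => h)) ?_)
    (by omega) (fun _ _ _ h => h)
  · simp only [nv_eval, hi1, RExp.eval, NExp.eval]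
    refine ⟨fun i hik => ⟨?_, ?_, ?_⟩, ?_⟩
    · intro w hw
      rw [← (g0 i hik).1 w hw]
      simp [Mem.storeR, hik.ne]
    · intro w hw
      rw [← (g0 i hik).2.1 w hw, storeR_ne _ _ _ _ (by decide)]
    · rw [storeR_ne _ _ _ _ (by decide), (g0 i hik).2.2]
    · intro w hw
      rw [gsB_eq]
      simp only [Mem.storeR, true_and]
      have := g1 w hw
      split_ifs with h
      · subst h
        rw [this]
        simp only [Finset.sum_sub_distrib]
        simp; ring
      · rw [this]
        simp only [Finset.sum_sub_distrib]
        simp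
  rintro M₂ p1 p2 ⟨p3, p4⟩
  have hN2 : M₂.nat 10 0 = N := by rw [p1 10 (by decide), hN1]
  have hi2 : M₂.nat 20 0 = k := by rw [p1 20 (by decide), hi1]
  have hG2 : ∀ w < N, ∀ w' < N, M₂.real 7 w w' = gram n Φ w w' := by
    rw [p2 7 (by decide)]; exact hG1
  refine Runs.mono (Runs.seq (t₁ := N * (N * 35 + 40) + 10) (t₂ := N * 40 + 40)
    (Q₁ := fun M' => GsRows N n Φ k M' ∧ (∀ w < N, M'.real 8 k w = gsB N n Φ k w) ∧
      (∀ w < N, M'.real 9 k w = dot N (gram n Φ w) (gsB N n Φ k))) ?_ ?_)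
    (by nlinarith) (fun _ _ _ h => h)
  · refine Runs.mono (runs_mapSumN (K := N) (L := N) (ρ := k) (fun w j =>
      gram n Φ w j * gsB N n Φ k j)
      (by decide) (by decide) (by decide)
      (by decide) (by decide) (by decide) hN2 hN2 ?_ ?_) ?_ ?_
    · intro M' h; simp [h, hi2]
    · intro c hc s hs M' h1 h2 h3 h4 h5
      simp [RExp.eval, h1, hi2, h4, h5, h2, p4 s hs, hG2 c hc s hs]
    · simp only [RExp.cost, nv_cost]; ring_nf; nlinarith
    · intro M' f1 f2 h
      refine ⟨fun i hik => ⟨?_, ?_, ?_⟩, ?_, ?_⟩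
      · intro w hw
        rw [f2 8 (by decide), (p3 i hik).1 w hw]
      · intro w hw
        rw [h, if_neg (by omega), (p3 i hik).2.1 w hw]
      · rw [f2 10 (by decide), (p3 i hik).2.2]
      · rw [f2 8 (by decide)]; exact p4
      · intro w hw
        rw [h, if_pos ⟨rfl, hw⟩]; rfl
  rintro M₃ q1 q2 ⟨q3, q4, q5⟩
  have hN3 : M₃.nat 10 0 = N := by rw [q1 10 (by decide), hN2]
  have hi3 : M₃.nat 20 0 = k := by rw [q1 20 (by decide), hi2]
  refine Runs.mono (Runs.seq (t₁ := N * 40 + 16) (t₂ := 10)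
    (Q₁ := fun M' => M'.real 20 0 0 = gsn N n Φ k) ?_ ?_)
    (by nlinarith) (fun _ _ _ h => h)
  · refine Runs.mono (runs_sumN (K := N) (fun v => gsB N n Φ k v *
      dot N (gram n Φ v) (gsB N n Φ k)) (by decide) hN3 ?_) ?_ (fun _ _ _ h => h)
    · intro j hj M' h1 h2 h3
      simp [RExp.eval, h1, hi3, h3, h2, q4 j hj, q5 j hj]
    · simp only [RExp.cost, nv_cost]; omega
  intro M₄ r1 r2 r3
  have hi4 : M₄.nat 20 0 = k := by rw [r1 20 (by decide), hi3]
  refine Runs.mono (Runs.setR ?_) (by decide) (fun _ _ _ h => h)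
  simp only [nv_eval, hi4, NExp.eval, rv_eval, r3]
  intro i hik
  rw [storeR_ne _ _ _ _ (by decide), storeR_ne _ _ _ _ (by decide), r2 8 (by decide),
    r2 9 (by decide)]
  rcases Nat.lt_succ_iff_lt_or_eq.1 hik with h | rfl
  · refine ⟨(q3 i h).1, (q3 i h).2.1, ?_⟩
    rw [← (q3 i h).2.2]
    simp [Mem.storeR, h.ne, r2 10 (by decide)]
  · exact ⟨q4, q5, storeR_same _ _ _ _ _⟩

/-- Orthogonalization. -/
def gsC : Cmd := .seq gramC (forN 20 10 gsStepC)

theorem runs_gs {M : Mem} {N n : ℕ} {Φ : ℕ → ℕ → ℝ} (hN : M.nat 10 0 = N) (hn : M.nat 11 0 = n)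
    (hΦ : ∀ r < n, ∀ w < N, M.real 6 r w = Φ r w) :
    Runs gsC M (N * (N * (n * 31 + 38) + 23) + N * (N * (N * 80 + 120) + 113) + 21)
      (GsRows N n Φ N) := by
  refine Runs.mono (Runs.seq (runs_gram hN hn hΦ) (t₂ := N * (N * (N * 80 + 120) + 113) + 10) ?_)
    (by omega) (fun _ _ _ h => h)
  intro M₁ f1 f2 h
  refine Runs.mono (runs_forN (t := N * (N * 80 + 120) + 100) (K := N) (GsRows N n Φ)
    (by decide) (by decide) (by decide) ?_ (fun _ _ _ h => h) ?_ ?_) (le_of_eq (by ring))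
    (fun _ _ _ h => h)
  · rw [f1 10 (by decide), hN]
  · intro i hi; omega
  · intro k hk M' g1 g2 g3 g4
    refine runs_gsStep hk ?_ g3 ?_ g4
    · rw [g1 10 (by decide) (by decide), f1 10 (by decide), hN]
    · rw [g2 7 (by decide)]; exact h

/-- Compute the kernel coefficients in array `r`, the leverage and the unseen component of the point
whose features are in array `5`. -/
def projC (r : ℕ) : Cmd :=
  .seq (mapSumN 21 10 11 (.lit 0) 22 10 20 (.mul (.get 8 (nv 21) (nv 22)) (.get 5 (.lit 0) (nv 22))))
  (.seq (mapSumN 21 10 r (.lit 0) 22 10 20 (.mul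
    (.div (.get 11 (.lit 0) (nv 22)) (.get 10 (.lit 0) (nv 22))) (.get 8 (nv 22) (nv 21))))
  (.seq (sumN 21 10 21 (.mul (.get 5 (.lit 0) (nv 21)) (.get r (.lit 0) (nv 21))))
  (sumN 21 10 22 (.mul (.sub (.ofNat (.lit 1))
      (.div (.get 10 (.lit 0) (nv 21)) (.get 10 (.lit 0) (nv 21))))
    (.mul (.get 11 (.lit 0) (nv 21)) (.get 11 (.lit 0) (nv 21)))))))

/-- Array `11` holds the values of the basis polynomials at the point, from which kernel, leverage
and unseen component follow. The output array is `12` for labeled and `13` for reference examples,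
so that both kernels of a round coexist. -/
theorem runs_proj {M : Mem} {N n r : ℕ} {Φ : ℕ → ℕ → ℝ} {φ : ℕ → ℝ}
    (hr : r = 12 ∨ r = 13) (hN : M.nat 10 0 = N)
    (h0 : GsRows N n Φ N M) (hφ : ∀ w < N, M.real 5 0 w = φ w) :
    Runs (projC r) M (N * (N * 80 + 180) + 100)
      (fun M' => (∀ w < N, M'.real r 0 w = kap N n Φ φ w) ∧ M'.real 21 0 0 = lev N n Φ φ ∧
        M'.real 22 0 0 = nul N n Φ φ) := by
  have hr' : r ≠ 5 ∧ r ≠ 8 ∧ r ≠ 10 ∧ r ≠ 11 ∧ r ≠ 20 ∧ r ≠ 21 ∧ r ≠ 22 := by omega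
  refine Runs.mono (Runs.seq (t₁ := N * (N * 40 + 40) + 10) (t₂ := N * (N * 40 + 140) + 89)
    (Q₁ := fun M' => ∀ j < N, M'.real 11 0 j = dot N (gsB N n Φ j) φ) ?_ ?_)
    (by nlinarith) (fun _ _ _ h => h)
  · refine Runs.mono (runs_mapSumN (K := N) (L := N) (ρ := 0) (fun j w => gsB N n Φ j w * φ w)
      (by decide) (by decide) (by decide)
      (by decide) (by decide) (by decide) hN hN (fun _ _ => rfl) ?_) ?_ ?_
    · intro c hc s hs M' h1 h2 h3 h4 h5
      simp [RExp.eval, NExp.eval, h4, h5, h2, (h0 c hc).1 s hs, hφ s hs]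
    · simp only [RExp.cost, NExp.cost, nv_cost]; ring_nf; nlinarith
    · intro M' _ _ h j hj
      rw [h, if_pos ⟨rfl, hj⟩]; rfl
  intro M₁ f1 f2 h1
  have hN1 : M₁.nat 10 0 = N := by rw [f1 10 (by decide), hN]
  have h01 : GsRows N n Φ N M₁ := by
    intro i hi
    rw [f2 8 (by decide), f2 9 (by decide), f2 10 (by decide)]
    exact h0 i hi
  have hφ1 : ∀ w < N, M₁.real 5 0 w = φ w := by rw [f2 5 (by decide)]; exact hφ
  refine Runs.mono (Runs.seq (t₁ := N * (N * 40 + 40) + 10) (t₂ := N * 100 + 78)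
    (Q₁ := fun M' => ∀ w < N, M'.real r 0 w = kap N n Φ φ w) ?_ ?_)
    (by nlinarith) (fun _ _ _ h => h)
  · refine Runs.mono (runs_mapSumN (K := N) (L := N) (ρ := 0)
      (fun w j => dot N (gsB N n Φ j) φ / gsn N n Φ j * gsB N n Φ j w)
      (by decide) (by decide) (by decide)
      (by decide) (by decide) hr'.2.2.2.2.1 hN1 hN1 (fun _ _ => rfl) ?_) ?_ ?_
    · intro c hc s hs M' h1' h2 h3 h4 h5
      simp [RExp.eval, NExp.eval, h4, h5, h2 11 hr'.2.2.2.1.symm, h2 10 hr'.2.2.1.symm,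
        h2 8 hr'.2.1.symm, h1 s hs, (h01 s hs).1 c hc, (h01 s hs).2.2]
    · simp only [RExp.cost, NExp.cost, nv_cost]; ring_nf; nlinarith
    · intro M' _ _ h w hw
      rw [h, if_pos ⟨rfl, hw⟩]; rfl
  intro M₂ g1 g2 h2
  have w2 : ∀ a, a ≠ r → a ≠ 20 → M₂.real a = M₁.real a := by
    intro a ha ha'
    refine g2 a ?_
    simp [Cmd.writesR, mapSumN, forN, sumN, ha, ha']
  have hN2 : M₂.nat 10 0 = N := by rw [g1 10 (of_decide_eq_true rfl), hN1]
  refine Runs.mono (Runs.seq (t₁ := N * 40 + 20) (t₂ := N * 50 + 30)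
    (Q₁ := fun M' => M'.real 21 0 0 = lev N n Φ φ) ?_ ?_)
    (by nlinarith) (fun _ _ _ h => h)
  · refine Runs.mono (runs_sumN (K := N) (fun w => φ w * kap N n Φ φ w) (by decide) hN2 ?_) ?_
      (fun _ _ _ h => h)
    · intro j hj M' p1 p2 p3
      simp [RExp.eval, NExp.eval, p3, p2 5 (by decide), p2 r hr'.2.2.2.2.2.1,
        w2 5 hr'.1.symm (by decide), hφ1 j hj, h2 j hj]
    · simp only [RExp.cost, NExp.cost, nv_cost]; omega
  intro M₃ p1 p2 h3
  have hN3 : M₃.nat 10 0 = N := by rw [p1 10 (of_decide_eq_true rfl), hN2]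
  refine Runs.mono (runs_sumN (K := N) (fun j => (1 - gsn N n Φ j / gsn N n Φ j) *
    (dot N (gsB N n Φ j) φ * dot N (gsB N n Φ j) φ)) (by decide) hN3 ?_) ?_ ?_
  · intro j hj M' q1 q2 q3
    simp [RExp.eval, NExp.eval, q3, q2 10 (by decide), q2 11 (by decide), p2 10 (of_decide_eq_true rfl),
      p2 11 (of_decide_eq_true rfl), w2 10 hr'.2.2.1.symm (by decide), w2 11 hr'.2.2.2.1.symm (by decide),
      h1 j hj, (h01 j hj).2.2]
  · simp only [RExp.cost, NExp.cost, nv_cost]; omega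
  · intro M' q1 q2 q3
    refine ⟨?_, ?_, q3⟩
    · intro w hw
      rw [q2 r, p2 r, h2 w hw]
      · simp [Cmd.writesR, sumN, forN]; omega
      · simp [Cmd.writesR, sumN, forN]; omega
    · rw [q2 21 (by decide), h3]

/-! ### Programs for the online algorithm -/

/-- The sizes and constants used by the algorithm, and its data. -/
structure Config : Type where
  d : ℕ
  l : ℕ
  n : ℕ
  T : ℕ
  k : ℕ
  ε : ℝ
  τ : ℝ
  η : ℝ
  xs : ℕ → ℕ → ℝ
  ys : ℕ → ℝ
  rs : ℕ → ℕ → ℝ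

/-- The number of features. -/
def Config.N (c : Config) : ℕ := (c.d + 1) ^ c.l

/-- The sizes, constants and data are in memory. -/
structure Config.InMem (c : Config) (M : Mem) : Prop where
  hd : M.nat 0 0 = c.d
  hl : M.nat 4 0 = c.l
  hN : M.nat 10 0 = c.N
  hn : M.nat 11 0 = c.n
  hT : M.nat 12 0 = c.T
  hk : M.nat 13 0 = c.k
  hKT : M.nat 14 0 = c.k * c.T
  hε : M.real 0 0 1 = c.ε
  hτ : M.real 0 0 3 = c.τ
  hη : M.real 31 0 0 = c.η
  hx : M.real 1 = c.xs
  hy : ∀ i, M.real 2 i 0 = c.ys i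
  hr : M.real 3 = c.rs

/-- The listed arrays hold the sizes, constants and data. Once these are set up, a command preserves
them as soon as its footprint avoids the lists, which `decide` checks. -/
theorem Config.InMem.frame {c : Config} {M M' : Mem} {W V : List ℕ} (h : c.InMem M)
    (f1 : ∀ a ∉ W, M'.nat a = M.nat a) (f2 : ∀ a ∉ V, M'.real a = M.real a)
    (h1 : ∀ a ∈ [0, 4, 10, 11, 12, 13, 14], a ∉ W) (h2 : ∀ a ∈ [0, 1, 2, 3, 31], a ∉ V) :
    c.InMem M' where
  hd := by rw [f1 0 (h1 0 (by decide)), h.hd]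
  hl := by rw [f1 4 (h1 4 (by decide)), h.hl]
  hN := by rw [f1 10 (h1 10 (by decide)), h.hN]
  hn := by rw [f1 11 (h1 11 (by decide)), h.hn]
  hT := by rw [f1 12 (h1 12 (by decide)), h.hT]
  hk := by rw [f1 13 (h1 13 (by decide)), h.hk]
  hKT := by rw [f1 14 (h1 14 (by decide)), h.hKT]
  hε := by rw [f2 0 (h2 0 (by decide)), h.hε]
  hτ := by rw [f2 0 (h2 0 (by decide)), h.hτ]
  hη := by rw [f2 31 (h2 31 (by decide)), h.hη]
  hx := by rw [f2 1 (h2 1 (by decide)), h.hx]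
  hy := fun i => by rw [f2 2 (h2 2 (by decide)), h.hy]
  hr := by rw [f2 3 (h2 3 (by decide)), h.hr]

theorem Config.InMem.frame_loop {c : Config} {M M' : Mem} {W V : List ℕ} {i : ℕ} (h : c.InMem M)
    (f1 : ∀ a ∉ W, a ≠ i → M'.nat a = M.nat a) (f2 : ∀ a ∉ V, M'.real a = M.real a)
    (h1 : ∀ a ∈ [0, 4, 10, 11, 12, 13, 14], a ∉ i :: W) (h2 : ∀ a ∈ [0, 1, 2, 3, 31], a ∉ V) :
    c.InMem M' :=
  h.frame (W := i :: W) (fun a ha => f1 a (fun h => ha (List.mem_cons_of_mem _ h))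
    fun h => ha (h ▸ List.mem_cons_self)) f2 h1 h2

theorem GsRows.frame {N n k : ℕ} {Φ : ℕ → ℕ → ℝ} {M M' : Mem} {V : List ℕ} (h : GsRows N n Φ k M)
    (f2 : ∀ a ∉ V, M'.real a = M.real a) (h2 : ∀ a ∈ [8, 9, 10], a ∉ V) : GsRows N n Φ k M' := by
  intro i hi
  rw [f2 8 (h2 8 (by decide)), f2 9 (h2 9 (by decide)), f2 10 (h2 10 (by decide))]
  exact h i hi

/-- The test for the region. -/
def regionTest : Test :=
  .and (.not (.realLt (.ofNat (.lit 0)) (rv 22))) (.not (.realLt (.ofNat (.lit 1)) (rv 21)))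

theorem regionTest_holds {N n : ℕ} {Φ : ℕ → ℕ → ℝ} {φ : ℕ → ℝ} {M : Mem}
    (h1 : M.real 21 0 0 = lev N n Φ φ) (h2 : M.real 22 0 0 = nul N n Φ φ) :
    regionTest.Holds M ↔ InRegion N n Φ φ := by
  simp [regionTest, Test.Holds, InRegion, RExp.eval, NExp.eval, h1, h2]

/-- The inner product of row `row` of array `r` with the features in array `5`. -/
def dotC (acc r : ℕ) (row : NExp) : Cmd :=
  sumN 21 10 acc (.mul (.get r row (nv 21)) (.get 5 (.lit 0) (nv 21)))

theorem runs_dotC {M : Mem} {N acc r ρ : ℕ} {row : NExp} {u φ : ℕ → ℝ} (hr : r ≠ acc)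
    (h5 : 5 ≠ acc) (hc : row.cost ≤ 10)
    (hN : M.nat 10 0 = N) (hrow : ∀ M' : Mem, (∀ b, b ≠ 21 → M'.nat b = M.nat b) → row.eval M' = ρ)
    (hu : ∀ w < N, M.real r ρ w = u w) (hφ : ∀ w < N, M.real 5 0 w = φ w) :
    Runs (dotC acc r row) M (N * 40 + 16) (fun M' => M'.real acc 0 0 = dot N u φ) := by
  refine Runs.mono (runs_sumN (K := N) (fun w => u w * φ w) (by decide) hN ?_) ?_
    (fun _ _ _ h => h)
  · intro j hj M' h1 h2 h3
    simp [RExp.eval, NExp.eval, hrow M' h1, h3, h2 r hr, h2 5 h5, hu j hj, hφ j hj]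
  · simp only [RExp.cost, NExp.cost, nv_cost]
    have := Nat.mul_le_mul_left N (by omega : row.cost + 2 + 1 + (1 + 2 + 1) + 1 + 20 ≤ 40)
    omega

/-- Process the reference example of a round. -/
def roundRefC : Cmd :=
  .seq (loadFeatC 3 (nv 17)) (.seq (projC 13) (.seq (dotC 28 14 (.lit 0))
    (.ite regionTest
      (.ite (.realLt (rv 28) (.ofNat (.lit 0)))
        (.setR 24 (.lit 0) (.lit 0) (.sub (.ofNat (.lit 0)) (.ofNat (.lit 1))))
        (.setR 24 (.lit 0) (.lit 0) (.ofNat (.lit 1))))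
      (.setR 24 (.lit 0) (.lit 0) (.ofNat (.lit 0))))))

theorem runs_roundRef {c : Config} {M : Mem} {Φ : ℕ → ℕ → ℝ} {q : ℕ → ℝ} {i : ℕ}
    (hC : c.InMem M) (hG : GsRows c.N c.n Φ c.N M) (hi : M.nat 17 0 = i)
    (hq : ∀ w < c.N, M.real 14 0 w = q w) :
    Runs roundRefC M (featTime c.d c.l + c.N * (c.N * 80 + 220) + 200)
      (fun M' => (∀ w < c.N, M'.real 13 0 w = kap c.N c.n Φ (feat c.d (c.rs i) c.l) w) ∧
        M'.real 28 0 0 = dot c.N q (feat c.d (c.rs i) c.l) ∧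
        M'.real 24 0 0 = sgnR c.N c.n Φ q (feat c.d (c.rs i) c.l)) := by
  set φ := feat c.d (c.rs i) c.l
  refine Runs.mono (Runs.seq (runs_loadFeat (s := 3) (ρ := i) (by decide) (by decide) hC.hd hC.hl ?_)
    (t₂ := c.N * (c.N * 80 + 220) + 160) ?_) (by omega) (fun _ _ _ h => h)
  · intro M' h; simp [h, hi]
  intro M₁ f1 f2 h1
  rw [hC.hr] at h1
  have hC1 := hC.frame f1 f2 (by decide) (by decide)
  have hG1 := hG.frame f2 (by decide)
  refine Runs.mono (Runs.seq (runs_proj (φ := φ) (Or.inr rfl) hC1.hN hG1 h1)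
    (t₂ := c.N * 40 + 59) ?_) (by nlinarith) (fun _ _ _ h => h)
  rintro M₂ g1 g2 ⟨h2, h3, h4⟩
  have hC2 := hC1.frame g1 g2 (by decide) (by decide)
  refine Runs.mono (Runs.seq (runs_dotC (ρ := 0) (u := q) (φ := φ) (by decide) (by decide)
    (by decide) hC2.hN (fun _ _ => rfl) ?_ ?_)
    (t₂ := 42) ?_) (by omega) (fun _ _ _ h => h)
  · rw [g2 14 (by decide), f2 14 (by decide)]; exact hq
  · rw [g2 5 (by decide)]; exact h1
  intro M₃ p1 p2 p3
  have h213 : M₃.real 21 0 0 = lev c.N c.n Φ φ := by rw [p2 21 (by decide), h3]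
  have h223 : M₃.real 22 0 0 = nul c.N c.n Φ φ := by rw [p2 22 (by decide), h4]
  have e : ∀ v, v = sgnR c.N c.n Φ q φ → (∀ w < c.N, (M₃.storeR 24 0 0 v).real 13 0 w =
      kap c.N c.n Φ φ w) ∧ (M₃.storeR 24 0 0 v).real 28 0 0 = dot c.N q φ ∧
      (M₃.storeR 24 0 0 v).real 24 0 0 = sgnR c.N c.n Φ q φ := by
    rintro v rfl
    refine ⟨?_, ?_, storeR_same _ _ _ _ _⟩
    · rw [storeR_ne _ _ _ _ (by decide), p2 13 (by decide)]; exact h2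
    · rw [storeR_ne _ _ _ _ (by decide), p3]
  refine Runs.mono (Runs.ite (t := 20) ?_ ?_) (by decide) (fun _ _ _ h => h)
  · intro hb
    rw [regionTest_holds h213 h223] at hb
    refine Runs.mono (Runs.ite (t := 10) ?_ ?_) (by decide) (fun _ _ _ h => h)
    · intro hb2
      refine Runs.mono (Runs.setR (e _ ?_)) (by decide) (fun _ _ _ h => h)
      simp only [Test.Holds, RExp.eval, NExp.eval, rv_eval, p3, Nat.cast_zero] at hb2
      rw [sgnR, if_pos hb, if_pos hb2]
      simp [RExp.eval, NExp.eval]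
    · intro hb2
      refine Runs.mono (Runs.setR (e _ ?_)) (by decide) (fun _ _ _ h => h)
      simp only [Test.Holds, RExp.eval, NExp.eval, rv_eval, p3, Nat.cast_zero] at hb2
      rw [sgnR, if_pos hb, if_neg hb2]
      simp [RExp.eval, NExp.eval]
  · intro hb
    rw [regionTest_holds h213 h223] at hb
    refine Runs.mono (Runs.setR (e _ ?_)) (by decide) (fun _ _ _ h => h)
    rw [sgnR, if_neg hb]
    simp [RExp.eval, NExp.eval]

/-- Process the labeled example of a round. -/
def roundObsC : Cmd :=
  .seq (loadFeatC 1 (nv 17)) (.seq (projC 12) (.seq (dotC 26 14 (.lit 0)) (.seq (dotC 27 15 (.lit 0))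
    (.seq (.ite (.and regionTest (.realLt (rv 26) (.ofNat (.lit 1))))
      (.setR 23 (.lit 0) (.lit 0) (.ofNat (.lit 1))) (.setR 23 (.lit 0) (.lit 0) (.ofNat (.lit 0))))
    (.ite (.realLt (rv 27) (.get 2 (nv 17) (.lit 0)))
        (.setR 25 (.lit 0) (.lit 0) (.ofNat (.lit 1)))
        (.setR 25 (.lit 0) (.lit 0) (.sub (.ofNat (.lit 0)) (.ofNat (.lit 1)))))))))

theorem runs_roundObs {c : Config} {M : Mem} {Φ : ℕ → ℕ → ℝ} {q p : ℕ → ℝ} {i : ℕ}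
    (hC : c.InMem M) (hG : GsRows c.N c.n Φ c.N M) (hi : M.nat 17 0 = i)
    (hq : ∀ w < c.N, M.real 14 0 w = q w) (hp : ∀ w < c.N, M.real 15 0 w = p w) :
    Runs roundObsC M (featTime c.d c.l + c.N * (c.N * 80 + 260) + 250)
      (fun M' => (∀ w < c.N, M'.real 12 0 w = kap c.N c.n Φ (feat c.d (c.xs i) c.l) w) ∧
        M'.real 26 0 0 = dot c.N q (feat c.d (c.xs i) c.l) ∧
        M'.real 23 0 0 = gate c.N c.n Φ q (feat c.d (c.xs i) c.l) ∧
        M'.real 25 0 0 = sgnY c.N p (feat c.d (c.xs i) c.l) (c.ys i)) := by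
  set φ := feat c.d (c.xs i) c.l
  refine Runs.mono (Runs.seq (runs_loadFeat (s := 1) (ρ := i) (by decide) (by decide) hC.hd hC.hl ?_)
    (t₂ := c.N * (c.N * 80 + 260) + 240) ?_) (by omega) (fun _ _ _ h => h)
  · intro M' h; simp [h, hi]
  intro M₁ f1 f2 h1
  rw [hC.hx] at h1
  have hC1 := hC.frame f1 f2 (by decide) (by decide)
  have hG1 := hG.frame f2 (by decide)
  refine Runs.mono (Runs.seq (runs_proj (φ := φ) (Or.inl rfl) hC1.hN hG1 h1)
    (t₂ := c.N * 80 + 139) ?_) (by nlinarith) (fun _ _ _ h => h)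
  rintro M₂ g1 g2 ⟨h2, h3, h4⟩
  have hC2 := hC1.frame g1 g2 (by decide) (by decide)
  refine Runs.mono (Runs.seq (runs_dotC (ρ := 0) (u := q) (φ := φ) (by decide) (by decide)
    (by decide) hC2.hN (fun _ _ => rfl) ?_ ?_)
    (t₂ := c.N * 40 + 100) ?_) (by omega) (fun _ _ _ h => h)
  · rw [g2 14 (by decide), f2 14 (by decide)]; exact hq
  · rw [g2 5 (by decide)]; exact h1
  intro M₃ p1 p2 p3
  have hC3 := hC2.frame p1 p2 (by decide) (by decide)
  refine Runs.mono (Runs.seq (runs_dotC (ρ := 0) (u := p) (φ := φ) (by decide) (by decide)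
    (by decide) hC3.hN (fun _ _ => rfl) ?_ ?_)
    (t₂ := 80) ?_) (by omega) (fun _ _ _ h => h)
  · rw [p2 15 (by decide), g2 15 (by decide), f2 15 (by decide)]; exact hp
  · rw [p2 5 (by decide), g2 5 (by decide)]; exact h1
  intro M₄ q1 q2 q3
  have hC4 := hC3.frame q1 q2 (by decide) (by decide)
  have h17 : M₄.nat 17 0 = i := by
    rw [q1 17 (by decide), p1 17 (by decide), g1 17 (by decide), f1 17 (by decide), hi]
  have h214 : M₄.real 21 0 0 = lev c.N c.n Φ φ := by rw [q2 21 (by decide), p2 21 (by decide), h3]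
  have h224 : M₄.real 22 0 0 = nul c.N c.n Φ φ := by rw [q2 22 (by decide), p2 22 (by decide), h4]
  have h264 : M₄.real 26 0 0 = dot c.N q φ := by rw [q2 26 (by decide), p3]
  have h12 : ∀ w < c.N, M₄.real 12 0 w = kap c.N c.n Φ φ w := by
    rw [q2 12 (by decide), p2 12 (by decide)]; exact h2
  refine Runs.mono (Runs.seq (t₁ := 40) (t₂ := 30)
    (Q₁ := fun M' => M'.real 23 0 0 = gate c.N c.n Φ q φ)
    (Runs.mono (Runs.ite (t := 8) ?_ ?_) (by decide) (fun _ _ _ h => h)) ?_) (by decide)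
    (fun _ _ _ h => h)
  · intro hb
    refine Runs.mono (Runs.setR ?_) (by decide) (fun _ _ _ h => h)
    have hb' : InRegion c.N c.n Φ φ ∧ dot c.N q φ < 1 := by
      refine ⟨(regionTest_holds h214 h224).1 hb.1, ?_⟩
      simpa [Test.Holds, RExp.eval, NExp.eval, h264] using hb.2
    rw [gate, if_pos hb']
    simp [RExp.eval, NExp.eval]
  · intro hb
    refine Runs.mono (Runs.setR ?_) (by decide) (fun _ _ _ h => h)
    have hb' : ¬ (InRegion c.N c.n Φ φ ∧ dot c.N q φ < 1) := by
      rintro ⟨h5, h6⟩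
      refine hb ⟨(regionTest_holds h214 h224).2 h5, ?_⟩
      simpa [Test.Holds, RExp.eval, NExp.eval, h264] using h6
    rw [gate, if_neg hb']
    simp [RExp.eval, NExp.eval]
  intro M₅ r1 r2 r3
  have hC5 := hC4.frame r1 r2 (by decide) (by decide)
  have e : ∀ v, v = sgnY c.N p φ (c.ys i) → (∀ w < c.N, (M₅.storeR 25 0 0 v).real 12 0 w =
      kap c.N c.n Φ φ w) ∧ (M₅.storeR 25 0 0 v).real 26 0 0 = dot c.N q φ ∧
      (M₅.storeR 25 0 0 v).real 23 0 0 = gate c.N c.n Φ q φ ∧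
      (M₅.storeR 25 0 0 v).real 25 0 0 = sgnY c.N p φ (c.ys i) := by
    rintro v rfl
    refine ⟨?_, ?_, ?_, storeR_same _ _ _ _ _⟩
    · rw [storeR_ne _ _ _ _ (by decide), r2 12 (by decide)]; exact h12
    · rw [storeR_ne _ _ _ _ (by decide), r2 26 (by decide), h264]
    · rw [storeR_ne _ _ _ _ (by decide), r3]
  have hh : (Test.realLt (rv 27) (.get 2 (nv 17) (.lit 0))).Holds M₅ ↔ dot c.N p φ < c.ys i := by
    simp [Test.Holds, RExp.eval, NExp.eval, r1 17 (by decide), h17, hC5.hy, r2 27 (by decide), q3]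
  refine Runs.mono (Runs.ite (t := 10) ?_ ?_) (by decide) (fun _ _ _ h => h)
  · intro hb
    refine Runs.mono (Runs.setR (e _ ?_)) (by decide) (fun _ _ _ h => h)
    rw [sgnY, if_pos (hh.1 hb)]
    simp [RExp.eval, NExp.eval]
  · intro hb
    refine Runs.mono (Runs.setR (e _ ?_)) (by decide) (fun _ _ _ h => h)
    rw [sgnY, if_neg (fun h => hb (hh.2 h))]
    simp [RExp.eval, NExp.eval]

/-- Update the statistic, store the candidate and update the state. -/
def updateC : Cmd :=
  .seq (.setR 29 (.lit 0) (.lit 0) (.add (rv 29) (.sub (.add (.sub (.ofNat (.lit 1)) (rv 23))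
    (.mul (rv 23) (rv 26))) (.mul (rv 24) (rv 28)))))
  (.seq (mapN 21 10 16 (nv 17) (.get 15 (.lit 0) (nv 21)))
  (.seq (mapN 21 10 14 (.lit 0) (.add (.get 14 (.lit 0) (nv 21)) (.mul (rv 31)
    (.sub (.mul (rv 23) (.get 12 (.lit 0) (nv 21))) (.mul (rv 24) (.get 13 (.lit 0) (nv 21)))))))
  (.seq (mapN 21 10 15 (.lit 0) (.add (.get 15 (.lit 0) (nv 21)) (.mul (rv 31)
    (.mul (.mul (rv 23) (rv 25)) (.get 12 (.lit 0) (nv 21))))))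
  (.setN 17 (.lit 0) (.add (nv 17) (.lit 1))))))

/-- One round of the online algorithm. -/
def roundC : Cmd := .seq roundRefC (.seq roundObsC updateC)

/-- The data of the round that uses the `i`-th examples. -/
def Config.round (c : Config) (i : ℕ) : Round :=
  (feat c.d (c.xs i) c.l, c.ys i, feat c.d (c.rs i) c.l)

/-- The state and the statistic of the online algorithm are in memory. -/
structure StateIn (N : ℕ) (s : (ℕ → ℝ) × (ℕ → ℝ)) (v : ℝ) (M : Mem) : Prop where
  hq : ∀ w < N, M.real 14 0 w = s.1 w
  hp : ∀ w < N, M.real 15 0 w = s.2 w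
  hv : M.real 29 0 0 = v

/-- Time for one round. -/
def roundTime (d l : ℕ) : ℕ :=
  2 * featTime d l + (d + 1) ^ l * ((d + 1) ^ l * 160 + 700) + 700

-- The stored candidate is the second component before the update. Candidate `t` therefore depends
-- only on rounds before `t`, as the online-to-batch conversion requires.
set_option maxRecDepth 4000 in
theorem runs_round {c : Config} {M : Mem} {Φ : ℕ → ℕ → ℝ} {s : (ℕ → ℝ) × (ℕ → ℝ)} {v : ℝ} {i : ℕ}
    (hC : c.InMem M) (hG : GsRows c.N c.n Φ c.N M) (hi : M.nat 17 0 = i)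
    (hs : StateIn c.N s v M) :
    Runs roundC M (roundTime c.d c.l)
      (fun M' => StateIn c.N (step c.N c.n Φ c.η s (c.round i))
          (v + val c.N c.n Φ s.1 (c.round i)) M' ∧ M'.nat 17 0 = i + 1 ∧
        ∀ r w, M'.real 16 r w = if r = i ∧ w < c.N then s.2 w else M.real 16 r w) := by
  refine Runs.mono (Runs.seq (runs_roundRef hC hG hi hs.hq)
    (t₂ := featTime c.d c.l + c.N * (c.N * 80 + 450) + 480) ?_)
    (by rw [roundTime, ← Config.N.eq_def]; nlinarith) (fun _ _ _ h => h)
  rintro M₁ f1 f2 ⟨h1, h2, h3⟩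
  have hC1 := hC.frame f1 f2 (by decide) (by decide)
  have hG1 := hG.frame f2 (by decide)
  refine Runs.mono (Runs.seq (runs_roundObs (q := s.1) (p := s.2) (i := i) hC1 hG1 ?_ ?_ ?_)
    (t₂ := c.N * 150 + 200) ?_) (by nlinarith) (fun _ _ _ h => h)
  · rw [f1 17 (by decide), hi]
  · rw [f2 14 (by decide)]; exact hs.hq
  · rw [f2 15 (by decide)]; exact hs.hp
  rintro M₂ g1 g2 ⟨h4, h5, h6, h7⟩
  have hC2 := hC1.frame g1 g2 (by decide) (by decide)
  set z := c.round i with hz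
  have hi2 : M₂.nat 17 0 = i := by rw [g1 17 (by decide), f1 17 (by decide), hi]
  have h13 : ∀ w < c.N, M₂.real 13 0 w = kap c.N c.n Φ z.2.2 w := by
    rw [g2 13 (by decide)]; exact h1
  have h28 : M₂.real 28 0 0 = dot c.N s.1 z.2.2 := by rw [g2 28 (by decide)]; exact h2
  have h24 : M₂.real 24 0 0 = sgnR c.N c.n Φ s.1 z.2.2 := by rw [g2 24 (by decide)]; exact h3
  have h14 : ∀ w < c.N, M₂.real 14 0 w = s.1 w := by
    rw [g2 14 (by decide), f2 14 (by decide)]; exact hs.hq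
  have h15 : ∀ w < c.N, M₂.real 15 0 w = s.2 w := by
    rw [g2 15 (by decide), f2 15 (by decide)]; exact hs.hp
  have h29 : M₂.real 29 0 0 = v := by
    rw [g2 29 (by decide), f2 29 (by decide)]; exact hs.hv
  have h16 : M₂.real 16 = M.real 16 := by rw [g2 16 (by decide), f2 16 (by decide)]
  refine Runs.mono (Runs.seq (t₁ := 40) (t₂ := c.N * 150 + 100)
    (Q₁ := fun M' => M'.real 29 0 0 = v + val c.N c.n Φ s.1 z) (Runs.mono (Runs.setR ?_)
      (Nat.le_of_ble_eq_true rfl) (fun _ _ _ h => h)) ?_) (by omega) (fun _ _ _ h => h)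
  · simp [RExp.eval, NExp.eval, h29, h28, h24, h5, h6, val, hz, Config.round]
  intro M₃ p1 p2 p3
  have hC3 := hC2.frame p1 p2 (by decide) (by decide)
  have hi3 : M₃.nat 17 0 = i := by rw [p1 17 (by decide), hi2]
  refine Runs.mono (Runs.seq (runs_mapN (K := c.N) (ρ := i) s.2 (by decide) hC3.hN ?_ ?_)
    (t₂ := c.N * 110 + 80) ?_) ?_ (fun _ _ _ h => h)
  · intro M' h; simp [h, hi3]
  · intro j hj M' a1 a2 _ a3
    simp [RExp.eval, NExp.eval, a2 15 (by decide), p2 15 (by decide), a3, h15 j hj]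
  swap
  · simp only [RExp.cost, NExp.cost, nv_cost]; omega
  intro M₄ q1 q2 q3
  rw [p2 16 (by decide), h16] at q3
  have hC4 := hC3.frame q1 q2 (by decide) (by decide)
  refine Runs.mono (Runs.seq (runs_mapN (K := c.N) (ρ := 0) (step c.N c.n Φ c.η s z).1 (by decide)
    hC4.hN (fun _ _ => rfl) ?_)
    (t₂ := c.N * 60 + 60) ?_) ?_ (fun _ _ _ h => h)
  · intro j hj M' a1 a2 a4 a3
    simp [RExp.eval, NExp.eval, a2, q2 _ (of_decide_eq_true rfl : 12 ∉ _),
      q2 _ (of_decide_eq_true rfl : 13 ∉ _), q2 _ (of_decide_eq_true rfl : 14 ∉ _),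
      q2 _ (of_decide_eq_true rfl : 23 ∉ _), q2 _ (of_decide_eq_true rfl : 24 ∉ _),
      p2 _ (of_decide_eq_true rfl : 12 ∉ _),
      p2 _ (of_decide_eq_true rfl : 13 ∉ _), p2 _ (of_decide_eq_true rfl : 14 ∉ _),
      p2 _ (of_decide_eq_true rfl : 23 ∉ _), p2 _ (of_decide_eq_true rfl : 24 ∉ _),
      a3, a4 0 j (Or.inr le_rfl), h14 j hj, hC4.hη, h24, h6, h4 j hj, h13 j hj, step, hz,
      Config.round]
  swap
  · simp only [RExp.cost, NExp.cost, nv_cost, rv_cost]; omega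
  intro M₅ r1 r2 r3
  have hC5 := hC4.frame r1 r2 (by decide) (by decide)
  refine Runs.mono (Runs.seq (runs_mapN (K := c.N) (ρ := 0) (step c.N c.n Φ c.η s z).2 (by decide)
    hC5.hN (fun _ _ => rfl) ?_)
    (t₂ := 10) ?_) ?_ (fun _ _ _ h => h)
  · intro j hj M' a1 a2 a4 a3
    simp [RExp.eval, NExp.eval, a2, q2 _ (of_decide_eq_true rfl : 12 ∉ _),
      q2 _ (of_decide_eq_true rfl : 15 ∉ _),
      q2 _ (of_decide_eq_true rfl : 23 ∉ _), q2 _ (of_decide_eq_true rfl : 25 ∉ _),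
      p2 _ (of_decide_eq_true rfl : 12 ∉ _),
      p2 _ (of_decide_eq_true rfl : 15 ∉ _),
      p2 _ (of_decide_eq_true rfl : 23 ∉ _), p2 _ (of_decide_eq_true rfl : 25 ∉ _),
      r2 _ (of_decide_eq_true rfl : 12 ∉ _),
      r2 _ (of_decide_eq_true rfl : 15 ∉ _),
      r2 _ (of_decide_eq_true rfl : 23 ∉ _), r2 _ (of_decide_eq_true rfl : 25 ∉ _),
      a3, a4 0 j (Or.inr le_rfl), h15 j hj, hC5.hη, h7, h6, h4 j hj, step, hz,
      Config.round]
  swap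
  · simp only [RExp.cost, NExp.cost, nv_cost, rv_cost]; omega
  intro M₆ t1 t2 t3
  refine Runs.mono (Runs.setN ?_) (by decide) (fun _ _ _ h => h)
  refine ⟨⟨?_, ?_, ?_⟩, ?_, ?_⟩
  · intro w hw
    rw [storeN_real, t2 14 (by decide), r3, if_pos ⟨rfl, hw⟩]
  · intro w hw
    rw [storeN_real, t3, if_pos ⟨rfl, hw⟩]
  · rw [storeN_real, t2 29 (by decide), r2 29 (by decide), q2 29 (by decide), p3]
  · simp [NExp.eval, t1 17 (by decide), r1 17 (by decide), q1 17 (by decide), hi3]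
  · intro r w
    rw [storeN_real, t2 16 (by decide), r2 16 (by decide), q3]

/-! ### Programs for blocks and validation -/

/-- The features of the reference examples of a block. -/
def Config.refs (c : Config) (b r : ℕ) : ℕ → ℝ := feat c.d (c.rs (c.k * c.T + b * c.n + r)) c.l

/-- The states of the online algorithm in a block. -/
def Config.state (c : Config) (b t : ℕ) : (ℕ → ℝ) × (ℕ → ℝ) :=
  runFrom c.N c.n (c.refs b) c.η 0 (fun t => c.round (b * c.T + t)) t

/-- The test statistic of a block. -/
def Config.stat (c : Config) (b : ℕ) : ℝ :=
  ∑ t ∈ Finset.range c.T, val c.N c.n (c.refs b) (c.state b t).1 (c.round (b * c.T + t))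

/-- The block accepts. -/
def Config.Pass (c : Config) (b : ℕ) : Prop := ¬ c.T * (c.τ + c.ε / 8) < c.stat b

open Classical in
/-- The number of blocks below `b` that accept. -/
def Config.passes (c : Config) (b : ℕ) : ℕ := ((Finset.range b).filter c.Pass).card

/-- Load the reference examples of a block. -/
def refsC : Cmd := forN 24 11 (.seq (loadFeatC 3 (nv 18))
  (.seq (mapN 21 10 6 (nv 24) (.get 5 (.lit 0) (nv 21))) (.setN 18 (.lit 0) (.add (nv 18) (.lit 1)))))

/-- The first `k * T` reference examples are reserved for the rounds, so the kernel points of block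
`b` start at `k * T + b * n`. -/
theorem runs_refs {c : Config} {M : Mem} {b : ℕ} (hC : c.InMem M)
    (hi : M.nat 18 0 = c.k * c.T + b * c.n) :
    Runs refsC M (c.n * (featTime c.d c.l + c.N * 30 + 50) + 10)
      (fun M' => M'.nat 18 0 = c.k * c.T + (b + 1) * c.n ∧
        ∀ r < c.n, ∀ w < c.N, M'.real 6 r w = c.refs b r w) := by
  refine Runs.mono (runs_forN (t := featTime c.d c.l + c.N * 30 + 37) (K := c.n)
    (fun j M' => M'.nat 18 0 = c.k * c.T + b * c.n + j ∧
      ∀ r < j, ∀ w < c.N, M'.real 6 r w = c.refs b r w) (by decide) (by decide) (by decide) hC.hn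
      ?_ ⟨hi, by simp⟩ ?_) (by ring_nf; rfl) ?_
  · rintro j M' v ⟨h1, h2⟩
    exact ⟨by rw [storeN_ne _ _ _ (by decide), h1], h2⟩
  · rintro j hj M₁ f1 f2 f3 ⟨f4, f5⟩
    have hC1 := hC.frame_loop f1 f2 (by decide) (by decide)
    refine Runs.mono (Runs.seq (runs_loadFeat (s := 3) (ρ := c.k * c.T + b * c.n + j) (by decide)
      (by decide) hC1.hd hC1.hl ?_) (t₂ := c.N * 30 + 36) ?_) (by omega) (fun _ _ _ h => h)
    · intro M' h; simp [h, f4]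
    intro M₂ g1 g2 g3
    rw [hC1.hr] at g3
    have hC2 := hC1.frame g1 g2 (by decide) (by decide)
    refine Runs.mono (Runs.seq (runs_mapN (K := c.N) (ρ := j) (c.refs b j) (by decide) hC2.hN ?_ ?_)
      (t₂ := 6) ?_) ?_ (fun _ _ _ h => h)
    · intro M' h; simp [h, g1 24 (by decide), f3]
    · intro w hw M' a1 a2 _ a3
      simp only [RExp.eval, NExp.eval, nv_eval, a2 5 (by decide), a3]
      exact g3 w hw
    · intro M₃ p1 p2 p3
      refine Runs.setN ⟨?_, ?_⟩
      · simp [NExp.eval, p1 18 (by decide), g1 18 (by decide), f4, add_assoc]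
      · intro r hr w hw
        rw [storeN_real, p3]
        split_ifs with h
        · rw [h.1]
        · rw [g2 6 (by decide)]; exact f5 r (by omega) w hw
    · simp only [RExp.cost, NExp.cost, nv_cost]; omega
  · rintro M' _ _ ⟨h1, h2⟩
    exact ⟨by rw [h1]; ring, h2⟩

/-- The online phase of a block. -/
def onlineC : Cmd :=
  .seq (mapN 21 10 14 (.lit 0) (.ofNat (.lit 0))) (.seq (mapN 21 10 15 (.lit 0) (.ofNat (.lit 0)))
    (.seq (.setR 29 (.lit 0) (.lit 0) (.ofNat (.lit 0))) (forN 24 12 roundC)))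

-- The last clause protects the candidates of earlier blocks, which must survive until validation.
set_option maxRecDepth 4000 in
theorem runs_online {c : Config} {M : Mem} {b : ℕ} (hC : c.InMem M)
    (hG : GsRows c.N c.n (c.refs b) c.N M) (hi : M.nat 17 0 = b * c.T) :
    Runs onlineC M (c.T * (roundTime c.d c.l + 13) + c.N * 40 + 50)
      (fun M' => M'.nat 17 0 = (b + 1) * c.T ∧ M'.real 29 0 0 = c.stat b ∧
        (∀ t < c.T, ∀ w < c.N, M'.real 16 (b * c.T + t) w = (c.state b t).2 w) ∧
        ∀ r < b * c.T, M'.real 16 r = M.real 16 r) := by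
  refine Runs.mono (Runs.seq (runs_mapN (K := c.N) (ρ := 0) (fun _ => 0) (by decide) hC.hN
    (fun _ _ => rfl) ?_) (t₂ := c.T * (roundTime c.d c.l + 13) + c.N * 20 + 39) ?_) ?_
    (fun _ _ _ h => h)
  · intros; simp [RExp.eval, NExp.eval]
  swap
  · simp only [RExp.cost, NExp.cost]; omega
  intro M₁ f1 f2 f3
  have hC1 := hC.frame f1 f2 (by decide) (by decide)
  refine Runs.mono (Runs.seq (runs_mapN (K := c.N) (ρ := 0) (fun _ => 0) (by decide) hC1.hN
    (fun _ _ => rfl) ?_) (t₂ := c.T * (roundTime c.d c.l + 13) + 28) ?_) ?_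
    (fun _ _ _ h => h)
  · intros; simp [RExp.eval, NExp.eval]
  swap
  · simp only [RExp.cost, NExp.cost]; omega
  intro M₂ g1 g2 g3
  have hC2 := hC1.frame g1 g2 (by decide) (by decide)
  refine Runs.mono (Runs.seq (t₁ := 5) (t₂ := c.T * (roundTime c.d c.l + 13) + 10)
    (Q₁ := StateIn c.N 0 0) (Runs.setR ⟨?_, ?_, ?_⟩) ?_) (by omega) (fun _ _ _ h => h)
  · intro w hw
    rw [storeR_ne _ _ _ _ (by decide), g2 14 (by decide), f3, if_pos ⟨rfl, hw⟩]; rfl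
  · intro w hw
    rw [storeR_ne _ _ _ _ (by decide), g3, if_pos ⟨rfl, hw⟩]; rfl
  · simp [RExp.eval, NExp.eval]
  intro M₃ p1 p2 p3
  have hC3 := hC2.frame p1 p2 (by decide) (by decide)
  have hG3 : GsRows c.N c.n (c.refs b) c.N M₃ :=
    ((hG.frame f2 (by decide)).frame g2 (by decide)).frame p2 (by decide)
  have h16 : M₃.real 16 = M.real 16 := by
    rw [p2 16 (by decide), g2 16 (by decide), f2 16 (by decide)]
  refine Runs.mono (runs_forN (t := roundTime c.d c.l) (K := c.T)
    (fun j M' => StateIn c.N (c.state b j) (∑ t ∈ Finset.range j, val c.N c.n (c.refs b)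
        (c.state b t).1 (c.round (b * c.T + t))) M' ∧ M'.nat 17 0 = b * c.T + j ∧
      (∀ t < j, ∀ w < c.N, M'.real 16 (b * c.T + t) w = (c.state b t).2 w) ∧
      ∀ r < b * c.T, M'.real 16 r = M.real 16 r) (by decide) (by decide) (by decide) hC3.hT
      ?_ ⟨?_, ?_, by simp, by rw [h16]; exact fun _ _ => rfl⟩ ?_) le_rfl ?_
  · rintro j M' v ⟨h1, h2, h3⟩
    exact ⟨⟨h1.hq, h1.hp, h1.hv⟩, by rw [storeN_ne _ _ _ (by decide), h2], h3⟩
  · simpa [Config.state, runFrom] using p3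
  · rw [p1 17 (by decide), g1 17 (by decide), f1 17 (by decide), hi, add_zero]
  · rintro j hj M₄ q1 q2 q3 ⟨q4, q5, q6, q7⟩
    refine Runs.mono (runs_round (hC3.frame_loop q1 q2 (by decide) (by decide))
      (hG3.frame q2 (by decide)) q5 q4) le_rfl ?_
    rintro M' _ _ ⟨h1, h2, h3⟩
    refine ⟨?_, by rw [h2]; ring, ?_, ?_⟩
    · rw [Finset.sum_range_succ]; exact h1
    · intro t ht w hw
      rw [h3]
      rcases Nat.lt_succ_iff_lt_or_eq.1 ht with h | rfl
      · rw [if_neg (by omega), q6 t h w hw]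
      · rw [if_pos ⟨rfl, hw⟩]
    · intro r hr
      funext w
      rw [h3, if_neg (by omega), q7 r hr]
  · rintro M' _ _ ⟨h1, h2, h3, h4⟩
    exact ⟨by rw [h2]; ring, h1.hv, h3, h4⟩

/-- One block. -/
def blockC : Cmd :=
  .seq refsC (.seq gsC (.seq onlineC
    (.ite (.realLt (.mul (.ofNat (nv 12)) (.add (.get 0 (.lit 0) (.lit 3))
      (.div (.get 0 (.lit 0) (.lit 1)) (.ofNat (.lit 8))))) (rv 29))
      .skip (.setN 19 (.lit 0) (.add (nv 19) (.lit 1))))))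

/-- Time for one block. -/
def blockTime (d l n T : ℕ) : ℕ :=
  n * (featTime d l + (d + 1) ^ l * 30 + 50) +
    ((d + 1) ^ l * ((d + 1) ^ l * (n * 31 + 38) + 23) +
      (d + 1) ^ l * ((d + 1) ^ l * ((d + 1) ^ l * 80 + 120) + 113)) +
    (T * (roundTime d l + 13) + (d + 1) ^ l * 40) + 150

set_option maxRecDepth 8000 in
theorem runs_block {c : Config} {M : Mem} {b : ℕ} (hC : c.InMem M)
    (hi : M.nat 17 0 = b * c.T) (hr : M.nat 18 0 = c.k * c.T + b * c.n)
    (ha : M.nat 19 0 = c.passes b) :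
    Runs blockC M (blockTime c.d c.l c.n c.T)
      (fun M' => M'.nat 17 0 = (b + 1) * c.T ∧ M'.nat 18 0 = c.k * c.T + (b + 1) * c.n ∧
        M'.nat 19 0 = c.passes (b + 1) ∧
        (∀ t < c.T, ∀ w < c.N, M'.real 16 (b * c.T + t) w = (c.state b t).2 w) ∧
        ∀ r < b * c.T, M'.real 16 r = M.real 16 r) := by
  refine Runs.mono (Runs.seq (runs_refs hC hr) (t₂ :=
    (c.N * (c.N * (c.n * 31 + 38) + 23) + c.N * (c.N * (c.N * 80 + 120) + 113)) +
    (c.T * (roundTime c.d c.l + 13) + c.N * 40) + 130) ?_) ?_ (fun _ _ _ h => h)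
  swap
  · rw [blockTime, ← Config.N.eq_def]; omega
  rintro M₁ f1 f2 ⟨f3, f4⟩
  have hC1 := hC.frame f1 f2 (by decide) (by decide)
  refine Runs.mono (Runs.seq (runs_gs hC1.hN hC1.hn f4) (t₂ :=
    (c.T * (roundTime c.d c.l + 13) + c.N * 40) + 100) ?_) (by omega) (fun _ _ _ h => h)
  intro M₂ g1 g2 g3
  have hC2 := hC1.frame g1 g2 (by decide) (by decide)
  refine Runs.mono (Runs.seq (runs_online hC2 g3 ?_) (t₂ := 40) ?_) (by omega) (fun _ _ _ h => h)
  · rw [g1 17 (by decide), f1 17 (by decide), hi]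
  rintro M₃ p1 p2 ⟨p3, p4, p5, p6⟩
  have hC3 := hC2.frame p1 p2 (by decide) (by decide)
  have h18 : M₃.nat 18 0 = c.k * c.T + (b + 1) * c.n := by
    rw [p1 18 (by decide), g1 18 (by decide), f3]
  have h19 : M₃.nat 19 0 = c.passes b := by
    rw [p1 19 (by decide), g1 19 (by decide), f1 19 (by decide), ha]
  have h16 : ∀ r < b * c.T, M₃.real 16 r = M.real 16 r := by
    intro r hr
    rw [p6 r hr, g2 16 (by decide), f2 16 (by decide)]
  have hh : (Test.realLt (.mul (.ofNat (nv 12)) (.add (.get 0 (.lit 0) (.lit 3))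
      (.div (.get 0 (.lit 0) (.lit 1)) (.ofNat (.lit 8))))) (rv 29)).Holds M₃ ↔ ¬ c.Pass b := by
    simp [Test.Holds, RExp.eval, NExp.eval, hC3.hT, hC3.hτ, hC3.hε, p4, Config.Pass]
  refine Runs.mono (Runs.ite (t := 10) ?_ ?_) (Nat.le_of_ble_eq_true rfl) (fun _ _ _ h => h)
  · intro hb
    refine Runs.mono (Runs.skip ⟨p3, h18, ?_, p5, h16⟩) (by decide) (fun _ _ _ h => h)
    rw [h19, Config.passes, Config.passes, Finset.range_add_one, Finset.filter_insert,
      if_neg (hh.1 hb)]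
  · intro hb
    refine Runs.mono (Runs.setN ⟨?_, ?_, ?_, p5, h16⟩) (by decide) (fun _ _ _ h => h)
    · rw [storeN_ne _ _ _ (by decide), p3]
    · rw [storeN_ne _ _ _ (by decide), h18]
    · rw [NExp.eval, storeN_same]
      simp only [NExp.eval, nv_eval, h19]
      rw [Config.passes, Config.passes, Finset.range_add_one, Finset.filter_insert,
        if_pos (not_not.1 (mt hh.2 hb)), Finset.card_insert_of_notMem (by simp)]

/-- All candidates of the blocks below `b` are in memory. -/
def Config.CandIn (c : Config) (b : ℕ) (M : Mem) : Prop :=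
  ∀ b' < b, ∀ t < c.T, ∀ w < c.N, M.real 16 (b' * c.T + t) w = (c.state b' t).2 w

set_option maxRecDepth 8000 in
theorem runs_blocks {c : Config} {M : Mem} (hC : c.InMem M)
    (hi : M.nat 17 0 = 0) (hr : M.nat 18 0 = c.k * c.T) (ha : M.nat 19 0 = 0) :
    Runs (forN 25 13 blockC) M (c.k * (blockTime c.d c.l c.n c.T + 13) + 10)
      (fun M' => M'.nat 19 0 = c.passes c.k ∧ c.CandIn c.k M') := by
  refine Runs.mono (runs_forN (t := blockTime c.d c.l c.n c.T) (K := c.k)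
    (fun b M' => M'.nat 17 0 = b * c.T ∧ M'.nat 18 0 = c.k * c.T + b * c.n ∧
        M'.nat 19 0 = c.passes b ∧ c.CandIn b M') (by decide) (by decide) (by decide) hC.hk
      ?_ ⟨by rw [hi, zero_mul], by rw [hr, zero_mul, add_zero], by rw [ha]; simp [Config.passes], ?_⟩
      ?_) le_rfl ?_
  · rintro j M' v ⟨h1, h2, h3, h4⟩
    exact ⟨by rw [storeN_ne _ _ _ (by decide), h1], by rw [storeN_ne _ _ _ (by decide), h2],
      by rw [storeN_ne _ _ _ (by decide), h3], h4⟩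
  · intro b' hb'; omega
  · rintro b hb M₁ f1 f2 f3 ⟨h1, h2, h3, h4⟩
    refine Runs.mono (runs_block (hC.frame_loop f1 f2 (by decide) (by decide)) h1 h2 h3) le_rfl ?_
    rintro M' _ _ ⟨g1, g2, g3, g4, g5⟩
    refine ⟨g1, g2, g3, ?_⟩
    intro b' hb' t ht w hw
    rcases Nat.lt_succ_iff_lt_or_eq.1 hb' with h | rfl
    · rw [g5, h4 b' h t ht w hw]
      have : (b' + 1) * c.T ≤ b * c.T := Nat.mul_le_mul_right _ h
      rw [Nat.succ_mul] at this
      omega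
    · exact g4 t ht w hw
  · rintro M' _ _ ⟨-, -, h3, h4⟩
    exact ⟨h3, h4⟩

/-- The `i`-th candidate. -/
def Config.cand (c : Config) (i : ℕ) : ℕ → ℝ := (c.state (i / c.T) (i % c.T)).2

/-- The thresholds. -/
def thr (n j : ℕ) : ℝ := (j + j : ℝ) / n - 1

open Classical in
/-- The number of errors of a candidate on the first `i` validation examples. -/
def Config.errs (c : Config) (u : ℕ → ℝ) (θ : ℝ) (i : ℕ) : ℕ :=
  ((Finset.range i).filter fun j => ¬ (0 < c.ys (c.k * c.T + j) ↔
    θ < dot c.N u (feat c.d (c.xs (c.k * c.T + j)) c.l))).card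

theorem Config.CandIn.cand {c : Config} {M : Mem} (h : c.CandIn c.k M) {i : ℕ} (hi : i < c.k * c.T) :
    ∀ w < c.N, M.real 16 i w = c.cand i w := by
  intro w hw
  have hT : 0 < c.T := Nat.pos_of_ne_zero fun h => by simp [h] at hi
  have := h (i / c.T) (by rw [Nat.div_lt_iff_lt_mul hT]; exact hi) (i % c.T) (Nat.mod_lt _ hT) w hw
  rwa [Nat.div_add_mod'] at this

/-- Compare the prediction with one validation example. -/
def compareC : Cmd :=
  .seq (loadFeatC 1 (nv 17)) (.seq (dotC 28 16 (nv 25))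
    (.seq (.ite (.realLt (.ofNat (.lit 0)) (.get 2 (nv 17) (.lit 0)))
      (.ite (.realLt (rv 34) (rv 28)) .skip (.setN 7 (.lit 0) (.add (nv 7) (.lit 1))))
      (.ite (.realLt (rv 34) (rv 28)) (.setN 7 (.lit 0) (.add (nv 7) (.lit 1))) .skip))
    (.setN 17 (.lit 0) (.add (nv 17) (.lit 1)))))

theorem runs_compare {c : Config} {M : Mem} {i j : ℕ} {u : ℕ → ℝ} {θ : ℝ} (hC : c.InMem M)
    (hu : ∀ w < c.N, M.real 16 i w = u w) (hi : M.nat 25 0 = i) (hθ : M.real 34 0 0 = θ)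
    (h17 : M.nat 17 0 = c.k * c.T + j) (h7 : M.nat 7 0 = c.errs u θ j) :
    Runs compareC M (featTime c.d c.l + c.N * 40 + 100)
      (fun M' => M'.nat 17 0 = c.k * c.T + (j + 1) ∧ M'.nat 7 0 = c.errs u θ (j + 1)) := by
  set φ := feat c.d (c.xs (c.k * c.T + j)) c.l with hφ
  refine Runs.mono (Runs.seq (runs_loadFeat (s := 1) (ρ := c.k * c.T + j) (by decide)
      (by decide) hC.hd hC.hl ?_) (t₂ := c.N * 40 + 90) ?_) (by omega) (fun _ _ _ h => h)
  · intro M' h; simp [h, h17]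
  intro M₁ f1 f2 f3
  rw [hC.hx] at f3
  have hC1 := hC.frame f1 f2 (by decide) (by decide)
  refine Runs.mono (Runs.seq (runs_dotC (ρ := i) (u := u) (φ := φ) (by decide)
    (by decide) (by decide) hC1.hN ?_ ?_ f3) (t₂ := 60) ?_) (by omega) (fun _ _ _ h => h)
  · intro M' h; simp [h, f1 25 (by decide), hi]
  · rw [f2 16 (by decide)]; exact hu
  intro M₂ g1 g2 g3
  have hC2 := hC1.frame g1 g2 (by decide) (by decide)
  have e17 : M₂.nat 17 0 = c.k * c.T + j := by rw [g1 17 (by decide), f1 17 (by decide), h17]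
  have e7 : M₂.nat 7 0 = c.errs u θ j := by rw [g1 7 (by decide), f1 7 (by decide), h7]
  have e34 : M₂.real 34 0 0 = θ := by rw [g2 34 (by decide), f2 34 (by decide), hθ]
  have hy : (Test.realLt (.ofNat (.lit 0)) (.get 2 (nv 17) (.lit 0))).Holds M₂ ↔
      0 < c.ys (c.k * c.T + j) := by
    simp [Test.Holds, RExp.eval, NExp.eval, e17, hC2.hy]
  have ht : (Test.realLt (rv 34) (rv 28)).Holds M₂ ↔ θ < dot c.N u φ := by
    simp [Test.Holds, e34, g3]
  have hsucc : ∀ v, (v = c.errs u θ j + if (0 < c.ys (c.k * c.T + j) ↔ θ < dot c.N u φ) then 0 else 1) →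
      v = c.errs u θ (j + 1) := by
    rintro v rfl
    rw [Config.errs, Config.errs, Finset.range_add_one, Finset.filter_insert, ← hφ]
    split_ifs with h
    · simp
    · rw [Finset.card_insert_of_notMem (by simp)]
  have hskip : (0 < c.ys (c.k * c.T + j) ↔ θ < dot c.N u φ) →
      Runs .skip M₂ 10 (fun M' => M'.nat 17 0 = c.k * c.T + j ∧ M'.nat 7 0 = c.errs u θ (j + 1)) := by
    intro h
    refine Runs.mono (Runs.skip ⟨e17, hsucc _ ?_⟩) (by decide) (fun _ _ _ h => h)
    rw [if_pos h, e7, add_zero]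
  have hinc : ¬ (0 < c.ys (c.k * c.T + j) ↔ θ < dot c.N u φ) →
      Runs (.setN 7 (.lit 0) (.add (nv 7) (.lit 1))) M₂ 10
        (fun M' => M'.nat 17 0 = c.k * c.T + j ∧ M'.nat 7 0 = c.errs u θ (j + 1)) := by
    intro h
    refine Runs.mono (Runs.setN ⟨?_, hsucc _ ?_⟩) (by decide) (fun _ _ _ h => h)
    · rw [storeN_ne _ _ _ (by decide), e17]
    · rw [if_neg h, ← e7]; simp [NExp.eval]
  refine Runs.mono (Runs.seq (t₁ := 40) (t₂ := 10)
    (Q₁ := fun M' => M'.nat 17 0 = c.k * c.T + j ∧ M'.nat 7 0 = c.errs u θ (j + 1))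
    (Runs.mono (Runs.ite (t := 20) ?_ ?_) (by decide) (fun _ _ _ h => h)) ?_)
    (by decide) (fun _ _ _ h => h)
  · intro h1
    rw [hy] at h1
    refine Runs.mono (Runs.ite (t := 10) (fun h2 => hskip ?_) (fun h2 => hinc ?_)) (by decide)
      (fun _ _ _ h => h)
    · rw [ht] at h2; exact iff_of_true h1 h2
    · rw [ht] at h2; exact fun h => h2 (h.1 h1)
  · intro h1
    rw [hy] at h1
    refine Runs.mono (Runs.ite (t := 10) (fun h2 => hinc ?_) (fun h2 => hskip ?_)) (by decide)
      (fun _ _ _ h => h)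
    · rw [ht] at h2; exact fun h => h1 (h.2 h2)
    · rw [ht] at h2; exact iff_of_false h1 h2
  · rintro M₃ p1 p2 ⟨p3, p4⟩
    refine Runs.mono (Runs.setN ⟨?_, ?_⟩) (by decide) (fun _ _ _ h => h)
    · simp [NExp.eval, p3, add_assoc]
    · rw [storeN_ne _ _ _ (by decide), p4]

/-- Evaluate one candidate, with one threshold, on the validation examples. -/
def candC : Cmd :=
  .seq (.setR 34 (.lit 0) (.lit 0) (.sub (.div (.ofNat (.add (nv 24) (nv 24))) (.ofNat (nv 11)))
    (.ofNat (.lit 1))))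
  (.seq (.setN 7 (.lit 0) (.lit 0)) (.seq (.setN 17 (.lit 0) (nv 14)) (.seq (forN 26 14 compareC)
  (.ite (.natLt (nv 7) (nv 6))
    (.seq (.setN 6 (.lit 0) (nv 7)) (.seq (.setN 5 (.lit 0) (nv 25))
      (.setR 33 (.lit 0) (.lit 0) (rv 34)))) .skip))))

/-- The best candidate among those that satisfy `P` is in memory. -/
def Config.Best (c : Config) (P : ℕ → ℕ → Prop) (M : Mem) : Prop :=
  (∀ i j, P i j → M.nat 6 0 ≤ c.errs (c.cand i) (thr c.n j) (c.k * c.T)) ∧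
  (M.nat 6 0 = c.k * c.T + 1 ∨ ∃ i < c.k * c.T, ∃ j < c.n, M.nat 5 0 = i ∧
    M.real 33 0 0 = thr c.n j ∧ M.nat 6 0 = c.errs (c.cand i) (thr c.n j) (c.k * c.T))

theorem Config.Best.congr {c : Config} {P Q : ℕ → ℕ → Prop} {M M' : Mem} (h : c.Best P M)
    (hPQ : ∀ i j, Q i j → P i j) (h6 : M'.nat 6 = M.nat 6) (h5 : M'.nat 5 = M.nat 5)
    (h33 : M'.real 33 = M.real 33) : c.Best Q M' := by
  rw [Config.Best, h6, h5, h33]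
  exact ⟨fun i j hq => h.1 i j (hPQ i j hq), h.2⟩

/-- Time for the validation of one candidate. -/
def candTime (d l KT : ℕ) : ℕ := KT * (featTime d l + (d + 1) ^ l * 40 + 113) + 100

/-- One step of a running minimum: `P` is the set of pairs (candidate, threshold) already examined.
The record is replaced only on strict improvement. -/
theorem runs_cand {c : Config} {M : Mem} {i j : ℕ} {P : ℕ → ℕ → Prop} (hC : c.InMem M)
    (hK : c.CandIn c.k M) (hi : M.nat 25 0 = i) (hj : M.nat 24 0 = j) (hil : i < c.k * c.T)
    (hjl : j < c.n) (hB : c.Best P M) :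
    Runs candC M (candTime c.d c.l (c.k * c.T))
      (c.Best fun i' j' => P i' j' ∨ i' = i ∧ j' = j) := by
  set KT := c.k * c.T with hKT
  refine Runs.mono (Runs.seq (t₁ := 20) (t₂ := KT * (featTime c.d c.l + c.N * 40 + 113) + 70)
    (Q₁ := fun M' => M'.real 34 0 0 = thr c.n j) (Runs.mono (Runs.setR ?_) (by decide)
      (fun _ _ _ h => h)) ?_) (by rw [candTime, ← Config.N.eq_def]; omega) (fun _ _ _ h => h)
  · simp [RExp.eval, NExp.eval, hj, hC.hn, thr]
  intro M₁ f1 f2 f3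
  refine Runs.mono (Runs.seq (t₁ := 3) (t₂ := KT * (featTime c.d c.l + c.N * 40 + 113) + 60)
    (Q₁ := fun M' => M'.nat 7 0 = 0) (Runs.setN (by simp [NExp.eval])) ?_) (by omega)
    (fun _ _ _ h => h)
  intro M₂ g1 g2 g3
  have hC2 := (hC.frame f1 f2 (by decide) (by decide)).frame g1 g2 (by decide) (by decide)
  refine Runs.mono (Runs.seq (t₁ := 4) (t₂ := KT * (featTime c.d c.l + c.N * 40 + 113) + 50)
    (Q₁ := fun M' => M'.nat 17 0 = KT) (Runs.setN ?_) ?_) (by omega)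
    (fun _ _ _ h => h)
  · simp [NExp.eval, hC2.hKT, hKT]
  intro M₃ p1 p2 p3
  have hC3 := hC2.frame p1 p2 (by decide) (by decide)
  have h34 : M₃.real 34 0 0 = thr c.n j := by rw [p2 34 (by decide), g2 34 (by decide), f3]
  have h25 : M₃.nat 25 0 = i := by
    rw [p1 25 (by decide), g1 25 (by decide), f1 25 (by decide), hi]
  have h16 : ∀ w < c.N, M₃.real 16 i w = c.cand i w := by
    rw [p2 16 (by decide), g2 16 (by decide), f2 16 (by decide)]; exact hK.cand hil
  refine Runs.mono (Runs.seq (t₁ := KT * (featTime c.d c.l + c.N * 40 + 113) + 10) (t₂ := 30)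
    (Q₁ := fun M' => M'.nat 7 0 = c.errs (c.cand i) (thr c.n j) KT) ?_ ?_) (by omega)
    (fun _ _ _ h => h)
  · refine Runs.mono (runs_forN (t := featTime c.d c.l + c.N * 40 + 100) (K := KT)
      (fun s M' => M'.nat 17 0 = KT + s ∧ M'.nat 7 0 = c.errs (c.cand i) (thr c.n j) s) (by decide)
      (by decide) (by decide) hC3.hKT ?_ ⟨p3, ?_⟩ ?_) le_rfl (fun _ _ _ h => h.2)
    · rintro s M' v ⟨h1, h2⟩
      exact ⟨by rw [storeN_ne _ _ _ (by decide), h1], by rw [storeN_ne _ _ _ (by decide), h2]⟩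
    · rw [p1 7 (by decide), g3]; simp [Config.errs]
    · rintro s hs M₄ q1 q2 q3 ⟨q4, q5⟩
      refine runs_compare (hC3.frame_loop q1 q2 (by decide) (by decide)) (i := i) ?_ ?_ ?_ q4 q5
      · rw [q2 16 (by decide)]; exact h16
      · rw [q1 25 (by decide) (by decide), h25]
      · rw [q2 34 (by decide), h34]
  intro M₄ q1 q2 q3
  have e6 : M₄.nat 6 = M.nat 6 := by
    rw [q1 6 (by decide), p1 6 (by decide), g1 6 (by decide), f1 6 (by decide)]
  have e5 : M₄.nat 5 = M.nat 5 := by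
    rw [q1 5 (by decide), p1 5 (by decide), g1 5 (by decide), f1 5 (by decide)]
  have e33 : M₄.real 33 = M.real 33 := by
    rw [q2 33 (by decide), p2 33 (by decide), g2 33 (by decide), f2 33 (by decide)]
  have hB4 : c.Best P M₄ := hB.congr (fun _ _ h => h) e6 e5 e33
  have h25' : M₄.nat 25 0 = i := by rw [q1 25 (by decide), h25]
  have h34' : M₄.real 34 0 0 = thr c.n j := by rw [q2 34 (by decide), h34]
  refine Runs.mono (Runs.ite (t := 20) ?_ ?_) (by decide) (fun _ _ _ h => h)
  · intro hb
    have hb' : M₄.nat 7 0 < M₄.nat 6 0 := hb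
    have key : Runs (.seq (.setN 6 (.lit 0) (nv 7)) (.seq (.setN 5 (.lit 0) (nv 25))
      (.setR 33 (.lit 0) (.lit 0) (rv 34)))) M₄ 20 (fun M' => M'.nat 6 0 = M₄.nat 7 0 ∧
        M'.nat 5 0 = i ∧ M'.real 33 0 0 = thr c.n j) := by
      refine Runs.mono (Runs.seq (t₁ := 4) (t₂ := 12) (Q₁ := fun M' => M'.nat 6 0 = M₄.nat 7 0)
        (Runs.setN (by simp [NExp.eval])) ?_) (by decide) (fun _ _ _ h => h)
      intro M₅ r1 r2 r3
      refine Runs.mono (Runs.seq (t₁ := 4) (t₂ := 6) (Q₁ := fun M' => M'.nat 5 0 = i)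
        (Runs.setN ?_) ?_) (by decide) (fun _ _ _ h => h)
      · simp [NExp.eval, r1 25 (by decide), h25']
      intro M₆ t1 t2 t3
      refine Runs.mono (Runs.setR ⟨?_, ?_, ?_⟩) (by decide) (fun _ _ _ h => h)
      · rw [storeR_nat, t1 6 (by decide), r3]
      · rw [storeR_nat, t3]
      · simp [NExp.eval, t2 34 (by decide), r2 34 (by decide), h34']
    refine Runs.mono key le_rfl ?_
    rintro M' _ _ ⟨h1, h2, h3⟩
    refine ⟨?_, Or.inr ⟨i, hil, j, hjl, h2, h3, by rw [h1, q3]⟩⟩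
    rintro i' j' (h | ⟨rfl, rfl⟩)
    · rw [h1]; exact hb'.le.trans (hB4.1 i' j' h)
    · rw [h1, q3]
  · intro hb
    have hb' : M₄.nat 6 0 ≤ M₄.nat 7 0 := not_lt.1 hb
    refine Runs.mono (Runs.skip ⟨?_, hB4.2⟩) (by decide) (fun _ _ _ h => h)
    rintro i' j' (h | ⟨rfl, rfl⟩)
    · exact hB4.1 i' j' h
    · rw [← q3]; exact hb'

/-- Validation: find the best candidate. -/
def validC : Cmd :=
  .seq (.setN 6 (.lit 0) (.add (nv 14) (.lit 1))) (forN 25 14 (forN 24 11 candC))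

/-- The initial record `k * T + 1` exceeds every possible number of errors, so it acts as infinity.
-/
theorem runs_valid {c : Config} {M : Mem} (hC : c.InMem M) (hK : c.CandIn c.k M) :
    Runs validC M (c.k * c.T * (c.n * (candTime c.d c.l (c.k * c.T) + 13) + 23) + 20)
      (c.Best fun i j => i < c.k * c.T ∧ j < c.n) := by
  refine Runs.mono (Runs.seq (t₁ := 6)
    (t₂ := c.k * c.T * (c.n * (candTime c.d c.l (c.k * c.T) + 13) + 23) + 10)
    (Q₁ := fun M' => M'.nat 6 0 = c.k * c.T + 1) (Runs.setN ?_) ?_) (by omega) (fun _ _ _ h => h)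
  · simp [NExp.eval, hC.hKT]
  intro M₁ f1 f2 f3
  have hC1 := hC.frame f1 f2 (by decide) (by decide)
  refine Runs.mono (runs_forN (t := c.n * (candTime c.d c.l (c.k * c.T) + 13) + 10) (K := c.k * c.T)
    (fun i => c.Best fun i' j' => i' < i ∧ j' < c.n) (by decide) (by decide) (by decide) hC1.hKT
      ?_ ⟨?_, Or.inl f3⟩ ?_) le_rfl (fun _ _ _ h => h)
  · intro i M' v h
    exact h.congr (fun _ _ h => h) (storeN_ne _ _ _ (by decide)) (storeN_ne _ _ _ (by decide)) rfl
  · rintro i j ⟨h, -⟩; omega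
  intro i hi M₂ g1 g2 g3 g4
  have hC2 := hC1.frame_loop g1 g2 (by decide) (by decide)
  refine Runs.mono (runs_forN (t := candTime c.d c.l (c.k * c.T)) (K := c.n)
    (fun j => c.Best fun i' j' => (i' < i ∧ j' < c.n) ∨ (i' = i ∧ j' < j)) (by decide) (by decide)
      (by decide) hC2.hn ?_ (g4.congr ?_ rfl rfl rfl) ?_) le_rfl ?_
  · intro i M' v h
    exact h.congr (fun _ _ h => h) (storeN_ne _ _ _ (by decide)) (storeN_ne _ _ _ (by decide)) rfl
  · rintro i' j' (h | h)
    · exact h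
    · omega
  · intro j hj M₃ p1 p2 p3 p4
    refine Runs.mono (runs_cand (hC2.frame_loop p1 p2 (by decide) (by decide)) ?_ ?_ p3 hi hj p4)
      le_rfl ?_
    · rw [Config.CandIn, p2 16 (by decide), g2 16 (by decide), f2 16 (by decide)]; exact hK
    · rw [p1 25 (by decide) (by decide), g3]
    · intro M' _ _ h
      refine h.congr ?_ rfl rfl rfl
      intro i' j' h
      omega
  · intro M' _ _ h
    refine h.congr ?_ rfl rfl rfl
    intro i' j' h
    omega

/-! ### The complete learner -/

/-- Count in the variable `a` while the test holds. -/
def countC (a : ℕ) (b : Test) : Cmd := .while b (.setN a (.lit 0) (.add (nv a) (.lit 1)))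

/-- Reals cannot be converted to integers on this machine, so a ceiling is found by counting up. The
time is proportional to the result, which is affordable since the results are sizes of data that are
processed anyway. -/
theorem runs_count {a : ℕ} {b : Test} {M : Mem} {x : ℝ} (h0 : M.nat a 0 = 0)
    (hb : ∀ M' : Mem, (∀ i, i ≠ a → M'.nat i = M.nat i) → M'.real = M.real →
      (b.Holds M' ↔ (M'.nat a 0 : ℝ) < x)) :
    Runs (countC a b) M (⌈x⌉₊ * (b.cost + 7) + b.cost + 1) (fun M' => M'.nat a 0 = ⌈x⌉₊) := by
  refine Runs.mono (Runs.while (t := 6) (K := ⌈x⌉₊) (fun j M' => M'.nat a 0 = j ∧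
    (∀ i, i ≠ a → M'.nat i = M.nat i) ∧ M'.real = M.real) ?_ ?_
    ⟨h0, fun _ _ => rfl, rfl⟩) le_rfl (fun _ _ _ h => h.1)
  · rintro j hj M' ⟨h1, h2, h3⟩
    refine ⟨?_, Runs.setN ⟨?_, ?_, ?_⟩⟩
    · rw [hb M' h2 h3, h1]; exact Nat.lt_ceil.1 hj
    · simp [NExp.eval, h1]
    · intro i hi; rw [storeN_ne _ _ _ hi, h2 i hi]
    · rw [storeN_real, h3]
  · rintro M' ⟨h1, h2, h3⟩
    rw [hb M' h2 h3, h1, ← Nat.lt_ceil]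
    exact lt_irrefl _

/-- The number of features. -/
def Params.numFeat (P : Params) : ℕ := (P.d + 1) ^ P.l

/-- The number of reference examples for the kernel of a block. -/
def Params.numRef (P : Params) : ℕ := ⌈16384 * P.numFeat / P.ε⌉₊

/-- The hypercontractivity factor `(2A)^(2l)`. -/
def Params.factor (P : Params) : ℝ := (4 * P.A * P.A) ^ P.l

/-- The number of rounds of a block. -/
def Params.rounds (P : Params) : ℕ := ⌈8796093022208 * P.numRef * P.factor / P.ε ^ 3⌉₊

/-- The number of doublings of the failure probability. -/
def Params.doublings (P : Params) : ℕ := ⌈Real.logb 2 (1 / P.δ)⌉₊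

/-- The configuration of the algorithm on given data. -/
@[simps] def Params.config (P : Params) {X : Set (Fin P.d → ℝ)} {m : ℕ} (S : Fin m → X × Bool)
    (ω : ℕ → X) : Config where
  d := P.d
  l := P.l
  n := P.numRef
  T := P.rounds
  k := P.doublings + 1
  ε := P.ε
  τ := P.τ
  η := P.ε ^ 2 / 67108864
  xs := fun i => if h : i < m then entry (S ⟨i, h⟩).1.1 else 0
  ys := fun i => if h : i < m then labelValue (S ⟨i, h⟩).2 else 0
  rs := fun i => entry (ω i).1

/-- Compute the number of rounds. -/
def roundsTest : Test :=
  .realLt (.mul (.mul (.mul (.ofNat (nv 12)) (.get 0 (.lit 0) (.lit 1))) (.get 0 (.lit 0) (.lit 1)))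
    (.get 0 (.lit 0) (.lit 1))) (.mul (.mul (.ofNat (.lit 8796093022208)) (.ofNat (nv 11))) (rv 30))

/-- Compute the number of reference examples. -/
def refTest : Test :=
  .realLt (.mul (.ofNat (nv 11)) (.get 0 (.lit 0) (.lit 1)))
    (.mul (.ofNat (.lit 16384)) (.ofNat (nv 10)))

/-- Compute the factor `(2A)^(2l)`. -/
def factorC : Cmd :=
  .seq (.setR 30 (.lit 0) (.lit 0) (.ofNat (.lit 1)))
    (forN 20 4 (.setR 30 (.lit 0) (.lit 0) (.mul (rv 30) (.mul (.mul (.ofNat (.lit 4))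
      (.get 0 (.lit 0) (.lit 0))) (.get 0 (.lit 0) (.lit 0))))))

theorem runs_factor {M : Mem} {l : ℕ} {A : ℝ} (hl : M.nat 4 0 = l) (hA : M.real 0 0 0 = A) :
    Runs factorC M (l * 40 + 20) (fun M' => M'.real 30 0 0 = (4 * A * A) ^ l) := by
  refine Runs.mono (Runs.seq (t₁ := 5) (t₂ := l * 40 + 10) (Q₁ := fun M' => M'.real 30 0 0 = 1)
    (Runs.setR ?_) ?_) (by omega) (fun _ _ _ h => h)
  · simp [RExp.eval, NExp.eval]
  intro M₁ f1 f2 f3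
  refine Runs.mono (runs_forN (t := 27) (K := l) (fun j M' => M'.real 30 0 0 = (4 * A * A) ^ j)
    (by decide) (by decide) (by decide) ?_ (fun _ _ _ h => h) (by rw [f3, pow_zero]) ?_) le_rfl
    (fun _ _ _ h => h)
  · rw [f1 4 (by decide), hl]
  · intro j hj M' g1 g2 g3 g4
    refine Runs.mono (Runs.setR ?_) (by decide) (fun _ _ _ h => h)
    simp only [RExp.eval, NExp.eval, rv_eval, storeR_same, g4, g2 0 (by decide), f2 0 (by decide), hA]
    rw [pow_succ]; push_cast; ring

/-- Compute the number of blocks. -/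
def blocksC : Cmd :=
  .seq (.setR 32 (.lit 0) (.lit 0) (.get 0 (.lit 0) (.lit 2)))
    (.seq (.setN 13 (.lit 0) (.lit 1))
      (.while (.realLt (rv 32) (.ofNat (.lit 1)))
        (.seq (.setR 32 (.lit 0) (.lit 0) (.add (rv 32) (rv 32)))
          (.setN 13 (.lit 0) (.add (nv 13) (.lit 1))))))

/-- This is why doubling `δ` until it reaches one computes the rounded logarithm without
transcendental functions. -/
theorem lt_ceil_logb_iff {δ : ℝ} (hδ : 0 < δ) (j : ℕ) :
    j < ⌈Real.logb 2 (1 / δ)⌉₊ ↔ 2 ^ j * δ < 1 := by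
  rw [Nat.lt_ceil, Real.lt_logb_iff_rpow_lt one_lt_two (by positivity), Real.rpow_natCast,
    lt_div_iff₀ hδ]

theorem runs_blockCount {M : Mem} {δ : ℝ} (hδ : 0 < δ) (h : M.real 0 0 2 = δ) :
    Runs blocksC M (⌈Real.logb 2 (1 / δ)⌉₊ * 30 + 30)
      (fun M' => M'.nat 13 0 = ⌈Real.logb 2 (1 / δ)⌉₊ + 1) := by
  set K := ⌈Real.logb 2 (1 / δ)⌉₊ with hK
  refine Runs.mono (Runs.seq (t₁ := 6) (t₂ := K * 30 + 20) (Q₁ := fun M' => M'.real 32 0 0 = δ)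
    (Runs.setR ?_) ?_) (by omega) (fun _ _ _ h => h)
  · simp [RExp.eval, NExp.eval, h]
  intro M₁ f1 f2 f3
  refine Runs.mono (Runs.seq (t₁ := 3) (t₂ := K * 30 + 10) (Q₁ := fun M' => M'.nat 13 0 = 1)
    (Runs.setN ?_) ?_) (by omega) (fun _ _ _ h => h)
  · simp [NExp.eval]
  intro M₂ g1 g2 g3
  refine Runs.mono (Runs.while (t := 20) (K := K) (fun j M' => M'.real 32 0 0 = 2 ^ j * δ ∧
    M'.nat 13 0 = j + 1) ?_ ?_ ⟨?_, by rw [g3]⟩) ?_ (fun _ _ _ h => h.2)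
  · rintro j hj M' ⟨h1, h2⟩
    refine ⟨?_, ?_⟩
    · simp only [Test.Holds, rv_eval, h1, RExp.eval, NExp.eval, Nat.cast_one]
      exact (lt_ceil_logb_iff hδ j).1 hj
    · refine Runs.mono (Runs.seq (t₁ := 10) (t₂ := 6) (Q₁ := fun M' => M'.real 32 0 0 = 2 ^ (j + 1) * δ)
        (Runs.setR ?_) ?_) (by decide) (fun _ _ _ h => h)
      · simp only [RExp.eval, NExp.eval, rv_eval, storeR_same, h1]; ring
      intro M₃ p1 p2 p3
      refine Runs.setN ⟨p3, ?_⟩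
      simp [NExp.eval, p1 13 (by decide), h2]
  · rintro M' ⟨h1, h2⟩
    simp only [Test.Holds, rv_eval, h1, RExp.eval, NExp.eval, Nat.cast_one]
    rw [← lt_ceil_logb_iff hδ]
    exact lt_irrefl _
  · rw [g2 32 (by decide), f3, pow_zero, one_mul]
  · simp only [Test.cost, RExp.cost, NExp.cost, rv_cost]; omega

/-- Compute all sizes. -/
def sizesC : Cmd :=
  .seq (.setN 4 (.lit 0) (.get 0 (.lit 1))) (.seq featC (.seq (.setN 10 (.lit 0) (nv 15))
    (.seq factorC (.seq (countC 11 refTest) (.seq (countC 12 roundsTest) (.seq blocksC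
      (.seq (forN 20 13 (.setN 14 (.lit 0) (.add (nv 14) (nv 12))))
        (.seq (.setR 31 (.lit 0) (.lit 0) (.div (.mul (.get 0 (.lit 0) (.lit 1))
          (.get 0 (.lit 0) (.lit 1))) (.ofNat (.lit 67108864))))
        (.setN 18 (.lit 0) (nv 14))))))))))

/-- Time for the computation of the sizes. -/
def sizesTime (d l n T k : ℕ) : ℕ :=
  l * (d * ((d + 1) ^ l * 34 + 23) + 38) + l * 40 + n * 40 + T * 40 + k * 60 + 300

-- Natural numbers cannot be multiplied on the machine. `(d + 1) ^ l` is obtained as the length of a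
-- feature vector, the features being computed once for whatever is in array `4`, and `k * T` by
-- repeated addition.
set_option maxRecDepth 8000 in
theorem runs_sizes (P : Params) (hε : 0 < P.ε) (hδ : 0 < P.δ) {X : Set (Fin P.d → ℝ)} {m : ℕ}
    (S : Fin m → X × Bool) (ω : ℕ → X) :
    Runs sizesC (P.input S ω) (sizesTime P.d P.l P.numRef P.rounds (P.doublings + 1))
      (fun M => (P.config S ω).InMem M ∧ M.nat 17 0 = 0 ∧
        M.nat 18 0 = (P.doublings + 1) * P.rounds ∧ M.nat 19 0 = 0 ∧ M.nat 1 0 = 0) := by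
  set M₀ := P.input S ω with hM0
  have i0 : ∀ a, a ≠ 0 → M₀.nat a 0 = 0 := fun a ha => by simp [hM0, Params.input, ha]
  refine Runs.mono (Runs.seq (t₁ := 4) (t₂ := P.l * (P.d * ((P.d + 1) ^ P.l * 34 + 23) + 38) +
    P.l * 40 + P.numRef * 40 + P.rounds * 40 + (P.doublings + 1) * 60 + 290)
    (Q₁ := fun M => M.nat 4 0 = P.l) (Runs.setN ?_) ?_) (by rw [sizesTime]; omega)
    (fun _ _ _ h => h)
  · simp [NExp.eval, hM0, Params.input]
  intro M₁ f1 f2 f3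
  refine Runs.mono (Runs.seq (runs_feat (d := P.d) (l := P.l) ?_ f3) (t₂ :=
    P.l * 40 + P.numRef * 40 + P.rounds * 40 + (P.doublings + 1) * 60 + 250) ?_) (by omega)
    (fun _ _ _ h => h)
  · rw [f1 0 (by decide)]; simp [hM0, Params.input]
  rintro M₂ g1 g2 ⟨g3, -⟩
  refine Runs.mono (Runs.seq (t₁ := 4) (t₂ :=
    P.l * 40 + P.numRef * 40 + P.rounds * 40 + (P.doublings + 1) * 60 + 240)
    (Q₁ := fun M => M.nat 10 0 = P.numFeat) (Runs.setN ?_) ?_) (by omega)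
    (fun _ _ _ h => h)
  · simp [NExp.eval, g3, Params.numFeat]
  intro M₃ h1 h2 h3
  refine Runs.mono (Runs.seq (runs_factor (l := P.l) (A := P.A) ?_ ?_) (t₂ :=
    P.numRef * 40 + P.rounds * 40 + (P.doublings + 1) * 60 + 210) ?_) (by omega)
    (fun _ _ _ h => h)
  · rw [h1 4 (by decide), g1 4 (by decide), f3]
  · rw [h2 0 (by decide), g2 0 (by decide), f2 0 (by decide)]; simp [hM0, Params.input]
  intro M₄ p1 p2 p3
  have e4 : M₄.real 0 = M₀.real 0 := by
    rw [p2 0 (by decide), h2 0 (by decide), g2 0 (by decide), f2 0 (by decide)]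
  have eε : M₄.real 0 0 1 = P.ε := by rw [e4]; simp [hM0, Params.input]
  have e10 : M₄.nat 10 0 = P.numFeat := by rw [p1 10 (by decide), h3]
  have en : ∀ a, a ∉ [4, 10, 15, 20, 22, 23, 21] → a ∉ featC.writesN → a ∉ factorC.writesN →
      M₄.nat a = M₀.nat a := by
    intro a ha hb hc
    rw [p1 a hc, h1 a (by simp_all [Cmd.writesN]), g1 a hb, f1 a (by simp_all [Cmd.writesN])]
  refine Runs.mono (Runs.seq (runs_count (a := 11) (x := 16384 * P.numFeat / P.ε) ?_ ?_) (t₂ :=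
    P.rounds * 40 + (P.doublings + 1) * 60 + 180) ?_) ?_
    (fun _ _ _ h => h)
  · rw [en 11 (by decide) (by decide) (by decide), i0 11 (by decide)]
  · intro M' q1 q2
    simp only [refTest, Test.Holds, RExp.eval, NExp.eval, nv_eval, q1 10 (by decide), q2, eε, e10]
    rw [lt_div_iff₀ hε]; norm_num
  swap
  · have : refTest.cost = 14 := by decide
    rw [this, ← Params.numRef.eq_def]; omega
  intro M₅ q1 q2 q3
  refine Runs.mono (Runs.seq (runs_count (a := 12)
    (x := 8796093022208 * P.numRef * P.factor / P.ε ^ 3) ?_ ?_) (t₂ :=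
    (P.doublings + 1) * 60 + 130) ?_) ?_ (fun _ _ _ h => h)
  · rw [q1 12 (by decide), en 12 (by decide) (by decide) (by decide), i0 12 (by decide)]
  · intro M' r1 r2
    simp only [roundsTest, Test.Holds, RExp.eval, NExp.eval, nv_eval, rv_eval, r1 11 (by decide), r2,
      q2 0 (by decide), q2 30 (by decide), eε, q3, p3]
    rw [lt_div_iff₀ (by positivity), Params.factor, Params.numRef]
    have : (((8796093022208 : ℕ) : ℝ)) = 8796093022208 := by norm_num
    rw [this]
    have e : (M'.nat 12 0 : ℝ) * P.ε * P.ε * P.ε = M'.nat 12 0 * P.ε ^ 3 := by ring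
    rw [e]
  swap
  · have : roundsTest.cost = 26 := by decide
    rw [this, ← Params.rounds.eq_def]; omega
  intro M₆ r1 r2 r3
  refine Runs.mono (Runs.seq (runs_blockCount (δ := P.δ) hδ ?_) (t₂ :=
    (P.doublings + 1) * 30 + 60) ?_) (by rw [← Params.doublings.eq_def]; omega) (fun _ _ _ h => h)
  · rw [r2 0 (by decide), q2 0 (by decide), e4]; simp [hM0, Params.input]
  intro M₇ s1 s2 s3
  have e12 : M₇.nat 12 0 = P.rounds := by rw [s1 12 (by decide), r3, Params.rounds]
  refine Runs.mono (Runs.seq (runs_forN (t := 10) (K := P.doublings + 1)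
    (fun j M' => M'.nat 14 0 = j * P.rounds) (by decide)
    (by decide) (by decide) s3 ?_ ?_ ?_) (t₂ := 30) ?_) (by omega) (fun _ _ _ h => h)
  · intro j M' v h; rw [storeN_ne _ _ _ (by decide), h]
  · rw [s1 14 (by decide), r1 14 (by decide), q1 14 (by decide),
      en 14 (by decide) (by decide) (by decide), i0 14 (by decide), zero_mul]
  · intro j hj M' t1 t2 t3 t4
    refine Runs.mono (Runs.setN ?_) (by decide) (fun _ _ _ h => h)
    simp only [NExp.eval, nv_eval, storeN_same, t4, t1 12 (by decide) (by decide), e12]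
    ring
  intro M₈ t1 t2 t3
  refine Runs.mono (Runs.seq (t₁ := 15) (t₂ := 10)
    (Q₁ := fun M => M.real 31 0 0 = P.ε ^ 2 / 67108864) (Runs.mono (Runs.setR ?_)
      (Nat.le_of_ble_eq_true rfl) (fun _ _ _ h => h)) ?_) (by omega) (fun _ _ _ h => h)
  · have : M₈.real 0 0 1 = P.ε := by
      rw [t2 0 (by decide), s2 0 (by decide), r2 0 (by decide), q2 0 (by decide), eε]
    simp only [NExp.eval, RExp.eval, storeR_same, this]
    norm_num [pow_two]
  intro M₉ u1 u2 u3
  have eN : ∀ a, a ∉ [18, 14, 20, 13, 12, 11] → M₉.nat a = M₄.nat a := by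
    intro a ha
    rw [u1 a (by simp [Cmd.writesN]), t1 a (by simp_all [Cmd.writesN, forN]),
      s1 a (by simp_all [Cmd.writesN, blocksC]), r1 a (by simp_all [Cmd.writesN, countC]),
      q1 a (by simp_all [Cmd.writesN, countC])]
  have eR : ∀ a, a ∉ [31, 32] → M₉.real a = M₄.real a := by
    intro a ha
    rw [u2 a (by simp_all [Cmd.writesR]), t2 a (by simp_all [Cmd.writesR, forN]),
      s2 a (by simp_all [Cmd.writesR, blocksC]), r2 a (by simp_all [Cmd.writesR, countC]),
      q2 a (by simp_all [Cmd.writesR, countC])]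
  have eR0 : ∀ a, a < 4 → M₉.real a = M₀.real a := by
    intro a ha
    rw [eR a (by simp; omega)]
    interval_cases a <;> rw [p2 _ (by decide), h2 _ (by decide), g2 _ (by decide), f2 _ (by decide)]
  have e14 : M₉.nat 14 0 = (P.doublings + 1) * P.rounds := by
    rw [u1 14 (by decide), t3]
  refine Runs.mono (Runs.setN ⟨⟨?_, ?_, ?_, ?_, ?_, ?_, ?_, ?_, ?_, ?_, ?_, ?_, ?_⟩, ?_, ?_, ?_, ?_⟩)
    (by decide) (fun _ _ _ h => h)
  · rw [storeN_ne _ _ _ (by decide), eN 0 (by decide), p1 0 (by decide), h1 0 (by decide),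
      g1 0 (by decide), f1 0 (by decide)]
    simp [hM0, Params.input]
  · rw [storeN_ne _ _ _ (by decide), eN 4 (by decide), p1 4 (by decide), h1 4 (by decide),
      g1 4 (by decide), f3]; rfl
  · rw [storeN_ne _ _ _ (by decide), eN 10 (by decide), e10]; rfl
  · rw [storeN_ne _ _ _ (by decide), u1 11 (by decide), t1 11 (by decide), s1 11 (by decide),
      r1 11 (by decide), q3]; rfl
  · rw [storeN_ne _ _ _ (by decide), u1 12 (by decide), t1 12 (by decide), e12]; rfl
  · rw [storeN_ne _ _ _ (by decide), u1 13 (by decide), t1 13 (by decide), s3]; rfl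
  · rw [storeN_ne _ _ _ (by decide), e14]; rfl
  · rw [storeN_real, eR0 0 (by decide)]; simp [hM0, Params.input]
  · rw [storeN_real, eR0 0 (by decide)]; simp [hM0, Params.input]
  · rw [storeN_real, u3]; rfl
  · rw [storeN_real, eR0 1 (by decide)]
    funext i j
    simp only [hM0, Params.input, Params.config_xs]
    norm_num
    split_ifs <;> rfl
  · intro i
    rw [storeN_real, eR0 2 (by decide)]
    simp [hM0, Params.input]
  · rw [storeN_real, eR0 3 (by decide)]
    funext i j
    simp [hM0, Params.input]
  · rw [storeN_ne _ _ _ (by decide), eN 17 (by decide), en 17 (by decide) (by decide) (by decide),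
      i0 17 (by decide)]
  · simp [NExp.eval, e14]
  · rw [storeN_ne _ _ _ (by decide), eN 19 (by decide), en 19 (by decide) (by decide) (by decide),
      i0 19 (by decide)]
  · rw [storeN_ne _ _ _ (by decide), eN 1 (by decide), en 1 (by decide) (by decide) (by decide),
      i0 1 (by decide)]

/-- The training program. -/
def trainC : Cmd :=
  .seq sizesC (.seq (forN 25 13 blockC) (.seq validC
    (.ite (.natLt (.add (nv 19) (nv 19)) (nv 13)) .skip (.setN 1 (.lit 0) (.lit 1)))))

/-- The evaluation program. -/
def predictC : Cmd :=
  .seq (loadFeatC 1 (.lit 0)) (.seq (dotC 28 16 (nv 5))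
    (.ite (.realLt (rv 33) (rv 28)) (.setN 2 (.lit 0) (.lit 1)) (.setN 2 (.lit 0) (.lit 0))))

/-- The tester-learner. -/
def learner : Learner := ⟨trainC, predictC⟩

/-- Time for training. -/
def trainTime (d l n T k : ℕ) : ℕ :=
  sizesTime d l n T k + k * (blockTime d l n T + 13) +
    k * T * (n * (candTime d l (k * T) + 13) + 23) + 80

/-- Time for evaluating the hypothesis. -/
def predictTime (d l : ℕ) : ℕ := featTime d l + (d + 1) ^ l * 40 + 60

theorem Config.errs_le (c : Config) (u : ℕ → ℝ) (θ : ℝ) (i : ℕ) : c.errs u θ i ≤ i := by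
  classical
  exact (Finset.card_filter_le _ _).trans (Finset.card_range i).le

-- A query replaces only the real arrays `1`, `2`, `3`, so the candidates, the index of the chosen
-- one and its threshold are still available.
set_option maxRecDepth 8000 in
theorem runs_predict {c : Config} {M : Mem} {i j : ℕ} (h0 : M.nat 0 0 = c.d) (h4 : M.nat 4 0 = c.l)
    (h10 : M.nat 10 0 = c.N) (h5 : M.nat 5 0 = i) (h33 : M.real 33 0 0 = thr c.n j)
    (h16 : ∀ w < c.N, M.real 16 i w = c.cand i w) {d : ℕ} (x : Fin d → ℝ) :
    Runs predictC (M.query x) (predictTime c.d c.l) (fun M' => M'.nat 2 0 = 1 ↔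
      thr c.n j < dot c.N (c.cand i) (feat c.d (entry x) c.l)) := by
  refine Runs.mono (Runs.seq (runs_loadFeat (s := 1) (ρ := 0) (by decide) (by decide) h0 h4
    (fun _ _ => rfl)) (t₂ := c.N * 40 + 50) ?_) (by rw [predictTime, ← Config.N.eq_def]; omega)
    (fun _ _ _ h => h)
  intro M₁ f1 f2 f3
  have hx : (M.query x).real 1 0 = entry x := by funext j; simp [Mem.query]
  rw [hx] at f3
  refine Runs.mono (Runs.seq (runs_dotC (ρ := i) (u := c.cand i) (by decide)
    (by decide) (by decide) (N := c.N) ?_ ?_ ?_ f3) (t₂ := 30) ?_) (by omega) (fun _ _ _ h => h)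
  · rw [f1 10 (by decide)]; exact h10
  · intro M' h; simp only [nv_eval]; rw [h 5 (by decide), f1 5 (by decide)]; exact h5
  · rw [f2 16 (by decide)]; exact h16
  intro M₂ g1 g2 g3
  have e33 : M₂.real 33 0 0 = thr c.n j := by
    rw [g2 33 (by decide), f2 33 (by decide)]; exact h33
  have hh : (Test.realLt (rv 33) (rv 28)).Holds M₂ ↔
      thr c.n j < dot c.N (c.cand i) (feat c.d (entry x) c.l) := by
    simp [Test.Holds, e33, g3]
  refine Runs.mono (Runs.ite (t := 10) ?_ ?_) (by decide) (fun _ _ _ h => h)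
  · intro h
    refine Runs.mono (Runs.setN ?_) (by decide) (fun _ _ _ h => h)
    simpa [NExp.eval] using hh.1 h
  · intro h
    refine Runs.mono (Runs.setN ?_) (by decide) (fun _ _ _ h => h)
    simpa [NExp.eval] using mt hh.2 h

set_option maxRecDepth 8000 in
theorem runs_train (P : Params) (hε : 0 < P.ε) (hδ : 0 < P.δ) (hn : 0 < P.numRef)
    (hT : 0 < P.rounds) {X : Set (Fin P.d → ℝ)} {m : ℕ} (S : Fin m → X × Bool) (ω : ℕ → X)
    {c : Config} (hc : c = P.config S ω) :
    Runs trainC (P.input S ω) (trainTime P.d P.l P.numRef P.rounds (P.doublings + 1))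
      (fun M => (M.Accepts ↔ c.k ≤ 2 * c.passes c.k) ∧
        ∃ i < c.k * c.T, ∃ j < c.n, (∀ i' < c.k * c.T, ∀ j' < c.n,
          c.errs (c.cand i) (thr c.n j) (c.k * c.T) ≤ c.errs (c.cand i') (thr c.n j') (c.k * c.T)) ∧
        ∀ x : Fin P.d → ℝ, Runs predictC (M.query x) (predictTime P.d P.l) (fun M' => M'.nat 2 0 = 1 ↔
          thr c.n j < dot c.N (c.cand i) (feat c.d (entry x) c.l))) := by
  have hn' : 0 < c.n := by rw [hc]; exact hn
  have hKT : 0 < c.k * c.T := by rw [hc]; exact Nat.mul_pos (Nat.succ_pos _) hT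
  refine Runs.mono (Runs.seq (runs_sizes P hε hδ S ω) (t₂ := c.k * (blockTime c.d c.l c.n c.T + 13) +
    c.k * c.T * (c.n * (candTime c.d c.l (c.k * c.T) + 13) + 23) + 70) ?_) ?_ (fun _ _ _ h => h)
  swap
  · simp only [trainTime, hc, Params.config_d, Params.config_l, Params.config_n, Params.config_T,
      Params.config_k]
    omega
  rintro M₁ f1 f2 ⟨hC1, f3, f4, f5, f6⟩
  rw [← hc] at hC1
  replace f4 : M₁.nat 18 0 = c.k * c.T := by rw [f4, hc]; rfl
  refine Runs.mono (Runs.seq (runs_blocks hC1 f3 f4 f5) (t₂ :=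
    c.k * c.T * (c.n * (candTime c.d c.l (c.k * c.T) + 13) + 23) + 50) ?_) (by omega)
    (fun _ _ _ h => h)
  rintro M₂ g1 g2 ⟨g3, g4⟩
  have hC2 := hC1.frame g1 g2 (by decide) (by decide)
  refine Runs.mono (Runs.seq (runs_valid hC2 g4) (t₂ := 20) ?_) (by omega) (fun _ _ _ h => h)
  intro M₃ h1 h2 h3
  have hC3 := hC2.frame h1 h2 (by decide) (by decide)
  have e16 : c.CandIn c.k M₃ := by rw [Config.CandIn, h2 16 (by decide)]; exact g4
  have e19 : M₃.nat 19 0 = c.passes c.k := by rw [h1 19 (by decide), g3]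
  have e1 : M₃.nat 1 0 = 0 := by rw [h1 1 (by decide), g1 1 (by decide), f6]
  -- At least one candidate and one threshold exist, and no count exceeds `k * T`, so the initial
  -- record `k * T + 1` cannot have survived.
  obtain ⟨i, hi, j, hj, b5, b33, b6⟩ : ∃ i < c.k * c.T, ∃ j < c.n, M₃.nat 5 0 = i ∧
      M₃.real 33 0 0 = thr c.n j ∧ M₃.nat 6 0 = c.errs (c.cand i) (thr c.n j) (c.k * c.T) := by
    rcases h3.2 with h | h
    · have := (h3.1 0 0 ⟨hKT, hn'⟩).trans (c.errs_le _ _ _)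
      omega
    · exact h
  have hopt : ∀ i' < c.k * c.T, ∀ j' < c.n,
      c.errs (c.cand i) (thr c.n j) (c.k * c.T) ≤ c.errs (c.cand i') (thr c.n j') (c.k * c.T) := by
    intro i' hi' j' hj'
    rw [← b6]; exact h3.1 i' j' ⟨hi', hj'⟩
  refine Runs.mono (Runs.ite (t := 5) (Q := fun M => (M.nat 1 0 = 1 ↔ c.k ≤ 2 * c.passes c.k)) ?_ ?_)
    (by decide) ?_
  · intro h
    have h' : M₃.nat 19 0 + M₃.nat 19 0 < M₃.nat 13 0 := h
    rw [e19, hC3.hk] at h'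
    refine Runs.mono (Runs.skip ?_) (by decide) (fun _ _ _ h => h)
    rw [e1]; omega
  · intro h
    have h' : ¬ M₃.nat 19 0 + M₃.nat 19 0 < M₃.nat 13 0 := h
    rw [e19, hC3.hk] at h'
    refine Runs.mono (Runs.setN ?_) (by decide) (fun _ _ _ h => h)
    simp only [NExp.eval, storeN_same, true_iff]; omega
  · intro M₄ p1 p2 p3
    refine ⟨p3, i, hi, j, hj, hopt, fun x => ?_⟩
    have ht : predictTime P.d P.l = predictTime c.d c.l := by rw [hc]; rfl
    rw [ht]
    refine runs_predict (c := c) ?_ ?_ ?_ ?_ ?_ ?_ x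
    · rw [p1 0 (by decide), hC3.hd]
    · rw [p1 4 (by decide), hC3.hl]
    · rw [p1 10 (by decide), hC3.hN]
    · rw [p1 5 (by decide), b5]
    · rw [p2 33 (by decide), b33]
    · rw [p2 16 (by decide)]; exact e16.cand hi

/-! ### Bounds on sizes and running times -/

/-- In this part `z` is a common bound for all sizes, and running times become monomials in `z`. -/
theorem featTime_le {d l z : ℕ} (hd : d ≤ z) (hl : l ≤ z) (hN : (d + 1) ^ l ≤ z) (hz : 1 ≤ z) :
    featTime d l ≤ 195 * z ^ 3 := by
  have h1 : 1 ≤ z ^ 3 := Nat.one_le_pow _ _ hz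
  have h2 : z ^ 2 ≤ z ^ 3 := Nat.pow_le_pow_right hz (by norm_num)
  have h3 : z ≤ z ^ 2 := by nlinarith
  calc featTime d l ≤ z * (z * (z * 34 + 23) + 38) + z * 40 + 60 := by
        unfold featTime; gcongr
    _ ≤ 195 * z ^ 3 := by nlinarith

theorem roundTime_le {d l z : ℕ} (hd : d ≤ z) (hl : l ≤ z) (hN : (d + 1) ^ l ≤ z) (hz : 1 ≤ z) :
    roundTime d l ≤ 2000 * z ^ 3 := by
  have h1 : 1 ≤ z ^ 3 := Nat.one_le_pow _ _ hz
  have h2 : z ^ 2 ≤ z ^ 3 := Nat.pow_le_pow_right hz (by norm_num)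
  have h3 : z ≤ z ^ 2 := by nlinarith
  calc roundTime d l ≤ 2 * (195 * z ^ 3) + z * (z * 160 + 700) + 700 := by
        unfold roundTime; gcongr; exact featTime_le hd hl hN hz
    _ ≤ 2000 * z ^ 3 := by nlinarith

theorem blockTime_le {d l n T z : ℕ} (hd : d ≤ z) (hl : l ≤ z) (hN : (d + 1) ^ l ≤ z) (hz : 1 ≤ z)
    (hn : n ≤ z) (hT : T ≤ z) : blockTime d l n T ≤ 3000 * z ^ 4 := by
  have h1 : 1 ≤ z ^ 4 := Nat.one_le_pow _ _ hz
  have h2 : z ^ 2 ≤ z ^ 4 := Nat.pow_le_pow_right hz (by norm_num)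
  have h4 : z ^ 3 ≤ z ^ 4 := Nat.pow_le_pow_right hz (by norm_num)
  have h3 : z ≤ z ^ 2 := by nlinarith
  calc blockTime d l n T ≤ z * (195 * z ^ 3 + z * 30 + 50) +
    (z * (z * (z * 31 + 38) + 23) + z * (z * (z * 80 + 120) + 113)) +
    (z * (2000 * z ^ 3 + 13) + z * 40) + 150 := by
        unfold blockTime; gcongr
        · exact featTime_le hd hl hN hz
        · exact roundTime_le hd hl hN hz
    _ ≤ 3000 * z ^ 4 := by nlinarith

theorem candTime_le {d l KT z : ℕ} (hd : d ≤ z) (hl : l ≤ z) (hN : (d + 1) ^ l ≤ z) (hz : 1 ≤ z)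
    (hK : KT ≤ z * z) : candTime d l KT ≤ 448 * z ^ 5 := by
  have h1 : 1 ≤ z ^ 5 := Nat.one_le_pow _ _ hz
  have h2 : z ^ 2 ≤ z ^ 5 := Nat.pow_le_pow_right hz (by norm_num)
  have h3 : z ^ 3 ≤ z ^ 5 := Nat.pow_le_pow_right hz (by norm_num)
  calc candTime d l KT ≤ z * z * (195 * z ^ 3 + z * 40 + 113) + 100 := by
        unfold candTime; gcongr; exact featTime_le hd hl hN hz
    _ ≤ 448 * z ^ 5 := by nlinarith

/-- Validation dominates: `k T` candidates, `n` thresholds and `k T` examples contribute `z ^ 5`,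
and each comparison recomputes features in time of order `z ^ 3`. -/
theorem trainTime_le {d l n T k z : ℕ} (hd : d ≤ z) (hl : l ≤ z) (hN : (d + 1) ^ l ≤ z) (hz : 1 ≤ z)
    (hn : n ≤ z) (hT : T ≤ z) (hk : k ≤ z) : trainTime d l n T k ≤ 5000 * z ^ 8 := by
  have h1 : 1 ≤ z ^ 8 := Nat.one_le_pow _ _ hz
  have h2 : z ^ 2 ≤ z ^ 8 := Nat.pow_le_pow_right hz (by norm_num)
  have h3 : z ^ 3 ≤ z ^ 8 := Nat.pow_le_pow_right hz (by norm_num)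
  have h4 : z ^ 5 ≤ z ^ 8 := Nat.pow_le_pow_right hz (by norm_num)
  have h5 : z ≤ z ^ 2 := by nlinarith
  calc trainTime d l n T k ≤ (z * (z * (z * 34 + 23) + 38) + z * 40 + z * 40 + z * 40 + z * 60 + 300) +
      z * (3000 * z ^ 4 + 13) + z * z * (z * (448 * z ^ 5 + 13) + 23) + 80 := by
        unfold trainTime sizesTime; gcongr
        · exact blockTime_le hd hl hN hz hn hT
        · exact candTime_le hd hl hN hz (Nat.mul_le_mul hk hT)
    _ ≤ 5000 * z ^ 8 := by
      have e : z * z * (z * (448 * z ^ 5 + 13) + 23) = 448 * z ^ 8 + 13 * z ^ 3 + 23 * z ^ 2 := by ring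
      have e' : z * (3000 * z ^ 4 + 13) = 3000 * z ^ 5 + 13 * z := by ring
      have e2 : z * (z * (z * 34 + 23) + 38) = 34 * z ^ 3 + 23 * z ^ 2 + 38 * z := by ring
      rw [e, e', e2]
      omega

/-- A prediction does about the work of one comparison during validation, and at least one
comparison takes place. -/
theorem predictTime_le_trainTime (d l n T k : ℕ) (hn : 1 ≤ n) (hT : 1 ≤ T) (hk : 1 ≤ k) :
    predictTime d l ≤ trainTime d l n T k := by
  have h1 : 1 ≤ k * T := Nat.mul_le_mul hk hT
  have h2 : featTime d l + (d + 1) ^ l * 40 + 113 ≤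
      k * T * (featTime d l + (d + 1) ^ l * 40 + 113) := Nat.le_mul_of_pos_left _ h1
  have h3 : candTime d l (k * T) + 13 ≤ n * (candTime d l (k * T) + 13) := Nat.le_mul_of_pos_left _ hn
  have h4 : n * (candTime d l (k * T) + 13) + 23 ≤
    k * T * (n * (candTime d l (k * T) + 13) + 23) := Nat.le_mul_of_pos_left _ h1
  have h5 : candTime d l (k * T) = k * T * (featTime d l + (d + 1) ^ l * 40 + 113) + 100 := rfl
  unfold trainTime predictTime
  omega

/-! ### The sizes in terms of the parameters -/

theorem Params.one_le_numFeat (P : Params) : (1 : ℝ) ≤ P.numFeat := by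
  exact_mod_cast Nat.one_le_pow _ _ (Nat.succ_pos _)

theorem Params.one_le_factor (P : Params) (hA : 1 ≤ P.A) : 1 ≤ P.factor :=
  one_le_pow₀ (by nlinarith)

theorem Params.numRef_le (P : Params) (hε : 0 < P.ε) (hε1 : P.ε < 1) :
    (P.numRef : ℝ) ≤ 2 ^ 15 * P.numFeat * (1 / P.ε) := by
  have h1 := P.one_le_numFeat
  have h2 : 1 ≤ 1 / P.ε := by rw [le_div_iff₀ hε]; linarith
  have h3 := (Nat.ceil_lt_add_one (show 0 ≤ 16384 * (P.numFeat : ℝ) / P.ε by positivity)).le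
  have h4 : 1 ≤ (P.numFeat : ℝ) * (1 / P.ε) := by nlinarith
  have h5 : 16384 * (P.numFeat : ℝ) / P.ε = 16384 * (P.numFeat * (1 / P.ε)) := by ring
  rw [Params.numRef]
  linarith

theorem Params.le_numRef (P : Params) : 16384 * P.numFeat / P.ε ≤ P.numRef := Nat.le_ceil _

theorem Params.le_rounds (P : Params) :
    8796093022208 * P.numRef * P.factor / P.ε ^ 3 ≤ P.rounds := Nat.le_ceil _

theorem Params.numRef_pos (P : Params) (hε : 0 < P.ε) : 0 < P.numRef := by
  rw [Params.numRef, Nat.ceil_pos]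
  have := P.one_le_numFeat
  positivity

theorem Params.rounds_pos (P : Params) (hε : 0 < P.ε) (hA : 1 ≤ P.A) : 0 < P.rounds := by
  rw [Params.rounds, Nat.ceil_pos]
  have h1 := P.one_le_factor hA
  have h2 : (0 : ℝ) < P.numRef := by exact_mod_cast P.numRef_pos hε
  positivity

/-- `2 ^ 43` rounds per unit times the `2 ^ 15` of `numRef_le` gives `2 ^ 58`; one more factor of
two absorbs the ceiling. -/
theorem Params.rounds_le (P : Params) (hε : 0 < P.ε) (hε1 : P.ε < 1) (hA : 1 ≤ P.A) :
    (P.rounds : ℝ) ≤ 2 ^ 59 * P.numFeat * P.factor * (1 / P.ε) ^ 4 := by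
  have h1 := P.one_le_numFeat
  have h2 : 1 ≤ 1 / P.ε := by rw [le_div_iff₀ hε]; linarith
  have h6 := P.one_le_factor hA
  have h7 : 0 ≤ P.factor := by linarith
  have h3 := (Nat.ceil_lt_add_one
    (show 0 ≤ 8796093022208 * P.numRef * P.factor / P.ε ^ 3 by positivity)).le
  have h4 : 1 ≤ (P.numFeat : ℝ) * P.factor * (1 / P.ε) ^ 4 :=
    one_le_mul_of_one_le_of_one_le (one_le_mul_of_one_le_of_one_le h1 h6) (one_le_pow₀ h2)
  have h5 : 8796093022208 * P.numRef * P.factor / P.ε ^ 3 ≤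
      2 ^ 58 * (P.numFeat * P.factor * (1 / P.ε) ^ 4) := by
    calc 8796093022208 * P.numRef * P.factor / P.ε ^ 3
        = 2 ^ 43 * P.numRef * (P.factor * (1 / P.ε) ^ 3) := by ring
      _ ≤ 2 ^ 43 * (2 ^ 15 * P.numFeat * (1 / P.ε)) * (P.factor * (1 / P.ε) ^ 3) := by
        gcongr; exact P.numRef_le hε hε1
      _ = _ := by ring
  rw [Params.rounds]
  linarith

theorem Params.doublings_le (P : Params) (hδ : 0 < P.δ) (hδ1 : P.δ < 1) :
    (P.doublings + 1 : ℝ) ≤ 4 * Real.log (2 / P.δ) := by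
  have h0 : 0 ≤ Real.logb 2 (1 / P.δ) := Real.logb_nonneg one_lt_two (by
    rw [le_div_iff₀ hδ]; linarith)
  have h1 := (Nat.ceil_lt_add_one h0).le
  have h2 : Real.logb 2 (1 / P.δ) = Real.log (1 / P.δ) / Real.log 2 := rfl
  have h3 : Real.log (2 / P.δ) = Real.log 2 + Real.log (1 / P.δ) := by
    rw [← Real.log_mul (by norm_num) (by positivity)]; congr 1; ring
  have h4 : (0.69 : ℝ) < Real.log 2 := lt_trans (by norm_num) Real.log_two_gt_d9
  have h5 : Real.log (1 / P.δ) / Real.log 2 ≤ 2 * Real.log (1 / P.δ) := by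
    rw [div_le_iff₀ (by linarith)]
    have : 0 ≤ Real.log (1 / P.δ) := Real.log_nonneg (by rw [le_div_iff₀ hδ]; linarith)
    nlinarith
  have : 0 ≤ Real.log (1 / P.δ) := Real.log_nonneg (by rw [le_div_iff₀ hδ]; linarith)
  rw [Params.doublings, h3]
  rw [h2] at h1 ⊢
  linarith

/-- The samples suffice for the algorithm. -/
theorem Params.two_mul_le (P : Params) (hd : 1 ≤ P.d) (hl : 1 ≤ P.l) (hA : 1 ≤ P.A) (hε : 0 < P.ε)
    (hε1 : P.ε < 1) (hδ : 0 < P.δ) (hδ1 : P.δ < 1) {m : ℕ}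
    (hm : 1 / P.ε ^ 5 * (2 ^ 40 * P.A * P.d) ^ (2 * P.l) * Real.log (2 / P.δ) ≤ m) :
    2 * ((P.doublings + 1) * P.rounds) ≤ m := by
  have hd' : (1 : ℝ) ≤ P.d := by exact_mod_cast hd
  have he : 1 ≤ 1 / P.ε := by rw [le_div_iff₀ hε]; linarith
  have hlog : 0 ≤ Real.log (2 / P.δ) := Real.log_nonneg (by rw [le_div_iff₀ hδ]; linarith)
  -- The constant is `2 ^ 62 = 2 * 4 * 2 ^ 59`: twice the rounds, the `4` of `doublings_le` and the
  -- `2 ^ 59` of `rounds_le`. It is absorbed into the `l`-th power because `l ≥ 1`, and `d + 1 ≤ 2 d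
  -- ^ 2` turns `N` into part of `d ^ (2 l)`.
  have hNQ : (P.numFeat : ℝ) * P.factor * 2 ^ 62 ≤ (2 ^ 40 * P.A * P.d) ^ (2 * P.l) := by
    have e1 : (P.numFeat : ℝ) * P.factor = ((P.d + 1) * (4 * P.A * P.A)) ^ P.l := by
      rw [Params.numFeat, Params.factor, mul_pow _ (4 * P.A * P.A)]; push_cast; rfl
    rw [e1, pow_mul]
    calc (((P.d : ℝ) + 1) * (4 * P.A * P.A)) ^ P.l * 2 ^ 62
        ≤ (((P.d : ℝ) + 1) * (4 * P.A * P.A)) ^ P.l * (2 ^ 62) ^ P.l := by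
          gcongr
          exact le_self_pow₀ (by norm_num) (by omega)
      _ = ((((P.d : ℝ) + 1) * (4 * P.A * P.A)) * 2 ^ 62) ^ P.l := by rw [← mul_pow]
      _ ≤ ((2 ^ 40 * P.A * P.d) ^ 2) ^ P.l := by
          gcongr
          have : (P.d : ℝ) + 1 ≤ 2 * P.d ^ 2 := by nlinarith
          calc ((P.d : ℝ) + 1) * (4 * P.A * P.A) * 2 ^ 62
              ≤ (2 * P.d ^ 2) * (4 * P.A * P.A) * 2 ^ 62 := by gcongr
            _ = 2 ^ 65 * (P.A ^ 2 * P.d ^ 2) := by ring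
            _ ≤ 2 ^ 80 * (P.A ^ 2 * P.d ^ 2) := by gcongr <;> norm_num
            _ = _ := by ring
  have hk := P.doublings_le hδ hδ1
  have hT := P.rounds_le hε hε1 hA
  have hf := P.one_le_factor hA
  have key : (2 * ((P.doublings + 1) * P.rounds) : ℝ) ≤ m := by
    calc (2 * ((P.doublings + 1) * P.rounds) : ℝ)
        ≤ 2 * ((4 * Real.log (2 / P.δ)) * (2 ^ 59 * P.numFeat * P.factor * (1 / P.ε) ^ 4)) := by gcongr
      _ = (1 / P.ε) ^ 4 * (P.numFeat * P.factor * 2 ^ 62) * Real.log (2 / P.δ) := by ring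
      _ ≤ (1 / P.ε) ^ 5 * (2 ^ 40 * P.A * P.d) ^ (2 * P.l) * Real.log (2 / P.δ) := by
          gcongr
          · norm_num
      _ ≤ m := by rw [one_div_pow]; exact hm
  exact_mod_cast key

/-- The polynomial that bounds the sizes. -/
def sizePoly : MvPolynomial (Fin 4) ℕ :=
  MvPolynomial.C (2 ^ 62) * (1 + MvPolynomial.X 1) * MvPolynomial.X 0 ^ 2 * MvPolynomial.X 2 ^ 3 *
    MvPolynomial.X 3 ^ 4

theorem Params.trainTime_le_aeval (P : Params) (hd : 1 ≤ P.d) (hl : 1 ≤ P.l) (hA : 1 ≤ P.A)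
    (hε : 0 < P.ε) (hε1 : P.ε < 1) (hδ : 0 < P.δ) (hδ1 : P.δ < 1) :
    (trainTime P.d P.l P.numRef P.rounds (P.doublings + 1) : ℝ) ≤
      MvPolynomial.aeval ![P.A ^ P.l, Real.log (1 / P.δ) ^ P.l, ((P.d : ℝ) + 1) ^ P.l, 1 / P.ε]
        (MvPolynomial.C 5000 * sizePoly ^ 8) := by
  set a := P.A ^ P.l with ha
  set s := ((P.d : ℝ) + 1) ^ P.l with hs
  set e := 1 / P.ε with he
  set L := Real.log (1 / P.δ) with hL
  have hN : (P.numFeat : ℝ) = s := by rw [Params.numFeat]; push_cast; rfl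
  have hL0 : 0 ≤ L := Real.log_nonneg (by rw [le_div_iff₀ hδ]; linarith)
  have he1 : 1 ≤ e := by rw [he, le_div_iff₀ hε]; linarith
  have ha1 : 1 ≤ a := one_le_pow₀ hA
  have hs1 : 1 ≤ s := by rw [← hN]; exact P.one_le_numFeat
  -- For `log (1/δ) < 1` the power is smaller than its base, which is why `sizePoly` contains `1 + X
  -- 1`.
  have hLl : L ≤ 1 + L ^ P.l := by
    rcases le_or_gt L 1 with h | h
    · have : 0 ≤ L ^ P.l := by positivity
      linarith
    · have := le_self_pow₀ h.le (show P.l ≠ 0 by omega)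
      linarith
  -- The factor `4 ^ l` is at most `s ^ 2`, since `4 ≤ (d + 1) ^ 2`. A constant to the power `l`
  -- could not be absorbed by a fixed coefficient.
  have hf : P.factor ≤ s ^ 2 * a ^ 2 := by
    have : s ^ 2 * a ^ 2 = (((P.d : ℝ) + 1) ^ 2 * P.A ^ 2) ^ P.l := by
      rw [hs, ha, ← pow_mul, ← pow_mul, mul_comm P.l 2, pow_mul, pow_mul, mul_pow]
    rw [this, Params.factor]
    have hd' : (1 : ℝ) ≤ P.d := by exact_mod_cast hd
    have h4 : (4 : ℝ) ≤ (P.d + 1) ^ 2 := by nlinarith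
    have : 4 * P.A * P.A ≤ ((P.d : ℝ) + 1) ^ 2 * P.A ^ 2 := by nlinarith [sq_nonneg P.A]
    gcongr
  have hf1 := P.one_le_factor hA
  have hy0 : 0 ≤ L ^ P.l := by positivity
  have hev : MvPolynomial.aeval ![a, L ^ P.l, s, e] (MvPolynomial.C 5000 * sizePoly ^ 8) =
      5000 * (2 ^ 62 * (1 + L ^ P.l) * a ^ 2 * s ^ 3 * e ^ 4) ^ 8 := by
    simp only [sizePoly, map_mul, map_pow, map_add, map_one, MvPolynomial.aeval_X, MvPolynomial.aeval_C]
    simp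
  rw [hev]
  set Z : ℝ := 2 ^ 62 * (1 + L ^ P.l) * a ^ 2 * s ^ 3 * e ^ 4 with hZ
  have hcore : 1 ≤ (1 + L ^ P.l) * a ^ 2 * s ^ 3 * e ^ 4 := by
    refine one_le_mul_of_one_le_of_one_le (one_le_mul_of_one_le_of_one_le
      (one_le_mul_of_one_le_of_one_le (by linarith) (one_le_pow₀ ha1)) (one_le_pow₀ hs1))
      (one_le_pow₀ he1)
  -- The time bounds need a natural number as common size bound, namely the floor of `Z`. The slack
  -- between `2 ^ 60` and `2 ^ 62` pays for rounding down.
  have hZle : ∀ x : ℝ, x ≤ 2 ^ 60 * ((1 + L ^ P.l) * a ^ 2 * s ^ 3 * e ^ 4) → x ≤ ⌊Z⌋₊ := by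
    intro x hx
    have h1 := (Nat.lt_floor_add_one Z).le
    have h2 : Z = 2 ^ 62 * ((1 + L ^ P.l) * a ^ 2 * s ^ 3 * e ^ 4) := by rw [hZ]; ring
    linarith
  have hsZ : s ≤ (1 + L ^ P.l) * a ^ 2 * s ^ 3 * e ^ 4 := by
    calc s = 1 * 1 * s ^ 1 * 1 := by ring
      _ ≤ (1 + L ^ P.l) * a ^ 2 * s ^ 3 * e ^ 4 := by
        gcongr
        · linarith
        · exact one_le_pow₀ ha1
        · norm_num
        · exact one_le_pow₀ he1
  have hs_le : s ≤ ⌊Z⌋₊ := hZle s (by linarith)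
  have hd_le : P.d ≤ ⌊Z⌋₊ := by
    have : P.d ≤ (P.d + 1) ^ P.l := (Nat.le_succ _).trans (Nat.le_self_pow (by omega) _)
    have h' : (P.d : ℝ) ≤ s := by rw [hs]; exact_mod_cast this
    exact_mod_cast h'.trans hs_le
  have hl_le : P.l ≤ ⌊Z⌋₊ := by
    have : P.l ≤ (P.d + 1) ^ P.l := (Nat.lt_pow_self (by omega)).le
    have h' : (P.l : ℝ) ≤ s := by rw [hs]; exact_mod_cast this
    exact_mod_cast h'.trans hs_le
  have hN_le : (P.d + 1) ^ P.l ≤ ⌊Z⌋₊ := by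
    have h' : (((P.d + 1) ^ P.l : ℕ) : ℝ) ≤ ⌊Z⌋₊ := by push_cast; exact hs_le
    exact_mod_cast h'
  have h1_le : 1 ≤ ⌊Z⌋₊ := by
    have := hs1.trans hs_le
    exact_mod_cast this
  have hn_le : P.numRef ≤ ⌊Z⌋₊ := by
    have h' : (P.numRef : ℝ) ≤ ⌊Z⌋₊ := by
      refine hZle _ ((P.numRef_le hε hε1).trans ?_)
      rw [hN]
      calc 2 ^ 15 * s * (1 / P.ε) = 2 ^ 15 * (1 * 1 * s ^ 1 * e ^ 1) := by rw [he]; ring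
        _ ≤ 2 ^ 60 * ((1 + L ^ P.l) * a ^ 2 * s ^ 3 * e ^ 4) := by
          gcongr
          · norm_num
          · norm_num
          · linarith
          · exact one_le_pow₀ ha1
          all_goals first | assumption | norm_num
    exact_mod_cast h'
  have hT_le : P.rounds ≤ ⌊Z⌋₊ := by
    have h' : (P.rounds : ℝ) ≤ ⌊Z⌋₊ := by
      refine hZle _ ((P.rounds_le hε hε1 hA).trans ?_)
      rw [hN]
      calc 2 ^ 59 * s * P.factor * (1 / P.ε) ^ 4 ≤ 2 ^ 59 * s * (s ^ 2 * a ^ 2) * e ^ 4 := by gcongr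
        _ = 2 ^ 59 * (1 * a ^ 2 * s ^ 3 * e ^ 4) := by ring
        _ ≤ 2 ^ 60 * ((1 + L ^ P.l) * a ^ 2 * s ^ 3 * e ^ 4) := by
          gcongr
          · norm_num
          · norm_num
          · linarith
    exact_mod_cast h'
  have hk_le : P.doublings + 1 ≤ ⌊Z⌋₊ := by
    have h' : (P.doublings + 1 : ℝ) ≤ ⌊Z⌋₊ := by
      refine hZle _ ((P.doublings_le hδ hδ1).trans ?_)
      have h3 : Real.log (2 / P.δ) = Real.log 2 + L := by
        rw [hL, ← Real.log_mul (by norm_num) (by positivity)]; congr 1; ring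
      have h4 := Real.log_two_lt_d9
      have h5 : (1 + L ^ P.l) ≤ (1 + L ^ P.l) * a ^ 2 * s ^ 3 * e ^ 4 := by
        calc (1 + L ^ P.l) = (1 + L ^ P.l) * 1 * 1 * 1 := by ring
          _ ≤ _ := by
            gcongr
            · exact one_le_pow₀ ha1
            · exact one_le_pow₀ hs1
            · exact one_le_pow₀ he1
      rw [h3]
      linarith
    exact_mod_cast h'
  have hfin := trainTime_le hd_le hl_le hN_le h1_le hn_le hT_le hk_le
  have hcast : (trainTime P.d P.l P.numRef P.rounds (P.doublings + 1) : ℝ) ≤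
      5000 * (⌊Z⌋₊ : ℝ) ^ 8 := by exact_mod_cast hfin
  refine hcast.trans ?_
  gcongr
  exact Nat.floor_le (by positivity)

/-! ### Measurability -/

section Measurability

variable {α : Type*} [MeasurableSpace α] {N n : ℕ} {Φ : α → ℕ → ℕ → ℝ} {u φ p q : α → ℕ → ℝ}

theorem measurable_apply_nat {β : Type*} [MeasurableSpace β] {u : α → ℕ → β} (hu : Measurable u)
    (w : ℕ) : Measurable fun a => u a w := (measurable_pi_apply w).comp hu

theorem measurable_entry {d : ℕ} {X : Set (Fin d → ℝ)} : Measurable fun x : X => entry x.1 := by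
  refine measurable_pi_iff.2 fun j => ?_
  unfold entry
  split_ifs with h
  · exact (measurable_pi_apply _).comp measurable_subtype_coe
  · exact measurable_const

theorem measurable_feat (d l : ℕ) (hφ : Measurable φ) : Measurable fun a => feat d (φ a) l := by
  induction l with
  | zero => exact measurable_pi_iff.2 fun w => by simp only [feat]; exact measurable_const
  | succ l ih =>
    refine measurable_pi_iff.2 fun w => ?_
    simp only [feat]
    split_ifs
    · exact measurable_apply_nat ih _
    · exact (measurable_apply_nat hφ _).mul (measurable_apply_nat ih _)

theorem measurable_dot (N : ℕ) (hu : Measurable u) (hφ : Measurable φ) :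
    Measurable fun a => dot N (u a) (φ a) :=
  Finset.measurable_sum _ fun w _ => (measurable_apply_nat hu w).mul (measurable_apply_nat hφ w)

theorem measurable_gram (n : ℕ) (hΦ : Measurable Φ) (w : ℕ) :
    Measurable fun a => gram n (Φ a) w := by
  refine measurable_pi_iff.2 fun w' => Finset.measurable_sum _ fun r _ => ?_
  exact (measurable_apply_nat (measurable_apply_nat hΦ r) w).mul
    (measurable_apply_nat (measurable_apply_nat hΦ r) w')

theorem measurable_ip (N n : ℕ) (hΦ : Measurable Φ) (hp : Measurable p) (hq : Measurable q) :
    Measurable fun a => ip N n (Φ a) (p a) (q a) :=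
  Finset.measurable_sum _ fun r _ => (measurable_dot N hp (measurable_apply_nat hΦ r)).mul
    (measurable_dot N hq (measurable_apply_nat hΦ r))

theorem measurable_gsB (N n : ℕ) (hΦ : Measurable Φ) (i : ℕ) :
    Measurable fun a => gsB N n (Φ a) i := by
  induction i using Nat.strong_induction_on with
  | _ i ih =>
    refine measurable_pi_iff.2 fun w => ?_
    simp only [gsB_eq N n _ i, gsn_eq]
    refine measurable_const.sub (Finset.measurable_sum _ fun j hj => ?_)
    have hj' := ih j (Finset.mem_range.1 hj)
    exact ((measurable_dot N (measurable_gram n hΦ i) hj').div (measurable_ip N n hΦ hj' hj')).mul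
      (measurable_apply_nat hj' w)

theorem measurable_gsn (N n : ℕ) (hΦ : Measurable Φ) (i : ℕ) :
    Measurable fun a => gsn N n (Φ a) i := by
  simp only [gsn_eq]
  exact measurable_ip N n hΦ (measurable_gsB N n hΦ i) (measurable_gsB N n hΦ i)

theorem measurable_kap (N n : ℕ) (hΦ : Measurable Φ) (hφ : Measurable φ) :
    Measurable fun a => kap N n (Φ a) (φ a) := by
  refine measurable_pi_iff.2 fun w => Finset.measurable_sum _ fun j _ => ?_
  exact ((measurable_dot N (measurable_gsB N n hΦ j) hφ).div (measurable_gsn N n hΦ j)).mul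
    (measurable_apply_nat (measurable_gsB N n hΦ j) w)

theorem measurableSet_inRegion (N n : ℕ) (hΦ : Measurable Φ) (hφ : Measurable φ) :
    MeasurableSet {a | InRegion N n (Φ a) (φ a)} := by
  have h1 : Measurable fun a => nul N n (Φ a) (φ a) := by
    refine Finset.measurable_sum _ fun j _ => ?_
    have h1 := measurable_gsn N n hΦ j
    have h2 := measurable_dot N (measurable_gsB N n hΦ j) hφ
    exact (measurable_const.sub (h1.div h1)).mul (h2.mul h2)
  have h2 : Measurable fun a => lev N n (Φ a) (φ a) :=
    measurable_dot N hφ (measurable_kap N n hΦ hφ)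
  exact (measurableSet_lt measurable_const h1).compl.inter
    (measurableSet_lt measurable_const h2).compl

theorem measurable_gate (N n : ℕ) (hΦ : Measurable Φ) (hq : Measurable q) (hφ : Measurable φ) :
    Measurable fun a => gate N n (Φ a) (q a) (φ a) :=
  Measurable.ite ((measurableSet_inRegion N n hΦ hφ).inter
    (measurableSet_lt (measurable_dot N hq hφ) measurable_const)) measurable_const measurable_const

theorem measurable_sgnR (N n : ℕ) (hΦ : Measurable Φ) (hq : Measurable q) (hφ : Measurable φ) :
    Measurable fun a => sgnR N n (Φ a) (q a) (φ a) :=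
  Measurable.ite (measurableSet_inRegion N n hΦ hφ)
    (Measurable.ite (measurableSet_lt (measurable_dot N hq hφ) measurable_const)
      measurable_const measurable_const) measurable_const

theorem measurable_sgnY (N : ℕ) {y : α → ℝ} (hp : Measurable p) (hφ : Measurable φ)
    (hy : Measurable y) : Measurable fun a => sgnY N (p a) (φ a) (y a) :=
  Measurable.ite (measurableSet_lt (measurable_dot N hp hφ) hy) measurable_const measurable_const

theorem measurable_step (N n : ℕ) (η : ℝ) {s : α → (ℕ → ℝ) × (ℕ → ℝ)} {z : α → Round}
    (hΦ : Measurable Φ) (hs : Measurable s) (hz : Measurable z) :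
    Measurable fun a => step N n (Φ a) η (s a) (z a) := by
  have h1 : Measurable fun a => (z a).1 := hz.fst
  have h2 : Measurable fun a => (z a).2.1 := hz.snd.fst
  have h3 : Measurable fun a => (z a).2.2 := hz.snd.snd
  refine Measurable.prodMk (measurable_pi_iff.2 fun w => ?_) (measurable_pi_iff.2 fun w => ?_)
  · exact (measurable_apply_nat hs.fst w).add (measurable_const.mul
      (((measurable_gate N n hΦ hs.fst h1).mul (measurable_apply_nat (measurable_kap N n hΦ h1) w)).sub
        ((measurable_sgnR N n hΦ hs.fst h3).mul (measurable_apply_nat (measurable_kap N n hΦ h3) w))))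
  · exact (measurable_apply_nat hs.snd w).add (measurable_const.mul
      (((measurable_gate N n hΦ hs.fst h1).mul (measurable_sgnY N hs.snd h1 h2)).mul
        (measurable_apply_nat (measurable_kap N n hΦ h1) w)))

theorem measurable_val (N n : ℕ) {z : α → Round} (hΦ : Measurable Φ) (hq : Measurable q)
    (hz : Measurable z) : Measurable fun a => val N n (Φ a) (q a) (z a) := by
  have h1 : Measurable fun a => (z a).1 := hz.fst
  have h3 : Measurable fun a => (z a).2.2 := hz.snd.snd
  have hg := measurable_gate N n hΦ hq h1
  exact ((measurable_const.sub hg).add (hg.mul (measurable_dot N hq h1))).sub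
    ((measurable_sgnR N n hΦ hq h3).mul (measurable_dot N hq h3))

end Measurability

/-! ### Sums along trajectories -/

/-- The states of a system driven by the inputs `z`. -/
def trajectory {S Y : Type*} (f : S → Y → S) (s : S) (z : ℕ → Y) : ℕ → S
  | 0 => s
  | t + 1 => f (trajectory f s z t) (z t)

/-- Peeling off the first input rather than the last lets the moment induction run over all initial
states. -/
theorem trajectory_succ {S Y : Type*} (f : S → Y → S) (s : S) (z : ℕ → Y) (t : ℕ) :
    trajectory f s z (t + 1) = trajectory f (f s (z 0)) (fun i => z (i + 1)) t := by
  induction t with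
  | zero => rfl
  | succ t ih => rw [trajectory, ih]; rfl

/-- The sum of `v` along a trajectory. -/
def trajSum {S Y : Type*} (f : S → Y → S) (v : S → Y → ℝ) (s : S) (z : ℕ → Y) (n : ℕ) : ℝ :=
  ∑ t ∈ Finset.range n, v (trajectory f s z t) (z t)

theorem trajSum_succ {S Y : Type*} (f : S → Y → S) (v : S → Y → ℝ) (s : S) (z : ℕ → Y) (n : ℕ) :
    trajSum f v s z (n + 1) = v s (z 0) + trajSum f v (f s (z 0)) (fun i => z (i + 1)) n := by
  rw [trajSum, Finset.sum_range_succ', add_comm]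
  simp only [trajectory_succ]
  rfl

theorem abs_trajSum_le {S Y : Type*} {f : S → Y → S} {v : S → Y → ℝ} {c : ℝ}
    (hc : ∀ s y, |v s y| ≤ c) (s : S) (z : ℕ → Y) (n : ℕ) : |trajSum f v s z n| ≤ n * c := by
  refine (Finset.abs_sum_le_sum_abs _ _).trans ?_
  refine (Finset.sum_le_sum fun t _ => hc _ _).trans ?_
  simp

theorem extend_succ {Y : Type*} (a : Y) {n : ℕ} (z : Fin (n + 1) → Y) :
    (fun i => extend a z (i + 1)) = extend a (fun i => z i.succ) := by
  funext i
  simp only [extend, Nat.add_lt_add_iff_right]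
  rfl

theorem measurable_extend {Y : Type*} [MeasurableSpace Y] (a : Y) (n : ℕ) :
    Measurable fun z : Fin n → Y => extend a z := by
  refine measurable_pi_iff.2 fun i => ?_
  unfold extend
  split_ifs
  · exact measurable_pi_apply _
  · exact measurable_const

section Martingale

variable {S Y : Type*} [MeasurableSpace S] [MeasurableSpace Y] {f : S → Y → S} {v : S → Y → ℝ}

theorem measurable_trajectory (hf : Measurable fun p : S × Y => f p.1 p.2) (t : ℕ) :
    Measurable fun p : S × (ℕ → Y) => trajectory f p.1 p.2 t := by
  induction t with
  | zero => exact measurable_fst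
  | succ t ih =>
    exact hf.comp (ih.prodMk ((measurable_pi_apply t).comp measurable_snd))

theorem measurable_trajSum (hf : Measurable fun p : S × Y => f p.1 p.2)
    (hv : Measurable fun p : S × Y => v p.1 p.2) (n : ℕ) :
    Measurable fun p : S × (ℕ → Y) => trajSum f v p.1 p.2 n :=
  Finset.measurable_sum _ fun t _ => hv.comp
    ((measurable_trajectory hf t).prodMk ((measurable_pi_apply t).comp measurable_snd))

theorem integral_pi_succ (ν : Measure Y) [IsProbabilityMeasure ν] {n : ℕ}
    (g : (Fin (n + 1) → Y) → ℝ) :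
    ∫ z, g z ∂(Measure.pi fun _ => ν) =
      ∫ p : Y × (Fin n → Y), g (Fin.cons p.1 p.2) ∂(ν.prod (Measure.pi fun _ => ν)) := by
  have h := (measurePreserving_piFinSuccAbove (fun _ : Fin (n + 1) => ν) 0).symm
  rw [← h.integral_comp' (g := g)]
  refine integral_congr_ae (Filter.Eventually.of_forall fun p => ?_)
  simp [MeasurableEquiv.piFinSuccAbove, Fin.insertNthEquiv]

theorem integrable_of_abs_le {α : Type*} [MeasurableSpace α] {μ : Measure α} [IsFiniteMeasure μ]
    {g : α → ℝ} (hg : Measurable g) {c : ℝ} (h : ∀ a, |g a| ≤ c) : Integrable g μ :=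
  Integrable.of_bound hg.aestronglyMeasurable c (Filter.Eventually.of_forall h)

/-- Orthogonality of martingale increments. Given the first input, the rest is a trajectory from a
new state, whose sum has mean zero by induction; the cross term vanishes and second moments add. -/
theorem trajSum_moments (ν : Measure Y) [IsProbabilityMeasure ν] (a : Y)
    (hf : Measurable fun p : S × Y => f p.1 p.2) (hv : Measurable fun p : S × Y => v p.1 p.2)
    {c : ℝ} (hc : ∀ s y, |v s y| ≤ c) (h0 : ∀ s, ∫ y, v s y ∂ν = 0) (n : ℕ) :
    ∀ s, ∫ z : Fin n → Y, trajSum f v s (extend a z) n ∂(Measure.pi fun _ => ν) = 0 ∧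
      ∫ z : Fin n → Y, trajSum f v s (extend a z) n ^ 2 ∂(Measure.pi fun _ => ν) ≤ n * c ^ 2 := by
  induction n with
  | zero => intro s; simp [trajSum]
  | succ n ih =>
    intro s
    set W : Y × (Fin n → Y) → ℝ := fun p => trajSum f v (f s p.1) (extend a p.2) n with hW
    have hWm : Measurable W :=
      (measurable_trajSum hf hv n).comp (((hf.comp (measurable_const.prodMk measurable_fst))).prodMk
        ((measurable_extend a n).comp measurable_snd))
    have hvm : Measurable fun p : Y × (Fin n → Y) => v s p.1 :=
      hv.comp (measurable_const.prodMk measurable_fst)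
    have hWb : ∀ p, |W p| ≤ n * c := fun p => abs_trajSum_le hc _ _ _
    have hc0 : 0 ≤ c := by
      have hne : Nonempty Y := ⟨a⟩
      exact (abs_nonneg _).trans (hc s a)
    have e : ∀ p : Y × (Fin n → Y),
        trajSum f v s (extend a (Fin.cons p.1 p.2 : Fin (n + 1) → Y)) (n + 1) = v s p.1 + W p := by
      intro p
      rw [trajSum_succ, extend_succ]
      simp [extend, hW]
    have hWi : Integrable W (ν.prod (Measure.pi fun _ => ν)) := integrable_of_abs_le hWm hWb
    have hvi : Integrable (fun p : Y × (Fin n → Y) => v s p.1) (ν.prod (Measure.pi fun _ => ν)) :=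
      integrable_of_abs_le hvm fun p => hc _ _
    have hv0 : ∫ p : Y × (Fin n → Y), v s p.1 ∂(ν.prod (Measure.pi fun _ => ν)) = 0 := by
      rw [integral_prod _ hvi]; simp [h0]
    have hW2i : Integrable (fun p => W p ^ 2) (ν.prod (Measure.pi fun _ => ν)) :=
      integrable_of_abs_le (hWm.pow_const 2) (c := (n * c) ^ 2) fun p => by
        rw [abs_pow]; exact pow_le_pow_left₀ (abs_nonneg _) (hWb p) 2
    have hv2b : ∀ p : Y × (Fin n → Y), |v s p.1 ^ 2| ≤ c ^ 2 := fun p => by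
      rw [abs_pow]; exact pow_le_pow_left₀ (abs_nonneg _) (hc _ _) 2
    have hv2i : Integrable (fun p : Y × (Fin n → Y) => v s p.1 ^ 2)
        (ν.prod (Measure.pi fun _ => ν)) := integrable_of_abs_le (hvm.pow_const 2) hv2b
    have hvWi : Integrable (fun p => v s p.1 * W p) (ν.prod (Measure.pi fun _ => ν)) :=
      integrable_of_abs_le (hvm.mul hWm) (c := c * (n * c)) fun p => by
        rw [abs_mul]; exact mul_le_mul (hc _ _) (hWb p) (abs_nonneg _) hc0
    have hvW0 : ∫ p, v s p.1 * W p ∂(ν.prod (Measure.pi fun _ => ν)) = 0 := by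
      rw [integral_prod _ hvWi]
      simp only [integral_const_mul, hW, (ih _).1, mul_zero, integral_zero]
    constructor
    · rw [integral_pi_succ]
      simp only [e]
      rw [integral_add hvi hWi, hv0, integral_prod _ hWi]
      simp only [hW, (ih _).1, integral_zero, add_zero]
    · rw [integral_pi_succ]
      simp only [e]
      have e2 : ∀ p : Y × (Fin n → Y), (v s p.1 + W p) ^ 2 =
          v s p.1 ^ 2 + 2 * (v s p.1 * W p) + W p ^ 2 := fun p => by ring
      simp only [e2]
      have hsi : Integrable (fun p : Y × (Fin n → Y) => v s p.1 ^ 2 + 2 * (v s p.1 * W p))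
        (ν.prod (Measure.pi fun _ => ν)) := hv2i.add (hvWi.const_mul 2)
      rw [integral_add hsi hW2i, integral_add hv2i (hvWi.const_mul 2),
        integral_const_mul, hvW0]
      have b1 : ∫ p : Y × (Fin n → Y), v s p.1 ^ 2 ∂(ν.prod (Measure.pi fun _ => ν)) ≤ c ^ 2 := by
        refine (integral_mono hv2i (integrable_const (c ^ 2)) fun p =>
          (le_abs_self _).trans (hv2b p)).trans ?_
        simp
      have b2 : ∫ p, W p ^ 2 ∂(ν.prod (Measure.pi fun _ => ν)) ≤ n * c ^ 2 := by
        rw [integral_prod _ hW2i]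
        refine (integral_mono hW2i.integral_prod_left (integrable_const (n * c ^ 2)) fun y =>
          (ih (f s y)).2).trans ?_
        simp
      push_cast
      linarith

/-- Chebyshev's inequality for the deviation from the conditional means along a trajectory. -/
theorem measure_trajSum_ge_le {R : Type*} [MeasurableSpace R] (μ : Measure R)
    [IsProbabilityMeasure μ] (ν : Measure Y) [IsProbabilityMeasure ν] (a : Y) {init : R → S}
    (hi : Measurable init) (hf : Measurable fun p : S × Y => f p.1 p.2)
    (hv : Measurable fun p : S × Y => v p.1 p.2) {c : ℝ} (hc : ∀ s y, |v s y| ≤ c) (n : ℕ) {x : ℝ}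
    (hx : 0 < x) :
    (μ.prod (Measure.pi fun _ : Fin n => ν)) {p | x ≤ trajSum f (fun s y => v s y - ∫ y', v s y' ∂ν)
      (init p.1) (extend a p.2) n} ≤ ENNReal.ofReal (4 * n * c ^ 2 / x ^ 2) := by
  set w : S → Y → ℝ := fun s y => v s y - ∫ y', v s y' ∂ν with hw
  have hmean : Measurable fun s => ∫ y', v s y' ∂ν :=
    (StronglyMeasurable.integral_prod_right hv.stronglyMeasurable).measurable
  have hwm : Measurable fun p : S × Y => w p.1 p.2 := hv.sub (hmean.comp measurable_fst)
  have hvi : ∀ s, Integrable (v s) ν := fun s =>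
    integrable_of_abs_le (hv.comp (measurable_const.prodMk measurable_id)) (hc s)
  have hmb : ∀ s, |∫ y', v s y' ∂ν| ≤ c := fun s => by
    have := norm_integral_le_of_norm_le_const (μ := ν) (f := v s) (C := c)
      (Filter.Eventually.of_forall (hc s))
    simpa using this
  -- Centering at most doubles the bound, whence the `4` in the variance term.
  have hwb : ∀ s y, |w s y| ≤ 2 * c := fun s y => by
    have := abs_sub (v s y) (∫ y', v s y' ∂ν)
    have h1 := hc s y
    have h2 := hmb s
    linarith
  have hw0 : ∀ s, ∫ y, w s y ∂ν = 0 := fun s => by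
    simp only [hw]; rw [integral_sub (hvi s) (integrable_const _)]; simp
  have hG : Measurable fun p : R × (Fin n → Y) => trajSum f w (init p.1) (extend a p.2) n :=
    (measurable_trajSum hf hwm n).comp ((hi.comp measurable_fst).prodMk
      ((measurable_extend a n).comp measurable_snd))
  rw [Measure.prod_apply (measurableSet_le measurable_const hG)]
  -- For fixed `r` the initial state is deterministic, and the second-moment bound does not depend
  -- on it; integrating over `r` then costs nothing.
  have key : ∀ r, (Measure.pi fun _ : Fin n => ν)
      (Prod.mk r ⁻¹' {p | x ≤ trajSum f w (init p.1) (extend a p.2) n}) ≤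
      ENNReal.ofReal (4 * n * c ^ 2 / x ^ 2) := by
    intro r
    have hGr : Measurable fun z : Fin n → Y => trajSum f w (init r) (extend a z) n :=
      hG.comp (measurable_const.prodMk measurable_id)
    have hGi : Integrable (fun z : Fin n → Y => trajSum f w (init r) (extend a z) n ^ 2)
        (Measure.pi fun _ => ν) :=
      integrable_of_abs_le (hGr.pow_const 2) (c := (n * (2 * c)) ^ 2) fun z => by
        rw [abs_pow]; exact pow_le_pow_left₀ (abs_nonneg _) (abs_trajSum_le hwb _ _ _) 2
    have h1 := mul_meas_ge_le_integral_of_nonneg (μ := Measure.pi fun _ : Fin n => ν)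
      (f := fun z : Fin n → Y => trajSum f w (init r) (extend a z) n ^ 2)
      (Filter.Eventually.of_forall fun z => sq_nonneg _) hGi (x ^ 2)
    have h2 := (trajSum_moments ν a hf hwm hwb hw0 n (init r)).2
    have h3 : (Measure.pi fun _ : Fin n => ν).real
        {z | x ^ 2 ≤ trajSum f w (init r) (extend a z) n ^ 2} ≤ 4 * n * c ^ 2 / x ^ 2 := by
      rw [le_div_iff₀ (by positivity), mul_comm]
      calc _ ≤ _ := h1
        _ ≤ n * (2 * c) ^ 2 := h2
        _ = _ := by ring
    rw [← ENNReal.ofReal_toReal (measure_ne_top _ _)]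
    refine ENNReal.ofReal_le_ofReal (le_trans ?_ h3)
    refine measureReal_mono ?_
    intro z hz
    exact pow_le_pow_left₀ hx.le hz 2
  calc _ ≤ ∫⁻ _, ENNReal.ofReal (4 * n * c ^ 2 / x ^ 2) ∂μ := lintegral_mono key
    _ = _ := by simp

end Martingale

/-! ### Probabilistic tools -/

theorem abs_measureReal_sub_le_tvDist {α : Type*} [MeasurableSpace α] (μ ν : Measure α)
    [IsProbabilityMeasure μ] [IsProbabilityMeasure ν] {B : Set α} (hB : MeasurableSet B) :
    |μ.real B - ν.real B| ≤ tvDist μ ν := by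
  refine le_ciSup (f := fun B : {B : Set α // MeasurableSet B} => |μ.real B.1 - ν.real B.1|)
    ⟨1, ?_⟩ ⟨B, hB⟩
  rintro _ ⟨C, rfl⟩
  have h1 : μ.real C.1 ≤ 1 := measureReal_le_one
  have h2 : ν.real C.1 ≤ 1 := measureReal_le_one
  have h3 : 0 ≤ μ.real C.1 := measureReal_nonneg
  have h4 : 0 ≤ ν.real C.1 := measureReal_nonneg
  exact abs_sub_le_iff.2 ⟨by linarith, by linarith⟩

/-- The layer-cake formula over an interval of length one: a bound `τ` on the difference for every
level set integrates to a bound `τ` for expectations, without loss of a constant. -/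
theorem integral_eq_integral_Ioc_measureReal {α : Type*} [MeasurableSpace α] (μ : Measure α)
    [IsProbabilityMeasure μ] {φ : α → ℝ} (hφ : Measurable φ) (h0 : ∀ a, 0 ≤ φ a)
    (h1 : ∀ a, φ a ≤ 1) : ∫ a, φ a ∂μ = ∫ t in Set.Ioc (0 : ℝ) 1, μ.real {a | t < φ a} := by
  have hi : Integrable φ μ :=
    integrable_of_abs_le hφ (c := 1) fun a => abs_le.2 ⟨by linarith [h0 a], h1 a⟩
  rw [hi.integral_eq_integral_meas_lt (Filter.Eventually.of_forall h0)]
  refine setIntegral_eq_of_subset_of_forall_sdiff_eq_zero measurableSet_Ioi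
    (fun t ht => ht.1) fun t ht => ?_
  have : {a | t < φ a} = ∅ := by
    ext a
    simp only [Set.mem_ofPred_eq, Set.mem_empty_iff_false, iff_false, not_lt]
    by_contra hc
    exact ht.2 ⟨ht.1, by linarith [h1 a]⟩
  rw [this, measureReal_empty]

/-- Expectations of functions with values in the unit interval differ by at most the total
variation distance. -/
theorem integral_le_add_of_tvDist_le {α : Type*} [MeasurableSpace α] (μ ν : Measure α)
    [IsProbabilityMeasure μ] [IsProbabilityMeasure ν] {τ : ℝ} (h : tvDist μ ν ≤ τ) {φ : α → ℝ}
    (hφ : Measurable φ) (h0 : ∀ a, 0 ≤ φ a) (h1 : ∀ a, φ a ≤ 1) :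
    ∫ a, φ a ∂μ ≤ ∫ a, φ a ∂ν + τ := by
  rw [integral_eq_integral_Ioc_measureReal μ hφ h0 h1, integral_eq_integral_Ioc_measureReal ν hφ h0 h1]
  have hint : ∀ (μ : Measure α) [IsProbabilityMeasure μ],
      IntegrableOn (fun t => μ.real {a | t < φ a}) (Set.Ioc (0 : ℝ) 1) := by
    intro μ _
    refine integrable_of_abs_le ?_ (c := 1) fun t => ?_
    · exact Antitone.measurable fun s t hst =>
        measureReal_mono (fun a (ha : t < φ a) => lt_of_le_of_lt hst ha)
    · rw [abs_of_nonneg measureReal_nonneg]; exact measureReal_le_one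
  have hc : ∫ _ in Set.Ioc (0 : ℝ) 1, τ = τ := by simp
  rw [← hc, ← integral_add (hint ν) (integrable_const τ)]
  refine integral_mono (hint μ) ((hint ν).add (integrable_const τ)) fun t => ?_
  have h2 := (le_abs_self _).trans ((abs_measureReal_sub_le_tvDist μ ν
    (measurableSet_lt measurable_const hφ : MeasurableSet {a | t < φ a})).trans h)
  simp only
  linarith

/-- Second moments of polynomials under a hypercontractive distribution. -/
theorem IsHypercontractive.lintegral_sq_le {d : ℕ} {X : Set (Fin d → ℝ)} {D : Measure X} {A : ℝ}
    (h : IsHypercontractive D A) (hA : 1 ≤ A) {l : ℕ} (p : MvPolynomial (Fin d) ℝ)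
    (hp : p.totalDegree ≤ l) :
    ∫⁻ x : X, ENNReal.ofReal (MvPolynomial.eval x.1 p ^ 2) ∂D ≤
      ENNReal.ofReal ((4 * A * A) ^ l) * (∫⁻ x : X, ENNReal.ofReal |MvPolynomial.eval x.1 p| ∂D) ^ 2 := by
  have := h.1 p 2 le_rfl
  simp only [Real.rpow_two, sq_abs] at this
  refine this.trans ?_
  rw [show ((2 : ℝ)) = ((2 : ℕ) : ℝ) by norm_num, ENNReal.rpow_natCast]
  gcongr
  rw [← Nat.cast_mul, Real.rpow_natCast, mul_comm p.totalDegree, pow_mul]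
  push_cast
  have e : (A * 2) ^ 2 = 4 * A * A := by ring
  rw [e]
  -- At `t = 2` the hypercontractive factor is `(4 A ^ 2) ^ deg`; the base is at least one, so the
  -- degree may be raised to `l`.
  exact pow_le_pow_right₀ (by nlinarith) hp

/-- Markov's inequality for a sum over independent points. -/
theorem measure_sum_ge_le {α : Type*} [MeasurableSpace α] (ν : Measure α) [IsProbabilityMeasure ν]
    (n : ℕ) {g : α → ℝ} (hg : Measurable g) (h0 : ∀ a, 0 ≤ g a) {x c : ℝ} (hx : 0 < x)
    (h : ∫⁻ a, ENNReal.ofReal (g a) ∂ν ≤ ENNReal.ofReal c) :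
    (Measure.pi fun _ : Fin n => ν) {z | x ≤ ∑ i, g (z i)} ≤ ENNReal.ofReal (n * c / x) := by
  have hm : Measurable fun z : Fin n → α => ∑ i, ENNReal.ofReal (g (z i)) :=
    Finset.measurable_sum _ fun i _ => (hg.comp (measurable_pi_apply i)).ennreal_ofReal
  have h1 : {z : Fin n → α | x ≤ ∑ i, g (z i)} ⊆
      {z | ENNReal.ofReal x ≤ ∑ i, ENNReal.ofReal (g (z i))} := by
    intro z hz
    simp only [Set.mem_ofPred_eq]
    rw [← ENNReal.ofReal_sum_of_nonneg fun i _ => h0 _]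
    exact ENNReal.ofReal_le_ofReal hz
  have h2 := mul_meas_ge_le_lintegral (μ := Measure.pi fun _ : Fin n => ν) hm (ENNReal.ofReal x)
  have h3 : ∫⁻ z, ∑ i, ENNReal.ofReal (g (z i)) ∂(Measure.pi fun _ : Fin n => ν) ≤
      ENNReal.ofReal (n * c) := by
    have hgi : ∀ i ∈ (Finset.univ : Finset (Fin n)), Measurable fun z : Fin n → α =>
        ENNReal.ofReal (g (z i)) := fun i _ => (hg.comp (measurable_pi_apply i)).ennreal_ofReal
    rw [lintegral_finsetSum _ hgi]
    have : ∀ i : Fin n, ∫⁻ z, ENNReal.ofReal (g (z i)) ∂(Measure.pi fun _ : Fin n => ν) ≤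
        ENNReal.ofReal c := fun i => by
      rw [(measurePreserving_eval (fun _ : Fin n => ν) i).lintegral_comp
        (f := fun a => ENNReal.ofReal (g a)) hg.ennreal_ofReal]
      exact h
    refine (Finset.sum_le_sum fun i _ => this i).trans ?_
    rw [Finset.sum_const, Finset.card_univ, Fintype.card_fin, nsmul_eq_mul,
      ENNReal.ofReal_mul (Nat.cast_nonneg n), ENNReal.ofReal_natCast]
  rw [ENNReal.ofReal_div_of_pos hx, ENNReal.le_div_iff_mul_le
    (Or.inl (ENNReal.ofReal_pos.2 hx).ne') (Or.inl ENNReal.ofReal_ne_top), mul_comm]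
  exact (mul_le_mul_right (measure_mono h1) _).trans (h2.trans h3)

/-- A fresh point is outside the region of `n` random points with probability at most
`2 N / (n + 1)`. -/
theorem measure_not_inRegion_le {α : Type*} [MeasurableSpace α] (ν : Measure α)
    [IsProbabilityMeasure ν] {ψ : α → ℕ → ℝ} (hψ : Measurable ψ) (N n : ℕ) :
    (ν.prod (Measure.pi fun _ : Fin n => ν)) {p | ¬ InRegion N n (extend 0 fun r => ψ (p.2 r)) (ψ p.1)} ≤
      ENNReal.ofReal (2 * N / (n + 1)) := by
  set B : Set (α × (Fin n → α)) :=
    {p | ¬ InRegion N n (extend 0 fun r => ψ (p.2 r)) (ψ p.1)} with hB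
  have hBm : MeasurableSet B := by
    refine (measurableSet_inRegion N n (Φ := fun p : α × (Fin n → α) => extend 0 fun r => ψ (p.2 r))
      (φ := fun p : α × (Fin n → α) => ψ p.1) ?_ (hψ.comp measurable_fst)).compl
    exact (measurable_extend 0 n).comp (measurable_pi_iff.2 fun r =>
      hψ.comp ((measurable_pi_apply r).comp measurable_snd))
  set μ := Measure.pi fun _ : Fin (n + 1) => ν with hμ
  have hmp := fun i : Fin (n + 1) => measurePreserving_piFinSuccAbove (fun _ : Fin (n + 1) => ν) i
  -- Exchangeability: each of the `n + 1` i.i.d. points may play the fresh point, with equal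
  -- probability of falling outside. For every sample the number of such points is at most `2 N`.
  have h1 : ∀ i : Fin (n + 1), μ (MeasurableEquiv.piFinSuccAbove (fun _ : Fin (n + 1) => α) i ⁻¹' B) =
      (ν.prod (Measure.pi fun _ : Fin n => ν)) B := fun i =>
    (hmp i).measure_preimage hBm.nullMeasurableSet
  have h2 : ∑ i : Fin (n + 1), μ (MeasurableEquiv.piFinSuccAbove (fun _ : Fin (n + 1) => α) i ⁻¹' B) ≤
      2 * N := by
    have hms : ∀ i : Fin (n + 1), MeasurableSet
        (MeasurableEquiv.piFinSuccAbove (fun _ : Fin (n + 1) => α) i ⁻¹' B) := fun i =>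
      (MeasurableEquiv.measurable _) hBm
    calc ∑ i : Fin (n + 1), μ (MeasurableEquiv.piFinSuccAbove (fun _ : Fin (n + 1) => α) i ⁻¹' B)
        = ∑ i : Fin (n + 1), ∫⁻ z, Set.indicator
          (MeasurableEquiv.piFinSuccAbove (fun _ : Fin (n + 1) => α) i ⁻¹' B) 1 z ∂μ := by
          simp only [lintegral_indicator_one (hms _)]
      _ = ∫⁻ z, ∑ i : Fin (n + 1), Set.indicator
          (MeasurableEquiv.piFinSuccAbove (fun _ : Fin (n + 1) => α) i ⁻¹' B) 1 z ∂μ := by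
          rw [lintegral_finsetSum _ fun i _ => measurable_one.indicator (hms i)]
      _ ≤ ∫⁻ _, (2 * N : ENNReal) ∂μ := by
          refine lintegral_mono fun z => ?_
          classical
          have hcard := card_not_inRegion_le N n (fun i => ψ (z i)) 0
            (Finset.univ.filter fun i : Fin (n + 1) =>
              z ∈ MeasurableEquiv.piFinSuccAbove (fun _ : Fin (n + 1) => α) i ⁻¹' B) (by
              intro i hi
              exact (Finset.mem_filter.1 hi).2)
          simp only [Set.indicator_apply, Pi.one_apply]
          rw [Finset.sum_boole]
          exact_mod_cast hcard
      _ = 2 * N := by simp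
  simp only [h1, Finset.sum_const, Finset.card_univ, Fintype.card_fin, nsmul_eq_mul] at h2
  have e : ENNReal.ofReal (2 * N / (n + 1)) = 2 * N / ((n + 1 : ℕ) : ENNReal) := by
    rw [ENNReal.ofReal_div_of_pos (by positivity), ENNReal.ofReal_mul (by norm_num)]
    congr 1
    · simp
    · rw [← ENNReal.ofReal_natCast]; push_cast; rfl
  rw [e, ENNReal.le_div_iff_mul_le (Or.inl (by simp)) (Or.inl (ENNReal.natCast_ne_top _)), mul_comm]
  exact h2

/-- With high probability, the region of random points has small complement. -/
theorem measure_region_small_le {α : Type*} [MeasurableSpace α] (ν : Measure α)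
    [IsProbabilityMeasure ν] {ψ : α → ℕ → ℝ} (hψ : Measurable ψ) (N n : ℕ) {x : ℝ} (hx : 0 < x) :
    (Measure.pi fun _ : Fin n => ν)
      {R | x ≤ ν.real {a | ¬ InRegion N n (extend 0 fun r => ψ (R r)) (ψ a)}} ≤
      ENNReal.ofReal (2 * N / (n + 1) / x) := by
  set B : Set (α × (Fin n → α)) :=
    {p | ¬ InRegion N n (extend 0 fun r => ψ (p.2 r)) (ψ p.1)} with hB
  have hBm : MeasurableSet B := by
    refine (measurableSet_inRegion N n (Φ := fun p : α × (Fin n → α) => extend 0 fun r => ψ (p.2 r))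
      (φ := fun p : α × (Fin n → α) => ψ p.1) ?_ (hψ.comp measurable_fst)).compl
    exact (measurable_extend 0 n).comp (measurable_pi_iff.2 fun r =>
      hψ.comp ((measurable_pi_apply r).comp measurable_snd))
  have h1 := measure_not_inRegion_le ν hψ N n
  rw [Measure.prod_apply_symm hBm] at h1
  have h2 := mul_meas_ge_le_lintegral (μ := Measure.pi fun _ : Fin n => ν)
    (measurable_measure_prodMk_right (μ := ν) hBm) (ENNReal.ofReal x)
  have h3 : {R : Fin n → α | x ≤ ν.real {a | ¬ InRegion N n (extend 0 fun r => ψ (R r)) (ψ a)}} ⊆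
      {R | ENNReal.ofReal x ≤ ν ((fun a => (a, R)) ⁻¹' B)} := by
    intro R hR
    exact (ENNReal.ofReal_le_iff_le_toReal (measure_ne_top _ _)).2 hR
  rw [ENNReal.ofReal_div_of_pos hx, ENNReal.le_div_iff_mul_le
    (Or.inl (ENNReal.ofReal_pos.2 hx).ne') (Or.inl ENNReal.ofReal_ne_top), mul_comm]
  exact (mul_le_mul_right (measure_mono h3) _).trans (h2.trans h1)

open scoped Classical in
/-- Hoeffding's inequality for the empirical frequency of an event. -/
theorem measure_count_deviation_le {α : Type*} [MeasurableSpace α] (ν : Measure α)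
    [IsProbabilityMeasure ν] (n : ℕ) {B : Set α} (hB : MeasurableSet B) {x : ℝ} (hx : 0 ≤ x) :
    (Measure.pi fun _ : Fin n => ν) {z | n * x ≤
      |((Finset.univ.filter fun i => z i ∈ B).card : ℝ) - n * ν.real B|} ≤
      ENNReal.ofReal (2 * Real.exp (-(2 * n * x ^ 2))) := by
  set μ := Measure.pi fun _ : Fin n => ν with hμ
  set Y : α → ℝ := Set.indicator B 1 with hY
  have hYm : Measurable Y := measurable_one.indicator hB
  have hYi : ∫ a, Y a ∂ν = ν.real B := integral_indicator_one hB
  have hY0 : ∀ a, Y a ∈ Set.Icc (0 : ℝ) 1 := fun a => by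
    simp only [hY, Set.indicator_apply, Pi.one_apply]; split_ifs <;> simp
  have hcard : ∀ z : Fin n → α, ((Finset.univ.filter fun i => z i ∈ B).card : ℝ) = ∑ i, Y (z i) := by
    intro z
    simp only [hY, Set.indicator_apply, Pi.one_apply]
    rw [Finset.sum_boole]
  have hmean : ∀ i : Fin n, ∫ z, Y (z i) ∂μ = ν.real B := fun i => by
    rw [← hYi]
    have h := measurePreserving_eval (fun _ : Fin n => ν) i
    rw [← h.map_eq, integral_map h.measurable.aemeasurable hYm.aestronglyMeasurable]
  have hneg : ∀ i : Fin n, ∫ z, -Y (z i) ∂μ = -ν.real B := fun i => by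
    rw [integral_neg, hmean]
  -- The one-sided bound is proved for a general variable with range of length one and is then
  -- applied to the indicator and to its negative.
  have tail : ∀ (W : α → ℝ) (a b w : ℝ), Measurable W → (∀ y, W y ∈ Set.Icc a b) → b - a = 1 →
      (∀ i : Fin n, ∫ z, W (z i) ∂μ = w) →
      μ {z | n * x ≤ ∑ i, (W (z i) - w)} ≤ ENNReal.ofReal (Real.exp (-(2 * n * x ^ 2))) := by
    intro W a b w hW hWb hab hw
    have hind : ProbabilityTheory.iIndepFun (fun i z => W (z i) - w) μ :=
      ProbabilityTheory.iIndepFun_pi (X := fun (_ : Fin n) y => W y - w)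
        fun i => (hW.sub_const w).aemeasurable
    have hsub : ∀ i ∈ (Finset.univ : Finset (Fin n)), ProbabilityTheory.HasSubgaussianMGF
        (fun z => W (z i) - w) ((‖b - a‖₊ / 2) ^ 2) μ := by
      intro i _
      have := ProbabilityTheory.hasSubgaussianMGF_of_mem_Icc (μ := μ) (X := fun z => W (z i))
        (hW.comp (measurable_pi_apply i)).aemeasurable (Filter.Eventually.of_forall fun z => hWb (z i))
      rwa [hw i] at this
    have h1 := ProbabilityTheory.HasSubgaussianMGF.measure_sum_ge_le_of_iIndepFun hind hsub
      (ε := n * x) (by positivity)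
    rw [← ENNReal.ofReal_toReal (measure_ne_top μ _)]
    refine ENNReal.ofReal_le_ofReal (h1.trans (Real.exp_le_exp.2 ?_))
    rw [hab]
    rcases Nat.eq_zero_or_pos n with rfl | hn
    · simp
    · have hn' : (0 : ℝ) < n := by exact_mod_cast hn
      simp only [Finset.sum_const, Finset.card_univ, Fintype.card_fin]
      have : ((n • (‖(1 : ℝ)‖₊ / 2) ^ 2 : NNReal) : ℝ) = n / 4 := by
        simp; ring
      refine le_of_eq ?_
      push_cast
      simp
      field_simp
  have h1 := tail Y 0 1 (ν.real B) hYm hY0 (by norm_num) hmean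
  have h2 := tail (fun a => -Y a) (-1) 0 (-ν.real B) hYm.neg
    (fun a => ⟨by linarith [(hY0 a).2], by linarith [(hY0 a).1]⟩) (by norm_num) hneg
  have hsub : {z : Fin n → α | n * x ≤
      |((Finset.univ.filter fun i => z i ∈ B).card : ℝ) - n * ν.real B|} ⊆
      {z | n * x ≤ ∑ i, (Y (z i) - ν.real B)} ∪ {z | n * x ≤ ∑ i, (-Y (z i) - -ν.real B)} := by
    intro z hz
    simp only [Set.mem_ofPred_eq, hcard] at hz
    simp only [Set.mem_union, Set.mem_ofPred_eq, Finset.sum_sub_distrib, Finset.sum_neg_distrib,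
      Finset.sum_const, Finset.card_univ, Fintype.card_fin, nsmul_eq_mul]
    rcases le_abs.1 hz with h | h
    · exact Or.inl h
    · exact Or.inr (by linarith)
  refine (measure_mono hsub).trans ((measure_union_le _ _).trans ((add_le_add h1 h2).trans ?_))
  rw [← ENNReal.ofReal_add (by positivity) (by positivity)]
  exact ENNReal.ofReal_le_ofReal (by linarith)

/-! ### The law of the blocks and of the validation data -/

/-- Reading an i.i.d. sequence at distinct positions yields an i.i.d. family; on product boxes both
measures are the same finite product. -/
theorem measurePreserving_comp_injective {ι κ α : Type*} [Fintype ι] [MeasurableSpace α]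
    (μ : Measure α) [IsProbabilityMeasure μ] {f : ι → κ} (hf : Function.Injective f) :
    MeasurePreserving (fun (x : κ → α) i => x (f i)) (Measure.infinitePi fun _ => μ)
      (Measure.pi fun _ => μ) := by
  have hm : Measurable fun (x : κ → α) i => x (f i) :=
    measurable_pi_iff.2 fun i => measurable_pi_apply (f i)
  refine ⟨hm, (Measure.pi_eq fun s hs => ?_).symm⟩
  rw [Measure.map_apply hm (MeasurableSet.univ_pi hs)]
  have e : (fun (x : κ → α) i => x (f i)) ⁻¹' Set.univ.pi s =
      Set.pi (Finset.univ.map ⟨f, hf⟩ : Finset κ) (Function.extend f s fun _ => Set.univ) := by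
    ext x
    simp [Set.mem_pi, hf.extend_apply]
  rw [e, Measure.infinitePi_pi, Finset.prod_map]
  · simp [hf.extend_apply]
  · intro i hi
    obtain ⟨j, -, rfl⟩ := Finset.mem_map.1 hi
    simpa [hf.extend_apply] using hs j

theorem measurePreserving_curry {ι κ α : Type*} [Fintype ι] [Fintype κ] [MeasurableSpace α]
    (μ : Measure α) [IsProbabilityMeasure μ] :
    MeasurePreserving (MeasurableEquiv.curry ι κ α) (Measure.pi fun _ => μ)
      (Measure.pi fun _ => Measure.pi fun _ => μ) := by
  refine ⟨MeasurableEquiv.measurable _, ?_⟩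
  have := Measure.infinitePi_map_curry (fun (_ : ι) (_ : κ) => μ)
  simpa only [Measure.infinitePi_eq_pi] using this

theorem measurePreserving_rearrange {α β γ δ : Type*} [MeasurableSpace α] [MeasurableSpace β]
    [MeasurableSpace γ] [MeasurableSpace δ] (a : Measure α) (b : Measure β) (c : Measure γ)
    (e : Measure δ) [IsProbabilityMeasure a] [IsProbabilityMeasure b] [IsProbabilityMeasure c]
    [IsProbabilityMeasure e] :
    MeasurePreserving (fun p : (α × β) × (γ × δ) => ((p.2.2, (p.1.1, p.2.1)), p.1.2))
      ((a.prod b).prod (c.prod e)) ((e.prod (a.prod c)).prod b) := by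
  have h1 : MeasurePreserving (fun p : (α × β) × (γ × δ) => ((p.1.2, p.1.1), (p.2.2, p.2.1)))
      ((a.prod b).prod (c.prod e)) ((b.prod a).prod (e.prod c)) :=
    Measure.measurePreserving_swap.prod Measure.measurePreserving_swap
  have h2 : MeasurePreserving (fun p : (β × α) × (δ × γ) => (p.1.1, (p.1.2, p.2)))
      ((b.prod a).prod (e.prod c)) (b.prod (a.prod (e.prod c))) := measurePreserving_prodAssoc b a _
  have h3 : MeasurePreserving (fun p : α × (δ × γ) => (p.2, p.1)) (a.prod (e.prod c))
      ((e.prod c).prod a) := Measure.measurePreserving_swap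
  have h4 : MeasurePreserving (fun p : (δ × γ) × α => (p.1.1, (p.1.2, p.2)))
      ((e.prod c).prod a) (e.prod (c.prod a)) := measurePreserving_prodAssoc e c a
  have h5 : MeasurePreserving (fun p : δ × (γ × α) => (p.1, (p.2.2, p.2.1)))
      (e.prod (c.prod a)) (e.prod (a.prod c)) :=
    (MeasurePreserving.id e).prod Measure.measurePreserving_swap
  have h6 : MeasurePreserving (fun p : β × (α × (δ × γ)) => (p.1, ((p.2.2.1, (p.2.1, p.2.2.2)))))
      (b.prod (a.prod (e.prod c))) (b.prod (e.prod (a.prod c))) :=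
    (MeasurePreserving.id b).prod (h5.comp (h4.comp h3))
  have h7 : MeasurePreserving (fun p : β × (δ × (α × γ)) => (p.2, p.1))
      (b.prod (e.prod (a.prod c))) ((e.prod (a.prod c)).prod b) := Measure.measurePreserving_swap
  exact h7.comp (h6.comp (h2.comp h1))

theorem mul_add_inj {T b b' t t' : ℕ} (ht : t < T) (ht' : t' < T) (h : b * T + t = b' * T + t') :
    b = b' ∧ t = t' := by
  have hT : 0 < T := by omega
  have h1 : (b * T + t) / T = b := by
    rw [mul_comm, Nat.mul_add_div hT, Nat.div_eq_of_lt ht, add_zero]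
  have h2 : (b' * T + t') / T = b' := by
    rw [mul_comm, Nat.mul_add_div hT, Nat.div_eq_of_lt ht', add_zero]
  have hb : b = b' := by rw [← h1, ← h2, h]
  subst hb
  exact ⟨rfl, by omega⟩

theorem mul_add_lt_mul {k T b t : ℕ} (hb : b < k) (ht : t < T) : b * T + t < k * T := by
  calc b * T + t < b * T + T := by omega
    _ = (b + 1) * T := by ring
    _ ≤ k * T := Nat.mul_le_mul_right _ hb

section Split

variable {X Z : Type*} [MeasurableSpace X] [MeasurableSpace Z]

/-- The reference examples and the stream of a block. -/
def blockData {k T m : ℕ} (n : ℕ) (hm : 2 * (k * T) ≤ m) (S : Fin m → Z) (ω : ℕ → X) (b : Fin k) :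
    (Fin n → X) × (Fin T → Z × X) :=
  (fun r => ω (k * T + b * n + r),
    fun t => (S ⟨b * T + t, by have := mul_add_lt_mul b.2 t.2; omega⟩, ω (b * T + t)))

/-- The validation examples. -/
def validData {k T m : ℕ} (hm : 2 * (k * T) ≤ m) (S : Fin m → Z) (j : Fin (k * T)) : Z :=
  S ⟨k * T + j, by omega⟩

/-- The maps `f` and `g` are the positions that the program reads. Their injectivity says that
blocks and validation use disjoint examples, so all parts are independent; the rest is reassociation
of product measures. -/
theorem measurePreserving_split {k T m : ℕ} (n : ℕ) (hm : 2 * (k * T) ≤ m) (E : Measure Z)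
    [IsProbabilityMeasure E] (D : Measure X) [IsProbabilityMeasure D] :
    MeasurePreserving (fun p : (Fin m → Z) × (ℕ → X) => (blockData n hm p.1 p.2, validData hm p.1))
      ((Measure.pi fun _ => E).prod (Measure.infinitePi fun _ => D))
      ((Measure.pi fun _ : Fin k => (Measure.pi fun _ : Fin n => D).prod
        (Measure.pi fun _ : Fin T => E.prod D)).prod (Measure.pi fun _ : Fin (k * T) => E)) := by
  let f : (Fin k × Fin T) ⊕ Fin (k * T) → Fin m := Sum.elim
    (fun p => ⟨p.1 * T + p.2, by have := mul_add_lt_mul p.1.2 p.2.2; omega⟩)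
    (fun j => ⟨k * T + j, by omega⟩)
  let g : (Fin k × Fin T) ⊕ (Fin k × Fin n) → ℕ := Sum.elim
    (fun p => p.1 * T + p.2) (fun p => k * T + p.1 * n + p.2)
  have hf : Function.Injective f := by
    rintro (⟨b, t⟩ | j) (⟨b', t'⟩ | j') h
    · have h' : b.1 = b'.1 ∧ t.1 = t'.1 := mul_add_inj t.2 t'.2 (Fin.mk.inj_iff.1 h)
      rw [Fin.ext h'.1, Fin.ext h'.2]
    · have h1 : b.1 * T + t.1 = k * T + j'.1 := Fin.mk.inj_iff.1 h
      have h2 := mul_add_lt_mul b.2 t.2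
      omega
    · have h1 : k * T + j.1 = b'.1 * T + t'.1 := Fin.mk.inj_iff.1 h
      have h2 := mul_add_lt_mul b'.2 t'.2
      omega
    · have h1 : k * T + j.1 = k * T + j'.1 := Fin.mk.inj_iff.1 h
      rw [Fin.ext (by omega : j.1 = j'.1)]
  have hg : Function.Injective g := by
    rintro (⟨b, t⟩ | ⟨b, r⟩) (⟨b', t'⟩ | ⟨b', r'⟩) h
    · have h' : b.1 = b'.1 ∧ t.1 = t'.1 := mul_add_inj t.2 t'.2 h
      rw [Fin.ext h'.1, Fin.ext h'.2]
    · have h1 : b.1 * T + t.1 = k * T + b'.1 * n + r'.1 := h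
      have h2 := mul_add_lt_mul b.2 t.2
      omega
    · have h1 : k * T + b.1 * n + r.1 = b'.1 * T + t'.1 := h
      have h2 := mul_add_lt_mul b'.2 t'.2
      omega
    · have h1 : k * T + b.1 * n + r.1 = k * T + b'.1 * n + r'.1 := h
      have h' := mul_add_inj (b := b) (b' := b') r.2 r'.2 (by omega)
      rw [Fin.ext h'.1, Fin.ext h'.2]
  have s1 := (measurePreserving_comp_injective E hf).prod (measurePreserving_comp_injective D hg)
  rw [Measure.infinitePi_eq_pi] at s1
  have s2 := (measurePreserving_sumPiEquivProdPi (fun _ : (Fin k × Fin T) ⊕ Fin (k * T) => E)).prod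
    (measurePreserving_sumPiEquivProdPi (fun _ : (Fin k × Fin T) ⊕ (Fin k × Fin n) => D))
  have s3 := measurePreserving_rearrange (Measure.pi fun _ : Fin k × Fin T => E)
    (Measure.pi fun _ : Fin (k * T) => E) (Measure.pi fun _ : Fin k × Fin T => D)
    (Measure.pi fun _ : Fin k × Fin n => D)
  have s4 := (measurePreserving_arrowProdEquivProdArrow Z X (Fin k × Fin T) (fun _ => E)
    (fun _ => D)).symm
  have s5 := (measurePreserving_curry (ι := Fin k) (κ := Fin n) D).prod
    ((measurePreserving_curry (ι := Fin k) (κ := Fin T) (E.prod D)).comp s4)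
  have s6 := (measurePreserving_arrowProdEquivProdArrow (Fin n → X) (Fin T → Z × X) (Fin k)
    (fun _ => Measure.pi fun _ => D) (fun _ => Measure.pi fun _ => E.prod D)).symm
  exact ((s6.comp s5).prod (MeasurePreserving.id _)).comp (s3.comp (s2.comp s1))

end Split

open scoped Classical in
/-- The probability that at least half of `k` independent events of probability `1 / 64` occur. -/
theorem measure_half_le {α : Type*} [MeasurableSpace α] (μ : Measure α) [IsProbabilityMeasure μ]
    {B : Set α} (h : μ B ≤ ENNReal.ofReal (1 / 64)) (k : ℕ) :
    (Measure.pi fun _ : Fin k => μ) {β | k ≤ 2 * (Finset.univ.filter fun b => β b ∈ B).card} ≤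
      ENNReal.ofReal ((1 / 4) ^ k) := by
  set ν := Measure.pi fun _ : Fin k => μ
  -- Union over the possible sets `J` of failing indices. With `|J| ≥ k / 2` each has probability at
  -- most `64 ^ (-k/2) = 8 ^ (-k)`, and there are at most `2 ^ k` of them.
  have hsub : {β : Fin k → α | k ≤ 2 * (Finset.univ.filter fun b => β b ∈ B).card} ⊆
      ⋃ J ∈ (Finset.univ : Finset (Finset (Fin k))).filter (fun J => k ≤ 2 * J.card),
        Set.univ.pi fun b => if b ∈ J then B else Set.univ := by
    intro β hβ
    simp only [Set.mem_iUnion]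
    refine ⟨_, Finset.mem_filter.2 ⟨Finset.mem_univ _, hβ⟩, ?_⟩
    intro b _
    dsimp only
    split_ifs with hb
    · exact (Finset.mem_filter.1 hb).2
    · trivial
  have hJ : ∀ J ∈ (Finset.univ : Finset (Finset (Fin k))).filter (fun J => k ≤ 2 * J.card),
      ν (Set.univ.pi fun b => if b ∈ J then B else Set.univ) ≤ ENNReal.ofReal ((1 / 8) ^ k) := by
    intro J hJ
    have hk := (Finset.mem_filter.1 hJ).2
    rw [Measure.pi_pi]
    have : ∀ b, μ (if b ∈ J then B else Set.univ) = if b ∈ J then μ B else 1 := by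
      intro b; split_ifs <;> simp
    simp only [this]
    rw [Finset.prod_ite_mem, Finset.univ_inter, Finset.prod_const]
    calc μ B ^ J.card ≤ ENNReal.ofReal (1 / 64) ^ J.card := pow_le_pow_left' h _
      _ = ENNReal.ofReal ((1 / 64) ^ J.card) := (ENNReal.ofReal_pow (by norm_num) _).symm
      _ ≤ ENNReal.ofReal ((1 / 8) ^ k) := by
        refine ENNReal.ofReal_le_ofReal ?_
        rw [show (1 / 64 : ℝ) = (1 / 8) ^ 2 by norm_num, ← pow_mul]
        exact pow_le_pow_of_le_one (by norm_num) (by norm_num) hk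
  calc ν {β | k ≤ 2 * (Finset.univ.filter fun b => β b ∈ B).card}
      ≤ ∑ J ∈ (Finset.univ : Finset (Finset (Fin k))).filter (fun J => k ≤ 2 * J.card),
        ν (Set.univ.pi fun b => if b ∈ J then B else Set.univ) :=
        (measure_mono hsub).trans (measure_biUnion_finset_le _ _)
    _ ≤ ∑ _J ∈ (Finset.univ : Finset (Finset (Fin k))).filter (fun J => k ≤ 2 * J.card),
        ENNReal.ofReal ((1 / 8) ^ k) := Finset.sum_le_sum hJ
    _ ≤ ∑ _J : Finset (Fin k), ENNReal.ofReal ((1 / 8) ^ k) :=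
        Finset.sum_le_sum_of_subset (Finset.filter_subset _ _)
    _ = ENNReal.ofReal ((1 / 4) ^ k) := by
        rw [Finset.sum_const, Finset.card_univ, Fintype.card_finset, Fintype.card_fin, nsmul_eq_mul,
          ← ENNReal.ofReal_natCast, ← ENNReal.ofReal_mul (by positivity)]
        congr 1
        push_cast
        rw [← mul_pow]; norm_num

/-! ### Thresholds -/

open Classical in
/-- The average error, over the thresholds, of the prediction `v` for the label `b`. -/
def thrLoss (n : ℕ) (v : ℝ) (b : Bool) : ℝ :=
  (∑ j ∈ Finset.range n, if b = decide (thr n j < v) then (0 : ℝ) else 1) / n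

theorem thrLoss_nonneg (n : ℕ) (v : ℝ) (b : Bool) : 0 ≤ thrLoss n v b :=
  div_nonneg (Finset.sum_nonneg fun j _ => by split_ifs <;> norm_num) (Nat.cast_nonneg n)

theorem thrLoss_le_one (n : ℕ) (v : ℝ) (b : Bool) : thrLoss n v b ≤ 1 := by
  refine div_le_one_of_le₀ ?_ (Nat.cast_nonneg n)
  refine (Finset.sum_le_sum (g := fun _ => (1 : ℝ)) fun j _ => by split_ifs <;> norm_num).trans ?_
  simp

theorem card_filter_le_cast (n : ℕ) (a : ℝ) :
    (((Finset.range n).filter fun j : ℕ => a ≤ j).card : ℝ) ≤ |n - a| := by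
  have h : (Finset.range n).filter (fun j : ℕ => a ≤ j) ⊆ Finset.Ico ⌈a⌉₊ n := by
    intro j hj
    rw [Finset.mem_filter, Finset.mem_range] at hj
    exact Finset.mem_Ico.2 ⟨Nat.ceil_le.2 hj.2, hj.1⟩
  have h1 := Finset.card_le_card h
  rw [Nat.card_Ico] at h1
  have h2 : (((Finset.range n).filter fun j : ℕ => a ≤ j).card : ℝ) ≤ ((n - ⌈a⌉₊ : ℕ) : ℝ) := by
    exact_mod_cast h1
  refine h2.trans ?_
  rcases le_total n ⌈a⌉₊ with h3 | h3
  · rw [Nat.sub_eq_zero_of_le h3, Nat.cast_zero]; exact abs_nonneg _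
  · rw [Nat.cast_sub h3]
    have := Nat.le_ceil a
    exact le_trans (by linarith) (le_abs_self _)

theorem card_filter_cast_lt (n : ℕ) (a : ℝ) :
    (((Finset.range n).filter fun j : ℕ => (j : ℝ) < a).card : ℝ) ≤ |a| + 1 := by
  have h : (Finset.range n).filter (fun j : ℕ => (j : ℝ) < a) ⊆ Finset.range ⌈a⌉₊ := by
    intro j hj
    rw [Finset.mem_filter] at hj
    exact Finset.mem_range.2 (Nat.lt_ceil.2 hj.2)
  have h1 := Finset.card_le_card h
  rw [Finset.card_range] at h1
  have h2 : (((Finset.range n).filter fun j : ℕ => (j : ℝ) < a).card : ℝ) ≤ (⌈a⌉₊ : ℝ) := by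
    exact_mod_cast h1
  refine h2.trans ?_
  rcases le_total a 0 with h3 | h3
  · rw [Nat.ceil_eq_zero.2 h3, Nat.cast_zero]; positivity
  · rw [abs_of_nonneg h3]; exact (Nat.ceil_lt_add_one h3).le

/-- With `a = n (v + 1) / 2`, threshold `j` predicts `+1` exactly if `j < a`. The wrong thresholds
are the integers between `a` and `n` for label `+1`, and those from `0` up to `a` for label `-1`.
Their number is at most the length of that interval plus one, and the length is `n |y - v| / 2`. -/
theorem thrLoss_le {n : ℕ} (hn : 0 < n) (v : ℝ) (b : Bool) :
    thrLoss n v b ≤ |labelValue b - v| / 2 + 1 / n := by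
  have hn' : (0 : ℝ) < n := by exact_mod_cast hn
  rw [thrLoss, div_le_iff₀ hn']
  have e : (|labelValue b - v| / 2 + 1 / n) * n = |labelValue b - v| * n / 2 + 1 := by
    field_simp
  rw [e]
  set a : ℝ := n * (v + 1) / 2 with ha
  have hthr : ∀ j : ℕ, thr n j < v ↔ (j : ℝ) < a := by
    intro j
    rw [thr, sub_lt_iff_lt_add, div_lt_iff₀ hn', ha]
    constructor <;> intro h <;> linarith
  cases b with
  | true =>
    have h1 : ∀ j : ℕ, (if true = decide (thr n j < v) then (0 : ℝ) else 1) =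
        if a ≤ j then 1 else 0 := by
      intro j
      by_cases h : thr n j < v
      · rw [if_pos (by simp [h]), if_neg (not_le.2 ((hthr j).1 h))]
      · rw [if_neg (by simp [h]), if_pos (not_lt.1 (mt (hthr j).2 h))]
    simp only [h1]
    rw [Finset.sum_boole]
    refine (card_filter_le_cast n a).trans ?_
    have : (n : ℝ) - a = (1 - v) * n / 2 := by rw [ha]; ring
    rw [this, abs_div, abs_mul, abs_of_pos hn', abs_two]
    simp [labelValue]
  | false =>
    have h1 : ∀ j : ℕ, (if false = decide (thr n j < v) then (0 : ℝ) else 1) =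
        if (j : ℝ) < a then 1 else 0 := by
      intro j
      by_cases h : thr n j < v
      · rw [if_neg (by simp [h]), if_pos ((hthr j).1 h)]
      · rw [if_pos (by simp [h]), if_neg (mt (hthr j).2 h)]
    simp only [h1]
    rw [Finset.sum_boole]
    refine (card_filter_cast_lt n a).trans ?_
    have h2 : a = -((-1 - v) * n / 2) := by rw [ha]; ring
    rw [h2, abs_neg, abs_div, abs_mul, abs_of_pos hn', abs_two]
    simp [labelValue]

/-! ### Analysis of one block -/

section Block

variable {d : ℕ} {X : Set (Fin d → ℝ)}

/-- The round given by a labeled example and a reference example. -/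
def roundOf (ψ : X → ℕ → ℝ) (y : (X × Bool) × X) : Round :=
  (ψ y.1.1, labelValue y.1.2, ψ y.2)

theorem measurable_labelValue : Measurable labelValue := measurable_of_finite _

theorem measurable_roundOf {ψ : X → ℕ → ℝ} (hψ : Measurable ψ) : Measurable (roundOf ψ) :=
  (hψ.comp measurable_fst.fst).prodMk
    ((measurable_labelValue.comp measurable_fst.snd).prodMk (hψ.comp measurable_snd))

/-- The hypothesis given by a polynomial and a threshold. -/
def hyp (N : ℕ) (ψ : X → ℕ → ℝ) (p : ℕ → ℝ) (θ : ℝ) (x : X) : Bool :=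
  decide (θ < dot N p (ψ x))

/-- The indicator of an error of `f`. -/
def errInd (f : X → Bool) (z : X × Bool) : ℝ := if z.2 = f z.1 then 0 else 1

theorem integral_errInd (E : Measure (X × Bool)) {f : X → Bool} (hf : Measurable f) :
    ∫ z, errInd f z ∂E = errorRate E f := by
  have hs : MeasurableSet {z : X × Bool | z.2 ≠ f z.1} :=
    (measurableSet_eq_fun measurable_snd (hf.comp measurable_fst)).compl
  rw [errorRate, ← integral_indicator_one hs]
  refine integral_congr_ae (Filter.Eventually.of_forall fun z => ?_)
  by_cases h : z.2 = f z.1 <;> simp [errInd, h]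

theorem measurable_errInd {f : X → Bool} (hf : Measurable f) : Measurable (errInd f) :=
  Measurable.ite (measurableSet_eq_fun measurable_snd (hf.comp measurable_fst)) measurable_const
    measurable_const

theorem measurable_hyp (N : ℕ) {ψ : X → ℕ → ℝ} (hψ : Measurable ψ) (p : ℕ → ℝ) (θ : ℝ) :
    Measurable (hyp N ψ p θ) := by
  refine measurable_to_bool ?_
  have : hyp N ψ p θ ⁻¹' {true} = {x | θ < dot N p (ψ x)} := by ext x; simp [hyp]
  rw [this]
  exact measurableSet_lt measurable_const (measurable_dot N measurable_const hψ)

theorem thrLoss_eq (n N : ℕ) (ψ : X → ℕ → ℝ) (p : ℕ → ℝ) (z : X × Bool) :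
    thrLoss n (dot N p (ψ z.1)) z.2 =
      (∑ j ∈ Finset.range n, errInd (hyp N ψ p (thr n j)) z) / n := by
  rw [thrLoss]
  congr 1

theorem integral_thrLoss (E : Measure (X × Bool)) [IsProbabilityMeasure E] (n N : ℕ)
    {ψ : X → ℕ → ℝ} (hψ : Measurable ψ) (p : ℕ → ℝ) :
    ∫ z : X × Bool, thrLoss n (dot N p (ψ z.1)) z.2 ∂E =
      (∑ j ∈ Finset.range n, errorRate E (hyp N ψ p (thr n j))) / n := by
  simp only [thrLoss_eq]
  rw [integral_div, integral_finsetSum]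
  · simp only [integral_errInd E (measurable_hyp N hψ p _)]
  · intro j _
    refine integrable_of_abs_le (measurable_errInd (measurable_hyp N hψ p _)) (c := 1) fun z => ?_
    unfold errInd; split_ifs <;> simp

/-- The online algorithm as a dynamical system. -/
def blockStep (N n : ℕ) (η : ℝ) (ψ : X → ℕ → ℝ) (s : (ℕ → ℕ → ℝ) × ((ℕ → ℝ) × (ℕ → ℝ)))
    (y : (X × Bool) × X) : (ℕ → ℕ → ℝ) × ((ℕ → ℝ) × (ℕ → ℝ)) :=
  (s.1, step N n s.1 η s.2 (roundOf ψ y))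

theorem trajectory_blockStep (N n : ℕ) (η : ℝ) (ψ : X → ℕ → ℝ) (Φ : ℕ → ℕ → ℝ)
    (s : (ℕ → ℝ) × (ℕ → ℝ)) (z : ℕ → (X × Bool) × X) (t : ℕ) :
    trajectory (blockStep N n η ψ) (Φ, s) z t =
      (Φ, runFrom N n Φ η s (fun i => roundOf ψ (z i)) t) := by
  induction t with
  | zero => rfl
  | succ t ih => rw [trajectory, ih]; rfl

theorem measurable_blockStep (N n : ℕ) (η : ℝ) {ψ : X → ℕ → ℝ} (hψ : Measurable ψ) :
    Measurable fun p : ((ℕ → ℕ → ℝ) × ((ℕ → ℝ) × (ℕ → ℝ))) × ((X × Bool) × X) =>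
      blockStep N n η ψ p.1 p.2 :=
  measurable_fst.fst.prodMk (measurable_step N n η measurable_fst.fst measurable_fst.snd
    ((measurable_roundOf hψ).comp measurable_snd))

/-- A passing block has small average loss. -/
theorem sum_thrLoss_le {N n T : ℕ} {η ε τ U : ℝ} {ψ : X → ℕ → ℝ} (hn : 0 < n) (hη : 0 < η)
    (f : X → Bool) (uq up : ℕ → ℝ)
    (hs : ∀ x, dot N up (ψ x) ≤ labelValue (f x) ∧
      labelValue (f x) ≤ dot N up (ψ x) + dot N uq (ψ x))
    (Φ : ℕ → ℕ → ℝ) (z : ℕ → (X × Bool) × X)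
    (hstat : ∑ t ∈ Finset.range T, val N n Φ (runFrom N n Φ η 0 (fun i => roundOf ψ (z i)) t).1
      (roundOf ψ (z t)) ≤ T * (τ + ε / 8))
    (hr : ∑ t ∈ Finset.range T, |dot N uq (ψ (z t).2)| ≤ T * (ε / 16))
    (hq : ip N n Φ uq uq ≤ U) (hp : ip N n Φ up up ≤ U) (hU : U / (2 * η) ≤ T * (ε / 128))
    (hη2 : 2 * η ≤ ε / 128) (hn2 : 1 / n ≤ ε / 128) :
    ∑ t ∈ Finset.range T, thrLoss n
        (dot N (runFrom N n Φ η 0 (fun i => roundOf ψ (z i)) t).2 (ψ (z t).1.1)) (z t).1.2 ≤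
      ∑ t ∈ Finset.range T, errInd f (z t).1 + T * (τ + 7 * ε / 32) := by
  set ρ : ℕ → Round := fun i => roundOf ψ (z i) with hρ
  set st := runFrom N n Φ η 0 ρ with hst
  set g : ℕ → ℝ := fun t => gate N n Φ (st t).1 (ρ t).1 with hg
  have h1 := sum_gate_le N n Φ hη ρ uq T
  have h2 := sum_gate_abs_le N n Φ hη ρ up T
  have hg01 : ∀ t, g t = 0 ∨ g t = 1 := fun t => by
    rcases gate_cases N n Φ (st t).1 (ρ t).1 with h | h
    · exact Or.inr h.1
    · exact Or.inl h
  have hT0 : (0 : ℝ) ≤ T := Nat.cast_nonneg T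
  have hdiv : ∀ u, ip N n Φ u u ≤ U → ip N n Φ u u / (2 * η) ≤ T * (ε / 128) := fun u hu =>
    (div_le_div_of_nonneg_right hu (by positivity)).trans hU
  have hηT : 2 * η * T ≤ T * (ε / 128) := by nlinarith
  -- A point that the filter rejects is charged the full loss `1`; a retained one is charged half
  -- its regression error plus the discretization `1 / n`.
  have hpt : ∀ t, thrLoss n (dot N (st t).2 (ψ (z t).1.1)) (z t).1.2 ≤
      (1 - g t) + g t * |(ρ t).2.1 - dot N (st t).2 (ρ t).1| / 2 + ε / 128 := by
    intro t
    have hε : 0 ≤ ε / 128 := by linarith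
    rcases hg01 t with h | h
    · rw [h]
      have := thrLoss_le_one n (dot N (st t).2 (ψ (z t).1.1)) (z t).1.2
      linarith
    · rw [h]
      have := thrLoss_le hn (dot N (st t).2 (ψ (z t).1.1)) (z t).1.2
      have e : |(ρ t).2.1 - dot N (st t).2 (ρ t).1| =
        |labelValue (z t).1.2 - dot N (st t).2 (ψ (z t).1.1)| := rfl
      rw [e]
      linarith
  -- A wrong label moves `y` by `2`, and the lower polynomial lies within the sandwiching gap of
  -- `f`.
  have hpt2 : ∀ t, g t * |(ρ t).2.1 - dot N up (ρ t).1| ≤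
      2 * errInd f (z t).1 + g t * dot N uq (ρ t).1 := by
    intro t
    have hs' := hs (z t).1.1
    have e1 : (ρ t).1 = ψ (z t).1.1 := rfl
    have e2 : (ρ t).2.1 = labelValue (z t).1.2 := rfl
    rw [e1, e2]
    have h3 : |labelValue (z t).1.2 - dot N up (ψ (z t).1.1)| ≤
        2 * errInd f (z t).1 + dot N uq (ψ (z t).1.1) := by
      have h4 : |labelValue (z t).1.2 - labelValue (f (z t).1.1)| ≤ 2 * errInd f (z t).1 := by
        unfold errInd
        split_ifs with h
        · rw [h]; simp
        · revert h
          cases (z t).1.2 <;> cases f (z t).1.1 <;> simp [labelValue] <;> norm_num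
      have h5 : |labelValue (f (z t).1.1) - dot N up (ψ (z t).1.1)| ≤ dot N uq (ψ (z t).1.1) := by
        rw [abs_of_nonneg (by linarith)]; linarith
      have h6 := abs_sub_le (labelValue (z t).1.2) (labelValue (f (z t).1.1))
        (dot N up (ψ (z t).1.1))
      linarith
    have he : 0 ≤ errInd f (z t).1 := by unfold errInd; split_ifs <;> norm_num
    rcases hg01 t with h | h
    · rw [h]; linarith
    · rw [h]; linarith
  have hqnn : ∀ t, 0 ≤ g t * dot N uq (ρ t).1 := by
    intro t
    have hs' := hs (z t).1.1
    have : 0 ≤ dot N uq (ψ (z t).1.1) := by linarith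
    rcases hg01 t with h | h
    · rw [h]; linarith
    · rw [h]; simpa [hρ, roundOf] using this
  have s1 := Finset.sum_le_sum fun t (_ : t ∈ Finset.range T) => hpt t
  have s2 := Finset.sum_le_sum fun t (_ : t ∈ Finset.range T) => hpt2 t
  have s3 := Finset.sum_nonneg fun t (_ : t ∈ Finset.range T) => hqnn t
  simp only [Finset.sum_add_distrib, ← Finset.sum_div, ← Finset.mul_sum, Finset.sum_const,
    Finset.card_range, nsmul_eq_mul] at s1 s2 h1 h2
  have e4 : ∑ t ∈ Finset.range T, |dot N uq (ρ t).2.2| ≤ T * (ε / 16) := hr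
  have e5 : ∑ t ∈ Finset.range T, val N n Φ (runFrom N n Φ η 0 ρ t).1 (ρ t) ≤ T * (τ + ε / 8) := hstat
  have d1 := hdiv uq hq
  have d2 := hdiv up hp
  simp only [hg] at s1 s2 s3
  -- Budget, in multiples of `T ε`: `1/8` from the test, `1/16` from the reference gap, `2/128` from
  -- the filter regret, half of `2/128` from the regression regret and `1/128` from the thresholds;
  -- together `7/32`. The retained gap enters the loss with weight one half only, and its
  -- nonnegativity gives the rest away.
  linarith

/-- Expectation of the contribution of a round to the statistic. -/
theorem integral_val_le {N n : ℕ} {ψ : X → ℕ → ℝ} (hψ : Measurable ψ) (D : Measure X)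
    [IsProbabilityMeasure D] (E : Measure (X × Bool)) [IsProbabilityMeasure E] {τ c : ℝ}
    (htv : tvDist (E.map Prod.fst) D ≤ τ) (Φ : ℕ → ℕ → ℝ) (q : ℕ → ℝ)
    (hc : ∀ x, InRegion N n Φ (ψ x) → |dot N q (ψ x)| ≤ c) :
    ∫ y, val N n Φ q (roundOf ψ y) ∂(E.prod D) ≤ τ + D.real {x | ¬ InRegion N n Φ (ψ x)} := by
  classical
  have hc0 : 0 ≤ |c| := abs_nonneg c
  have hG : MeasurableSet {x | InRegion N n Φ (ψ x)} :=
    measurableSet_inRegion N n measurable_const hψ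
  have hGc : MeasurableSet {x | ¬ InRegion N n Φ (ψ x)} := hG.compl
  have hdot : Measurable fun x => dot N q (ψ x) := measurable_dot N measurable_const hψ
  -- `φ` majorizes the observed part of the statistic and has values in `[0, 1]`, so the passage to
  -- `D` costs only `τ`. Under `D`, `φ - ρ` is at most zero in the region and equals one outside.
  -- The bound `c` serves integrability alone.
  set φ : X → ℝ := fun x => if InRegion N n Φ (ψ x) then min 1 |dot N q (ψ x)| else 1 with hφ
  set ρ : X → ℝ := fun x => if InRegion N n Φ (ψ x) then |dot N q (ψ x)| else 0 with hρ
  have hφm : Measurable φ :=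
    Measurable.ite hG (measurable_const.min hdot.abs) measurable_const
  have hρm : Measurable ρ := Measurable.ite hG hdot.abs measurable_const
  have hφ0 : ∀ x, 0 ≤ φ x := fun x => by
    simp only [hφ]; split_ifs
    · exact le_min zero_le_one (abs_nonneg _)
    · exact zero_le_one
  have hφ1 : ∀ x, φ x ≤ 1 := fun x => by
    simp only [hφ]; split_ifs
    · exact min_le_left _ _
    · exact le_rfl
  have hρb : ∀ x, |ρ x| ≤ |c| := fun x => by
    simp only [hρ]; split_ifs with h
    · rw [abs_abs]; exact (hc x h).trans (le_abs_self c)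
    · simp
  have hφb : ∀ x, |φ x| ≤ 1 := fun x => abs_le.2 ⟨by linarith [hφ0 x], hφ1 x⟩
  have hval : ∀ y, val N n Φ q (roundOf ψ y) ≤ φ y.1.1 - ρ y.2 := by
    intro y
    have h1 : sgnR N n Φ q (roundOf ψ y).2.2 * dot N q (roundOf ψ y).2.2 = ρ y.2 := by
      simp only [hρ]
      rcases sgnR_cases N n Φ q (ψ y.2) with h | h
      · rw [if_pos h.1]; exact h.2.2
      · rw [if_neg h.1]; change sgnR N n Φ q (ψ y.2) * _ = 0; rw [h.2, zero_mul]
    rw [val, h1]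
    refine sub_le_sub_right ?_ _
    change (1 - gate N n Φ q (ψ y.1.1)) + gate N n Φ q (ψ y.1.1) * dot N q (ψ y.1.1) ≤ _
    simp only [hφ, gate]
    by_cases hr : InRegion N n Φ (ψ y.1.1)
    · by_cases hq : dot N q (ψ y.1.1) < 1
      · rw [if_pos ⟨hr, hq⟩, if_pos hr]
        have := le_abs_self (dot N q (ψ y.1.1))
        simp only [sub_self, zero_add, one_mul]
        exact le_min hq.le this
      · rw [if_neg (fun h => hq h.2), if_pos hr]
        have h2 : 1 ≤ |dot N q (ψ y.1.1)| := (not_lt.1 hq).trans (le_abs_self _)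
        simp [min_eq_left h2]
    · rw [if_neg (fun h => hr h.1), if_neg hr]; simp
  have hvm : Measurable fun y => val N n Φ q (roundOf ψ y) :=
    measurable_val N n measurable_const measurable_const (measurable_roundOf hψ)
  have i1 : Integrable (fun y : (X × Bool) × X => φ y.1.1) (E.prod D) :=
    integrable_of_abs_le (hφm.comp measurable_fst.fst) fun y => hφb _
  have i2 : Integrable (fun y : (X × Bool) × X => ρ y.2) (E.prod D) :=
    integrable_of_abs_le (hρm.comp measurable_snd) fun y => hρb _
  have hvb : ∀ y, |val N n Φ q (roundOf ψ y)| ≤ 1 + 2 * |c| := by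
    intro y
    have hg : |(1 - gate N n Φ q (ψ y.1.1)) + gate N n Φ q (ψ y.1.1) * dot N q (ψ y.1.1)| ≤
        1 + |c| := by
      rcases gate_cases N n Φ q (ψ y.1.1) with h | h
      · rw [h.1]
        have := (hc _ h.2.1).trans (le_abs_self c)
        simp only [sub_self, zero_add, one_mul]
        linarith
      · rw [h]; simp
    have hs : |sgnR N n Φ q (ψ y.2) * dot N q (ψ y.2)| ≤ |c| := by
      rcases sgnR_cases N n Φ q (ψ y.2) with h | h
      · rw [h.2.2, abs_abs]; exact (hc _ h.1).trans (le_abs_self c)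
      · rw [h.2]; simp
    have := abs_sub ((1 - gate N n Φ q (ψ y.1.1)) + gate N n Φ q (ψ y.1.1) * dot N q (ψ y.1.1))
      (sgnR N n Φ q (ψ y.2) * dot N q (ψ y.2))
    change |((1 - gate N n Φ q (ψ y.1.1)) + gate N n Φ q (ψ y.1.1) * dot N q (ψ y.1.1)) -
      (sgnR N n Φ q (ψ y.2) * dot N q (ψ y.2))| ≤ _
    linarith
  have hEf : IsProbabilityMeasure (E.map Prod.fst) :=
    Measure.isProbabilityMeasure_map measurable_fst.aemeasurable
  calc ∫ y, val N n Φ q (roundOf ψ y) ∂(E.prod D)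
      ≤ ∫ y : (X × Bool) × X, (φ y.1.1 - ρ y.2) ∂(E.prod D) :=
        integral_mono (integrable_of_abs_le hvm hvb) (i1.sub i2) hval
    _ = ∫ x, φ x ∂(E.map Prod.fst) - ∫ x, ρ x ∂D := by
        rw [integral_sub i1 i2]
        congr 1
        · rw [integral_prod _ i1, integral_map measurable_fst.aemeasurable hφm.aestronglyMeasurable]
          simp
        · rw [integral_prod _ i2]; simp
    _ ≤ (∫ x, φ x ∂D + τ) - ∫ x, ρ x ∂D :=
        sub_le_sub_right (integral_le_add_of_tvDist_le _ _ htv hφm hφ0 hφ1) _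
    _ = τ + ∫ x, (φ x - ρ x) ∂D := by
        rw [integral_sub (integrable_of_abs_le hφm hφb) (integrable_of_abs_le hρm hρb)]; ring
    _ ≤ τ + ∫ x, Set.indicator {x | ¬ InRegion N n Φ (ψ x)} 1 x ∂D := by
        refine add_le_add_right (integral_mono ((integrable_of_abs_le hφm hφb).sub
          (integrable_of_abs_le hρm hρb)) ((integrable_const 1).indicator hG.compl) fun x => ?_) _
        simp only [hφ, hρ, Set.indicator_apply]
        by_cases h : InRegion N n Φ (ψ x)
        · simp [h]
        · simp [h]
    _ = _ := by rw [integral_indicator_one hGc]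

end Block

/-! ### Failure probability of one block -/

section Block

variable {d : ℕ} {X : Set (Fin d → ℝ)}

/-- The state of the online algorithm after `t` rounds on the data of a block. -/
def blockState (N n T : ℕ) (η : ℝ) (ψ : X → ℕ → ℝ) (a : (X × Bool) × X)
    (β : (Fin n → X) × (Fin T → (X × Bool) × X)) (t : ℕ) : (ℕ → ℝ) × (ℕ → ℝ) :=
  runFrom N n (extend 0 fun r => ψ (β.1 r)) η 0 (fun i => roundOf ψ (extend a β.2 i)) t

/-- The test statistic on the data of a block. -/
def blockStat (N n T : ℕ) (η : ℝ) (ψ : X → ℕ → ℝ) (a : (X × Bool) × X)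
    (β : (Fin n → X) × (Fin T → (X × Bool) × X)) : ℝ :=
  ∑ t ∈ Finset.range T, val N n (extend 0 fun r => ψ (β.1 r)) (blockState N n T η ψ a β t).1
    (roundOf ψ (extend a β.2 t))

/-- The initial state of the dynamical system given by the reference examples. -/
def blockInit {n : ℕ} (ψ : X → ℕ → ℝ) (R : Fin n → X) : (ℕ → ℕ → ℝ) × ((ℕ → ℝ) × (ℕ → ℝ)) :=
  (extend 0 fun r => ψ (R r), 0)

theorem measurable_blockInit {n : ℕ} {ψ : X → ℕ → ℝ} (hψ : Measurable ψ) :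
    Measurable (blockInit (n := n) ψ) := by
  have h : Measurable fun R : Fin n → X => fun r => ψ (R r) :=
    measurable_pi_iff.2 fun r => hψ.comp (measurable_pi_apply r)
  exact ((measurable_extend 0 n).comp h).prodMk measurable_const

theorem trajectory_blockInit (N n T : ℕ) (η : ℝ) (ψ : X → ℕ → ℝ) (a : (X × Bool) × X)
    (β : (Fin n → X) × (Fin T → (X × Bool) × X)) (t : ℕ) :
    trajectory (blockStep N n η ψ) (blockInit ψ β.1) (extend a β.2) t =
      (extend 0 fun r => ψ (β.1 r), blockState N n T η ψ a β t) :=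
  trajectory_blockStep N n η ψ _ _ _ t

open Classical in
/-- The contribution of a round to the statistic, where the state is bounded. -/
def clippedVal (N n : ℕ) (ψ : X → ℕ → ℝ) (c : ℝ) (s : (ℕ → ℕ → ℝ) × ((ℕ → ℝ) × (ℕ → ℝ)))
    (y : (X × Bool) × X) : ℝ :=
  if ip N n s.1 s.2.1 s.2.1 ≤ c then val N n s.1 s.2.1 (roundOf ψ y) else 0

theorem measurable_clippedVal (N n : ℕ) {ψ : X → ℕ → ℝ} (hψ : Measurable ψ) (c : ℝ) :
    Measurable fun p : ((ℕ → ℕ → ℝ) × ((ℕ → ℝ) × (ℕ → ℝ))) × ((X × Bool) × X) =>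
      clippedVal N n ψ c p.1 p.2 :=
  Measurable.ite (measurableSet_le (measurable_ip N n measurable_fst.fst measurable_fst.snd.fst
      measurable_fst.snd.fst) measurable_const)
    (measurable_val N n measurable_fst.fst measurable_fst.snd.fst
      ((measurable_roundOf hψ).comp measurable_snd)) measurable_const

theorem abs_dot_le_sqrt {N n : ℕ} {Φ : ℕ → ℕ → ℝ} {q φ : ℕ → ℝ} {c : ℝ} (h : ip N n Φ q q ≤ c)
    (hφ : InRegion N n Φ φ) : |dot N q φ| ≤ √c :=
  Real.abs_le_sqrt ((sq_dot_le_of_inRegion hφ q).trans h)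

/-- The martingale bound needs increments bounded at every state, reachable or not, which is the
purpose of the clipping. In the region the value of a polynomial is at most its norm. -/
theorem abs_clippedVal_le (N n : ℕ) (ψ : X → ℕ → ℝ) (c : ℝ)
    (s : (ℕ → ℕ → ℝ) × ((ℕ → ℝ) × (ℕ → ℝ))) (y : (X × Bool) × X) :
    |clippedVal N n ψ c s y| ≤ 1 + 2 * √c := by
  have hc := Real.sqrt_nonneg c
  unfold clippedVal
  split_ifs with hs
  · have hg : |(1 - gate N n s.1 s.2.1 (ψ y.1.1)) + gate N n s.1 s.2.1 (ψ y.1.1) *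
        dot N s.2.1 (ψ y.1.1)| ≤ 1 + √c := by
      rcases gate_cases N n s.1 s.2.1 (ψ y.1.1) with h | h
      · rw [h.1]
        have := abs_dot_le_sqrt hs h.2.1
        simp only [sub_self, zero_add, one_mul]
        linarith
      · rw [h]; simp
    have hs' : |sgnR N n s.1 s.2.1 (ψ y.2) * dot N s.2.1 (ψ y.2)| ≤ √c := by
      rcases sgnR_cases N n s.1 s.2.1 (ψ y.2) with h | h
      · rw [h.2.2, abs_abs]; exact abs_dot_le_sqrt hs h.1
      · rw [h.2]; simp
    have := abs_sub ((1 - gate N n s.1 s.2.1 (ψ y.1.1)) + gate N n s.1 s.2.1 (ψ y.1.1) *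
      dot N s.2.1 (ψ y.1.1)) (sgnR N n s.1 s.2.1 (ψ y.2) * dot N s.2.1 (ψ y.2))
    change |((1 - gate N n s.1 s.2.1 (ψ y.1.1)) + gate N n s.1 s.2.1 (ψ y.1.1) *
      dot N s.2.1 (ψ y.1.1)) - (sgnR N n s.1 s.2.1 (ψ y.2) * dot N s.2.1 (ψ y.2))| ≤ _
    linarith
  · rw [abs_zero]; linarith

/-- The excess of the error of `f` over the average loss. -/
def lossGap (N n : ℕ) (ψ : X → ℕ → ℝ) (f : X → Bool) (s : (ℕ → ℕ → ℝ) × ((ℕ → ℝ) × (ℕ → ℝ)))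
    (y : (X × Bool) × X) : ℝ :=
  errInd f y.1 - thrLoss n (dot N s.2.2 (ψ y.1.1)) y.1.2

theorem errInd_nonneg (f : X → Bool) (z : X × Bool) : 0 ≤ errInd f z := by
  unfold errInd; split_ifs <;> norm_num

theorem errInd_le_one (f : X → Bool) (z : X × Bool) : errInd f z ≤ 1 := by
  unfold errInd; split_ifs <;> norm_num

theorem abs_lossGap_le (N n : ℕ) (ψ : X → ℕ → ℝ) (f : X → Bool)
    (s : (ℕ → ℕ → ℝ) × ((ℕ → ℝ) × (ℕ → ℝ))) (y : (X × Bool) × X) :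
    |lossGap N n ψ f s y| ≤ 1 := by
  have h1 := errInd_nonneg f y.1
  have h2 := errInd_le_one f y.1
  have h3 := thrLoss_nonneg n (dot N s.2.2 (ψ y.1.1)) y.1.2
  have h4 := thrLoss_le_one n (dot N s.2.2 (ψ y.1.1)) y.1.2
  rw [lossGap, abs_le]
  constructor <;> linarith

theorem measurable_errInd_hyp {α : Type*} [MeasurableSpace α] (N : ℕ) {ψ : X → ℕ → ℝ}
    (hψ : Measurable ψ) {p : α → ℕ → ℝ} {z : α → X × Bool} (θ : ℝ) (hp : Measurable p)
    (hz : Measurable z) : Measurable fun a => errInd (hyp N ψ (p a) θ) (z a) := by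
  have h1 : MeasurableSet {a | θ < dot N (p a) (ψ (z a).1)} :=
    measurableSet_lt measurable_const (measurable_dot N hp (hψ.comp hz.fst))
  have h2 : Measurable fun a => hyp N ψ (p a) θ (z a).1 := by
    refine measurable_to_bool ?_
    convert! h1 using 1
    ext a; simp [hyp]
  exact Measurable.ite (measurableSet_eq_fun hz.snd h2) measurable_const measurable_const

theorem measurable_lossGap (N n : ℕ) {ψ : X → ℕ → ℝ} (hψ : Measurable ψ) {f : X → Bool}
    (hf : Measurable f) :
    Measurable fun p : ((ℕ → ℕ → ℝ) × ((ℕ → ℝ) × (ℕ → ℝ))) × ((X × Bool) × X) =>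
      lossGap N n ψ f p.1 p.2 := by
  refine ((measurable_errInd hf).comp measurable_snd.fst).sub ?_
  have e : ∀ p : ((ℕ → ℕ → ℝ) × ((ℕ → ℝ) × (ℕ → ℝ))) × ((X × Bool) × X),
      thrLoss n (dot N p.1.2.2 (ψ p.2.1.1)) p.2.1.2 =
        (∑ j ∈ Finset.range n, errInd (hyp N ψ p.1.2.2 (thr n j)) p.2.1) / n := fun p =>
    thrLoss_eq n N ψ p.1.2.2 p.2.1
  simp only [e]
  exact (Finset.measurable_sum _ fun j _ => measurable_errInd_hyp N hψ _ measurable_fst.snd.snd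
    measurable_snd.fst).div_const _

theorem integral_lossGap (N n : ℕ) {ψ : X → ℕ → ℝ} (hψ : Measurable ψ) {f : X → Bool}
    (hf : Measurable f) (E : Measure (X × Bool)) [IsProbabilityMeasure E] (D : Measure X)
    [IsProbabilityMeasure D] (s : (ℕ → ℕ → ℝ) × ((ℕ → ℝ) × (ℕ → ℝ))) :
    ∫ y, lossGap N n ψ f s y ∂(E.prod D) = errorRate E f -
      (∑ j ∈ Finset.range n, errorRate E (hyp N ψ s.2.2 (thr n j))) / n := by
  have hm : Measurable fun y => lossGap N n ψ f s y :=
    (measurable_lossGap N n hψ hf).comp (measurable_const.prodMk measurable_id)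
  rw [integral_prod _ (integrable_of_abs_le hm (abs_lossGap_le N n ψ f s))]
  have hl : Measurable fun z : X × Bool => thrLoss n (dot N s.2.2 (ψ z.1)) z.2 := by
    simp only [thrLoss_eq]
    exact (Finset.measurable_sum _ fun j _ => measurable_errInd (measurable_hyp N hψ _ _)).div_const _
  simp only [lossGap, integral_const, probReal_univ, smul_eq_mul, one_mul]
  rw [integral_sub, integral_errInd E hf, integral_thrLoss E n N hψ]
  · exact integrable_of_abs_le (measurable_errInd hf) (c := 1) fun z =>
      abs_le.2 ⟨by linarith [errInd_nonneg f z], errInd_le_one f z⟩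
  · exact integrable_of_abs_le hl (c := 1) fun z =>
      abs_le.2 ⟨by linarith [thrLoss_nonneg n (dot N s.2.2 (ψ z.1)) z.2], thrLoss_le_one _ _ _⟩

/-- A block is good for the comparison function `f`. -/
def BlockGood (N n T : ℕ) (η ε τ : ℝ) (ψ : X → ℕ → ℝ) (a : (X × Bool) × X) (D : Measure X)
    (E : Measure (X × Bool)) (f : X → Bool) (β : (Fin n → X) × (Fin T → (X × Bool) × X)) : Prop :=
  (¬ T * (τ + ε / 8) < blockStat N n T η ψ a β → ∃ t < T, ∃ j < n,
    errorRate E (hyp N ψ (blockState N n T η ψ a β t).2 (thr n j)) ≤ errorRate E f + τ + 9 * ε / 32) ∧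
  (tvDist (E.map Prod.fst) D ≤ τ → ¬ T * (τ + ε / 8) < blockStat N n T η ψ a β)

/-- The exceptional event of a block. -/
def blockExc (N n T : ℕ) (η ε Q : ℝ) (ψ : X → ℕ → ℝ) (a : (X × Bool) × X) (D : Measure X)
    (E : Measure (X × Bool)) (f : X → Bool) (uq up : ℕ → ℝ) :
    Set ((Fin n → X) × (Fin T → (X × Bool) × X)) :=
  {R | ε / 16 ≤ D.real {x | ¬ InRegion N n (extend 0 fun r => ψ (R r)) (ψ x)}} ×ˢ Set.univ ∪
  ({R | 2048 * n * Q ≤ ∑ r, dot N uq (ψ (R r)) ^ 2} ×ˢ Set.univ ∪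
  ({R | 2048 * n * Q ≤ ∑ r, dot N up (ψ (R r)) ^ 2} ×ˢ Set.univ ∪
  (Set.univ ×ˢ {z | T * (ε / 16) ≤ ∑ t, |dot N uq (ψ (z t).2)|} ∪
  ({β | T * (ε / 16) ≤ trajSum (blockStep N n η ψ)
      (fun s y => lossGap N n ψ f s y - ∫ y', lossGap N n ψ f s y' ∂(E.prod D))
      (blockInit ψ β.1) (extend a β.2) T} ∪
  {β | T * (ε / 16) ≤ trajSum (blockStep N n η ψ)
      (fun s y => clippedVal N n ψ (6 * η * T) s y -
        ∫ y', clippedVal N n ψ (6 * η * T) s y' ∂(E.prod D))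
      (blockInit ψ β.1) (extend a β.2) T}))))

theorem sum_extend {Y : Type*} (a : Y) {n : ℕ} (z : Fin n → Y) (g : Y → ℝ) :
    ∑ t ∈ Finset.range n, g (extend a z t) = ∑ t, g (z t) := by
  rw [Finset.sum_range]
  exact Finset.sum_congr rfl fun t _ => by rw [extend_lt a z t.2]

/-- Outside the exceptional event the argument is deterministic: the regret bounds give soundness,
the bound on conditional means gives completeness, and the two martingale events transfer between
sums and means. -/
theorem blockGood_of_notMem {N n T : ℕ} {η ε τ Q : ℝ} {ψ : X → ℕ → ℝ} (hψ : Measurable ψ)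
    (a : (X × Bool) × X) (D : Measure X) [IsProbabilityMeasure D] (E : Measure (X × Bool))
    [IsProbabilityMeasure E] {f : X → Bool} (hf : Measurable f) {uq up : ℕ → ℝ}
    (hs : ∀ x, dot N up (ψ x) ≤ labelValue (f x) ∧
      labelValue (f x) ≤ dot N up (ψ x) + dot N uq (ψ x)) (hn : 0 < n)
    (hT : 0 < T) (hη : 0 < η) (hη1 : η ≤ 1) (hU : 2048 * n * Q / (2 * η) ≤ T * (ε / 128))
    (hη2 : 2 * η ≤ ε / 128) (hn2 : 1 / n ≤ ε / 128) {β : (Fin n → X) × (Fin T → (X × Bool) × X)}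
    (hβ : β ∉ blockExc N n T η ε Q ψ a D E f uq up) :
    BlockGood N n T η ε τ ψ a D E f β := by
  simp only [blockExc, Set.mem_union, Set.mem_prod, Set.mem_ofPred_eq, Set.mem_univ, and_true,
    true_and, not_or, not_le] at hβ
  obtain ⟨h1, h2, h3, h4, h5, h6⟩ := hβ
  set Φ : ℕ → ℕ → ℝ := extend 0 fun r => ψ (β.1 r) with hΦ
  set z : ℕ → (X × Bool) × X := extend a β.2 with hz
  set st := blockState N n T η ψ a β with hst
  have hT' : (0 : ℝ) < T := by exact_mod_cast hT
  have hn' : (0 : ℝ) < n := by exact_mod_cast hn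
  have htr : ∀ t, trajectory (blockStep N n η ψ) (blockInit ψ β.1) z t = (Φ, st t) :=
    trajectory_blockInit N n T η ψ a β
  have hip : ∀ u, ip N n Φ u u = ∑ r, dot N u (ψ (β.1 r)) ^ 2 := by
    intro u
    rw [ip_self_eq, Finset.sum_range]
    exact Finset.sum_congr rfl fun r _ => by rw [hΦ, extend_lt _ _ r.2]
  simp only [trajSum, htr, Finset.sum_sub_distrib] at h5 h6
  constructor
  · intro hpass
    have hloss := sum_thrLoss_le (T := T) (τ := τ) (ε := ε) (U := 2048 * n * Q) hn hη f uq up hs Φ z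
      (not_lt.1 hpass)
      (by rw [hz, sum_extend a β.2 fun y => |dot N uq (ψ y.2)|]; exact h4.le)
      (by rw [hip]; exact h2.le) (by rw [hip]; exact h3.le) hU hη2 hn2
    change ∑ t ∈ Finset.range T, thrLoss n (dot N (st t).2 (ψ (z t).1.1)) (z t).1.2 ≤ _ at hloss
    simp only [integral_lossGap N n hψ hf] at h5
    -- If all rounds and thresholds had large error, so would their average, against the bound on
    -- the conditional means. `9/32` is the `7/32` of the loss bound plus the martingale deviation
    -- `1/16`.
    by_contra hcon
    push Not at hcon
    have hlow : ∑ t ∈ Finset.range T, (errorRate E f + τ + 9 * ε / 32) ≤ ∑ t ∈ Finset.range T,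
        (∑ j ∈ Finset.range n, errorRate E (hyp N ψ (st t).2 (thr n j))) / n := by
      refine Finset.sum_le_sum fun t ht => ?_
      rw [le_div_iff₀ hn']
      calc (errorRate E f + τ + 9 * ε / 32) * n
          = ∑ j ∈ Finset.range n, (errorRate E f + τ + 9 * ε / 32) := by
            rw [Finset.sum_const, Finset.card_range, nsmul_eq_mul, mul_comm]
        _ ≤ _ := Finset.sum_le_sum fun j hj =>
            (hcon t (Finset.mem_range.1 ht) j (Finset.mem_range.1 hj)).le
    simp only [lossGap, Finset.sum_sub_distrib, Finset.sum_const, Finset.card_range,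
      nsmul_eq_mul] at h5 hlow
    linarith
  · intro htv
    rw [not_lt]
    -- Reachable states satisfy the a priori norm bound, so clipping has no effect along the run.
    have hst2 : ∀ t < T, ip N n Φ (st t).1 (st t).1 ≤ 6 * η * T := by
      intro t ht
      refine (ip_runFrom_fst_le N n Φ hη.le hη1 _ t).trans ?_
      have : (t : ℝ) ≤ T := by exact_mod_cast ht.le
      gcongr
    have hmean : ∀ t ∈ Finset.range T,
        ∫ y', clippedVal N n ψ (6 * η * T) (Φ, st t) y' ∂(E.prod D) ≤ τ + ε / 16 := by
      intro t ht
      have e : ∀ y', clippedVal N n ψ (6 * η * T) (Φ, st t) y' =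
          val N n Φ (st t).1 (roundOf ψ y') := fun y' => if_pos (hst2 t (Finset.mem_range.1 ht))
      simp only [e]
      have := integral_val_le hψ D E htv Φ (st t).1 (c := √(6 * η * T)) fun x hx =>
        abs_dot_le_sqrt (hst2 t (Finset.mem_range.1 ht)) hx
      linarith
    have hsum := Finset.sum_le_sum hmean
    have hval : ∑ t ∈ Finset.range T, clippedVal N n ψ (6 * η * T) (Φ, st t) (z t) =
        blockStat N n T η ψ a β :=
      Finset.sum_congr rfl fun t ht => if_pos (hst2 t (Finset.mem_range.1 ht))
    rw [hval] at h6
    simp only [Finset.sum_const, Finset.card_range, nsmul_eq_mul] at hsum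
    linarith

/-! ### Probability of the exceptional event of a block -/

theorem measure_prod_univ_le {α γ : Type*} [MeasurableSpace α] [MeasurableSpace γ] (μ : Measure α)
    (ν : Measure γ) [SFinite ν] [IsProbabilityMeasure ν] {A : Set α} {c : ENNReal} (h : μ A ≤ c) :
    μ.prod ν (A ×ˢ Set.univ) ≤ c := by
  rw [Measure.prod_prod, measure_univ, mul_one]; exact h

theorem measure_univ_prod_le {α γ : Type*} [MeasurableSpace α] [MeasurableSpace γ] (μ : Measure α)
    (ν : Measure γ) [SFinite ν] [IsProbabilityMeasure μ] {A : Set γ} {c : ENNReal} (h : ν A ≤ c) :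
    μ.prod ν (Set.univ ×ˢ A) ≤ c := by
  rw [Measure.prod_prod, measure_univ, one_mul]; exact h

/-- Six events of probability at most `1/512` each. The constants are tuned to this: `16384 = 32 *
512` for the region, `2048 = 4 * 512` in Markov's inequality for the norms, `8192 = 16 * 512` for
the sandwiching gap; Chebyshev's inequality handles the two martingales. -/
theorem measure_blockExc_le {N n T : ℕ} {η ε Q : ℝ} {ψ : X → ℕ → ℝ} (hψ : Measurable ψ)
    (a : (X × Bool) × X) (D : Measure X) [IsProbabilityMeasure D] (E : Measure (X × Bool))
    [IsProbabilityMeasure E] {f : X → Bool} (hf : Measurable f) {uq up : ℕ → ℝ} (hε : 0 < ε)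
    (hε1 : ε < 1) (hn : 0 < n) (hN : 16384 * N / ε ≤ n) (hQ : 1 ≤ Q)
    (hT : 8796093022208 * n * Q / ε ^ 3 ≤ T) (hη : η = ε ^ 2 / 67108864)
    (hq1 : ∫⁻ x, ENNReal.ofReal |dot N uq (ψ x)| ∂D ≤ ENNReal.ofReal (ε / 8192))
    (hq2 : ∫⁻ x, ENNReal.ofReal (dot N uq (ψ x) ^ 2) ∂D ≤ ENNReal.ofReal (4 * Q))
    (hp2 : ∫⁻ x, ENNReal.ofReal (dot N up (ψ x) ^ 2) ∂D ≤ ENNReal.ofReal (4 * Q)) :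
    ((Measure.pi fun _ : Fin n => D).prod (Measure.pi fun _ : Fin T => E.prod D))
      (blockExc N n T η ε Q ψ a D E f uq up) ≤ ENNReal.ofReal (1 / 64) := by
  have hn' : (1 : ℝ) ≤ n := by exact_mod_cast hn
  have hTε : 8796093022208 ≤ T * ε ^ 2 := by
    have h1 : 8796093022208 * n * Q ≤ T * ε ^ 3 := by rwa [div_le_iff₀ (by positivity)] at hT
    have h2 : (T : ℝ) * ε ^ 3 ≤ T * ε ^ 2 :=
      mul_le_mul_of_nonneg_left (pow_le_pow_of_le_one hε.le hε1.le (by norm_num)) (Nat.cast_nonneg T)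
    have h3 : 1 ≤ n * Q := one_le_mul_of_one_le_of_one_le hn' hQ
    nlinarith
  have hT' : (0 : ℝ) < T := by
    by_contra h
    have : (T : ℝ) * ε ^ 2 ≤ 0 := mul_nonpos_of_nonpos_of_nonneg (not_lt.1 h) (by positivity)
    linarith
  have hdot : ∀ u, Measurable fun x => dot N u (ψ x) := fun u => measurable_dot N measurable_const hψ
  have b1 : (Measure.pi fun _ : Fin n => D)
      {R | ε / 16 ≤ D.real {x | ¬ InRegion N n (extend 0 fun r => ψ (R r)) (ψ x)}} ≤
      ENNReal.ofReal (1 / 512) := by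
    refine (measure_region_small_le D hψ N n (by positivity)).trans (ENNReal.ofReal_le_ofReal ?_)
    rw [div_le_iff₀ hε] at hN
    rw [div_div, div_le_div_iff₀ (by positivity) (by norm_num)]
    nlinarith
  have b2 : ∀ u, ∫⁻ x, ENNReal.ofReal (dot N u (ψ x) ^ 2) ∂D ≤ ENNReal.ofReal (4 * Q) →
      (Measure.pi fun _ : Fin n => D) {R | 2048 * n * Q ≤ ∑ r, dot N u (ψ (R r)) ^ 2} ≤
      ENNReal.ofReal (1 / 512) := by
    intro u hu
    refine (measure_sum_ge_le D n ((hdot u).pow_const 2) (fun x => sq_nonneg _)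
      (by positivity) hu).trans (ENNReal.ofReal_le_ofReal ?_)
    rw [div_le_div_iff₀ (by positivity) (by norm_num)]
    linarith
  have b4 : (Measure.pi fun _ : Fin T => E.prod D)
      {z | T * (ε / 16) ≤ ∑ t, |dot N uq (ψ (z t).2)|} ≤ ENNReal.ofReal (1 / 512) := by
    have h : ∫⁻ y : (X × Bool) × X, ENNReal.ofReal |dot N uq (ψ y.2)| ∂(E.prod D) ≤
        ENNReal.ofReal (ε / 8192) := by
      have hm : Measurable fun y : (X × Bool) × X => ENNReal.ofReal |dot N uq (ψ y.2)| :=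
        ((hdot uq).abs.ennreal_ofReal).comp measurable_snd
      rw [lintegral_prod _ hm.aemeasurable]
      simpa using hq1
    refine (measure_sum_ge_le (E.prod D) T (g := fun y => |dot N uq (ψ y.2)|)
      ((hdot uq).abs.comp measurable_snd) (fun y => abs_nonneg _)
      (by positivity) h).trans (ENNReal.ofReal_le_ofReal ?_)
    rw [div_le_div_iff₀ (by positivity) (by norm_num)]
    linarith
  have b5 := measure_trajSum_ge_le (Measure.pi fun _ : Fin n => D) (E.prod D) a
    (measurable_blockInit (n := n) hψ) (measurable_blockStep N n η hψ) (measurable_lossGap N n hψ hf)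
    (abs_lossGap_le N n ψ f) T (x := T * (ε / 16)) (by positivity)
  have b6 := measure_trajSum_ge_le (Measure.pi fun _ : Fin n => D) (E.prod D) a
    (measurable_blockInit (n := n) hψ) (measurable_blockStep N n η hψ)
    (measurable_clippedVal N n hψ (6 * η * T)) (abs_clippedVal_le N n ψ (6 * η * T)) T
    (x := T * (ε / 16)) (by positivity)
  have c5 : 4 * T * (1 : ℝ) ^ 2 / (T * (ε / 16)) ^ 2 ≤ 1 / 512 := by
    rw [div_le_div_iff₀ (by positivity) (by norm_num)]
    nlinarith
  -- The increments have squared size of order `1 + η T`, so the variance has order `T + η T ^ 2`,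
  -- to be compared with `(T ε) ^ 2`. This is why the step size must be a small multiple of `ε ^ 2`.
  have c6 : 4 * T * (1 + 2 * √(6 * η * T)) ^ 2 / (T * (ε / 16)) ^ 2 ≤ 1 / 512 := by
    have hη0 : 0 ≤ η := by rw [hη]; positivity
    have hsq : √(6 * η * T) ^ 2 = 6 * η * T := Real.sq_sqrt (by positivity)
    have h1 : (1 + 2 * √(6 * η * T)) ^ 2 ≤ 2 + 48 * η * T := by
      nlinarith [sq_nonneg (1 - 2 * √(6 * η * T))]
    rw [div_le_div_iff₀ (by positivity) (by norm_num)]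
    have h2 : 4 * T * (1 + 2 * √(6 * η * T)) ^ 2 * 512 ≤ 4 * T * (2 + 48 * η * T) * 512 := by
      gcongr
    refine h2.trans ?_
    rw [hη]
    nlinarith [mul_le_mul_of_nonneg_left hTε hT'.le]
  have hsum : ENNReal.ofReal (1 / 512) + (ENNReal.ofReal (1 / 512) + (ENNReal.ofReal (1 / 512) +
      (ENNReal.ofReal (1 / 512) + (ENNReal.ofReal (1 / 512) + ENNReal.ofReal (1 / 512))))) ≤
      ENNReal.ofReal (1 / 64) := by
    have h : ∀ a : ℝ, 0 ≤ a → ENNReal.ofReal (1 / 512) + ENNReal.ofReal a =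
        ENNReal.ofReal (1 / 512 + a) := fun a ha => (ENNReal.ofReal_add (by norm_num) ha).symm
    rw [h _ (by norm_num), h _ (by norm_num), h _ (by norm_num), h _ (by norm_num),
      h _ (by norm_num)]
    exact ENNReal.ofReal_le_ofReal (by norm_num)
  refine le_trans ?_ hsum
  refine (measure_union_le _ _).trans (add_le_add (measure_prod_univ_le _ _ b1) ?_)
  refine (measure_union_le _ _).trans (add_le_add (measure_prod_univ_le _ _ (b2 uq hq2)) ?_)
  refine (measure_union_le _ _).trans (add_le_add (measure_prod_univ_le _ _ (b2 up hp2)) ?_)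
  refine (measure_union_le _ _).trans (add_le_add (measure_univ_prod_le _ _ b4) ?_)
  refine (measure_union_le _ _).trans (add_le_add ?_ ?_)
  · exact b5.trans (ENNReal.ofReal_le_ofReal c5)
  · exact b6.trans (ENNReal.ofReal_le_ofReal c6)

end Block

/-! ### Failure probability of the validation and of the algorithm -/

section Valid

variable {d : ℕ} {X : Set (Fin d → ℝ)}

theorem measure_errInd_deviation_le (E : Measure (X × Bool)) [IsProbabilityMeasure E] (K : ℕ)
    {f : X → Bool} (hf : Measurable f) {x : ℝ} (hx : 0 ≤ x) :
    (Measure.pi fun _ : Fin K => E) {v | K * x ≤ |∑ i, errInd f (v i) - K * errorRate E f|} ≤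
      ENNReal.ofReal (2 * Real.exp (-(2 * K * x ^ 2))) := by
  have hs : MeasurableSet {z : X × Bool | z.2 ≠ f z.1} :=
    (measurableSet_eq_fun measurable_snd (hf.comp measurable_fst)).compl
  refine le_trans (measure_mono fun v hv => ?_) (measure_count_deviation_le E K hs hx)
  have e : ∑ i, errInd f (v i) =
      ((Finset.univ.filter fun i => v i ∈ {z : X × Bool | z.2 ≠ f z.1}).card : ℝ) := by
    rw [Finset.card_filter, Nat.cast_sum]
    refine Finset.sum_congr rfl fun i _ => ?_
    by_cases h : (v i).2 = f (v i).1 <;> simp [errInd, h]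
  rw [Set.mem_ofPred_eq, e, errorRate] at hv
  rw [Set.mem_ofPred_eq]
  convert! hv using 5
  ext i; simp

theorem measurable_errorRate_hyp (E : Measure (X × Bool)) [IsProbabilityMeasure E] (N : ℕ)
    {ψ : X → ℕ → ℝ} (hψ : Measurable ψ) (θ : ℝ) :
    Measurable fun p : ℕ → ℝ => errorRate E (hyp N ψ p θ) := by
  have h : Measurable fun q : (ℕ → ℝ) × (X × Bool) => errInd (hyp N ψ q.1 θ) q.2 :=
    measurable_errInd_hyp N hψ θ measurable_fst measurable_snd
  have := (h.stronglyMeasurable.integral_prod_right' (ν := E)).measurable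
  simpa only [integral_errInd E (measurable_hyp N hψ _ θ)] using this

/-- The candidate depends only on the block data, which are independent of the validation examples.
It is therefore a fixed hypothesis once the block data are fixed, and Hoeffding's inequality applies
conditionally. -/
theorem measure_prod_errInd_deviation_le (E : Measure (X × Bool)) [IsProbabilityMeasure E] (K : ℕ)
    {N : ℕ} {ψ : X → ℕ → ℝ} (hψ : Measurable ψ) {α : Type*} [MeasurableSpace α] (μ : Measure α)
    [IsProbabilityMeasure μ] {p : α → ℕ → ℝ} (hp : Measurable p) (θ : ℝ) {x : ℝ} (hx : 0 ≤ x) :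
    μ.prod (Measure.pi fun _ : Fin K => E) {q | K * x ≤
      |∑ i, errInd (hyp N ψ (p q.1) θ) (q.2 i) - K * errorRate E (hyp N ψ (p q.1) θ)|} ≤
      ENNReal.ofReal (2 * Real.exp (-(2 * K * x ^ 2))) := by
  have hm : MeasurableSet {q : α × (Fin K → X × Bool) | K * x ≤
      |∑ i, errInd (hyp N ψ (p q.1) θ) (q.2 i) - K * errorRate E (hyp N ψ (p q.1) θ)|} := by
    refine measurableSet_le measurable_const (Measurable.abs (Measurable.sub ?_ ?_))
    · exact Finset.measurable_sum _ fun j _ => measurable_errInd_hyp N hψ _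
        (hp.comp measurable_fst) ((measurable_pi_apply j).comp measurable_snd)
    · exact ((measurable_errorRate_hyp E N hψ _).comp (hp.comp measurable_fst)).const_mul _
  rw [Measure.prod_apply hm]
  refine (lintegral_mono fun β => measure_errInd_deviation_le E K
    (measurable_hyp N hψ (p β) θ) hx).trans ?_
  rw [lintegral_const, measure_univ, mul_one]

theorem measurable_blockState (N n T : ℕ) (η : ℝ) {ψ : X → ℕ → ℝ} (hψ : Measurable ψ)
    (a : (X × Bool) × X) (t : ℕ) :
    Measurable fun β : (Fin n → X) × (Fin T → (X × Bool) × X) => blockState N n T η ψ a β t := by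
  have h : Measurable fun β : (Fin n → X) × (Fin T → (X × Bool) × X) =>
      (trajectory (blockStep N n η ψ) (blockInit ψ β.1) (extend a β.2) t).2 :=
    ((measurable_trajectory (measurable_blockStep N n η hψ) t).comp
      (((measurable_blockInit hψ).comp measurable_fst).prodMk
        ((measurable_extend a T).comp measurable_snd))).snd
  simpa only [trajectory_blockInit N n T η ψ a] using h

/-- The event that the number of errors of some candidate on the validation examples is far from
its expectation. -/
def validExc (k N n T : ℕ) (η ε : ℝ) (ψ : X → ℕ → ℝ) (a : (X × Bool) × X) (E : Measure (X × Bool)) :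
    Set ((Fin k → (Fin n → X) × (Fin T → (X × Bool) × X)) × (Fin (k * T) → X × Bool)) :=
  ⋃ i : Fin k × Fin T × Fin n, {p | ((k * T : ℕ) : ℝ) * (ε / 8) ≤
    |∑ j, errInd (hyp N ψ (blockState N n T η ψ a (p.1 i.1) i.2.1).2 (thr n i.2.2)) (p.2 j) -
      ((k * T : ℕ) : ℝ) *
        errorRate E (hyp N ψ (blockState N n T η ψ a (p.1 i.1) i.2.1).2 (thr n i.2.2))|}

theorem measure_validExc_le {k N n T : ℕ} {η ε : ℝ} {ψ : X → ℕ → ℝ} (hψ : Measurable ψ)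
    (a : (X × Bool) × X) (E : Measure (X × Bool)) [IsProbabilityMeasure E] (hε : 0 < ε)
    (μ : Measure (Fin k → (Fin n → X) × (Fin T → (X × Bool) × X))) [IsProbabilityMeasure μ] :
    μ.prod (Measure.pi fun _ : Fin (k * T) => E) (validExc k N n T η ε ψ a E) ≤
      ENNReal.ofReal ((k * (T * n) : ℕ) * (2 * Real.exp (-(2 * (k * T : ℕ) * (ε / 8) ^ 2)))) := by
  refine (measure_iUnion_fintype_le _ _).trans ?_
  refine (Finset.sum_le_sum fun i _ => measure_prod_errInd_deviation_le E (k * T) hψ μ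
    (p := fun β => (blockState N n T η ψ a (β i.1) i.2.1).2) ?_ (thr n i.2.2)
    (x := ε / 8) (by positivity)).trans ?_
  · exact ((measurable_blockState N n T η hψ a i.2.1).comp (measurable_pi_apply i.1)).snd
  rw [Finset.sum_const, Finset.card_univ, Fintype.card_prod, Fintype.card_prod, Fintype.card_fin,
    Fintype.card_fin, Fintype.card_fin, nsmul_eq_mul, ENNReal.ofReal_mul (Nat.cast_nonneg _),
    ENNReal.ofReal_natCast]

/-- With `b = T ε ^ 2 / 32` the Hoeffding exponent is `k b`. Half of it pays for `k 2 ^ k` and the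
other half for the `2 T n` candidates of a block, which are polynomial in `b`; the remainder is `2 ^
(-k) ≤ δ / 2`. -/
theorem union_bound_le {k n T : ℕ} {ε δ Q : ℝ} (hk : 1 ≤ k) (hn : 1 ≤ n) (hε : 0 < ε) (hε1 : ε < 1)
    (hQ : 1 ≤ Q) (hδ : (1 / 2) ^ k ≤ δ / 2) (hT : 8796093022208 * n * Q / ε ^ 3 ≤ T) :
    ((k * (T * n) : ℕ) : ℝ) * (2 * Real.exp (-(2 * (k * T : ℕ) * (ε / 8) ^ 2))) ≤ δ / 2 := by
  have hn' : (1 : ℝ) ≤ n := by exact_mod_cast hn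
  have hk' : (1 : ℝ) ≤ k := by exact_mod_cast hk
  set b : ℝ := T * ε ^ 2 / 32 with hb
  have hTε : 8796093022208 * n * Q ≤ T * ε ^ 2 * ε := by
    rw [div_le_iff₀ (by positivity)] at hT
    linarith [hT, show (T : ℝ) * ε ^ 3 = T * ε ^ 2 * ε by ring]
  have hbε : 2 ^ 38 * n ≤ b * ε := by
    have : 8796093022208 * (n : ℝ) ≤ 8796093022208 * n * Q := le_mul_of_one_le_right (by positivity) hQ
    rw [hb]; linarith
  have hb0 : 0 ≤ b := by positivity
  have hbn : 2 ^ 38 * (n : ℝ) ≤ b := hbε.trans (mul_le_of_le_one_right hb0 hε1.le)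
  have hb1 : 2 ^ 38 ≤ b := by linarith
  -- The candidates must be counted in terms of `b` alone; the small `ε` is removed using that `b ε`
  -- is large.
  have hTb : (T : ℝ) ≤ b ^ 3 := by
    have h1 : 1 ≤ b * ε := by linarith
    have h2 : (1 : ℝ) ≤ (b * ε) ^ 2 := one_le_pow₀ h1
    have h3 : (T : ℝ) * ε ^ 2 = 32 * b := by rw [hb]; ring
    have h4 : 32 * b ≤ b ^ 3 * ε ^ 2 := by
      have : b ^ 3 * ε ^ 2 = b * (b * ε) ^ 2 := by ring
      rw [this]
      have h5 : 32 ≤ (b * ε) ^ 2 := by nlinarith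
      nlinarith
    exact le_of_mul_le_mul_right (h3.trans_le h4) (by positivity)
  -- The term of order five of the exponential series suffices, as `b` is huge.
  have hexp : 2 * b ^ 4 ≤ Real.exp (b / 4) := by
    have := Real.pow_div_factorial_le_exp (b / 4) (by positivity) 5
    refine le_trans ?_ this
    have e : (b / 4) ^ 5 / (Nat.factorial 5 : ℕ) = b ^ 4 * (b / 122880) := by
      norm_num [Nat.factorial]; ring
    rw [e, mul_comm 2]
    gcongr
    linarith
  have hk2 : (k : ℝ) * 2 ^ k ≤ Real.exp (k * (b / 2)) := by
    have h1 : (k : ℝ) ≤ Real.exp k := by linarith [Real.add_one_le_exp (k : ℝ)]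
    have h2 : (2 : ℝ) ^ k ≤ Real.exp k := by
      rw [← mul_one (k : ℝ), Real.exp_nat_mul]
      gcongr
      linarith [Real.add_one_le_exp (1 : ℝ)]
    calc (k : ℝ) * 2 ^ k ≤ Real.exp k * Real.exp k := by gcongr
      _ = Real.exp (k * 2) := by rw [← Real.exp_add]; congr 1; ring
      _ ≤ _ := Real.exp_le_exp.2 (by gcongr; linarith)
  have hmain : (k : ℝ) * (T * n) * 2 * 2 ^ k ≤ Real.exp (k * b) := by
    have h1 : (T : ℝ) * n * 2 ≤ 2 * b ^ 4 := by
      have : (T : ℝ) * n ≤ b ^ 3 * b := mul_le_mul hTb (by linarith) (by positivity) (by positivity)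
      nlinarith
    calc (k : ℝ) * (T * n) * 2 * 2 ^ k = (k * 2 ^ k) * (T * n * 2) := by ring
      _ ≤ Real.exp (k * (b / 2)) * Real.exp (k * (b / 2)) := by
        refine mul_le_mul hk2 ((h1.trans hexp).trans (Real.exp_le_exp.2 ?_)) (by positivity)
          (by positivity)
        nlinarith
      _ = _ := by rw [← Real.exp_add]; congr 1; ring
  have hx : 2 * ((k * T : ℕ) : ℝ) * (ε / 8) ^ 2 = k * b := by push_cast; rw [hb]; ring
  rw [hx, Real.exp_neg]
  push_cast
  calc (k : ℝ) * (T * n) * (2 * (Real.exp (k * b))⁻¹) =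
        (k * (T * n) * 2 * 2 ^ k) * ((1 / 2) ^ k) / Real.exp (k * b) := by
        rw [one_div, inv_pow]; field_simp
    _ ≤ Real.exp (k * b) * (1 / 2) ^ k / Real.exp (k * b) := by gcongr
    _ = (1 / 2) ^ k := by field_simp
    _ ≤ _ := hδ

open Classical in
/-- The exceptional event of the algorithm. -/
def runExc (k N n T : ℕ) (η ε Q : ℝ) (ψ : X → ℕ → ℝ) (a : (X × Bool) × X) (D : Measure X)
    (E : Measure (X × Bool)) (f : X → Bool) (uq up : ℕ → ℝ) :
    Set ((Fin k → (Fin n → X) × (Fin T → (X × Bool) × X)) × (Fin (k * T) → X × Bool)) :=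
  {β | k ≤ 2 * (Finset.univ.filter fun b => β b ∈ blockExc N n T η ε Q ψ a D E f uq up).card} ×ˢ
    Set.univ ∪ validExc k N n T η ε ψ a E

theorem measure_runExc_le {k N n T : ℕ} {η ε δ Q : ℝ} {ψ : X → ℕ → ℝ} (hψ : Measurable ψ)
    (a : (X × Bool) × X) (D : Measure X) [IsProbabilityMeasure D] (E : Measure (X × Bool))
    [IsProbabilityMeasure E] {f : X → Bool} (hf : Measurable f) {uq up : ℕ → ℝ} (hε : 0 < ε)
    (hε1 : ε < 1) (hδ : (1 / 2) ^ k ≤ δ / 2) (hk : 1 ≤ k) (hn : 0 < n) (hN : 16384 * N / ε ≤ n)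
    (hQ : 1 ≤ Q) (hT : 8796093022208 * n * Q / ε ^ 3 ≤ T) (hη : η = ε ^ 2 / 67108864)
    (hq1 : ∫⁻ x, ENNReal.ofReal |dot N uq (ψ x)| ∂D ≤ ENNReal.ofReal (ε / 8192))
    (hq2 : ∫⁻ x, ENNReal.ofReal (dot N uq (ψ x) ^ 2) ∂D ≤ ENNReal.ofReal (4 * Q))
    (hp2 : ∫⁻ x, ENNReal.ofReal (dot N up (ψ x) ^ 2) ∂D ≤ ENNReal.ofReal (4 * Q)) :
    ((Measure.pi fun _ : Fin k => (Measure.pi fun _ : Fin n => D).prod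
        (Measure.pi fun _ : Fin T => E.prod D)).prod (Measure.pi fun _ : Fin (k * T) => E))
      (runExc k N n T η ε Q ψ a D E f uq up) ≤ ENNReal.ofReal δ := by
  have hδ0 : 0 ≤ δ / 2 := le_trans (by positivity) hδ
  have h1 := measure_half_le ((Measure.pi fun _ : Fin n => D).prod
    (Measure.pi fun _ : Fin T => E.prod D))
    (measure_blockExc_le hψ a D E hf hε hε1 hn hN hQ hT hη hq1 hq2 hp2) k
  have h2 : ENNReal.ofReal ((1 / 4) ^ k) ≤ ENNReal.ofReal (δ / 2) :=
    ENNReal.ofReal_le_ofReal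
      ((pow_le_pow_left₀ (by norm_num) (show (1 / 4 : ℝ) ≤ 1 / 2 by norm_num) k).trans hδ)
  have h3 := measure_validExc_le (k := k) (N := N) (n := n) (T := T) (η := η) hψ a E hε
    (Measure.pi fun _ : Fin k => (Measure.pi fun _ : Fin n => D).prod
        (Measure.pi fun _ : Fin T => E.prod D))
  have h4 := ENNReal.ofReal_le_ofReal (union_bound_le hk hn hε hε1 hQ hδ hT)
  refine (measure_union_le _ _).trans ?_
  rw [← add_halves δ, ENNReal.ofReal_add hδ0 hδ0]
  exact add_le_add (measure_prod_univ_le _ _ (h1.trans h2)) (h3.trans h4)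

end Valid

/-! ### The run of the program on the data -/

section Congr

variable {N n : ℕ} {Φ Φ' : ℕ → ℕ → ℝ}

/-- The orthogonalization, the region and the updates see the reference points only through the Gram
matrix of the first `n`. Beyond row `n`, the program's sequence continues with other examples while
the probabilistic model continues by zero; this difference has no effect. -/
theorem gram_congr (h : ∀ r < n, Φ r = Φ' r) : gram n Φ = gram n Φ' := by
  funext w w'
  exact Finset.sum_congr rfl fun r hr => by rw [h r (Finset.mem_range.1 hr)]

theorem gsB_congr (h : gram n Φ = gram n Φ') (i : ℕ) : gsB N n Φ i = gsB N n Φ' i := by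
  induction i using Nat.strong_induction_on with
  | _ i ih =>
    funext w
    rw [gsB_eq, gsB_eq, h]
    congr 1
    refine Finset.sum_congr rfl fun j hj => ?_
    rw [gsn, gsn, ih j (Finset.mem_range.1 hj), h]

theorem gsn_congr (h : gram n Φ = gram n Φ') (i : ℕ) : gsn N n Φ i = gsn N n Φ' i := by
  rw [gsn, gsn, gsB_congr h, h]

theorem kap_congr (h : gram n Φ = gram n Φ') (φ : ℕ → ℝ) : kap N n Φ φ = kap N n Φ' φ := by
  funext w
  simp only [kap, gsB_congr h, gsn_congr h]

theorem inRegion_congr (h : gram n Φ = gram n Φ') (φ : ℕ → ℝ) :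
    InRegion N n Φ φ = InRegion N n Φ' φ := by
  simp only [InRegion, nul, lev, kap_congr h, gsB_congr h, gsn_congr h]

theorem gate_congr (h : gram n Φ = gram n Φ') (q φ : ℕ → ℝ) :
    gate N n Φ q φ = gate N n Φ' q φ := by
  unfold gate
  rw [inRegion_congr h]

theorem sgnR_congr (h : gram n Φ = gram n Φ') (q φ : ℕ → ℝ) :
    sgnR N n Φ q φ = sgnR N n Φ' q φ := by
  unfold sgnR
  rw [inRegion_congr h]

theorem val_congr (h : gram n Φ = gram n Φ') (q : ℕ → ℝ) (z : Round) :
    val N n Φ q z = val N n Φ' q z := by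
  simp only [val, gate_congr h, sgnR_congr h]

theorem runFrom_congr (h : gram n Φ = gram n Φ') (η : ℝ) (s : (ℕ → ℝ) × (ℕ → ℝ)) {z z' : ℕ → Round}
    (t : ℕ) (hz : ∀ i < t, z i = z' i) : runFrom N n Φ η s z t = runFrom N n Φ' η s z' t := by
  induction t with
  | zero => rfl
  | succ t ih =>
    rw [runFrom, runFrom, ih fun i hi => hz i (by omega), hz t (by omega)]
    simp only [step, gate_congr h, sgnR_congr h, kap_congr h]

end Congr

section Link

variable (P : Params) {X : Set (Fin P.d → ℝ)} {m : ℕ}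

/-- The features of a point. -/
def Params.feature (X : Set (Fin P.d → ℝ)) (x : X) : ℕ → ℝ := feat P.d (entry x.1) P.l

theorem Params.measurable_feature : Measurable (P.feature X) :=
  measurable_feat P.d P.l measurable_entry

variable (hm : 2 * ((P.doublings + 1) * P.rounds) ≤ m) (S : Fin m → X × Bool) (ω : ℕ → X)

theorem Params.config_round (i : ℕ) (hi : i < m) :
    (P.config S ω).round i = roundOf (P.feature X) (S ⟨i, hi⟩, ω i) := by
  have hx : (P.config S ω).xs i = entry (S ⟨i, hi⟩).1.1 := dif_pos hi
  have hy : (P.config S ω).ys i = labelValue (S ⟨i, hi⟩).2 := dif_pos hi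
  rw [Config.round, hx, hy]
  rfl

theorem Params.gram_config_refs (b : Fin (P.doublings + 1)) :
    gram P.numRef ((P.config S ω).refs b) = gram P.numRef
      (extend 0 fun r => P.feature X ((blockData P.numRef hm S ω b).1 r)) := by
  refine gram_congr fun r hr => ?_
  rw [extend_lt _ _ hr]
  rfl

theorem Params.config_round_block (a : (X × Bool) × X) (b : Fin (P.doublings + 1)) {t : ℕ}
    (ht : t < P.rounds) : (P.config S ω).round (b * P.rounds + t) =
      roundOf (P.feature X) (extend a (blockData P.numRef hm S ω b).2 t) := by
  rw [extend_lt _ _ ht, P.config_round S ω _ (by have := mul_add_lt_mul b.2 ht; omega)]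
  rfl

theorem Params.config_state (a : (X × Bool) × X) (b : Fin (P.doublings + 1)) {t : ℕ}
    (ht : t ≤ P.rounds) : (P.config S ω).state b t =
      blockState P.numFeat P.numRef P.rounds (P.ε ^ 2 / 67108864) (P.feature X) a
        (blockData P.numRef hm S ω b) t :=
  runFrom_congr (P.gram_config_refs hm S ω b) _ _ t fun _ hi =>
    P.config_round_block hm S ω a b (hi.trans_le ht)

theorem Params.config_stat (a : (X × Bool) × X) (b : Fin (P.doublings + 1)) :
    (P.config S ω).stat b =
      blockStat P.numFeat P.numRef P.rounds (P.ε ^ 2 / 67108864) (P.feature X) a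
        (blockData P.numRef hm S ω b) := by
  refine Finset.sum_congr rfl fun t ht => ?_
  have ht' : t < P.rounds := Finset.mem_range.1 ht
  rw [P.config_state hm S ω a b ht'.le]
  exact (congrArg _ (P.config_round_block hm S ω a b ht')).trans
    (val_congr (P.gram_config_refs hm S ω b) _ _)

theorem Params.config_cand (a : (X × Bool) × X) (b : Fin (P.doublings + 1)) {t : ℕ}
    (ht : t < P.rounds) : (P.config S ω).cand (b * P.rounds + t) =
      (blockState P.numFeat P.numRef P.rounds (P.ε ^ 2 / 67108864) (P.feature X) a
        (blockData P.numRef hm S ω b) t).2 := by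
  have h0 : 0 < P.rounds := by omega
  have h1 : (b * P.rounds + t) / P.rounds = b := by
    rw [mul_comm, Nat.mul_add_div h0, Nat.div_eq_of_lt ht, add_zero]
  have h2 : (b * P.rounds + t) % P.rounds = t := by
    rw [mul_comm, Nat.mul_add_mod, Nat.mod_eq_of_lt ht]
  rw [Config.cand, Params.config_T, h1, h2, P.config_state hm S ω a b ht.le]

theorem Params.config_errs (u : ℕ → ℝ) (θ : ℝ) :
    ((P.config S ω).errs u θ ((P.doublings + 1) * P.rounds) : ℝ) =
      ∑ j, errInd (hyp P.numFeat (P.feature X) u θ) (validData hm S j) := by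
  rw [Config.errs, Finset.card_filter, Finset.sum_range, Nat.cast_sum]
  refine Finset.sum_congr rfl fun j _ => ?_
  have hj : (P.doublings + 1) * P.rounds + j < m := by omega
  have hv : validData hm S j = S ⟨(P.doublings + 1) * P.rounds + j, hj⟩ := rfl
  have hx : (P.config S ω).xs ((P.doublings + 1) * P.rounds + j) =
      entry (S ⟨(P.doublings + 1) * P.rounds + j, hj⟩).1.1 := dif_pos hj
  have hy : (P.config S ω).ys ((P.doublings + 1) * P.rounds + j) =
      labelValue (S ⟨(P.doublings + 1) * P.rounds + j, hj⟩).2 := dif_pos hj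
  have e : (P.config S ω).N = P.numFeat := rfl
  rw [hv, Params.config_k, Params.config_T, hx, hy, e, Params.config_d, Params.config_l]
  rcases S ⟨(P.doublings + 1) * P.rounds + j, hj⟩ with ⟨x, y⟩
  have hf : P.feature X x = feat P.d (entry x.1) P.l := rfl
  have h10 : ¬ (1 : ℝ) < 0 := by norm_num
  cases y <;> by_cases h : θ < dot P.numFeat u (feat P.d (entry x.1) P.l) <;>
    simp [errInd, hyp, labelValue, hf, h, h10, -not_lt]

end Link

/-! ### Correctness of the algorithm -/

theorem exists_block_index {k T i : ℕ} (h : i < k * T) :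
    ∃ b : Fin k, ∃ t : Fin T, (b : ℕ) * T + t = i := by
  have hT : 0 < T := Nat.pos_of_ne_zero fun h0 => by simp [h0] at h
  exact ⟨⟨i / T, Nat.div_lt_of_lt_mul (by rwa [mul_comm])⟩, ⟨i % T, Nat.mod_lt _ hT⟩,
    by simpa [mul_comm] using Nat.div_add_mod i T⟩

theorem Config.passes_eq (c : Config) [DecidablePred fun b : Fin c.k => c.Pass b] :
    c.passes c.k = (Finset.univ.filter fun b : Fin c.k => c.Pass b).card := by
  rw [Config.passes, Finset.card_filter, Finset.card_filter, Finset.sum_range]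
  exact Finset.sum_congr rfl fun b _ => by congr

/-- The hypothesis is defined by the existence of a halting run. Determinism of programs makes the
exhibited run the only one. -/
theorem learner_hypothesis_eq {d : ℕ} {X : Set (Fin d → ℝ)} {M : Mem} {t : ℕ} {h : X → Bool}
    (hM : ∀ x : X, Runs predictC (M.query x.1) t fun M' => M'.nat 2 0 = 1 ↔ h x = true) :
    learner.hypothesis M = h := by
  funext x
  obtain ⟨M', n, he, _, hq⟩ := hM x
  rw [Bool.eq_iff_iff, ← hq]
  unfold Learner.hypothesis
  refine Iff.trans (@decide_eq_true_iff _ (Classical.propDecidable _)) ⟨?_, ?_⟩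
  · rintro ⟨M₁, n₁, he₁, h₁⟩
    rwa [(he.unique he₁).1]
  · exact fun h₁ => ⟨M', n, he, h₁⟩

theorem Params.two_pow_le (P : Params) (hδ : 0 < P.δ) : (1 / 2) ^ (P.doublings + 1) ≤ P.δ / 2 := by
  have h := (lt_ceil_logb_iff hδ P.doublings).not.1 (lt_irrefl _)
  rw [not_lt] at h
  have h1 : (1 / 2 : ℝ) ^ P.doublings ≤ P.δ := by
    rw [one_div, inv_pow, inv_le_iff_one_le_mul₀' (by positivity)]
    exact h
  rw [pow_succ]
  linarith

section Correct

variable (P : Params) {X : Set (Fin P.d → ℝ)} {m : ℕ}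

theorem Params.blockGood (hε : 0 < P.ε) (hε1 : P.ε < 1) (hA : 1 ≤ P.A)
    (a : (X × Bool) × X) (D : Measure X) [IsProbabilityMeasure D] (E : Measure (X × Bool))
    [IsProbabilityMeasure E] {f : X → Bool} (hf : Measurable f) {uq up : ℕ → ℝ}
    (hs : ∀ x, dot P.numFeat up (P.feature X x) ≤ labelValue (f x) ∧
      labelValue (f x) ≤ dot P.numFeat up (P.feature X x) + dot P.numFeat uq (P.feature X x))
    {β : (Fin P.numRef → X) × (Fin P.rounds → (X × Bool) × X)}
    (hβ : β ∉ blockExc P.numFeat P.numRef P.rounds (P.ε ^ 2 / 67108864) P.ε P.factor (P.feature X) a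
      D E f uq up) :
    BlockGood P.numFeat P.numRef P.rounds (P.ε ^ 2 / 67108864) P.ε P.τ (P.feature X) a D E f β := by
  have hn : (0 : ℝ) < P.numRef := by exact_mod_cast P.numRef_pos hε
  refine blockGood_of_notMem P.measurable_feature a D E hf hs (P.numRef_pos hε) (P.rounds_pos hε hA)
    (by positivity) ?_ ?_ ?_ ?_ hβ
  · have : P.ε ^ 2 ≤ 1 := pow_le_one₀ hε.le hε1.le
    linarith
  · have h := P.le_rounds
    rw [div_le_iff₀ (by positivity)] at h
    rw [div_le_iff₀ (by positivity)]
    linarith [h, show P.rounds * (P.ε / 128) * (2 * (P.ε ^ 2 / 67108864)) =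
      P.rounds * P.ε ^ 3 / 4294967296 by ring]
  · nlinarith
  · have h := P.le_numRef
    have h1 := P.one_le_numFeat
    rw [div_le_iff₀ hε] at h
    rw [div_le_iff₀ hn]
    nlinarith

/-- Fewer than half of the blocks are bad. If at least half pass, some passing block is good and
supplies an accurate candidate; if the marginal is close to the target, every good block passes and
the majority accepts. -/
theorem Params.succeeds_of_notMem (hε : 0 < P.ε) (hε1 : P.ε < 1) (hδ : 0 < P.δ) (hA : 1 ≤ P.A)
    (a : (X × Bool) × X) {F : Set (X → Bool)} (D : Measure X) [IsProbabilityMeasure D]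
    (E : Measure (X × Bool)) [IsProbabilityMeasure E] {f : X → Bool} (hf : Measurable f)
    (hopt : errorRate E f ≤ optError E F + P.ε / 16) {uq up : ℕ → ℝ}
    (hs : ∀ x, dot P.numFeat up (P.feature X x) ≤ labelValue (f x) ∧
      labelValue (f x) ≤ dot P.numFeat up (P.feature X x) + dot P.numFeat uq (P.feature X x))
    (hm : 2 * ((P.doublings + 1) * P.rounds) ≤ m) (S : Fin m → X × Bool) (ω : ℕ → X)
    (h : (blockData P.numRef hm S ω, validData hm S) ∉ runExc (P.doublings + 1) P.numFeat P.numRef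
      P.rounds (P.ε ^ 2 / 67108864) P.ε P.factor (P.feature X) a D E f uq up) :
    learner.Succeeds P F D E S ω := by
  classical
  have hT := P.rounds_pos hε hA
  have hKT : 0 < (((P.doublings + 1) * P.rounds : ℕ) : ℝ) := by
    exact_mod_cast Nat.mul_pos (Nat.succ_pos _) hT
  simp only [runExc, Set.mem_union, Set.mem_prod, Set.mem_univ, and_true, not_or,
    Set.mem_ofPred_eq, not_le, validExc, Set.mem_iUnion, not_exists] at h
  obtain ⟨hmaj, hval⟩ := h
  set bad := Finset.univ.filter fun b : Fin (P.doublings + 1) => blockData P.numRef hm S ω b ∈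
    blockExc P.numFeat P.numRef P.rounds (P.ε ^ 2 / 67108864) P.ε P.factor (P.feature X) a
      D E f uq up with hbad
  have hgood : ∀ b ∉ bad, BlockGood P.numFeat P.numRef P.rounds (P.ε ^ 2 / 67108864) P.ε P.τ
      (P.feature X) a D E f (blockData P.numRef hm S ω b) := fun b hb =>
    P.blockGood hε hε1 hA a D E hf hs fun hc => hb (Finset.mem_filter.2 ⟨Finset.mem_univ b, hc⟩)
  have hpass : ∀ b : Fin (P.doublings + 1), (P.config S ω).Pass b ↔
      ¬ P.rounds * (P.τ + P.ε / 8) < blockStat P.numFeat P.numRef P.rounds (P.ε ^ 2 / 67108864)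
        (P.feature X) a (blockData P.numRef hm S ω b) := fun b => by
    rw [← P.config_stat hm S ω a b]; rfl
  have hpasses : (P.config S ω).passes (P.doublings + 1) =
      (Finset.univ.filter fun b : Fin (P.doublings + 1) => (P.config S ω).Pass b).card :=
    (P.config S ω).passes_eq
  obtain ⟨M, t₀, hM, -, hacc, i, hi, j, hj, hmin, hpred⟩ :=
    runs_train P hε hδ (P.numRef_pos hε) hT S ω rfl
  refine ⟨M, t₀, hM, fun hA' => ?_, fun htv => hacc.2 ?_⟩
  · have hk : P.doublings + 1 ≤ 2 * (P.config S ω).passes (P.doublings + 1) := hacc.1 hA'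
    obtain ⟨b, hb1, hb2⟩ : ∃ b, (P.config S ω).Pass (b : Fin (P.doublings + 1)) ∧ b ∉ bad := by
      by_contra hcon
      push Not at hcon
      have : (Finset.univ.filter fun b : Fin (P.doublings + 1) => (P.config S ω).Pass b) ⊆ bad :=
        fun b hb => hcon b (Finset.mem_filter.1 hb).2
      have := Finset.card_le_card this
      omega
    obtain ⟨t, ht, j', hj', hle⟩ := (hgood b hb2).1 ((hpass b).1 hb1)
    obtain ⟨b₀, t₁, rfl⟩ := exists_block_index (k := P.doublings + 1) (T := P.rounds) hi
    have hle2 := hmin (b * P.rounds + t) (mul_add_lt_mul b.2 ht) j' hj'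
    rw [P.config_cand hm S ω a b ht, P.config_cand hm S ω a b₀ t₁.2] at hle2
    have hle3 := (Nat.cast_le (α := ℝ)).2 hle2
    change (((P.config S ω).errs _ _ ((P.doublings + 1) * P.rounds) : ℕ) : ℝ) ≤
      (((P.config S ω).errs _ _ ((P.doublings + 1) * P.rounds) : ℕ) : ℝ) at hle3
    rw [P.config_errs hm S ω, P.config_errs hm S ω] at hle3
    have hv1 := (abs_lt.1 (hval (b₀, t₁, ⟨j, hj⟩))).1
    have hv2 := (abs_lt.1 (hval (b, ⟨t, ht⟩, ⟨j', hj'⟩))).2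
    dsimp only at hv1 hv2
    have hyp_eq : learner.hypothesis M = hyp P.numFeat (P.feature X)
        (blockState P.numFeat P.numRef P.rounds (P.ε ^ 2 / 67108864) (P.feature X) a
          (blockData P.numRef hm S ω b₀) t₁).2 (thr P.numRef j) := by
      refine learner_hypothesis_eq (t := predictTime P.d P.l) fun x => ?_
      have := hpred x.1
      rw [P.config_cand hm S ω a b₀ t₁.2] at this
      simp only [hyp, decide_eq_true_iff]
      exact this
    rw [hyp_eq]
    have hfin : (((P.doublings + 1) * P.rounds : ℕ) : ℝ) * errorRate E (hyp P.numFeat (P.feature X)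
        (blockState P.numFeat P.numRef P.rounds (P.ε ^ 2 / 67108864) (P.feature X) a
          (blockData P.numRef hm S ω b₀) t₁).2 (thr P.numRef j)) ≤
        (((P.doublings + 1) * P.rounds : ℕ) : ℝ) * (errorRate E (hyp P.numFeat (P.feature X)
        (blockState P.numFeat P.numRef P.rounds (P.ε ^ 2 / 67108864) (P.feature X) a
          (blockData P.numRef hm S ω b) t).2 (thr P.numRef j')) + P.ε / 4) := by
      have hle4 := hle3
      simp only [Params.config_n] at hle4
      linarith
    -- The excess over `τ` is `9/32` from the good block, `1/4` from two validation deviations of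
    -- `1/8`, and `1/16` from the near-optimal `f`: in all `19/32 < 1` of `ε`.
    have := le_of_mul_le_mul_left hfin hKT
    linarith
  · change P.doublings + 1 ≤ 2 * (P.config S ω).passes (P.doublings + 1)
    have : badᶜ ⊆ Finset.univ.filter fun b : Fin (P.doublings + 1) => (P.config S ω).Pass b :=
      fun b hb => Finset.mem_filter.2 ⟨Finset.mem_univ b,
        (hpass b).2 ((hgood b (Finset.mem_compl.1 hb)).2 htv)⟩
    have := Finset.card_le_card this
    rw [Finset.card_compl, Fintype.card_fin] at this
    omega

end Correct

/-! ### The algorithm is an efficient tolerant tester-learner -/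

section Final

variable (P : Params) {X : Set (Fin P.d → ℝ)}

theorem Params.lintegral_sq_le (hA : 1 ≤ P.A) {D : Measure X} (h : IsHypercontractive D P.A)
    (p : MvPolynomial (Fin P.d) ℝ) (hp : p.totalDegree ≤ P.l)
    (h2 : ∫⁻ x : X, ENNReal.ofReal |MvPolynomial.eval x.1 p| ∂D ≤ ENNReal.ofReal 2) :
    ∫⁻ x : X, ENNReal.ofReal (MvPolynomial.eval x.1 p ^ 2) ∂D ≤ ENNReal.ofReal (4 * P.factor) := by
  refine (h.lintegral_sq_le hA p hp).trans ?_
  calc _ ≤ ENNReal.ofReal P.factor * ENNReal.ofReal 2 ^ 2 := by gcongr; rfl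
    _ = ENNReal.ofReal (4 * P.factor) := by
      rw [← ENNReal.ofReal_pow (by norm_num), ← ENNReal.ofReal_mul
        (by linarith [P.one_le_factor hA])]
      congr 1
      ring

theorem abs_labelValue (b : Bool) : |labelValue b| = 1 := by cases b <;> simp [labelValue]

/-- The sandwiching polynomials become coefficient vectors over the features: `up` for the lower one
and `uq` for the gap. They occur only in the analysis and are never computed. -/
theorem Params.isTolerantTesterLearner (hA : 1 ≤ P.A) (hε : 0 < P.ε) (hε1 : P.ε < 1) (hδ : 0 < P.δ)
    (hτ : 0 < P.τ) (D : Measure X) [IsProbabilityMeasure D] (hD : IsHypercontractive D P.A)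
    {F : Set (X → Bool)} (hF : F.Nonempty) (hFm : ∀ f ∈ F, Measurable f)
    (hs : HasSandwichingDegree F D (P.ε / (8192 * (1 + P.τ / P.ε))) P.l) {m : ℕ}
    (hm : 2 * ((P.doublings + 1) * P.rounds) ≤ m) :
    learner.IsTolerantTesterLearner P F D m := by
  intro E _
  obtain ⟨x₀⟩ : Nonempty X := nonempty_of_isProbabilityMeasure D
  have hFn : Nonempty F := hF.to_subtype
  -- The infimum over the class need not be attained, so an `ε/16`-optimal `f` is fixed.
  obtain ⟨⟨f, hf⟩, hfE⟩ := exists_lt_of_ciInf_lt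
    (show ⨅ f : F, errorRate E f.1 < optError E F + P.ε / 16 from lt_add_of_pos_right _ (by positivity))
  obtain ⟨pUp, pDown, hUp, hDown, hsand, hint⟩ := hs f hf
  obtain ⟨up, hup⟩ := exists_dot_feat pDown hDown
  have hdeg : (pUp - pDown).totalDegree ≤ P.l :=
    (MvPolynomial.totalDegree_sub _ _).trans (max_le hUp hDown)
  obtain ⟨uq, huq⟩ := exists_dot_feat (pUp - pDown) hdeg
  have hup' : ∀ x : X, dot P.numFeat up (P.feature X x) = MvPolynomial.eval x.1 pDown :=
    fun x => (hup x.1).symm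
  have huq' : ∀ x : X, dot P.numFeat uq (P.feature X x) = MvPolynomial.eval x.1 (pUp - pDown) :=
    fun x => (huq x.1).symm
  have hnn : ∀ x : X, 0 ≤ MvPolynomial.eval x.1 pUp - MvPolynomial.eval x.1 pDown := fun x => by
    linarith [(hsand x).1, (hsand x).2]
  have hγ : P.ε / (8192 * (1 + P.τ / P.ε)) ≤ P.ε / 8192 := by
    have : 0 ≤ P.τ / P.ε := by positivity
    gcongr
    linarith
  have hq1 : ∫⁻ x : X, ENNReal.ofReal |MvPolynomial.eval x.1 (pUp - pDown)| ∂D ≤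
      ENNReal.ofReal (P.ε / 8192) := by
    simp only [map_sub, abs_of_nonneg (hnn _)]
    exact hint.trans (ENNReal.ofReal_le_ofReal hγ)
  -- The lower polynomial has first moment at most `2`, being within the gap of a function with
  -- values `±1`. Hypercontractivity then bounds its second moment, whatever its coefficients are.
  have hp1 : ∫⁻ x : X, ENNReal.ofReal |MvPolynomial.eval x.1 pDown| ∂D ≤ ENNReal.ofReal 2 := by
    have hle : ∀ x : X, ENNReal.ofReal |MvPolynomial.eval x.1 pDown| ≤
        ENNReal.ofReal 1 + ENNReal.ofReal |MvPolynomial.eval x.1 (pUp - pDown)| := fun x => by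
      rw [← ENNReal.ofReal_add zero_le_one (abs_nonneg _), map_sub, abs_of_nonneg (hnn x)]
      refine ENNReal.ofReal_le_ofReal (abs_le.2 ?_)
      have h1 := abs_le.1 (abs_labelValue (f x)).le
      have h2 := hsand x
      constructor <;> linarith [hnn x]
    refine (lintegral_mono hle).trans ?_
    rw [lintegral_add_left measurable_const, lintegral_const, measure_univ, mul_one]
    refine (add_le_add le_rfl hq1).trans ?_
    rw [← ENNReal.ofReal_add zero_le_one (by positivity)]
    exact ENNReal.ofReal_le_ofReal (by linarith)
  have hsand' : ∀ x : X, dot P.numFeat up (P.feature X x) ≤ labelValue (f x) ∧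
      labelValue (f x) ≤ dot P.numFeat up (P.feature X x) + dot P.numFeat uq (P.feature X x) :=
    fun x => by
      rw [hup', huq', map_sub, add_sub_cancel]
      exact hsand x
  have hq2 := P.lintegral_sq_le hA hD _ hdeg
    (hq1.trans (ENNReal.ofReal_le_ofReal (by linarith)))
  have hexc := measure_runExc_le (k := P.doublings + 1) (N := P.numFeat) P.measurable_feature
    ((x₀, true), x₀) D E (hFm f hf) (uq := uq) (up := up) hε hε1 (P.two_pow_le hδ) (Nat.succ_pos _)
    (P.numRef_pos hε) P.le_numRef (P.one_le_factor hA) P.le_rounds rfl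
    (by simpa only [huq'] using hq1)
    (by simpa only [huq'] using hq2)
    (by simpa only [hup'] using P.lintegral_sq_le hA hD _ hDown hp1)
  have hsplit := measurePreserving_split (k := P.doublings + 1) (T := P.rounds) P.numRef hm E D
  refine le_trans ?_ hexc
  rw [← hsplit.map_eq]
  -- The inequality between a measure of a preimage and the image measure holds for arbitrary sets,
  -- so neither the failure event nor the exceptional event has to be shown measurable.
  refine le_trans (measure_mono ?_) (Measure.le_map_apply hsplit.measurable.aemeasurable _)
  intro z hz
  by_contra hcon
  exact hz (P.succeeds_of_notMem hε hε1 hδ hA ((x₀, true), x₀) D E (hFm f hf) hfE.le hsand' hm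
    z.1 z.2 hcon)

theorem Params.runsInTime (hd : 1 ≤ P.d) (hl : 1 ≤ P.l) (hA : 1 ≤ P.A) (hε : 0 < P.ε)
    (hε1 : P.ε < 1) (hδ : 0 < P.δ) (hδ1 : P.δ < 1) (m : ℕ) :
    learner.RunsInTime P X m (MvPolynomial.aeval
      ![P.A ^ P.l, Real.log (1 / P.δ) ^ P.l, ((P.d : ℝ) + 1) ^ P.l, 1 / P.ε]
      (MvPolynomial.C 5000 * sizePoly ^ 8 : MvPolynomial (Fin 4) ℕ)) := by
  intro S ω
  have hn := P.numRef_pos hε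
  have hT := P.rounds_pos hε hA
  have ht := P.trainTime_le_aeval hd hl hA hε hε1 hδ hδ1
  obtain ⟨M, t₀, hM, ht₀, -, i, -, j, -, -, hpred⟩ := runs_train P hε hδ hn hT S ω rfl
  refine ⟨M, t₀, hM, le_trans (by exact_mod_cast ht₀) ht, fun _ x => ?_⟩
  obtain ⟨M', t₁, hM', ht₁, -⟩ := hpred x.1
  refine ⟨M', t₁, hM', le_trans ?_ ht⟩
  exact_mod_cast ht₁.trans (predictTime_le_trainTime P.d P.l P.numRef P.rounds (P.doublings + 1)
    hn hT (Nat.succ_pos _))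

end Final

end

end TolerantTesting

theorem mainTheorem4 :
    -- universal: one algorithm, constants `C`, `K` and a polynomial `q`, independent of everything
    ∃ (L : TolerantTesting.Learner) (C K : ℝ) (q : MvPolynomial (Fin 4) ℕ), 1 ≤ C ∧ 1 ≤ K ∧
      ∀ (P : TolerantTesting.Params), 1 ≤ P.d → 1 ≤ P.l → 1 ≤ P.A →
        0 < P.ε → P.ε < 1 → 0 < P.δ → P.δ < 1 → 0 < P.τ → P.τ < 1 →
      ∀ (X : Set (Fin P.d → ℝ)), X = Set.univ ∨ X = TolerantTesting.hypercube P.d →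
      ∀ (D : Measure X) [IsProbabilityMeasure D], TolerantTesting.IsHypercontractive D P.A →
      ∀ (F : Set (X → Bool)), F.Nonempty → (∀ f ∈ F, Measurable f) →
        TolerantTesting.HasSandwichingDegree F D (P.ε / (C * (1 + P.τ / P.ε))) P.l →
      ∀ m : ℕ, 1 / P.ε ^ 5 * (K * P.A * P.d) ^ (2 * P.l) * Real.log (2 / P.δ) ≤ m →
        L.IsTolerantTesterLearner P F D m ∧
        L.RunsInTime P X m
          (MvPolynomial.aeval
            ![P.A ^ P.l, Real.log (1 / P.δ) ^ P.l, ((P.d : ℝ) + 1) ^ P.l, 1 / P.ε] q) := by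
  -- `C = 16 * 512` comes from Markov's inequality for the gap, and `K = 2 ^ 40` leaves room for all
  -- constants in the number of examples, its square exceeding the `2 ^ 65` that is needed.
  refine ⟨TolerantTesting.learner, 8192, 2 ^ 40,
    MvPolynomial.C 5000 * TolerantTesting.sizePoly ^ 8, by norm_num, by norm_num, ?_⟩
  intro P hd hl hA hε hε1 hδ hδ1 hτ _ X _ D _ hD F hF hFm hs m hm
  exact ⟨P.isTolerantTesterLearner hA hε hε1 hδ hτ D hD hF hFm hs
    (P.two_mul_le hd hl hA hε hε1 hδ hδ1 hm), P.runsInTime hd hl hA hε hε1 hδ hδ1 m⟩
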